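/- Let $X$ be a complex manifold of dimension $n$ and $(E,h)$ a holomorphic vector bundle of rank $r$ on $X$ with a smooth Hermitian metric, Chern connection $\nabla$ and Chern curvature $\Theta_{E,h}$. Let $\pi:Y=F(E^*)\to X$ be the bundle of full flags $E_x^*=V_0\supset V_1\supset\dots\supset V_r=\{0\}$, $\operatorname{codim}V_\lambda=\lambda$, let $Q_\lambda=V_{\lambda-1}/V_\lambda$ $(1\le\lambda\le r)$ be the tautological line bundles with the quotient metrics induced by $h$, and $Q^a=Q_1^{a_1}\otimes\dots\otimes Q_r^{a_r}$ (a formal real combination if $a\in\mathbb R^r$), with curvature $\Theta_{Q^a}=-\partial\bar\partial\log\|S\|^2$ for local holomorphic frames $S$. A normal frame at $(z_0,\xi_0)\in Y$ is a holomorphic frame $(e_\lambda)$ of $E$ near $z_0$ with $\langle e_\lambda(z),e_\mu(z)\rangle=\delta_{\lambda\mu}-\sum_{j,k}c_{jk\lambda\mu}z_j\bar z_k+O(|z|^3)$ in coordinates $z$ centred at $z_0$, and such that the flag $\xi_0$ is $V_\lambda=\operatorname{Vect}(e_1,\dots,e_\lambda)^\dagger$ (annihilator). It defines normal coordinates $(z,\xi_{\lambda\mu})_{\lambda<\mu}$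 on $Y$ near $(z_0,\xi_0)$: the point $(z,\xi)$ is the flag given in the same way by the frame $e_\lambda(z)+\sum_{\mu>\lambda}\xi_{\lambda\mu}e_\mu(z)$. Horizontal vectors on $Y$ are those tangent to the local sections given by frames of $E$ that are $\nabla$-parallel at the point. Let $(\hat e_\lambda)$ denote any orthonormal basis of $E_z$ giving the flag $\xi$. Then normal frames exist at every point of $Y$, the horizontal vectors form a complement of $T_{Y/X}$ in $T_Y$, and: (a) For every $a\in\mathbb R^r$, $\Theta_{Q^a}=\theta_a^H+\theta_a^V$, where $$\theta_a^H=-\sum_{1\le\lambda\le r}a_\lambda\,\pi^*\langle\Theta_{E,h}(\hat e_\lambda),\hat e_\lambda\rangle$$ and $\theta_a^V$ vanishes on horizontal vectors and is given at any point $(z_0,\xi_0)$, in normal coordinates there, by $$\theta_a^V(z_0,\xi_0)=\sum_{1\le\lambda<\mu\le r}(a_\lambda-a_\mu)\,d\xi_{\lambda\mu}\wedge d\bar\xi_{\lambda\mu}.$$ (b) The relative canonical bundle $K_{Y/X}=\det T_{Y/X}^*$ is isomorphic, as a holomorphic line bundle, to $Q^\rho$ with $\rho_\lambda=2\lambda-r-1$.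 There is a (unique) smooth form $\eta$ on $Y$ given at every point, in normal coordinates there, by $\eta(z_0,\xi_0)=\bigwedge_{\lambda<\mu}i\,d\xi_{\lambda\mu}\wedge d\bar\xi_{\lambda\mu}$, and for any positive definite $(1,1)$-form $\omega$ on $X$, $$i\partial\bar\partial\eta\wedge\pi^*\omega^{n-1}=-i\theta_\rho^H\wedge\eta\wedge\pi^*\omega^{n-1}=\sum_{1\le\lambda\le r}\rho_\lambda\,\pi^*\langle i\Theta_{E,h}(\hat e_\lambda),\hat e_\lambda\rangle\wedge\eta\wedge\pi^*\omega^{n-1}.$$ -/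

import Mathlib

open Set Filter Topology Module Bundle
open scoped Manifold ContDiff TensorProduct

set_option linter.unusedSectionVars false

noncomputable section

/-! ### Complex-valued alternating forms on a complex vector space -/

section PointwiseForms
variable {V W : Type*} [AddCommGroup V] [Module ℂ V] [TopologicalSpace V]
  [AddCommGroup W] [Module ℂ W] [TopologicalSpace W]

/-- The multilinear map `v ↦ α (v₁, …, v_k) * β (v_{k+1}, …, v_{k+l})`. -/
def tensorForm {k l : ℕ} (α : V [⋀^Fin k]→L[ℝ] ℂ) (β : V [⋀^Fin l]→L[ℝ] ℂ) :
    ContinuousMultilinearMap ℝ (fun _ : Fin (k + l) => V) ℂ where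
  toMultilinearMap := (LinearMap.mul' ℝ ℂ).compMultilinearMap
    ((MultilinearMap.domCoprod α.toContinuousMultilinearMap.toMultilinearMap
      β.toContinuousMultilinearMap.toMultilinearMap).domDomCongr finSumFinEquiv)
  cont := by
    have h : Continuous fun v : Fin (k + l) → V =>
        α (fun i => v (Fin.castAdd l i)) * β (fun i => v (Fin.natAdd k i)) :=
      (α.coe_continuous.comp (by fun_prop)).mul (β.coe_continuous.comp (by fun_prop))
    exact h

theorem tensorForm_apply {k l : ℕ} (α : V [⋀^Fin k]→L[ℝ] ℂ) (β : V [⋀^Fin l]→L[ℝ] ℂ)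
    (v : Fin (k + l) → V) :
    tensorForm α β v = α (fun i => v (Fin.castAdd l i)) * β (fun i => v (Fin.natAdd k i)) := rfl

/-- Wedge product, with the convention
`(α ∧ β) v = (1 / (k! l!)) ∑ σ, sign σ * α (v_{σ 1}, …, v_{σ k}) * β (v_{σ (k+1)}, …)`,
so that `(α ∧ β) (u, v) = α u * β v - α v * β u` for forms of degree one. -/
def wedge {k l : ℕ} (α : V [⋀^Fin k]→L[ℝ] ℂ) (β : V [⋀^Fin l]→L[ℝ] ℂ) :
    V [⋀^Fin (k + l)]→L[ℝ] ℂ :=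
  ((k.factorial * l.factorial : ℝ)⁻¹ : ℝ) •
    ContinuousMultilinearMap.alternatization (tensorForm α β)

theorem wedge_apply {k l : ℕ} (α : V [⋀^Fin k]→L[ℝ] ℂ) (β : V [⋀^Fin l]→L[ℝ] ℂ)
    (v : Fin (k + l) → V) :
    wedge α β v = ((k.factorial * l.factorial : ℝ)⁻¹ : ℝ) •
      ∑ σ : Equiv.Perm (Fin (k + l)), Equiv.Perm.sign σ •
        (α (fun i => v (σ (Fin.castAdd l i))) * β (fun i => v (σ (Fin.natAdd k i)))) := by
  simp [wedge, ContinuousMultilinearMap.alternatization_apply_apply, tensorForm_apply]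

/-- The power `α ^ m = α ∧ … ∧ α` of a form of degree two. -/
def wedgePow (α : V [⋀^Fin 2]→L[ℝ] ℂ) : (m : ℕ) → V [⋀^Fin (2 * m)]→L[ℝ] ℂ
  | 0 => ContinuousAlternatingMap.constOfIsEmpty ℝ V (Fin 0) 1
  | m + 1 => wedge (wedgePow α m) α

/-- The product `α₁ ∧ … ∧ α_m` of forms of degree two. -/
def wedgeProd : (m : ℕ) → (Fin m → V [⋀^Fin 2]→L[ℝ] ℂ) → V [⋀^Fin (2 * m)]→L[ℝ] ℂ
  | 0, _ => ContinuousAlternatingMap.constOfIsEmpty ℝ V (Fin 0) 1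
  | m + 1, α => wedge (wedgeProd m fun i => α i.castSucc) (α (Fin.last m))

/-- The form `ℓ ∧ conj ℓ` attached to a complex linear functional `ℓ`. -/
def wedgeConj (ℓ : V →L[ℂ] ℂ) : V [⋀^Fin 2]→L[ℝ] ℂ :=
  wedge (ContinuousAlternatingMap.ofSubsingleton ℝ V ℂ (0 : Fin 1) (ℓ.restrictScalars ℝ))
    (ContinuousAlternatingMap.ofSubsingleton ℝ V ℂ (0 : Fin 1)
      ((Complex.conjCLE : ℂ →L[ℝ] ℂ).comp (ℓ.restrictScalars ℝ)))

/-- Pull-back of a form by a complex linear map. -/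
def pullForm {k : ℕ} (α : W [⋀^Fin k]→L[ℝ] ℂ) (f : V →L[ℂ] W) : V [⋀^Fin k]→L[ℝ] ℂ :=
  α.compContinuousLinearMap (f.restrictScalars ℝ)
end PointwiseForms

/-! ### The operators `∂`, `∂bar` and differential forms on complex manifolds -/

section Dolbeault
variable {M : Type*} [NormedAddCommGroup M] [NormedSpace ℂ M]
  {G : Type*} [NormedAddCommGroup G] [NormedSpace ℂ G]

/-- Multiplication by the imaginary unit, as a real linear map. -/
def mulI (M : Type*) [NormedAddCommGroup M] [NormedSpace ℂ M] : M →L[ℝ] M :=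
  (Complex.I • ContinuousLinearMap.id ℂ M).restrictScalars ℝ

/-- The complex linear part of a real linear map. -/
def linPart (D : M →L[ℝ] G) : M →L[ℝ] G :=
  (1 / 2 : ℂ) • (D - Complex.I • D.comp (mulI M))

/-- The conjugate linear part of a real linear map. -/
def antilinPart (D : M →L[ℝ] G) : M →L[ℝ] G :=
  (1 / 2 : ℂ) • (D + Complex.I • D.comp (mulI M))

/-- The operator `∂` on forms on a complex vector space: like Mathlib's `extDeriv`, but with the
complex linear part of the derivative of the coefficients. -/
def del {k : ℕ} (α : M → M [⋀^Fin k]→L[ℝ] ℂ) (u : M) : M [⋀^Fin (k + 1)]→L[ℝ] ℂ :=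
  .alternatizeUncurryFin (linPart (fderiv ℝ α u))

/-- The operator `∂bar` on forms on a complex vector space: like Mathlib's `extDeriv`, but with the
conjugate linear part of the derivative of the coefficients. Thus `del + delbar` is `extDeriv`. -/
def delbar {k : ℕ} (α : M → M [⋀^Fin k]→L[ℝ] ℂ) (u : M) : M [⋀^Fin (k + 1)]→L[ℝ] ℂ :=
  .alternatizeUncurryFin (antilinPart (fderiv ℝ α u))

variable {Y : Type*} [TopologicalSpace Y] [ChartedSpace M Y]

variable (M Y) in
/-- Complex-valued differential forms of degree `k` on a complex manifold modelled on `M`. -/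
abbrev DiffForm (k : ℕ) := ∀ y : Y, TangentSpace 𝓘(ℂ, M) y [⋀^Fin k]→L[ℝ] ℂ

/-- The expression of a form in the preferred chart at `y₀`. -/
def DiffForm.inChart {k : ℕ} (α : DiffForm M Y k) (y₀ : Y) : M → M [⋀^Fin k]→L[ℝ] ℂ := fun u =>
  pullForm (α ((chartAt M y₀).symm u)) (mfderiv 𝓘(ℂ, M) 𝓘(ℂ, M) (chartAt M y₀).symm u)

/-- Smoothness of a differential form. -/
def DiffForm.Smooth {k : ℕ} (α : DiffForm M Y k) : Prop :=
  ∀ y₀ : Y, ContDiffAt ℝ ∞ (α.inChart y₀) (chartAt M y₀ y₀)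

/-- The form `∂ ∂bar α`, computed at each point in the preferred chart there. (It does not depend on
the chart, the changes of coordinates being holomorphic. The tangent space at `y` is identified with
the model space by the same chart.) -/
def DiffForm.delDelbar {k : ℕ} (α : DiffForm M Y k) : DiffForm M Y (k + 2) := fun y =>
  del (M := M) (delbar (α.inChart y)) (chartAt M y y)

/-- A function as a form of degree zero. -/
def funForm (f : Y → ℂ) : DiffForm M Y 0 := fun y =>
  ContinuousAlternatingMap.constOfIsEmpty ℝ _ (Fin 0) (f y)
end Dolbeault

/-! ### Full flags -/

/-- Pairs of indices `i < j`. -/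
abbrev PairIdx (r : ℕ) := {p : Fin r × Fin r // p.1 < p.2}

/-- Full flags `V = V₀ ⊃ V₁ ⊃ … ⊃ V_r = 0`, `codim V_i = i`, in a space of dimension `r`. -/
structure FullFlag (r : ℕ) (V : Type*) [AddCommGroup V] [Module ℂ V] where
  space : Fin (r + 1) → Submodule ℂ V
  anti : Antitone space
  finrank_add : ∀ i, finrank ℂ (space i) + i = r

theorem FullFlag.ext_space {r : ℕ} {V : Type*} [AddCommGroup V] [Module ℂ V] {a b : FullFlag r V}
    (h : ∀ i, a.space i = b.space i) : a = b := by
  cases a; cases b; congr; exact funext h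

section Flags
variable {r : ℕ} {V : Type*} [AddCommGroup V] [Module ℂ V]

/-- `leadSpan w i` is the span of the first `i` vectors of `w`. -/
def leadSpan (w : Fin r → V) (i : Fin (r + 1)) : Submodule ℂ V :=
  Submodule.span ℂ (w '' {j | j.castSucc < i})

/-- The flag `f` of the dual space is the one given by the frame `w`:
`V_i = Vect(w₁, …, w_i)^†` (the annihilator) for all `i`. -/
def Adapted (w : Fin r → V) (f : FullFlag r (Dual ℂ V)) : Prop :=
  ∀ i, f.space i = (leadSpan w i).dualAnnihilator

/-- The frame `e_i + ∑_{j > i} ξ_{ij} e_j`. -/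
def tildeFrame (e : Fin r → V) (ξ : PairIdx r → ℂ) (i : Fin r) : V :=
  e i + ∑ j, if h : i < j then ξ ⟨(i, j), h⟩ • e j else 0

open Classical in
/-- The coordinates `ξ_{ij}`, `i < j`, of a flag of the dual space with respect to the frame `e`: the
flag is the one given by the frame `e_i + ∑_{j > i} ξ_{ij} e_j` (junk value `0` if there is no such
`ξ`). -/
def flagCoord (e : Fin r → V) (f : FullFlag r (Dual ℂ V)) : PairIdx r → ℂ :=
  if h : ∃ ξ, Adapted (tildeFrame e ξ) f then h.choose else 0

theorem Adapted.eq {w : Fin r → V} {f g : FullFlag r (Dual ℂ V)} (hf : Adapted w f)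
    (hg : Adapted w g) : f = g :=
  FullFlag.ext_space fun i => (hf i).trans (hg i).symm

theorem finrank_leadSpan {w : Fin r → V} (hw : LinearIndependent ℂ w) (i : Fin (r + 1)) :
    finrank ℂ (leadSpan w i) = i := by
  have h := finrank_span_eq_card (R := ℂ) (b := fun j : {j : Fin r // j.castSucc < i} => w j)
    (hw.comp _ Subtype.val_injective)
  have h2 : Set.range (fun j : {j : Fin r // j.castSucc < i} => w j)
      = w '' {j | j.castSucc < i} := by
    ext x; simp
  rw [h2] at h
  rw [leadSpan, h, Fintype.card_subtype]
  have : (Finset.univ.filter fun j : Fin r => j.castSucc < i).map Fin.castSuccEmb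
      = Finset.Iio i := by
    ext j
    simp only [Finset.mem_map, Finset.mem_filter, Finset.mem_univ, true_and, Finset.mem_Iio,
      Fin.coe_castSuccEmb]
    constructor
    · rintro ⟨a, ha, rfl⟩; exact ha
    · intro hj
      exact ⟨⟨j, by omega⟩, by simpa using hj, by ext; simp⟩
  rw [← Finset.card_map Fin.castSuccEmb, this, Fin.card_Iio]

/-- The flag given by a frame. -/
def flagOfFrame (b : Basis (Fin r) ℂ V) (w : Fin r → V) (hw : LinearIndependent ℂ w) :
    FullFlag r (Dual ℂ V) where
  space i := (leadSpan w i).dualAnnihilator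
  anti i j hij := by
    apply Submodule.dualAnnihilator_anti
    exact Submodule.span_mono (Set.image_mono fun k hk => lt_of_lt_of_le hk hij)
  finrank_add i := by
    have : FiniteDimensional ℂ V := b.finiteDimensional_of_finite
    have h := Subspace.finrank_add_finrank_dualAnnihilator_eq (leadSpan w i)
    rw [finrank_leadSpan hw, finrank_eq_card_basis b, Fintype.card_fin] at h
    omega

/-- Every flag of the dual space is given by some basis. -/
theorem exists_adapted_basis (b : Basis (Fin r) ℂ V) (f : FullFlag r (Dual ℂ V)) :
    ∃ w : Basis (Fin r) ℂ V, Adapted w f := by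
  have : FiniteDimensional ℂ V := b.finiteDimensional_of_finite
  have hr : finrank ℂ V = r := by rw [finrank_eq_card_basis b, Fintype.card_fin]
  let W : Fin (r + 1) → Submodule ℂ V := fun i => (f.space i).dualCoannihilator
  have hWf : ∀ i, finrank ℂ (W i) = i := fun i => by
    have h := Subspace.finrank_add_finrank_dualCoannihilator_eq (f.space i)
    have h2 := f.finrank_add i
    simp only [W]; omega
  have hWm : Monotone W := fun i j hij => Submodule.dualCoannihilator_anti (f.anti hij)
  have hex : ∀ j : Fin r, ∃ x, x ∈ W j.succ ∧ x ∉ W j.castSucc := fun j => by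
    by_contra! hc
    have := Submodule.finrank_mono (show W j.succ ≤ W j.castSucc from hc)
    rw [hWf, hWf] at this
    simp at this
  choose w hw1 hw2 using hex
  have hle : ∀ i, leadSpan w i ≤ W i := fun i => by
    rw [leadSpan, Submodule.span_le]
    rintro _ ⟨j, hj, rfl⟩
    exact hWm (Fin.castSucc_lt_iff_succ_le.mp hj) (hw1 j)
  have hli : LinearIndependent ℂ w := by
    rw [linearIndependent_iff']
    by_contra! hc
    obtain ⟨s, g, hs, i, his, hgi⟩ := hc
    have hne : (s.filter fun j => g j ≠ 0).Nonempty := ⟨i, by simp [his, hgi]⟩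
    set m := (s.filter fun j => g j ≠ 0).max' hne with hm
    have hmm := Finset.max'_mem _ hne
    rw [← hm, Finset.mem_filter] at hmm
    apply hw2 m
    have h1 : g m • w m = - ∑ j ∈ s.erase m, g j • w j := by
      rw [← Finset.add_sum_erase s _ hmm.1] at hs
      exact eq_neg_of_add_eq_zero_left hs
    have h2 : g m • w m ∈ W m.castSucc := by
      rw [h1]
      refine Submodule.neg_mem _ (Submodule.sum_mem _ fun j hj => ?_)
      by_cases hg : g j = 0
      · simp [hg]
      · have hj' := Finset.mem_erase.mp hj
        have hjm : j ≤ m := Finset.le_max' _ _ (by simp [hj'.2, hg])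
        have hlt : j < m := lt_of_le_of_ne hjm hj'.1
        exact Submodule.smul_mem _ _ (hWm (Fin.castSucc_lt_iff_succ_le.mp
          (by simpa using hlt)) (hw1 j))
    exact (Submodule.smul_mem_iff _ hmm.2).mp h2
  have heq : ∀ i, leadSpan w i = W i := fun i =>
    Submodule.eq_of_le_of_finrank_eq (hle i) (by rw [finrank_leadSpan hli, hWf])
  refine ⟨basisOfLinearIndependentOfCardEqFinrank' w hli (by rw [Fintype.card_fin, hr]), ?_⟩
  intro i
  rw [coe_basisOfLinearIndependentOfCardEqFinrank', heq]
  exact (Subspace.dualCoannihilator_dualAnnihilator_eq).symm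

theorem tildeFrame_zero (e : Fin r → V) : tildeFrame e 0 = e := by
  ext i; simp [tildeFrame]

/-- Leading square block of a matrix. -/
def leadBlock (A : Matrix (Fin r) (Fin r) ℂ) (k : Fin r) :
    Matrix {j : Fin r // j ≤ k} {j : Fin r // j ≤ k} ℂ := A.submatrix (↑) (↑)

/-- The flag coordinates in terms of the coordinate matrix of a frame giving the flag. -/
def blockCoord (A : Matrix (Fin r) (Fin r) ℂ) (p : PairIdx r) : ℂ :=
  ∑ ν : {j : Fin r // j ≤ p.1.1}, (leadBlock A p.1.1)⁻¹ ⟨p.1.1, le_refl _⟩ ν * A ν p.1.2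

/-- Coordinates of a family of vectors in a basis. -/
def coordMatrix (e : Basis (Fin r) ℂ V) (w : Fin r → V) : Matrix (Fin r) (Fin r) ℂ :=
  fun i j => e.repr (w i) j

theorem tildeFrame_repr (e : Basis (Fin r) ℂ V) (ξ : PairIdx r → ℂ) (i j : Fin r) :
    e.repr (tildeFrame e ξ i) j = if i = j then 1 else if h : i < j then ξ ⟨(i, j), h⟩ else 0 := by
  simp only [tildeFrame, map_add, Basis.repr_self, map_sum, Finsupp.add_apply,
    Finsupp.finsetSum_apply]
  rw [Finset.sum_eq_single j]
  · by_cases hij : i = j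
    · subst hij; simp
    · by_cases h : i < j <;> simp [hij, h]
  · intro k _ hk
    by_cases h : i < k <;> simp [h, hk]
  · simp

theorem coordMatrix_tildeFrame_lt (e : Basis (Fin r) ℂ V) (ξ : PairIdx r → ℂ) (i j : Fin r)
    (h : j < i) : coordMatrix e (tildeFrame e ξ) i j = 0 := by
  rw [coordMatrix, tildeFrame_repr, if_neg h.ne', dif_neg h.not_gt]

theorem det_leadBlock_tildeFrame (e : Basis (Fin r) ℂ V) (ξ : PairIdx r → ℂ) (k : Fin r) :
    (leadBlock (coordMatrix e (tildeFrame e ξ)) k).det = 1 := by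
  rw [Matrix.det_of_isUpperTriangular]
  · apply Finset.prod_eq_one
    intro i _
    simp [leadBlock, coordMatrix, tildeFrame_repr]
  · intro i j hij
    exact coordMatrix_tildeFrame_lt e ξ _ _ hij

theorem linearIndependent_tildeFrame (e : Basis (Fin r) ℂ V) (ξ : PairIdx r → ℂ) :
    LinearIndependent ℂ (tildeFrame e ξ) := by
  have h : IsUnit (e.det (tildeFrame e ξ)) := by
    rw [Basis.det_apply]
    have : (e.toMatrix (tildeFrame e ξ)).det = 1 := by
      rw [← Matrix.det_transpose, Matrix.det_of_isUpperTriangular]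
      · apply Finset.prod_eq_one
        intro i _
        simp [Basis.toMatrix_apply, tildeFrame_repr]
      · intro i j hij
        exact coordMatrix_tildeFrame_lt e ξ _ _ hij
    rw [this]; exact isUnit_one
  exact ((Module.Basis.is_basis_iff_det e).mpr h).1

theorem mem_leadSpan_succ {w : Fin r → V} {x : V} {k : Fin r} (h : x ∈ leadSpan w k.succ) :
    ∃ c : {j : Fin r // j ≤ k} → ℂ, x = ∑ ν, c ν • w ν := by
  have h2 : w '' {j | j.castSucc < k.succ} = Set.range fun j : {j : Fin r // j ≤ k} => w j := by
    ext x
    simp only [Set.mem_image, Set.mem_ofPred_eq, Set.mem_range, Subtype.exists, exists_prop,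
      Fin.castSucc_lt_succ_iff]
  rw [leadSpan, h2] at h
  obtain ⟨c, hc⟩ := (Submodule.mem_span_range_iff_exists_fun ℂ).mp h
  exact ⟨c, hc.symm⟩

theorem leadSpan_mono (w : Fin r → V) : Monotone (leadSpan w) := fun _ _ hij =>
  Submodule.span_mono (Set.image_mono fun _ hk => lt_of_lt_of_le hk hij)

theorem mem_leadSpan (w : Fin r → V) {i : Fin (r + 1)} {j : Fin r} (h : j.castSucc < i) :
    w j ∈ leadSpan w i := Submodule.subset_span ⟨j, h, rfl⟩

theorem det_ne_zero_of_adapted (e : Basis (Fin r) ℂ V) {w : Fin r → V} {ξ : PairIdx r → ℂ}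
    {f : FullFlag r (Dual ℂ V)} (hw : Adapted w f) (he : Adapted (tildeFrame e ξ) f) :
    (∀ k, (leadBlock (coordMatrix e w) k).det ≠ 0) ∧ ξ = blockCoord (coordMatrix e w) := by
  have hsp : ∀ i, leadSpan w i = leadSpan (tildeFrame e ξ) i := fun i =>
    Subspace.dualAnnihilator_inj.mp ((hw i).symm.trans (he i))
  have hc : ∀ k : Fin r, ∃ c : {j : Fin r // j ≤ k} → ℂ, tildeFrame e ξ k = ∑ ν, c ν • w ν :=
    fun k => mem_leadSpan_succ (by rw [hsp]; exact mem_leadSpan _ (Fin.castSucc_lt_succ))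
  choose c hc using hc
  set U := coordMatrix e (tildeFrame e ξ) with hU
  set A := coordMatrix e w with hA
  have hUA : ∀ k j, U k j = ∑ ν, c k ν * A ν j := fun k j => by
    rw [hU, coordMatrix, hc k]
    simp [hA, coordMatrix]
  let L : ∀ k : Fin r, Matrix {j : Fin r // j ≤ k} {j : Fin r // j ≤ k} ℂ := fun k i ν =>
    if h : (ν : Fin r) ≤ i then c i ⟨ν, h⟩ else 0
  have hL : ∀ k, leadBlock U k = L k * leadBlock A k := fun k => by
    ext i j
    rw [Matrix.mul_apply]
    simp only [leadBlock, Matrix.submatrix_apply]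
    rw [hUA]
    simp only [L, dite_mul, zero_mul]
    rw [← Finset.sum_filter_add_sum_filter_not Finset.univ
      (fun ν : {j : Fin r // j ≤ k} => (ν : Fin r) ≤ i)]
    rw [Finset.sum_eq_zero (s := Finset.univ.filter fun ν : {j : Fin r // j ≤ k} => ¬ (ν : Fin r) ≤ i), add_zero]
    · refine Finset.sum_bij (fun ν _ => ⟨ν.1, le_trans ν.2 i.2⟩) ?_ ?_ ?_ ?_
      · intro a _
        exact Finset.mem_filter.mpr ⟨Finset.mem_univ _, a.2⟩
      · intro a _ b _ hab; simpa [Subtype.ext_iff] using hab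
      · intro b hb
        exact ⟨⟨b, (Finset.mem_filter.mp hb).2⟩, Finset.mem_univ _, rfl⟩
      · intro a _
        split_ifs with h
        · rfl
        · exact absurd a.2 h
    · intro ν hν
      rw [dif_neg (Finset.mem_filter.mp hν).2]
  have hdet : ∀ k, (leadBlock A k).det ≠ 0 := fun k h0 => by
    have := det_leadBlock_tildeFrame e ξ k
    rw [← hU, hL, Matrix.det_mul, h0, mul_zero] at this
    exact zero_ne_one this
  refine ⟨hdet, ?_⟩
  ext p
  obtain ⟨⟨i, j⟩, hij⟩ := p
  have h1 : L i = leadBlock U i * (leadBlock A i)⁻¹ := by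
    rw [hL, Matrix.mul_assoc, Matrix.mul_nonsing_inv _ (isUnit_iff_ne_zero.mpr (hdet i)),
      Matrix.mul_one]
  have h2 : ∀ ν, L i ⟨i, le_refl _⟩ ν = (leadBlock A i)⁻¹ ⟨i, le_refl _⟩ ν := fun ν => by
    rw [h1, Matrix.mul_apply, Finset.sum_eq_single ⟨i, le_refl _⟩]
    · simp [leadBlock, hU, coordMatrix, tildeFrame_repr]
    · intro b _ hb
      have : (b : Fin r) < i := lt_of_le_of_ne b.2 fun h => hb (Subtype.ext h)
      simp only [leadBlock, Matrix.submatrix_apply]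
      rw [hU, coordMatrix_tildeFrame_lt e ξ _ _ this, zero_mul]
    · simp
  have h3 : U i j = ξ ⟨(i, j), hij⟩ := by
    have hij' : i < j := hij
    simp [hU, coordMatrix, tildeFrame_repr, hij'.ne, hij']
  rw [← h3, hUA, blockCoord]
  refine Finset.sum_congr rfl fun ν _ => ?_
  rw [← h2]
  simp only [L, dif_pos ν.2]

theorem adapted_of_det_ne_zero (e : Basis (Fin r) ℂ V) {w : Fin r → V}
    (hli : LinearIndependent ℂ w) {f : FullFlag r (Dual ℂ V)} (hw : Adapted w f)
    (hdet : ∀ k, (leadBlock (coordMatrix e w) k).det ≠ 0) :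
    Adapted (tildeFrame e (blockCoord (coordMatrix e w))) f := by
  have : FiniteDimensional ℂ V := e.finiteDimensional_of_finite
  set A := coordMatrix e w with hA
  have hmem : ∀ i, tildeFrame e (blockCoord A) i =
      ∑ ν : {j : Fin r // j ≤ i}, (leadBlock A i)⁻¹ ⟨i, le_refl _⟩ ν • w ν := fun i => by
    apply e.repr.injective
    ext j
    rw [tildeFrame_repr]
    simp only [map_sum, map_smul, Finsupp.finsetSum_apply, Finsupp.smul_apply, smul_eq_mul]
    by_cases hij : i < j
    · rw [if_neg hij.ne, dif_pos hij]; rfl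
    · have hji : j ≤ i := not_lt.mp hij
      have h1 : ((leadBlock A i)⁻¹ * leadBlock A i) ⟨i, le_refl _⟩ ⟨j, hji⟩
          = if i = j then 1 else 0 := by
        rw [Matrix.nonsing_inv_mul _ (isUnit_iff_ne_zero.mpr (hdet i)), Matrix.one_apply]
        simp
      rw [dif_neg hij, ← h1, Matrix.mul_apply]
      rfl
  have hle : ∀ i, leadSpan (tildeFrame e (blockCoord A)) i ≤ leadSpan w i := fun i => by
    rw [leadSpan, Submodule.span_le]
    rintro _ ⟨j, hj, rfl⟩
    rw [SetLike.mem_coe, hmem]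
    refine Submodule.sum_mem _ fun ν _ => Submodule.smul_mem _ _ (mem_leadSpan w ?_)
    exact lt_of_le_of_lt (by simpa using ν.2) hj
  intro i
  rw [hw i, Submodule.eq_of_le_of_finrank_eq (hle i)
    (by rw [finrank_leadSpan hli, finrank_leadSpan (linearIndependent_tildeFrame e _)])]

theorem flagCoord_eq (e : Basis (Fin r) ℂ V) {ξ : PairIdx r → ℂ}
    {f : FullFlag r (Dual ℂ V)} (h : Adapted (tildeFrame e ξ) f) : flagCoord e f = ξ := by
  have hex : ∃ ξ, Adapted (tildeFrame e ξ) f := ⟨ξ, h⟩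
  rw [flagCoord, dif_pos hex, (det_ne_zero_of_adapted e h hex.choose_spec).2,
    ← (det_ne_zero_of_adapted e h h).2]

theorem contDiff_det {ι G : Type*} [Fintype ι] [DecidableEq ι] [NormedAddCommGroup G]
    [NormedSpace ℂ G] {A : G → Matrix ι ι ℂ} {s : Set G}
    (hA : ∀ i j, ContDiffOn ℂ ω (fun x => A x i j) s) : ContDiffOn ℂ ω (fun x => (A x).det) s := by
  simp only [Matrix.det_apply]
  refine ContDiffOn.sum fun σ _ => ContDiffOn.const_smul _ ?_
  exact contDiffOn_prod fun i _ => hA _ _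

theorem contDiffOn_blockCoord {G : Type*} [NormedAddCommGroup G]
    [NormedSpace ℂ G] {A : G → Matrix (Fin r) (Fin r) ℂ} {s : Set G}
    (hA : ∀ i j, ContDiffOn ℂ ω (fun x => A x i j) s)
    (hd : ∀ x ∈ s, ∀ k, (leadBlock (A x) k).det ≠ 0) :
    ContDiffOn ℂ ω (fun x => blockCoord (A x)) s := by
  rw [contDiffOn_pi]
  intro p
  unfold blockCoord
  refine ContDiffOn.sum fun ν _ => ContDiffOn.mul ?_ (hA _ _)
  simp only [Matrix.inv_def, Matrix.smul_apply, Ring.inverse_eq_inv', smul_eq_mul,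
    Matrix.adjugate_apply]
  refine ContDiffOn.mul (ContDiffOn.inv (contDiff_det fun i j => hA _ _) fun x hx => hd x hx _) ?_
  refine contDiff_det fun i j => ?_
  simp only [Matrix.updateRow_apply]
  split_ifs
  · exact contDiffOn_const
  · exact hA _ _

end Flags

/-! ### The flag bundle of the dual of a holomorphic vector bundle, as a complex manifold -/

section FlagBundle
variable {n r : ℕ} {X : Type*} [TopologicalSpace X] [ChartedSpace (Fin n → ℂ) X]
  {E : X → Type*} [TopologicalSpace (TotalSpace (Fin r → ℂ) E)]
  [∀ x, AddCommGroup (E x)] [∀ x, Module ℂ (E x)] [∀ x, TopologicalSpace (E x)]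
  [FiberBundle (Fin r → ℂ) E]

/-- The bundle `F(E^*) → X` of full flags in the fibres of the dual of `E`. The parameter `n`, the
dimension of `X`, only serves to make the complex structure of `F(E^*)` available to instance
search. -/
structure FlagBundle (n r : ℕ) {X : Type*} (E : X → Type*) [∀ x, AddCommGroup (E x)]
    [∀ x, Module ℂ (E x)] where
  base : X
  flag : FullFlag r (Dual ℂ (E base))

/-- The model space of `F(E^*)`: coordinates `z_k` on the base and `ξ_{ij}`, `i < j`, on the fibre. -/
abbrev FlagModel (n r : ℕ) : Type := (Fin n → ℂ) × (PairIdx r → ℂ)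

variable [VectorBundle ℂ (Fin r → ℂ) E]

namespace FlagBundle

variable (n r) in
/-- The set where both the chart of `X` and the trivialization of `E` at `x₀` are defined. -/
def baseDomain (E : X → Type*) [TopologicalSpace (TotalSpace (Fin r → ℂ) E)]
    [∀ x, AddCommGroup (E x)] [∀ x, Module ℂ (E x)] [∀ x, TopologicalSpace (E x)]
    [FiberBundle (Fin r → ℂ) E] (x₀ : X) : Set X :=
  (chartAt (Fin n → ℂ) x₀).source ∩ (trivializationAt (Fin r → ℂ) E x₀).baseSet

variable (E) in
/-- The holomorphic frame of `E` near `x₀` given by the trivialization at `x₀` and a basis. -/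
def stdFrame (x₀ : X) (b : Basis (Fin r) ℂ (Fin r → ℂ)) (i : Fin r) (x : X) : E x :=
  (trivializationAt (Fin r → ℂ) E x₀).localFrame b i x

/-- The local coordinates `(z, ξ)` on `F(E^*)`. -/
def chartFun (x₀ : X) (b : Basis (Fin r) ℂ (Fin r → ℂ)) (y : FlagBundle n r E) : FlagModel n r :=
  (chartAt (Fin n → ℂ) x₀ y.base, flagCoord (fun i => stdFrame E x₀ b i y.base) y.flag)

/-- The domain of the local coordinates `(z, ξ)`. -/
def chartDom (x₀ : X) (b : Basis (Fin r) ℂ (Fin r → ℂ)) : Set (FlagBundle n r E) :=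
  {y | y.base ∈ baseDomain n r E x₀ ∧
    ∃ ξ, Adapted (tildeFrame (fun i => stdFrame E x₀ b i y.base) ξ) y.flag}

variable (n r E) in
/-- The range of the local coordinates `(z, ξ)`. -/
def chartRange (x₀ : X) : Set (FlagModel n r) :=
  {u | u.1 ∈ (chartAt (Fin n → ℂ) x₀).target ∧
    (chartAt (Fin n → ℂ) x₀).symm u.1 ∈ (trivializationAt (Fin r → ℂ) E x₀).baseSet}

theorem stdFrame_eq {x₀ x : X} (b : Basis (Fin r) ℂ (Fin r → ℂ))
    (hx : x ∈ (trivializationAt (Fin r → ℂ) E x₀).baseSet) :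
    (fun i => stdFrame E x₀ b i x) = (trivializationAt (Fin r → ℂ) E x₀).basisAt b hx := by
  ext i; simp [stdFrame, hx]

theorem adapted_chartFun {x₀ : X} {b : Basis (Fin r) ℂ (Fin r → ℂ)} {y : FlagBundle n r E}
    (hy : y ∈ chartDom x₀ b) :
    Adapted (tildeFrame (fun i => stdFrame E x₀ b i y.base) (chartFun x₀ b y).2) y.flag := by
  obtain ⟨hx, ξ, hξ⟩ := hy
  simp only [chartFun]
  rw [stdFrame_eq b hx.2] at hξ ⊢
  rwa [flagCoord_eq _ hξ]

theorem bijOn_chartFun (x₀ : X) (b : Basis (Fin r) ℂ (Fin r → ℂ)) :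
    BijOn (chartFun x₀ b) (chartDom (n := n) (E := E) x₀ b) (chartRange n r E x₀) := by
  refine ⟨?_, ?_, ?_⟩
  · intro y hy
    refine ⟨(chartAt (Fin n → ℂ) x₀).map_source hy.1.1, ?_⟩
    simp only [chartFun]
    rw [(chartAt (Fin n → ℂ) x₀).left_inv hy.1.1]
    exact hy.1.2
  · intro y hy y' hy' h
    have h1 := adapted_chartFun hy
    have h2 := adapted_chartFun hy'
    have hx : y.base = y'.base := (chartAt (Fin n → ℂ) x₀).injOn hy.1.1 hy'.1.1 (congrArg Prod.fst h)
    rw [h] at h1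
    obtain ⟨x, f⟩ := y
    obtain ⟨x', f'⟩ := y'
    simp only at hx
    subst hx
    exact congrArg (FlagBundle.mk x) (Adapted.eq h1 h2)
  · rintro ⟨z, ξ⟩ ⟨hz, hb⟩
    set x := (chartAt (Fin n → ℂ) x₀).symm z with hx
    set e := (trivializationAt (Fin r → ℂ) E x₀).basisAt b hb with he
    have had : Adapted (tildeFrame e ξ)
        (flagOfFrame e (tildeFrame e ξ) (linearIndependent_tildeFrame e ξ)) := fun i => rfl
    refine ⟨⟨x, flagOfFrame e (tildeFrame e ξ) (linearIndependent_tildeFrame e ξ)⟩,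
      ⟨⟨(chartAt (Fin n → ℂ) x₀).map_target hz, hb⟩, ξ, ?_⟩, ?_⟩
    · rw [stdFrame_eq b hb]
      exact had
    · simp only [chartFun]
      rw [stdFrame_eq b hb, flagCoord_eq _ had, hx, (chartAt (Fin n → ℂ) x₀).right_inv hz]

theorem exists_mem_chartDom (y : FlagBundle n r E) :
    ∃ b : Basis (Fin r) ℂ (Fin r → ℂ), y ∈ chartDom y.base b ∧ (chartFun y.base b y).2 = 0 := by
  have hx : y.base ∈ (trivializationAt (Fin r → ℂ) E y.base).baseSet :=
    FiberBundle.mem_baseSet_trivializationAt' y.base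
  let L := (trivializationAt (Fin r → ℂ) E y.base).linearEquivAt ℂ y.base hx
  obtain ⟨w, hw⟩ := exists_adapted_basis ((Pi.basisFun ℂ (Fin r)).map L.symm) y.flag
  have hb : (trivializationAt (Fin r → ℂ) E y.base).basisAt (w.map L) hx = w := by
    ext i
    rw [Trivialization.basisAt, Basis.map_apply, Basis.map_apply]
    exact L.symm_apply_apply _
  have had : Adapted (tildeFrame (fun i => stdFrame E y.base (w.map L) i y.base) 0) y.flag := by
    rw [tildeFrame_zero, stdFrame_eq _ hx, hb]
    exact hw
  refine ⟨w.map L, ⟨⟨mem_chart_source _ _, hx⟩, 0, had⟩, ?_⟩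
  simp only [chartFun]
  rw [stdFrame_eq _ hx] at had ⊢
  exact flagCoord_eq _ had

theorem nonempty_of_base (x₀ : X) : Nonempty (FlagBundle n r E) := by
  have hx : x₀ ∈ (trivializationAt (Fin r → ℂ) E x₀).baseSet :=
    FiberBundle.mem_baseSet_trivializationAt' x₀
  let e := (trivializationAt (Fin r → ℂ) E x₀).basisAt (Pi.basisFun ℂ (Fin r)) hx
  exact ⟨⟨x₀, flagOfFrame e e e.linearIndependent⟩⟩

variable (n r E) in
/-- The local coordinates `(z, ξ)` as a partial equivalence. -/
def localChart (x₀ : X) (b : Basis (Fin r) ℂ (Fin r → ℂ)) :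
    PartialEquiv (FlagBundle n r E) (FlagModel n r) :=
  haveI : Nonempty (FlagBundle n r E) := nonempty_of_base x₀
  BijOn.toPartialEquiv (chartFun x₀ b) (chartDom x₀ b) (chartRange n r E x₀) (bijOn_chartFun x₀ b)

theorem isOpen_chartRange (x₀ : X) : IsOpen (chartRange n r E x₀) := by
  have h := (chartAt (Fin n → ℂ) x₀).isOpen_inter_preimage_symm
    (trivializationAt (Fin r → ℂ) E x₀).open_baseSet
  exact h.preimage continuous_fst

variable (E) in
/-- The matrix expressing one frame of `E` in another one. -/
def frameMatrix (x₀ : X) (b : Basis (Fin r) ℂ (Fin r → ℂ)) (x₁ : X)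
    (b' : Basis (Fin r) ℂ (Fin r → ℂ)) (x : X) (k j : Fin r) : ℂ :=
  (b'.repr ((trivializationAt (Fin r → ℂ) E x₀).coordChangeL ℂ
    (trivializationAt (Fin r → ℂ) E x₁) x (b k))) j

variable (n r E) in
/-- The coordinates of the frame `e_i + ∑ ξ_{ij} e_j` in another frame of `E`. -/
def transMatrix (x₀ : X) (b : Basis (Fin r) ℂ (Fin r → ℂ)) (x₁ : X)
    (b' : Basis (Fin r) ℂ (Fin r → ℂ)) (u : FlagModel n r) : Matrix (Fin r) (Fin r) ℂ :=
  fun i j => frameMatrix E x₀ b x₁ b' ((chartAt (Fin n → ℂ) x₀).symm u.1) i j +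
    ∑ k, if h : i < k then u.2 ⟨(i, k), h⟩ *
      frameMatrix E x₀ b x₁ b' ((chartAt (Fin n → ℂ) x₀).symm u.1) k j else 0

variable (n r E) in
/-- The part of a coordinate domain that lies over another base domain. -/
def overlap (x₀ x₁ : X) : Set (FlagModel n r) :=
  {u | u ∈ chartRange n r E x₀ ∧ (chartAt (Fin n → ℂ) x₀).symm u.1 ∈ baseDomain n r E x₁}

theorem isOpen_overlap (x₀ x₁ : X) : IsOpen (overlap n r E x₀ x₁) := by
  have h := (chartAt (Fin n → ℂ) x₀).isOpen_inter_preimage_symm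
    ((trivializationAt (Fin r → ℂ) E x₀).open_baseSet.inter
      ((chartAt (Fin n → ℂ) x₁).open_source.inter
        (trivializationAt (Fin r → ℂ) E x₁).open_baseSet))
  convert h.preimage (continuous_fst (X := Fin n → ℂ) (Y := PairIdx r → ℂ)) using 1
  ext u
  simp [overlap, chartRange, baseDomain, and_assoc]

theorem coordMatrix_eq {x₀ x₁ : X} (b b' : Basis (Fin r) ℂ (Fin r → ℂ)) {u : FlagModel n r}
    (hu : u ∈ overlap n r E x₀ x₁) :
    coordMatrix ((trivializationAt (Fin r → ℂ) E x₁).basisAt b' hu.2.2)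
      (tildeFrame ((trivializationAt (Fin r → ℂ) E x₀).basisAt b hu.1.2) u.2) =
    transMatrix n r E x₀ b x₁ b' u := by
  have key : ∀ k j, ((trivializationAt (Fin r → ℂ) E x₁).basisAt b' hu.2.2).repr
      ((trivializationAt (Fin r → ℂ) E x₀).basisAt b hu.1.2 k) j =
      frameMatrix E x₀ b x₁ b' ((chartAt (Fin n → ℂ) x₀).symm u.1) k j := fun k j => by
    rw [frameMatrix, Trivialization.coordChangeL_apply _ _ ⟨hu.1.2, hu.2.2⟩]
    simp [Trivialization.basisAt]
  ext i j
  simp only [coordMatrix, transMatrix, tildeFrame, map_add, map_sum, Finsupp.add_apply,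
    Finsupp.finsetSum_apply, key]
  congr 1
  refine Finset.sum_congr rfl fun k _ => ?_
  by_cases h : i < k
  · simp [h, key]
  · simp [h]

theorem localChart_trans_source (x₀ : X) (b : Basis (Fin r) ℂ (Fin r → ℂ)) (x₁ : X)
    (b' : Basis (Fin r) ℂ (Fin r → ℂ)) :
    ((localChart n r E x₀ b).symm.trans (localChart n r E x₁ b')).source =
      {u | u ∈ overlap n r E x₀ x₁ ∧ ∀ k, (leadBlock (transMatrix n r E x₀ b x₁ b' u) k).det ≠ 0} ∧
    ∀ u ∈ ((localChart n r E x₀ b).symm.trans (localChart n r E x₁ b')).source,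
      (localChart n r E x₀ b).symm.trans (localChart n r E x₁ b') u =
        (chartAt (Fin n → ℂ) x₁ ((chartAt (Fin n → ℂ) x₀).symm u.1),
          blockCoord (transMatrix n r E x₀ b x₁ b' u)) := by
  have hpt : ∀ u ∈ chartRange n r E x₀, ∃ y : FlagBundle n r E,
      (localChart n r E x₀ b).symm u = y ∧ y.base = (chartAt (Fin n → ℂ) x₀).symm u.1 ∧
      Adapted (tildeFrame (fun i => stdFrame E x₀ b i y.base) u.2) y.flag := fun u hu => by
    have h1 : (localChart n r E x₀ b).symm u ∈ chartDom x₀ b :=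
      (localChart n r E x₀ b).map_target hu
    have h2 : chartFun x₀ b ((localChart n r E x₀ b).symm u) = u :=
      (localChart n r E x₀ b).right_inv hu
    refine ⟨_, rfl, ?_, ?_⟩
    · have h3 : chartAt (Fin n → ℂ) x₀ ((localChart n r E x₀ b).symm u).base = u.1 :=
        congrArg Prod.fst h2
      rw [← h3, (chartAt (Fin n → ℂ) x₀).left_inv h1.1.1]
    · have h4 := adapted_chartFun h1
      rwa [h2] at h4
  have hiff : ∀ u ∈ overlap n r E x₀ x₁, ∀ y : FlagBundle n r E,
      y.base = (chartAt (Fin n → ℂ) x₀).symm u.1 →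
      Adapted (tildeFrame (fun i => stdFrame E x₀ b i y.base) u.2) y.flag →
      ∀ ξ, Adapted (tildeFrame (fun i => stdFrame E x₁ b' i y.base) ξ) y.flag ↔
        (∀ k, (leadBlock (transMatrix n r E x₀ b x₁ b' u) k).det ≠ 0) ∧
          ξ = blockCoord (transMatrix n r E x₀ b x₁ b' u) := by
    rintro u hu ⟨x, f⟩ hx had ξ
    simp only at hx had ⊢
    subst hx
    rw [← coordMatrix_eq b b' hu]
    rw [stdFrame_eq b hu.1.2] at had
    rw [stdFrame_eq b' hu.2.2]
    constructor
    · exact fun h => det_ne_zero_of_adapted _ had h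
    · rintro ⟨h, rfl⟩
      exact adapted_of_det_ne_zero _ (linearIndependent_tildeFrame _ _) had h
  have hsrc : ∀ u, u ∈ ((localChart n r E x₀ b).symm.trans (localChart n r E x₁ b')).source ↔
      u ∈ chartRange n r E x₀ ∧ (localChart n r E x₀ b).symm u ∈ chartDom x₁ b' := fun u => by
    rw [PartialEquiv.trans_source]; rfl
  constructor
  · ext u
    rw [hsrc]
    constructor
    · rintro ⟨hu, hd⟩
      obtain ⟨y, hy, hyb, had⟩ := hpt u hu
      rw [hy] at hd
      have ho : u ∈ overlap n r E x₀ x₁ := ⟨hu, hyb ▸ hd.1⟩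
      obtain ⟨ξ, hξ⟩ := hd.2
      exact ⟨ho, ((hiff u ho y hyb had ξ).mp hξ).1⟩
    · rintro ⟨ho, hdet⟩
      obtain ⟨y, hy, hyb, had⟩ := hpt u ho.1
      refine ⟨ho.1, ?_⟩
      rw [hy]
      exact ⟨hyb ▸ ho.2, _, (hiff u ho y hyb had _).mpr ⟨hdet, rfl⟩⟩
  · intro u hu
    rw [hsrc] at hu
    obtain ⟨y, hy, hyb, had⟩ := hpt u hu.1
    have hd := hu.2
    rw [hy] at hd
    have ho : u ∈ overlap n r E x₀ x₁ := ⟨hu.1, hyb ▸ hd.1⟩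
    have h5 : (localChart n r E x₀ b).symm.trans (localChart n r E x₁ b') u = chartFun x₁ b' y := by
      rw [← hy]; rfl
    rw [h5]
    refine Prod.ext ?_ ?_
    · change chartAt (Fin n → ℂ) x₁ y.base = _
      rw [hyb]
    · exact ((hiff u ho y hyb had _).mp (adapted_chartFun hd)).2

variable [IsManifold 𝓘(ℂ, Fin n → ℂ) ω X]
  [ContMDiffVectorBundle ω (Fin r → ℂ) E 𝓘(ℂ, Fin n → ℂ)]

theorem contDiffOn_transMatrix (x₀ : X) (b : Basis (Fin r) ℂ (Fin r → ℂ)) (x₁ : X)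
    (b' : Basis (Fin r) ℂ (Fin r → ℂ)) (i j : Fin r) :
    ContDiffOn ℂ ω (fun u => transMatrix n r E x₀ b x₁ b' u i j) (overlap n r E x₀ x₁) := by
  have hc : ContDiffOn ℂ ω (fun z : Fin n → ℂ => ((trivializationAt (Fin r → ℂ) E x₀).coordChangeL ℂ
      (trivializationAt (Fin r → ℂ) E x₁) ((chartAt (Fin n → ℂ) x₀).symm z) :
        (Fin r → ℂ) →L[ℂ] (Fin r → ℂ)))
      ((chartAt (Fin n → ℂ) x₀).target ∩ (chartAt (Fin n → ℂ) x₀).symm ⁻¹'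
        ((trivializationAt (Fin r → ℂ) E x₀).baseSet ∩
          (trivializationAt (Fin r → ℂ) E x₁).baseSet)) := by
    rw [← contMDiffOn_iff_contDiffOn]
    exact (contMDiffOn_coordChangeL (IB := 𝓘(ℂ, Fin n → ℂ)) (n := ω)
      (trivializationAt (Fin r → ℂ) E x₀) (trivializationAt (Fin r → ℂ) E x₁)).comp
      ((contMDiffOn_chart_symm (I := 𝓘(ℂ, Fin n → ℂ)) (n := ω) (x := x₀)).mono inter_subset_left)
      inter_subset_right
  have hf : ∀ k j, ContDiffOn ℂ ω (fun u : FlagModel n r => frameMatrix E x₀ b x₁ b'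
      ((chartAt (Fin n → ℂ) x₀).symm u.1) k j) (overlap n r E x₀ x₁) := fun k j => by
    have h1 : ContDiffOn ℂ ω (fun u : FlagModel n r =>
        ((trivializationAt (Fin r → ℂ) E x₀).coordChangeL ℂ
        (trivializationAt (Fin r → ℂ) E x₁) ((chartAt (Fin n → ℂ) x₀).symm u.1) :
        (Fin r → ℂ) →L[ℂ] (Fin r → ℂ)) (b k)) (overlap n r E x₀ x₁) := by
      refine ContDiffOn.clm_apply ?_ contDiffOn_const
      exact hc.comp contDiff_fst.contDiffOn fun u hu => ⟨hu.1.1, hu.1.2, hu.2.2⟩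
    exact ((b'.coord j).toContinuousLinearMap.contDiff (n := ω)).comp_contDiffOn h1
  unfold transMatrix
  refine (hf i j).add (ContDiffOn.sum fun k _ => ?_)
  by_cases h : i < k
  · simp only [h, dif_pos]
    refine ContDiffOn.mul ?_ (hf k j)
    fun_prop
  · simp only [h, dif_neg, not_false_eq_true]
    exact contDiffOn_const

theorem isOpen_trans_source (x₀ : X) (b : Basis (Fin r) ℂ (Fin r → ℂ)) (x₁ : X)
    (b' : Basis (Fin r) ℂ (Fin r → ℂ)) :
    IsOpen ((localChart n r E x₀ b).symm.trans (localChart n r E x₁ b')).source := by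
  rw [(localChart_trans_source x₀ b x₁ b').1]
  have h : ContinuousOn (fun u k => (leadBlock (transMatrix n r E x₀ b x₁ b' u) k).det)
      (overlap n r E x₀ x₁) := by
    rw [continuousOn_pi]
    exact fun k => (contDiff_det fun i j => contDiffOn_transMatrix x₀ b x₁ b' _ _).continuousOn
  have ho : IsOpen {v : Fin r → ℂ | ∀ k, v k ≠ 0} := by
    simp only [ofPred_forall]
    exact isOpen_iInter_of_finite fun k => isOpen_ne_fun (continuous_apply k) continuous_const
  exact h.isOpen_inter_preimage (isOpen_overlap x₀ x₁) ho

theorem contDiffOn_trans (x₀ : X) (b : Basis (Fin r) ℂ (Fin r → ℂ)) (x₁ : X)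
    (b' : Basis (Fin r) ℂ (Fin r → ℂ)) :
    ContDiffOn ℂ ω ((localChart n r E x₀ b).symm.trans (localChart n r E x₁ b'))
      ((localChart n r E x₀ b).symm.trans (localChart n r E x₁ b')).source := by
  refine ContDiffOn.congr ?_ (localChart_trans_source x₀ b x₁ b').2
  rw [(localChart_trans_source x₀ b x₁ b').1]
  refine ContDiffOn.prodMk ?_ ?_
  · have h : ContDiffOn ℂ ω (fun z => chartAt (Fin n → ℂ) x₁ ((chartAt (Fin n → ℂ) x₀).symm z))
        ((chartAt (Fin n → ℂ) x₀).target ∩ (chartAt (Fin n → ℂ) x₀).symm ⁻¹'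
          (chartAt (Fin n → ℂ) x₁).source) := by
      rw [← contMDiffOn_iff_contDiffOn]
      exact (contMDiffOn_chart (I := 𝓘(ℂ, Fin n → ℂ)) (n := ω) (x := x₁)).comp
        ((contMDiffOn_chart_symm (I := 𝓘(ℂ, Fin n → ℂ)) (n := ω) (x := x₀)).mono inter_subset_left)
        inter_subset_right
    exact h.comp contDiff_fst.contDiffOn fun u hu => ⟨hu.1.1.1, hu.1.2.1⟩
  · exact contDiffOn_blockCoord
      (fun i j => (contDiffOn_transMatrix x₀ b x₁ b' i j).mono fun u hu => hu.1)
      fun u hu => hu.2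

variable (n r E) in
/-- The holomorphic atlas of `F(E^*)` by the coordinates `(z, ξ)`. -/
@[reducible]
def chartedSpaceCore : ChartedSpaceCore (FlagModel n r) (FlagBundle n r E) where
  atlas := {c | ∃ x₀ b, c = localChart n r E x₀ b}
  chartAt y := localChart n r E y.base (exists_mem_chartDom y).choose
  mem_chart_source y := (exists_mem_chartDom y).choose_spec.1
  chart_mem_atlas y := ⟨_, _, rfl⟩
  open_source := by
    rintro _ _ ⟨x₀, b, rfl⟩ ⟨x₁, b', rfl⟩
    exact isOpen_trans_source x₀ b x₁ b'
  continuousOn_toFun := by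
    rintro _ _ ⟨x₀, b, rfl⟩ ⟨x₁, b', rfl⟩
    exact (contDiffOn_trans x₀ b x₁ b').continuousOn

instance : TopologicalSpace (FlagBundle n r E) := (chartedSpaceCore n r E).toTopologicalSpace

instance : ChartedSpace (FlagModel n r) (FlagBundle n r E) :=
  (chartedSpaceCore n r E).toChartedSpace

/-- `F(E^*)` is a complex manifold. -/
instance : IsManifold 𝓘(ℂ, FlagModel n r) ω (FlagBundle n r E) := by
  refine isManifold_of_contDiffOn _ _ _ ?_
  intro c c' hc hc'
  obtain ⟨e, he⟩ := Set.mem_iUnion.mp hc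
  obtain ⟨⟨x₀, b, rfl⟩, rfl⟩ := Set.mem_iUnion.mp he
  obtain ⟨e', he'⟩ := Set.mem_iUnion.mp hc'
  obtain ⟨⟨x₁, b', rfl⟩, rfl⟩ := Set.mem_iUnion.mp he'
  have h := contDiffOn_trans (n := n) (E := E) x₀ b x₁ b'
  simp only [modelWithCornersSelf_coe, modelWithCornersSelf_coe_symm, range_id, preimage_id,
    inter_univ, Function.id_comp, Function.comp_id]
  exact h

end FlagBundle
end FlagBundle

/-! ### Hermitian bundles, Chern connection and curvature -/

section Local
variable {M : Type*} [NormedAddCommGroup M] [NormedSpace ℂ M]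

/-- The matrix `A = ∂H H⁻¹` of the Chern connection in a holomorphic frame `e` with Gram matrix
`H_{ij} = ⟨e_i, e_j⟩`, so that `∇ e_i = ∑ j, A_{ij} e_j`. -/
def connectionMatrix {r : ℕ} (H : M → Matrix (Fin r) (Fin r) ℂ) (i j : Fin r) (z : M) :
    M [⋀^Fin 1]→L[ℝ] ℂ :=
  ∑ k, (H z)⁻¹ k j • del (fun w => ContinuousAlternatingMap.constOfIsEmpty ℝ M (Fin 0) (H w i k)) z

/-- The curvature matrix `Θ = ∂bar A` of the Chern connection, so that
`Θ(e_i) = ∑ j, Θ_{ij} e_j`. -/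
def curvatureMatrix {r : ℕ} (H : M → Matrix (Fin r) (Fin r) ℂ) (i j : Fin r) (z : M) :
    M [⋀^Fin 2]→L[ℝ] ℂ :=
  delbar (connectionMatrix H i j) z

variable {Y : Type*} [TopologicalSpace Y] [ChartedSpace M Y]

variable (M) in
/-- Smoothness in the real sense of a complex-valued function on a complex manifold. -/
def SmoothFunOn (f : Y → ℂ) (s : Set Y) : Prop := ContMDiffOn 𝓘(ℝ, M) 𝓘(ℝ, ℂ) ∞ f s

variable (M) in
/-- The function `f` is holomorphic in a neighbourhood of `y₀`. -/
def HolomorphicNear (f : Y → ℂ) (y₀ : Y) : Prop :=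
  ∀ᶠ y in 𝓝 y₀, MDifferentiableAt 𝓘(ℂ, M) 𝓘(ℂ, ℂ) f y

/-- Positive definite real `(1,1)`-forms `i ∑ κ_{jk} dz_j ∧ dzbar_k`. -/
def IsPositiveForm (κ : DiffForm M Y 2) : Prop :=
  ∀ (y : Y) (u v : TangentSpace 𝓘(ℂ, M) y),
    (κ y ![u, v]).im = 0 ∧ κ y ![Complex.I • u, Complex.I • v] = κ y ![u, v] ∧
      (u ≠ 0 → 0 < (κ y ![u, Complex.I • u]).re)

/-- The form `β` of type `(k,0)` is holomorphic in a neighbourhood of `y₀`. -/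
def IsHolomorphicForm {k : ℕ} (β : ∀ y : Y, TangentSpace 𝓘(ℂ, M) y [⋀^Fin k]→L[ℂ] ℂ) (y₀ : Y) :
    Prop :=
  ∀ᶠ u in 𝓝 (chartAt M y₀ y₀), DifferentiableAt ℂ (fun v : M =>
    ((β ((chartAt M y₀).symm v)).compContinuousLinearMap
      (mfderiv 𝓘(ℂ, M) 𝓘(ℂ, M) (chartAt M y₀).symm v) : M [⋀^Fin k]→L[ℂ] ℂ)) u

end Local

open FlagBundle

section Main
variable {n r : ℕ} {X : Type*} [TopologicalSpace X] [ChartedSpace (Fin n → ℂ) X]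
  {E : X → Type*} [TopologicalSpace (TotalSpace (Fin r → ℂ) E)]
  [∀ x, AddCommGroup (E x)] [∀ x, Module ℂ (E x)] [∀ x, TopologicalSpace (E x)]
  [FiberBundle (Fin r → ℂ) E] [VectorBundle ℂ (Fin r → ℂ) E]

variable (n r E) in
/-- Smooth Hermitian metrics on `E`, linear in the first and conjugate linear in the second variable.
-/
structure HermitianMetric where
  inner : ∀ x, E x →ₗ[ℂ] E x →ₗ⋆[ℂ] ℂ
  conj_symm : ∀ x v w, (starRingEnd ℂ) (inner x v w) = inner x w v
  pos : ∀ x v, v ≠ 0 → 0 < (inner x v v).re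
  smooth : ∀ (x₀ : X) (i j : Fin r), SmoothFunOn (Fin n → ℂ)
    (fun x => inner x (stdFrame E x₀ (Pi.basisFun ℂ (Fin r)) i x)
      (stdFrame E x₀ (Pi.basisFun ℂ (Fin r)) j x))
    (trivializationAt (Fin r → ℂ) E x₀).baseSet

variable (h : HermitianMetric n r E)

/-- The Gram matrix of a frame, in the chart of `X` at `x₀`. -/
def gramInChart (e : Fin r → ∀ x, E x) (x₀ : X) (z : Fin n → ℂ) : Matrix (Fin r) (Fin r) ℂ :=
  fun i j => h.inner ((chartAt (Fin n → ℂ) x₀).symm z) (e i _) (e j _)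

/-- The two-form `⟨Θ_{E,h}(s), t⟩` at `x`, where `Θ_{E,h}` is the curvature of the Chern connection
(computed in the holomorphic frame given by the trivialization at `x`). -/
def curvaturePairing (x : X) (s t : E x) : TangentSpace 𝓘(ℂ, Fin n → ℂ) x [⋀^Fin 2]→L[ℝ] ℂ :=
  ∑ i, ∑ j, ((trivializationAt (Fin r → ℂ) E x ⟨x, s⟩).2 i *
      h.inner x (stdFrame E x (Pi.basisFun ℂ (Fin r)) j x) t) •
    curvatureMatrix (gramInChart h (stdFrame E x (Pi.basisFun ℂ (Fin r))) x) i j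
      (chartAt (Fin n → ℂ) x x)

variable (n) in
/-- The family `e` is a holomorphic frame of `E` in a neighbourhood of `x₀`. -/
def IsHolFrameNear (e : Fin r → ∀ x, E x) (x₀ : X) : Prop :=
  ∃ U : Set X, IsOpen U ∧ x₀ ∈ U ∧ IsLocalFrameOn 𝓘(ℂ, Fin n → ℂ) (Fin r → ℂ) ω e U

/-- The Chern connection satisfies `∇ e_i = 0` at `x₀` for all `i`. -/
def IsParallelAt (e : Fin r → ∀ x, E x) (x₀ : X) : Prop :=
  ∀ i j, connectionMatrix (gramInChart h e x₀) i j (chartAt (Fin n → ℂ) x₀ x₀) = 0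

/-- The holomorphic frame `e` near the base point of `y` is normal at that point,
`⟨e_i(z), e_j(z)⟩ = δ_{ij} - ∑ c_{klij} z_k zbar_l + O(|z|^3)`, and the flag `y` is
`V_i = Vect(e₁, …, e_i)^†`. Here `z` are the coordinates of the preferred chart, centred at the point;
the condition is the same for all holomorphic coordinates. The normal coordinates on `F(E^*)` are then
`(z, ξ)` with `ξ = flagCoord e`. -/
def IsNormalFrame (e : Fin r → ∀ x, E x) (y : FlagBundle n r E) : Prop :=
  IsHolFrameNear n e y.base ∧ Adapted (fun i => e i y.base) y.flag ∧
  ∃ c : Fin n → Fin n → Fin r → Fin r → ℂ, ∀ i j,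
    (fun x => h.inner x (e i x) (e j x) - ((if i = j then 1 else 0) - ∑ k, ∑ l, c k l i j *
      (chartAt (Fin n → ℂ) y.base x - chartAt (Fin n → ℂ) y.base y.base) k *
      (starRingEnd ℂ) ((chartAt (Fin n → ℂ) y.base x - chartAt (Fin n → ℂ) y.base y.base) l)))
    =O[𝓝 y.base] fun x => ‖chartAt (Fin n → ℂ) y.base x - chartAt (Fin n → ℂ) y.base y.base‖ ^ 3

/-- An orthonormal basis of the fibre of `E` that gives the flag `y`. -/
def IsUnitaryAdapted (y : FlagBundle n r E) (v : Fin r → E y.base) : Prop :=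
  (∀ i j, h.inner y.base (v i) (v j) = if i = j then 1 else 0) ∧ Adapted v y.flag

variable [IsManifold 𝓘(ℂ, Fin n → ℂ) ω X]
  [ContMDiffVectorBundle ω (Fin r → ℂ) E 𝓘(ℂ, Fin n → ℂ)]

/-- The differential of the projection `π : F(E^*) → X`. -/
def projDeriv (y : FlagBundle n r E) :
    TangentSpace 𝓘(ℂ, FlagModel n r) y →L[ℂ] TangentSpace 𝓘(ℂ, Fin n → ℂ) y.base :=
  mfderiv 𝓘(ℂ, FlagModel n r) 𝓘(ℂ, Fin n → ℂ) FlagBundle.base y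

/-- The vertical tangent space `T_{Y/X}`, for `Y = F(E^*)`. -/
def verticalSpace (y : FlagBundle n r E) : Submodule ℂ (TangentSpace 𝓘(ℂ, FlagModel n r) y) :=
  LinearMap.ker (projDeriv y).toLinearMap

/-- The horizontal tangent space given by the Chern connection: the tangent vectors to the local
sections of `F(E^*)` given by frames of `E` that are parallel at the point. -/
def horizontalSpace (y : FlagBundle n r E) : Submodule ℂ (TangentSpace 𝓘(ℂ, FlagModel n r) y) :=
  Submodule.span ℂ {w | ∃ (e : Fin r → ∀ x, E x) (s : X → FlagBundle n r E),
    IsHolFrameNear n e y.base ∧ IsParallelAt h e y.base ∧ s y.base = y ∧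
    (∀ᶠ x in 𝓝 y.base, (s x).base = x ∧ Adapted (fun i => e i (s x).base) (s x).flag) ∧
    ∃ v : TangentSpace 𝓘(ℂ, Fin n → ℂ) y.base,
      w = mfderiv 𝓘(ℂ, Fin n → ℂ) 𝓘(ℂ, FlagModel n r) s y.base v}

/-- The differential at `y` of the coordinate function `ξ_{ij}` given by the frame `e` of `E`. -/
def coordDeriv (e : Fin r → ∀ x, E x) (y : FlagBundle n r E) (p : PairIdx r) :
    TangentSpace 𝓘(ℂ, FlagModel n r) y →L[ℂ] ℂ :=
  mfderiv 𝓘(ℂ, FlagModel n r) 𝓘(ℂ, ℂ)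
    (fun y' : FlagBundle n r E => flagCoord (fun i => e i y'.base) y'.flag p) y

/-! ### Tautological line bundles and the relative canonical bundle -/

/-- The fibre `V_{i-1} / V_i` of the tautological line bundle `Q_i` (the index `i` runs from `0` in
`Fin r`). -/
abbrev TautFiber (i : Fin r) (y : FlagBundle n r E) : Type _ :=
  ↥(y.flag.space i.castSucc) ⧸ (y.flag.space i.succ).submoduleOf (y.flag.space i.castSucc)

/-- The square of the dual norm on `E^*`. -/
def dualNormSq (x : X) (σ : Dual ℂ (E x)) : ℝ :=
  sSup {t | ∃ v : E x, (h.inner x v v).re ≤ 1 ∧ t = ‖σ v‖ ^ 2}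

/-- The square of the tautological (quotient) norm on `Q_i`. -/
def tautNormSq (i : Fin r) (y : FlagBundle n r E) (q : TautFiber i y) : ℝ :=
  sInf {t | ∃ σ : y.flag.space i.castSucc,
    Submodule.Quotient.mk σ = q ∧ t = dualNormSq h y.base σ}

/-- The section `s` of `Q_i` is holomorphic in a neighbourhood of `y₀`: it lifts to a section of
`V_{i-1}` that is holomorphic as a section of the pull-back of `E^*`. -/
def IsHolTautSection (i : Fin r) (s : ∀ y : FlagBundle n r E, TautFiber i y)
    (y₀ : FlagBundle n r E) : Prop :=
  ∃ σ : ∀ y : FlagBundle n r E, y.flag.space i.castSucc,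
    (∀ᶠ y in 𝓝 y₀, s y = Submodule.Quotient.mk (σ y)) ∧
    ∀ j, HolomorphicNear (FlagModel n r) (fun y => (σ y : Dual ℂ (E y.base))
      (stdFrame E y₀.base (Pi.basisFun ℂ (Fin r)) j y.base)) y₀

/-- The sections `s_i` of the `Q_i` are holomorphic and without zeros near `y₀`. -/
def IsTautFrame (s : ∀ i, ∀ y : FlagBundle n r E, TautFiber i y) (y₀ : FlagBundle n r E) : Prop :=
  ∀ i, IsHolTautSection i (s i) y₀ ∧ s i y₀ ≠ 0

/-- `Θ` is the curvature form of `Q^a` with its tautological metric: `Θ = -∂∂bar log ‖S‖²` for all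
local holomorphic frames `S = f · s₁^{a₁} ⊗ … ⊗ s_r^{a_r}`, where `s_i` is a local holomorphic frame of
`Q_i` and `f` a holomorphic function without zeros, with `‖S‖² = |f|² ∏ ‖s_i‖^{2 a_i}`. The weights
`a_i` may be any real numbers. -/
def IsTautCurvature (a : Fin r → ℝ) (Θ : DiffForm (FlagModel n r) (FlagBundle n r E) 2) : Prop :=
  ∀ y₀, (∃ s, IsTautFrame s y₀) ∧ ∀ s f, IsTautFrame s y₀ →
    HolomorphicNear (FlagModel n r) f y₀ → f y₀ ≠ 0 →
    Θ y₀ = -DiffForm.delDelbar (funForm fun y =>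
      ((Real.log (‖f y‖ ^ 2 * ∏ i, tautNormSq h i y (s i y) ^ a i) : ℝ) : ℂ)) y₀

/-- `θ = -∑ a_i π^* ⟨Θ_{E,h}(v_i), v_i⟩` for all orthonormal frames `v` giving the flag. -/
def IsHorizontalPart (a : Fin r → ℝ) (θ : DiffForm (FlagModel n r) (FlagBundle n r E) 2) : Prop :=
  ∀ y v, IsUnitaryAdapted h y v →
    θ y = -∑ i, (a i : ℂ) • pullForm (curvaturePairing h y.base (v i) (v i)) (projDeriv y)

/-- `θ` vanishes on horizontal vectors, and `θ = ∑_{i < j} (a_i - a_j) dξ_{ij} ∧ dξbar_{ij}` at every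
point in all normal coordinates there. -/
def IsVerticalPart (a : Fin r → ℝ) (θ : DiffForm (FlagModel n r) (FlagBundle n r E) 2) : Prop :=
  (∀ y, ∀ u ∈ horizontalSpace h y, ∀ w, θ y ![u, w] = 0) ∧
  ∀ y e, IsNormalFrame h e y →
    θ y = ∑ p : PairIdx r, ((a p.1.1 - a p.1.2 : ℝ) : ℂ) • wedgeConj (coordDeriv e y p)

/-- The dimension `r (r - 1) / 2` of the fibres of `F(E^*) → X`. -/
abbrev fiberDim (r : ℕ) : ℕ := Fintype.card (PairIdx r)

/-- `η` is the normalized relative volume form: `η = ⋀_{i < j} i dξ_{ij} ∧ dξbar_{ij}` at every point in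
all normal coordinates there. (The order of the factors is immaterial.) -/
def IsRelVolume (η : DiffForm (FlagModel n r) (FlagBundle n r E) (2 * fiberDim r)) : Prop :=
  ∀ y e, IsNormalFrame h e y → η y = wedgeProd (fiberDim r) fun m =>
    Complex.I • wedgeConj (coordDeriv e y ((Fintype.equivFin (PairIdx r)).symm m))

/-- The power `L^{⊗ k}` of a line, with the dual line if `k < 0` (one of the two factors is the empty
tensor power). -/
abbrev LinePow (L : Type*) [AddCommGroup L] [Module ℂ L] (k : ℤ) : Type _ :=
  (⨂[ℂ]^k.toNat L) ⊗[ℂ] (⨂[ℂ]^(-k).toNat (Dual ℂ L))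

/-- The element `s^{⊗ k}` of `L^{⊗ k}`, where `t` is the element of the dual line with `t s = 1`. -/
def linePowVec {L : Type*} [AddCommGroup L] [Module ℂ L] (s : L) (t : Dual ℂ L) (k : ℤ) :
    LinePow L k :=
  (PiTensorProduct.tprod ℂ fun _ => s) ⊗ₜ[ℂ] (PiTensorProduct.tprod ℂ fun _ => t)

/-- The fibre of `Q^a = Q₁^{a₁} ⊗ … ⊗ Q_r^{a_r}` for integers `a_i`. -/
abbrev TautPow (a : Fin r → ℤ) (y : FlagBundle n r E) : Type _ :=
  ⨂[ℂ] i, LinePow (TautFiber i y) (a i)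

/-- The section `S` of `Q^a` is holomorphic near `y₀`: `S = f · s₁^{a₁} ⊗ … ⊗ s_r^{a_r}` with local
holomorphic frames `s_i` of the `Q_i` and a holomorphic function `f`. -/
def IsHolTautPowSection (a : Fin r → ℤ) (S : ∀ y : FlagBundle n r E, TautPow a y)
    (y₀ : FlagBundle n r E) : Prop :=
  ∃ (f : FlagBundle n r E → ℂ) (s : ∀ i, ∀ y : FlagBundle n r E, TautFiber i y)
    (t : ∀ i, ∀ y : FlagBundle n r E, Dual ℂ (TautFiber i y)),
    HolomorphicNear (FlagModel n r) f y₀ ∧ IsTautFrame s y₀ ∧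
    (∀ᶠ y in 𝓝 y₀, ∀ i, t i y (s i y) = 1) ∧
    ∀ᶠ y in 𝓝 y₀, S y = f y • PiTensorProduct.tprod ℂ fun i => linePowVec (s i y) (t i y) (a i)

/-- The fibre of the relative canonical bundle `K_{Y/X} = det T_{Y/X}^*`. -/
abbrev RelCanonical (y : FlagBundle n r E) : Type _ :=
  verticalSpace y [⋀^Fin (fiberDim r)]→ₗ[ℂ] ℂ

/-- The section `κ` of `K_{Y/X}` is holomorphic near `y₀`: it is the restriction of a holomorphic form
on `Y` to the vertical tangent spaces. -/
def IsHolRelCanonicalSection (κ : ∀ y : FlagBundle n r E, RelCanonical y)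
    (y₀ : FlagBundle n r E) : Prop :=
  ∃ β : ∀ y : FlagBundle n r E,
      TangentSpace 𝓘(ℂ, FlagModel n r) y [⋀^Fin (fiberDim r)]→L[ℂ] ℂ,
    IsHolomorphicForm β y₀ ∧ ∀ᶠ y in 𝓝 y₀,
      κ y = (β y).toAlternatingMap.compLinearMap (verticalSpace y).subtype

/-- The canonical weight `ρ_i = 2 i - r - 1`, `1 ≤ i ≤ r`. -/
def canonicalWeight (r : ℕ) (i : Fin r) : ℤ := 2 * ((i : ℤ) + 1) - r - 1

end Main

end

/-!
# Curvature of the tautological line bundles on a flag bundle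

Everything is computed at a point `y = (z₀, ξ₀)` in the coordinates `(z, ξ)` of a holomorphic frame `e` of
`E` that is normal there; `frameChart e y` passes from the preferred chart at `y` to these coordinates. Let `H(z)` be the Gram matrix of `e`, so that `H(z₀) = 1`, `dH(z₀) = 0` and the second
derivative of `H_ii` at `z₀` gives the curvature `⟨Θ e_i, e_i⟩` (`curvaturePairing_of_normal`). A normal
frame is obtained from an orthonormal one by two polynomial corrections, of first and of second order
(`exists_isNormalFrame`). The frame that belongs to the flag with coordinates `ξ` is `U e` with the
unipotent upper triangular matrix `U = 1 + ξ`, and its Gram matrix is `S = U H Uᴴ` (`fibreGram`).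

*Horizontal vectors.* A frame that gives the flag with coordinates `ξ` in the frame `e` is `L U e` with `L` lower
triangular, which expresses the differentials of its flag coordinates by those of `e`. For two frames that
are parallel at the point they differ by the invertible map `N ↦ L N L⁻¹` on strictly upper triangular
matrices (`exists_coordMap_eq`). Hence their common kernel is well defined; it is the horizontal space
(`mem_horizontalSpace_iff`), a complement of the vertical one. For two normal frames `L` is diagonal and
unitary, so that the forms in the theorem do not depend on the choice of a normal frame.

*Curvature of `Q^a`.* By the Gram–Schmidt process, the squared norm of the frame of `Q_i` dual to `U e` is the
last diagonal entry of the inverse of the leading `i × i` block of `S` (`quotNorm`). Its expansion to second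
order at `(z₀, 0)` (`quotNorm_fibreGram`) gives the horizontal and the vertical part at once
(`ddbar_log_quotNorm`, `isTautCurvature`).

*The relative canonical bundle.* For an adapted basis of the fibre, the vertical tangent space is the space of
strictly upper triangular matrices `N`, and the change of basis by `L` acts as `N ↦ L N L⁻¹`, with determinant
`∏_{i < j} L_ii / L_jj = ∏ L_ii ^ (-ρ_i)` (`det_conjUpper_inv`, `prod_pairs_div`). The fibre of `Q^ρ` is
subject to the same factor, so the identification of the two lines by an adapted basis does not depend on
the basis (`relCanonicalEquiv`), and it is holomorphic because the frames of the charts are.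

*The relative volume form.* Since `η` is given at each point by a normal frame there, near `y` it is the pull-back
of the standard volume form by the differentials of flag coordinates of parallel frames, up to a density
`∏_{i < j} ‖L_ii‖² / ‖L_jj‖²` where `L` is the Gram–Schmidt matrix of `S` (`relForm`,
`IsNormalFrame.relVolume_inChart`). The product with `π^* ω^{n-1}` only sees the values of `i ∂∂bar η` on two
horizontal and otherwise vertical vectors (`wedge_pullForm_fst_eq_zero`). On these, the second derivatives of
the density and those of the connection terms (`connTwist`), given by commutators with the derivative of the
connection matrix, both contribute multiples of `∑ ρ_i ∂∂bar H_ii`, because `ρ` also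
gives the trace of the commutator action (`trace_commUpper`, `del_delbar_relForm`).
-/

open scoped Matrix

noncomputable section

/-! ### The operators `∂` and `∂bar` on a complex vector space -/

section DolbeaultCalculus
variable {M : Type*} [NormedAddCommGroup M] [NormedSpace ℂ M]
  {M' : Type*} [NormedAddCommGroup M'] [NormedSpace ℂ M']
  {G : Type*} [NormedAddCommGroup G] [NormedSpace ℂ G]
  {G' : Type*} [NormedAddCommGroup G'] [NormedSpace ℂ G']

@[simp] theorem mulI_apply (u : M) : mulI M u = Complex.I • u := rfl

theorem linPart_apply (D : M →L[ℝ] G) (u : M) :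
    linPart D u = (1 / 2 : ℂ) • (D u - Complex.I • D (Complex.I • u)) := rfl

theorem antilinPart_apply (D : M →L[ℝ] G) (u : M) :
    antilinPart D u = (1 / 2 : ℂ) • (D u + Complex.I • D (Complex.I • u)) := rfl

/-- Precomposition with the multiplication by the imaginary unit. -/
def precompI (M G : Type*) [NormedAddCommGroup M] [NormedSpace ℂ M] [NormedAddCommGroup G]
    [NormedSpace ℂ G] : (M →L[ℝ] G) →L[ℝ] (M →L[ℝ] G) :=
  (ContinuousLinearMap.compL ℝ M M G).flip (mulI M)

/-- `linPart` as a continuous linear map. -/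
def linPartL (M G : Type*) [NormedAddCommGroup M] [NormedSpace ℂ M] [NormedAddCommGroup G]
    [NormedSpace ℂ G] : (M →L[ℝ] G) →L[ℝ] (M →L[ℝ] G) :=
  (1 / 2 : ℂ) • (ContinuousLinearMap.id ℝ _ - Complex.I • precompI M G)

/-- `antilinPart` as a continuous linear map. -/
def antilinPartL (M G : Type*) [NormedAddCommGroup M] [NormedSpace ℂ M] [NormedAddCommGroup G]
    [NormedSpace ℂ G] : (M →L[ℝ] G) →L[ℝ] (M →L[ℝ] G) :=
  (1 / 2 : ℂ) • (ContinuousLinearMap.id ℝ _ + Complex.I • precompI M G)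

theorem antilinPartL_apply (D : M →L[ℝ] G) : antilinPartL M G D = antilinPart D := rfl

/-- The part of a real bilinear form that is complex linear in the first and conjugate linear in the
second variable. Applied to a second derivative, this is the derivative of type `∂` in the direction
of the first and of type `∂bar` in the direction of the second variable. -/
def leviPart (B : M →L[ℝ] M →L[ℝ] G) (u v : M) : G :=
  (1 / 4 : ℂ) • (B u v - Complex.I • B (Complex.I • u) v + Complex.I • B u (Complex.I • v)
    + B (Complex.I • u) (Complex.I • v))

theorem linPart_antilinPart_comp (B : M →L[ℝ] M →L[ℝ] G) (u v : M) :
    linPart ((antilinPartL M G).comp B) u v = leviPart B u v := by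
  simp only [linPart_apply, ContinuousLinearMap.comp_apply, antilinPartL_apply,
    smul_apply, sub_apply, antilinPart_apply, leviPart]
  simp only [smul_sub, smul_add, smul_smul]
  have h : Complex.I * (1 / 2 * Complex.I) = -(1 / 2) := by
    linear_combination (1 / 2) * Complex.I_mul_I
  rw [show (1 / 2 * (Complex.I * (1 / 2 * Complex.I)) : ℂ) = -(1/4) by rw [h]; ring]
  rw [show (1 / 2 * (Complex.I * (1 / 2)) : ℂ) = 1 / 4 * Complex.I by ring,
    show (1 / 2 * (1 / 2) : ℂ) = 1 / 4 by ring,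
    show (1 / 2 * (1 / 2 * Complex.I) : ℂ) = 1 / 4 * Complex.I by ring]
  rw [neg_smul]
  abel

theorem leviPart_comp (L : G →L[ℂ] G') (B : M →L[ℝ] M →L[ℝ] G) (B' : M →L[ℝ] M →L[ℝ] G')
    (h : ∀ u v, B' u v = L (B u v)) (u v : M) : leviPart B' u v = L (leviPart B u v) := by
  simp [leviPart, h]

theorem fderiv_fderiv_clm_comp (L : G →L[ℝ] G') {α : M → G} {x : M} (hα : ContDiffAt ℝ 2 α x)
    (u v : M) : fderiv ℝ (fderiv ℝ fun y => L (α y)) x u v = L (fderiv ℝ (fderiv ℝ α) x u v) := by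
  have h1 : (fderiv ℝ fun y => L (α y)) =ᶠ[𝓝 x]
      fun y => ContinuousLinearMap.compL ℝ M G G' L (fderiv ℝ α y) := by
    filter_upwards [hα.eventually (by simp)] with y hy
    exact (L.hasFDerivAt.comp y (hy.differentiableAt (by simp)).hasFDerivAt).fderiv
  have h2 : DifferentiableAt ℝ (fderiv ℝ α) x :=
    (hα.fderiv_right (m := 1) (by norm_num)).differentiableAt (by simp)
  have h3 : fderiv ℝ (fun y => ContinuousLinearMap.compL ℝ M G G' L (fderiv ℝ α y)) x = _ :=
    ((ContinuousLinearMap.compL ℝ M G G' L).hasFDerivAt.comp x h2.hasFDerivAt).fderiv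
  rw [h1.fderiv_eq, h3]
  rfl

theorem map_linPart (A : (M →L[ℝ] G) →L[ℝ] G') (hA : ∀ (c : ℂ) D, A (c • D) = c • A D)
    (D : M →L[ℝ] G) :
    A (linPart D) = (1 / 2 : ℂ) • (A D - Complex.I • A (D.comp (mulI M))) := by
  rw [linPart, hA, map_sub, hA]

theorem map_antilinPart (A : (M →L[ℝ] G) →L[ℝ] G') (hA : ∀ (c : ℂ) D, A (c • D) = c • A D)
    (D : M →L[ℝ] G) :
    A (antilinPart D) = (1 / 2 : ℂ) • (A D + Complex.I • A (D.comp (mulI M))) := by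
  rw [antilinPart, hA, map_add, hA]

theorem differentiableAt_map_antilinPart (A : (M →L[ℝ] G) →L[ℝ] G') {α : M → G} {x : M}
    (hα : ContDiffAt ℝ 2 α x) :
    DifferentiableAt ℝ (fun y => A (antilinPart (fderiv ℝ α y))) x :=
  A.differentiableAt.comp x ((antilinPartL M G).differentiableAt.comp x
    ((hα.fderiv_right (m := 1) (by norm_num)).differentiableAt (by simp)))

theorem linPart_fderiv_antilinPart (A : (M →L[ℝ] G) →L[ℝ] G')
    (hA : ∀ (c : ℂ) D, A (c • D) = c • A D) {α : M → G} {x : M} (hα : ContDiffAt ℝ 2 α x) (u : M) :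
    linPart (fderiv ℝ (fun y => A (antilinPart (fderiv ℝ α y))) x) u =
      A (linPart ((antilinPartL M G).comp (fderiv ℝ (fderiv ℝ α) x)) u) := by
  have h2 : DifferentiableAt ℝ (fderiv ℝ α) x :=
    (hα.fderiv_right (m := 1) (by norm_num)).differentiableAt (by simp)
  have h3 : fderiv ℝ (fun y => A (antilinPart (fderiv ℝ α y))) x =
      A.comp ((antilinPartL M G).comp (fderiv ℝ (fderiv ℝ α) x)) :=
    (A.hasFDerivAt.comp x ((antilinPartL M G).hasFDerivAt.comp x h2.hasFDerivAt)).fderiv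
  rw [h3]
  simp only [linPart_apply, ContinuousLinearMap.comp_apply, hA, map_sub]

/-- The form `∂∂bar α` is the alternation of the Levi part of the second derivative of the coefficients. -/
theorem del_delbar_apply {k : ℕ} {α : M → M [⋀^Fin k]→L[ℝ] ℂ} {x : M}
    (hα : ContDiffAt ℝ 2 α x) (w : Fin (k + 2) → M) :
    del (delbar α) x w = ∑ i : Fin (k + 2), (-1) ^ (i : ℕ) • ∑ j : Fin (k + 1), (-1) ^ (j : ℕ) •
      leviPart (fderiv ℝ (fderiv ℝ α) x) (w i) (i.removeNth w j) (j.removeNth (i.removeNth w)) := by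
  have h4 : ∀ u, linPart (fderiv ℝ (delbar α) x) u =
      .alternatizeUncurryFin (linPart ((antilinPartL M _).comp (fderiv ℝ (fderiv ℝ α) x)) u) :=
    linPart_fderiv_antilinPart (ContinuousAlternatingMap.alternatizeUncurryFinCLM ℝ M ℂ)
      (fun c D => ContinuousAlternatingMap.alternatizeUncurryFin_smul c D) hα
  rw [del, ContinuousAlternatingMap.alternatizeUncurryFin_apply]
  refine Finset.sum_congr rfl fun i _ => ?_
  rw [h4, ContinuousAlternatingMap.alternatizeUncurryFin_apply]
  simp only [linPart_antilinPart_comp]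

/-- Evaluation of a form on a fixed tuple of vectors, as a complex linear map. -/
def evalForm {k : ℕ} (w : Fin k → M) : (M [⋀^Fin k]→L[ℝ] ℂ) →L[ℂ] ℂ where
  toFun α := α w
  map_add' _ _ := rfl
  map_smul' _ _ := rfl
  cont := (ContinuousAlternatingMap.apply ℝ M ℂ w).continuous

theorem leviPart_fderiv_apply {k : ℕ} {α : M → M [⋀^Fin k]→L[ℝ] ℂ} {x : M}
    (hα : ContDiffAt ℝ 2 α x) (u v : M) (w : Fin k → M) :
    leviPart (fderiv ℝ (fderiv ℝ α) x) u v w =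
      leviPart (fderiv ℝ (fderiv ℝ fun y => α y w) x) u v := by
  refine (leviPart_comp (evalForm w) _ _ (fun u v => ?_) u v).symm
  exact fderiv_fderiv_clm_comp ((evalForm w).restrictScalars ℝ) hα u v

/-- Constants as forms of degree zero. -/
def constFormL (M : Type*) [NormedAddCommGroup M] [NormedSpace ℂ M] :
    ℂ →L[ℝ] (M [⋀^Fin 0]→L[ℝ] ℂ) :=
  (ContinuousAlternatingMap.constOfIsEmptyLIE ℝ M ℂ (Fin 0)).toContinuousLinearEquiv

theorem del_constOfIsEmpty (f : M → ℂ) (x u : M) (hf : DifferentiableAt ℝ f x) :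
    del (fun y => ContinuousAlternatingMap.constOfIsEmpty ℝ M (Fin 0) (f y)) x ![u] =
      linPart (fderiv ℝ f x) u := by
  have h : fderiv ℝ (fun y => ContinuousAlternatingMap.constOfIsEmpty ℝ M (Fin 0) (f y)) x =
      (constFormL M).comp (fderiv ℝ f x) :=
    ((constFormL M).hasFDerivAt.comp x hf.hasFDerivAt).fderiv
  rw [del, ContinuousAlternatingMap.alternatizeUncurryFin_apply, h]
  simp [linPart_apply, constFormL]

theorem contDiffAt_constOfIsEmpty {f : M → ℂ} {x : M} {m : ℕ∞ω} (hf : ContDiffAt ℝ m f x) :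
    ContDiffAt ℝ m (fun y => ContinuousAlternatingMap.constOfIsEmpty ℝ M (Fin 0) (f y)) x :=
  (constFormL M).contDiff.contDiffAt.comp x hf

theorem del_delbar_constOfIsEmpty {f : M → ℂ} {x : M} (hf : ContDiffAt ℝ 2 f x) (u v : M) :
    del (delbar fun y => ContinuousAlternatingMap.constOfIsEmpty ℝ M (Fin 0) (f y)) x ![u, v] =
      leviPart (fderiv ℝ (fderiv ℝ f) x) u v - leviPart (fderiv ℝ (fderiv ℝ f) x) v u := by
  rw [del_delbar_apply (contDiffAt_constOfIsEmpty hf)]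
  simp only [leviPart_fderiv_apply (contDiffAt_constOfIsEmpty hf)]
  simp [Fin.sum_univ_succ, Fin.removeNth]
  ring

theorem fderiv_restrictScalars {Ψ : M → M'} {x : M} (hΨ : DifferentiableAt ℂ Ψ x) :
    fderiv ℝ Ψ x = (fderiv ℂ Ψ x).restrictScalars ℝ :=
  (hΨ.hasFDerivAt.restrictScalars ℝ).fderiv

theorem alternatize_fderiv_pullForm {k : ℕ} {α : M' → M' [⋀^Fin k]→L[ℝ] ℂ} {Ψ : M → M'} {x : M}
    (hα : DifferentiableAt ℝ α (Ψ x)) (hΨ : ContDiffAt ℂ 2 Ψ x) :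
    ContinuousAlternatingMap.alternatizeUncurryFin
        (fderiv ℝ (fun u => pullForm (α (Ψ u)) (fderiv ℂ Ψ u)) x) =
      pullForm (.alternatizeUncurryFin (fderiv ℝ α (Ψ x))) (fderiv ℂ Ψ x) ∧
    ContinuousAlternatingMap.alternatizeUncurryFin
        ((fderiv ℝ (fun u => pullForm (α (Ψ u)) (fderiv ℂ Ψ u)) x).comp (mulI M)) =
      pullForm (.alternatizeUncurryFin ((fderiv ℝ α (Ψ x)).comp (mulI M'))) (fderiv ℂ Ψ x) := by
  have hd : DifferentiableAt ℂ Ψ x := hΨ.differentiableAt (by simp)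
  have hdd : DifferentiableAt ℂ (fderiv ℂ Ψ) x :=
    (hΨ.fderiv_right (m := 1) (by norm_num)).differentiableAt (by simp)
  set S := ContinuousLinearMap.restrictScalarsL ℂ M M' ℝ ℝ with hS
  set H := S.comp ((fderiv ℂ (fderiv ℂ Ψ) x).restrictScalars ℝ) with hH
  have hh : HasFDerivAt (fun u => (fderiv ℂ Ψ u).restrictScalars ℝ) H x :=
    S.hasFDerivAt.comp x (hdd.hasFDerivAt.restrictScalars ℝ)
  have h1 : fderiv ℝ (fun u => pullForm (α (Ψ u)) (fderiv ℂ Ψ u)) x = _ :=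
    (HasFDerivAt.continuousAlternatingMapCompContinuousLinearMap
      (hα.hasFDerivAt.comp x (hd.hasFDerivAt.restrictScalars ℝ)) hh).fderiv
  have hsymm : ∀ u v, fderiv ℂ (fderiv ℂ Ψ) x u v = fderiv ℂ (fderiv ℂ Ψ) x v u := fun u v =>
    (hΨ.isSymmSndFDerivAt (by simp)) u v
  have hs1 : ∀ u v, H u v = H v u := hsymm
  have hs2 : ∀ u v, H.comp (mulI M) u v = H.comp (mulI M) v u := fun u v => by
    change fderiv ℂ (fderiv ℂ Ψ) x (Complex.I • u) v = fderiv ℂ (fderiv ℂ Ψ) x (Complex.I • v) u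
    rw [map_smul, map_smul, smul_apply, smul_apply, hsymm]
  rw [h1]
  constructor
  · rw [ContinuousAlternatingMap.alternatizeUncurryFin_add,
      ContinuousAlternatingMap.alternatizeUncurryFin_fderivCompContinuousLinearMap_eq_zero _ _ hs1,
      add_zero]
    ext v
    simp +unfoldPartialApp [ContinuousAlternatingMap.alternatizeUncurryFin_apply, Fin.removeNth,
      Function.comp_def, pullForm]
  · rw [ContinuousLinearMap.add_comp, ContinuousLinearMap.comp_assoc, ContinuousLinearMap.comp_assoc,
      ContinuousLinearMap.comp_assoc _ H, ContinuousAlternatingMap.alternatizeUncurryFin_add,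
      ContinuousAlternatingMap.alternatizeUncurryFin_fderivCompContinuousLinearMap_eq_zero _ _ hs2,
      add_zero]
    ext v
    simp +unfoldPartialApp [ContinuousAlternatingMap.alternatizeUncurryFin_apply, Fin.removeNth,
      Function.comp_def, pullForm]

theorem alternatize_linPart {k : ℕ} (D : M →L[ℝ] M [⋀^Fin k]→L[ℝ] ℂ) :
    ContinuousAlternatingMap.alternatizeUncurryFin (linPart D) = (1 / 2 : ℂ) •
      (ContinuousAlternatingMap.alternatizeUncurryFin D - Complex.I •
        ContinuousAlternatingMap.alternatizeUncurryFin (D.comp (mulI M))) :=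
  map_linPart (ContinuousAlternatingMap.alternatizeUncurryFinCLM ℝ M ℂ)
    (fun c D => ContinuousAlternatingMap.alternatizeUncurryFin_smul c D) D

theorem alternatize_antilinPart {k : ℕ} (D : M →L[ℝ] M [⋀^Fin k]→L[ℝ] ℂ) :
    ContinuousAlternatingMap.alternatizeUncurryFin (antilinPart D) = (1 / 2 : ℂ) •
      (ContinuousAlternatingMap.alternatizeUncurryFin D + Complex.I •
        ContinuousAlternatingMap.alternatizeUncurryFin (D.comp (mulI M))) :=
  map_antilinPart (ContinuousAlternatingMap.alternatizeUncurryFinCLM ℝ M ℂ)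
    (fun c D => ContinuousAlternatingMap.alternatizeUncurryFin_smul c D) D

/-- The operator `∂` commutes with pull-back by holomorphic maps. -/
theorem del_pullForm {k : ℕ} {α : M' → M' [⋀^Fin k]→L[ℝ] ℂ} {Ψ : M → M'} {x : M}
    (hα : DifferentiableAt ℝ α (Ψ x)) (hΨ : ContDiffAt ℂ 2 Ψ x) :
    del (fun u => pullForm (α (Ψ u)) (fderiv ℂ Ψ u)) x =
      pullForm (del α (Ψ x)) (fderiv ℂ Ψ x) := by
  rw [del, del, alternatize_linPart, alternatize_linPart, (alternatize_fderiv_pullForm hα hΨ).1,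
    (alternatize_fderiv_pullForm hα hΨ).2]
  rfl

/-- The operator `∂bar` commutes with pull-back by holomorphic maps. -/
theorem delbar_pullForm {k : ℕ} {α : M' → M' [⋀^Fin k]→L[ℝ] ℂ} {Ψ : M → M'} {x : M}
    (hα : DifferentiableAt ℝ α (Ψ x)) (hΨ : ContDiffAt ℂ 2 Ψ x) :
    delbar (fun u => pullForm (α (Ψ u)) (fderiv ℂ Ψ u)) x =
      pullForm (delbar α (Ψ x)) (fderiv ℂ Ψ x) := by
  rw [delbar, delbar, alternatize_antilinPart, alternatize_antilinPart,
    (alternatize_fderiv_pullForm hα hΨ).1, (alternatize_fderiv_pullForm hα hΨ).2]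
  rfl

theorem differentiableAt_delbar {k : ℕ} {α : M → M [⋀^Fin k]→L[ℝ] ℂ} {x : M}
    (hα : ContDiffAt ℝ 2 α x) : DifferentiableAt ℝ (delbar α) x :=
  differentiableAt_map_antilinPart (ContinuousAlternatingMap.alternatizeUncurryFinCLM ℝ M ℂ) hα

theorem delbar_congr {k : ℕ} {α β : M → M [⋀^Fin k]→L[ℝ] ℂ} {x : M} (h : α =ᶠ[𝓝 x] β) :
    delbar α =ᶠ[𝓝 x] delbar β := by
  filter_upwards [h.eventuallyEq_nhds] with y hy
  rw [delbar, delbar, hy.fderiv_eq]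

theorem del_congr {k : ℕ} {α β : M → M [⋀^Fin k]→L[ℝ] ℂ} {x : M} (h : α =ᶠ[𝓝 x] β) :
    del α x = del β x := by
  rw [del, del, h.fderiv_eq]

/-- The operator `∂ ∂bar` commutes with pull-back by holomorphic maps. -/
theorem del_delbar_pullForm {k : ℕ} {α : M' → M' [⋀^Fin k]→L[ℝ] ℂ} {Ψ : M → M'} {x : M}
    (hα : ContDiffAt ℝ 2 α (Ψ x)) (hΨ : ContDiffAt ℂ 2 Ψ x) :
    del (delbar fun u => pullForm (α (Ψ u)) (fderiv ℂ Ψ u)) x =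
      pullForm (del (delbar α) (Ψ x)) (fderiv ℂ Ψ x) := by
  rw [← del_pullForm (differentiableAt_delbar hα) hΨ]
  refine del_congr ?_
  filter_upwards [hΨ.eventually (by simp), hΨ.continuousAt.eventually
    (hα.eventually (by simp))] with u h1 h2
  exact delbar_pullForm (h2.differentiableAt (by simp)) h1

end DolbeaultCalculus

/-! ### Wedge products -/

section WedgeAlgebra
variable {V W : Type*} [AddCommGroup V] [Module ℂ V] [TopologicalSpace V]
  [AddCommGroup W] [Module ℂ W] [TopologicalSpace W]

@[simp] theorem pullForm_apply {k : ℕ} (α : W [⋀^Fin k]→L[ℝ] ℂ) (f : V →L[ℂ] W) (v : Fin k → V) :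
    pullForm α f v = α fun i => f (v i) := rfl

theorem wedge_add_right {k l : ℕ} (α : V [⋀^Fin k]→L[ℝ] ℂ) (β β' : V [⋀^Fin l]→L[ℝ] ℂ) :
    wedge α (β + β') = wedge α β + wedge α β' := by
  ext v
  simp only [wedge_apply, ContinuousAlternatingMap.add_apply, mul_add, smul_add,
    Finset.sum_add_distrib]

theorem wedge_add_left {k l : ℕ} (α α' : V [⋀^Fin k]→L[ℝ] ℂ) (β : V [⋀^Fin l]→L[ℝ] ℂ) :
    wedge (α + α') β = wedge α β + wedge α' β := by
  ext v
  simp only [wedge_apply, ContinuousAlternatingMap.add_apply, add_mul, smul_add,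
    Finset.sum_add_distrib]

theorem wedge_smul_right {k l : ℕ} (c : ℂ) (α : V [⋀^Fin k]→L[ℝ] ℂ) (β : V [⋀^Fin l]→L[ℝ] ℂ) :
    wedge α (c • β) = c • wedge α β := by
  ext v
  simp only [wedge_apply, ContinuousAlternatingMap.smul_apply, smul_eq_mul, Finset.mul_sum, Finset.smul_sum,
    mul_smul_comm, mul_left_comm _ c]

theorem wedge_smul_left {k l : ℕ} (c : ℂ) (α : V [⋀^Fin k]→L[ℝ] ℂ) (β : V [⋀^Fin l]→L[ℝ] ℂ) :
    wedge (c • α) β = c • wedge α β := by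
  ext v
  simp only [wedge_apply, ContinuousAlternatingMap.smul_apply, smul_eq_mul, Finset.mul_sum, Finset.smul_sum,
    mul_smul_comm, mul_assoc]

theorem wedge_sub_left {k l : ℕ} (α α' : V [⋀^Fin k]→L[ℝ] ℂ) (β : V [⋀^Fin l]→L[ℝ] ℂ) :
    wedge (α - α') β = wedge α β - wedge α' β := by
  rw [eq_sub_iff_add_eq, ← wedge_add_left, sub_add_cancel]

theorem wedge_zero_left {k l : ℕ} (β : V [⋀^Fin l]→L[ℝ] ℂ) :
    wedge (0 : V [⋀^Fin k]→L[ℝ] ℂ) β = 0 := by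
  ext v
  simp [wedge_apply]

theorem wedge_zero_right {k l : ℕ} (α : V [⋀^Fin k]→L[ℝ] ℂ) :
    wedge α (0 : V [⋀^Fin l]→L[ℝ] ℂ) = 0 := by
  ext v
  simp [wedge_apply]

theorem wedge_sum_right {ι : Type*} (s : Finset ι) {k l : ℕ} (α : V [⋀^Fin k]→L[ℝ] ℂ)
    (β : ι → V [⋀^Fin l]→L[ℝ] ℂ) : wedge α (∑ i ∈ s, β i) = ∑ i ∈ s, wedge α (β i) := by
  classical
  induction s using Finset.induction_on with
  | empty => simp [wedge_zero_right]
  | insert a s ha ih => rw [Finset.sum_insert ha, Finset.sum_insert ha, wedge_add_right, ih]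

theorem wedge_sum_left {ι : Type*} (s : Finset ι) {k l : ℕ} (α : ι → V [⋀^Fin k]→L[ℝ] ℂ)
    (β : V [⋀^Fin l]→L[ℝ] ℂ) : wedge (∑ i ∈ s, α i) β = ∑ i ∈ s, wedge (α i) β := by
  classical
  induction s using Finset.induction_on with
  | empty => simp [wedge_zero_left]
  | insert a s ha ih => rw [Finset.sum_insert ha, Finset.sum_insert ha, wedge_add_left, ih]

theorem pullForm_wedge {k l : ℕ} (α : W [⋀^Fin k]→L[ℝ] ℂ) (β : W [⋀^Fin l]→L[ℝ] ℂ)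
    (f : V →L[ℂ] W) : pullForm (wedge α β) f = wedge (pullForm α f) (pullForm β f) := by
  ext v
  simp only [pullForm_apply, wedge_apply]

theorem pullForm_smul {k : ℕ} (c : ℂ) (α : W [⋀^Fin k]→L[ℝ] ℂ) (f : V →L[ℂ] W) :
    pullForm (c • α) f = c • pullForm α f := rfl

theorem pullForm_sum {ι : Type*} (s : Finset ι) {k : ℕ} (α : ι → W [⋀^Fin k]→L[ℝ] ℂ)
    (f : V →L[ℂ] W) : pullForm (∑ i ∈ s, α i) f = ∑ i ∈ s, pullForm (α i) f := by
  ext v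
  simp [ContinuousAlternatingMap.sum_apply]

theorem wedgeConj_apply (ℓ : V →L[ℂ] ℂ) (v : Fin 2 → V) :
    wedgeConj ℓ v = ℓ (v 0) * (starRingEnd ℂ) (ℓ (v 1)) - ℓ (v 1) * (starRingEnd ℂ) (ℓ (v 0)) := by
  have h : (Finset.univ : Finset (Equiv.Perm (Fin (1 + 1)))) = {1, Equiv.swap 0 1} := by decide
  have hne : (1 : Equiv.Perm (Fin (1 + 1))) ≠ Equiv.swap 0 1 := by decide
  have hc : (Fin.castAdd 1 (0 : Fin 1)) = 0 := rfl
  rw [wedgeConj, wedge_apply, h, Finset.sum_pair hne]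
  simp [hc, sub_eq_add_neg]

theorem pullForm_wedgeConj (ℓ : W →L[ℂ] ℂ) (f : V →L[ℂ] W) :
    pullForm (wedgeConj ℓ) f = wedgeConj (ℓ.comp f) := by
  ext v
  simp [wedgeConj_apply]

theorem wedgeConj_smul (c : ℂ) (ℓ : V →L[ℂ] ℂ) :
    wedgeConj (c • ℓ) = ((‖c‖ ^ 2 : ℝ) : ℂ) • wedgeConj ℓ := by
  ext v
  have h : ((‖c‖ ^ 2 : ℝ) : ℂ) = c * (starRingEnd ℂ) c := by
    rw [Complex.mul_conj, Complex.normSq_eq_norm_sq]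
  simp only [wedgeConj_apply, ContinuousAlternatingMap.smul_apply, h, smul_apply, smul_eq_mul,
    map_mul]
  ring

theorem pullForm_wedgeProd (m : ℕ) (α : Fin m → W [⋀^Fin 2]→L[ℝ] ℂ) (f : V →L[ℂ] W) :
    pullForm (wedgeProd m α) f = wedgeProd m fun i => pullForm (α i) f := by
  induction m with
  | zero => ext v; simp [wedgeProd]
  | succ m ih =>
    have h := pullForm_wedge (wedgeProd m fun i => α i.castSucc) (α (Fin.last m)) f
    rw [ih] at h
    exact h

/-- A product whose second factor vanishes as soon as one of its arguments is among the first
`k` vectors is the product of the values of the two factors. -/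
theorem wedge_apply_of_vanish {k l : ℕ} (α : V [⋀^Fin k]→L[ℝ] ℂ) (β : V [⋀^Fin l]→L[ℝ] ℂ)
    (w : Fin (k + l) → V)
    (h : ∀ u : Fin l → V, (∃ i j, u i = w (Fin.castAdd l j)) → β u = 0) :
    wedge α β w = α (fun i => w (Fin.castAdd l i)) * β (fun i => w (Fin.natAdd k i)) := by
  classical
  let e : Equiv.Perm (Fin k) × Equiv.Perm (Fin l) → Equiv.Perm (Fin (k + l)) := fun p =>
    finSumFinEquiv.permCongr (Equiv.Perm.sumCongr p.1 p.2)
  have he1 : ∀ p i, e p (Fin.castAdd l i) = Fin.castAdd l (p.1 i) := fun p i => by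
    simp [e, Equiv.permCongr_apply]
  have he2 : ∀ p i, e p (Fin.natAdd k i) = Fin.natAdd k (p.2 i) := fun p i => by
    simp [e, Equiv.permCongr_apply]
  have hinj : Function.Injective e := fun p q hpq => by
    refine Prod.ext (Equiv.ext fun i => ?_) (Equiv.ext fun i => ?_)
    · have := he1 p i
      rw [hpq, he1] at this
      exact (Fin.castAdd_injective k l this).symm
    · have := he2 p i
      rw [hpq, he2] at this
      exact (Fin.natAdd_injective l k this).symm
  have hout : ∀ σ : Equiv.Perm (Fin (k + l)), σ ∉ Set.range e →
      ∃ i j, σ (Fin.natAdd k i) = Fin.castAdd l j := fun σ hσ => by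
    by_contra! hc
    apply hσ
    have h1 : Set.MapsTo (finSumFinEquiv.symm.permCongr σ) (Set.range (Sum.inr : Fin l → Fin k ⊕ Fin l))
        (Set.range Sum.inr) := by
      rintro _ ⟨i, rfl⟩
      rcases hx : finSumFinEquiv.symm.permCongr σ (Sum.inr i) with j | j
      · exfalso
        refine hc i j ?_
        rw [Equiv.permCongr_apply, Equiv.symm_apply_eq] at hx
        simpa using hx
      · exact ⟨j, rfl⟩
    obtain ⟨p, hp⟩ := Equiv.Perm.mem_sumCongrHom_range_of_perm_mapsTo_inl
      ((Equiv.Perm.perm_mapsTo_inl_iff_mapsTo_inr _).mpr h1)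
    refine ⟨p, ?_⟩
    change finSumFinEquiv.permCongr (Equiv.Perm.sumCongrHom _ _ p) = σ
    rw [hp]
    ext x
    simp [Equiv.permCongr_apply]
  rw [wedge_apply]
  have hsum : ∑ σ : Equiv.Perm (Fin (k + l)), Equiv.Perm.sign σ •
      (α (fun i => w (σ (Fin.castAdd l i))) * β (fun i => w (σ (Fin.natAdd k i)))) =
      ∑ _p : Equiv.Perm (Fin k) × Equiv.Perm (Fin l),
        α (fun i => w (Fin.castAdd l i)) * β (fun i => w (Fin.natAdd k i)) := by
    symm
    refine Finset.sum_of_injOn e hinj.injOn (fun _ _ => Finset.mem_univ _) ?_ ?_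
    · intro σ _ hσ
      obtain ⟨i, j, hij⟩ := hout σ (by simpa using hσ)
      rw [h _ ⟨i, j, by rw [hij]⟩, mul_zero, smul_zero]
    · intro p _
      simp only [he1, he2]
      have h1 : α (fun i => w (Fin.castAdd l (p.1 i))) =
          Equiv.Perm.sign p.1 • α (fun i => w (Fin.castAdd l i)) :=
        α.toAlternatingMap.map_perm (fun i => w (Fin.castAdd l i)) p.1
      have h2 : β (fun i => w (Fin.natAdd k (p.2 i))) =
          Equiv.Perm.sign p.2 • β (fun i => w (Fin.natAdd k i)) :=
        β.toAlternatingMap.map_perm (fun i => w (Fin.natAdd k i)) p.2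
      rw [h1, h2, smul_mul_smul_comm, smul_smul]
      have hs : Equiv.Perm.sign (e p) = Equiv.Perm.sign p.1 * Equiv.Perm.sign p.2 := by
        simp [e, Equiv.Perm.sign_permCongr]
      rw [hs, Int.units_mul_self, one_smul]
  rw [hsum, Finset.sum_const, Finset.card_univ, Fintype.card_prod, Fintype.card_perm,
    Fintype.card_perm, Fintype.card_fin, Fintype.card_fin]
  rw [← Nat.cast_smul_eq_nsmul ℝ, smul_smul]
  have hk : (k.factorial : ℝ) ≠ 0 := Nat.cast_ne_zero.mpr k.factorial_ne_zero
  have hl : (l.factorial : ℝ) ≠ 0 := Nat.cast_ne_zero.mpr l.factorial_ne_zero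
  rw [Nat.cast_mul, inv_mul_cancel₀ (mul_ne_zero hk hl), one_smul]

theorem map_eq_det_smul {m : ℕ} (e : Basis (Fin m) ℝ V) (α : V [⋀^Fin m]→L[ℝ] ℂ) (v : Fin m → V) :
    α v = e.det v • α e := by
  have h : α.toAlternatingMap =
      (LinearMap.toSpanSingleton ℝ ℂ (α e)).compAlternatingMap e.det := by
    refine Basis.ext_alternating e fun f hf => ?_
    have hb : Function.Bijective f := Finite.injective_iff_bijective.mp hf
    have h1 : α (fun i => e (f i)) = Equiv.Perm.sign (Equiv.ofBijective f hb) • α e :=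
      α.toAlternatingMap.map_perm e (Equiv.ofBijective f hb)
    have h2 := e.det.map_perm e (Equiv.ofBijective f hb)
    simp only [Function.comp_def, Equiv.ofBijective_apply, e.det_self] at h2
    simp only [ContinuousAlternatingMap.coe_toAlternatingMap,
      LinearMap.compAlternatingMap_apply, LinearMap.toSpanSingleton_apply]
    rw [h1, h2]
    rcases Int.units_eq_one_or (Equiv.Perm.sign (Equiv.ofBijective f hb)) with hs | hs <;>
      simp [hs]
  exact congrArg (fun g => g v) h

/-- Forms of top degree are multiplied by the squared modulus of the determinant under complex linear
maps. -/
theorem pullForm_of_top {m : ℕ} [FiniteDimensional ℂ V] (hm : finrank ℝ V = m)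
    (α : V [⋀^Fin m]→L[ℝ] ℂ) (R : V →L[ℂ] V) :
    pullForm α R = ((‖LinearMap.det (R : V →ₗ[ℂ] V)‖ ^ 2 : ℝ) : ℂ) • α := by
  have : FiniteDimensional ℝ V := FiniteDimensional.complexToReal V
  let e : Basis (Fin m) ℝ V := finBasisOfFinrankEq ℝ V hm
  ext v
  rw [pullForm_apply, map_eq_det_smul e, ContinuousAlternatingMap.smul_apply, map_eq_det_smul e α v]
  have h1 := e.det_comp ((R : V →ₗ[ℂ] V).restrictScalars ℝ) v
  rw [LinearMap.det_restrictScalars, Algebra.norm_complex_apply, Complex.normSq_eq_norm_sq] at h1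
  have h2 : e.det (fun i => R (v i)) = ‖LinearMap.det (R : V →ₗ[ℂ] V)‖ ^ 2 * e.det v := h1
  rw [h2, mul_smul, Complex.coe_smul]

theorem exists_perm_map_zero_one {m : ℕ} {i j : Fin (m + 2)} (hij : i ≠ j) :
    ∃ τ : Equiv.Perm (Fin (m + 2)), τ 0 = i ∧ τ 1 = j := by
  have h01 : (0 : Fin (m + 2)) ≠ 1 := by simp
  refine ⟨Equiv.swap 0 i * Equiv.swap 1 (Equiv.swap 0 i j), ?_, ?_⟩
  · rw [Equiv.Perm.mul_apply, Equiv.swap_apply_of_ne_of_ne h01, Equiv.swap_apply_left]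
    intro h
    rw [eq_comm, Equiv.swap_apply_eq_iff, Equiv.swap_apply_left] at h
    exact hij h.symm
  · simp

/-- The derivation given by an endomorphism acts on forms of top degree as the trace. -/
theorem sum_update_eq_trace {m : ℕ} [FiniteDimensional ℝ V] (hm : finrank ℝ V = m) (α : V [⋀^Fin m]→L[ℝ] ℂ)
    (L : V →ₗ[ℝ] V) (v : Fin m → V) (hv : LinearIndependent ℝ v) :
    ∑ j, α (Function.update v j (L (v j))) = (LinearMap.trace ℝ V L : ℂ) * α v := by
  have hcard : Fintype.card (Fin m) = finrank ℝ V := by rw [hm, Fintype.card_fin]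
  let e : Basis (Fin m) ℝ V := basisOfLinearIndependentOfCardEqFinrank' v hv hcard
  have he : ∀ i, e i = v i := fun i => by simp [e]
  rw [LinearMap.trace_eq_matrix_trace ℝ e, Matrix.trace, Complex.ofReal_sum, Finset.sum_mul]
  refine Finset.sum_congr rfl fun j _ => ?_
  have h1 : L (v j) = ∑ k, LinearMap.toMatrix e e L k j • v k := by
    rw [← he j, ← e.sum_repr (L (e j))]
    simp only [he, LinearMap.toMatrix_apply]
  have h2 := α.toAlternatingMap.toMultilinearMap.map_update_sum Finset.univ j
    (fun k => LinearMap.toMatrix e e L k j • v k) v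
  rw [← h1] at h2
  refine h2.trans ?_
  rw [Finset.sum_eq_single j]
  · rw [MultilinearMap.map_update_smul, Function.update_eq_self, Matrix.diag_apply, Complex.real_smul]
    rfl
  · intro k _ hk
    rw [MultilinearMap.map_update_smul]
    have : α (Function.update v j (v k)) = 0 := α.map_update_self v hk.symm
    exact smul_eq_zero_of_right _ this
  · simp

theorem map_removeNth_succ_cons {m : ℕ} (α : V [⋀^Fin m]→L[ℝ] ℂ) (h : V) (v : Fin m → V)
    (j : Fin m) : α (j.succ.removeNth (Fin.cons h v : Fin (m + 1) → V)) =
      (-1) ^ (j : ℕ) * α (Function.update v j h) := by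
  cases m with
  | zero => exact j.elim0
  | succ m =>
    have h1 : j.succ.removeNth (Fin.cons h v : Fin (m + 2) → V) = Matrix.vecCons h (j.removeNth v) := by
      ext k
      refine Fin.cases ?_ (fun k => ?_) k
      · simp [Fin.removeNth]
      · simp [Fin.removeNth]
    have h2 : Function.update v j h = j.insertNth h (j.removeNth v) := by
      rw [Fin.insertNth_removeNth]
    have h3 : (-1) ^ (j : ℕ) • α (j.insertNth h (j.removeNth v)) = α (Matrix.vecCons h (j.removeNth v)) :=
      α.toAlternatingMap.neg_one_pow_smul_map_insertNth j h (j.removeNth v)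
    rw [h1, h2, ← h3]
    simp

/-- The alternating double sum that occurs in `∂ ∂bar`, evaluated on two vectors `h₁`, `h₂` followed by
a tuple `v`, when the terms vanish in which both derivatives are in the direction of `v`. -/
theorem alternating_sum_cons_cons {m : ℕ} (C : V → V → V [⋀^Fin m]→L[ℝ] ℂ) (h₁ h₂ : V)
    (v : Fin m → V)
    (hC : ∀ (i j : Fin m) (x : Fin m → V), (∃ k l, k ≠ l ∧ x k = h₁ ∧ x l = h₂) →
      C (v i) (v j) x = 0) (w : Fin (m + 2) → V) (hw : w = Fin.cons h₁ (Fin.cons h₂ v)) :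
    ∑ i : Fin (m + 2), (-1) ^ (i : ℕ) • ∑ j : Fin (m + 1), (-1) ^ (j : ℕ) •
      C (w i) (i.removeNth w j) (j.removeNth (i.removeNth w)) =
    C h₁ h₂ v - C h₂ h₁ v
      - ∑ j, C h₁ (v j) (Function.update v j h₂) + ∑ j, C h₂ (v j) (Function.update v j h₁)
      + ∑ j, C (v j) h₁ (Function.update v j h₂) - ∑ j, C (v j) h₂ (Function.update v j h₁) := by
  subst hw
  have key : ∀ (u h : V) (s : Fin m → V), ∑ j : Fin (m + 1), (-1) ^ (j : ℕ) •
      C u ((Fin.cons h s : Fin (m + 1) → V) j) (j.removeNth (Fin.cons h s : Fin (m + 1) → V)) =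
      C u h s - ∑ j, C u (s j) (Function.update s j h) := fun u h s => by
    rw [Fin.sum_univ_succ]
    simp only [map_removeNth_succ_cons, Fin.cons_zero, Fin.cons_succ, Fin.val_zero, pow_zero,
      one_smul, Fin.val_succ, zsmul_eq_mul]
    rw [sub_eq_add_neg, ← Finset.sum_neg_distrib]
    congr 1
    · refine Finset.sum_congr rfl fun j _ => ?_
      rw [← mul_assoc]
      push_cast
      rw [pow_succ, mul_assoc, mul_assoc, mul_left_comm, ← mul_assoc ((-1) ^ (j : ℕ)), ← mul_pow]
      simp
  have hsplit : ∀ g : Fin (m + 2) → ℂ,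
      ∑ i, g i = g 0 + (g (Fin.succ 0) + ∑ i : Fin m, g i.succ.succ) := fun g => by
    rw [Fin.sum_univ_succ, Fin.sum_univ_succ]
  rw [hsplit]
  have e0 : (0 : Fin (m + 2)).removeNth (Fin.cons h₁ (Fin.cons h₂ v) : Fin (m + 2) → V) =
      Fin.cons h₂ v := by ext; simp [Fin.removeNth]
  have e1 : (Fin.succ (0 : Fin (m + 1))).removeNth
      (Fin.cons h₁ (Fin.cons h₂ v) : Fin (m + 2) → V) = Fin.cons h₁ v := by
    ext k
    refine Fin.cases ?_ (fun k => ?_) k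
    · simp [Fin.removeNth]
    · simp [Fin.removeNth]
  have e2 : ∀ j : Fin m, j.succ.succ.removeNth
      (Fin.cons h₁ (Fin.cons h₂ v) : Fin (m + 2) → V) =
      Fin.cons h₁ (j.succ.removeNth (Fin.cons h₂ v : Fin (m + 1) → V)) := fun j => by
    ext k
    refine Fin.cases ?_ (fun k => ?_) k
    · simp [Fin.removeNth]
    · simp [Fin.removeNth]
  simp only [e0, e1, e2, key, Fin.cons_zero, Fin.cons_succ]
  have e3 : ∀ j : Fin m, ∑ l, C (v j) (j.succ.removeNth (Fin.cons h₂ v : Fin (m + 1) → V) l)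
      (Function.update (j.succ.removeNth (Fin.cons h₂ v : Fin (m + 1) → V)) l h₁) =
      (-1) ^ (j : ℕ) * C (v j) h₂ (Function.update v j h₁) := fun j => by
    cases m with
    | zero => exact j.elim0
    | succ m =>
      have h1 : j.succ.removeNth (Fin.cons h₂ v : Fin (m + 2) → V) = Fin.cons h₂ (j.removeNth v) := by
        ext k
        refine Fin.cases ?_ (fun k => ?_) k
        · simp [Fin.removeNth]
        · simp [Fin.removeNth]
      rw [h1, Fin.sum_univ_succ, Finset.sum_eq_zero, add_zero]
      · have h3 : Function.update (Fin.cons h₂ (j.removeNth v) : Fin (m + 1) → V) 0 h₁ =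
            j.succ.removeNth (Fin.cons h₁ v : Fin (m + 2) → V) := by
          ext k
          refine Fin.cases ?_ (fun k => ?_) k
          · simp [Fin.removeNth]
          · simp [Fin.removeNth]
        rw [h3, map_removeNth_succ_cons, Fin.cons_zero]
      · intro l _
        rw [Fin.cons_succ]
        refine hC _ _ _ ⟨l.succ, 0, Fin.succ_ne_zero l, ?_, ?_⟩
        · simp
        · rw [Function.update_of_ne (Fin.succ_ne_zero l).symm, Fin.cons_zero]
  simp only [e3, map_removeNth_succ_cons]
  have e4 : ∀ (j : Fin m) (a b : ℂ), (-1 : ℤ) ^ ((j.succ.succ : Fin (m + 2)) : ℕ) •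
      ((-1) ^ (j : ℕ) * a - (-1) ^ (j : ℕ) * b) = a - b := fun j a b => by
    rw [← mul_sub, Fin.val_succ, Fin.val_succ, zsmul_eq_mul]
    push_cast
    have : ((-1 : ℂ) ^ (j : ℕ)) * (-1) ^ (j : ℕ) = 1 := by rw [← mul_pow]; simp
    linear_combination (a - b) * this
  simp only [e4, Finset.sum_sub_distrib]
  simp
  ring

/-- The positions of the two vectors that need not be vertical are immaterial. -/
theorem eq_zero_of_two_horizontal {m : ℕ} (p : V →L[ℂ] W) (ζ : V [⋀^Fin (m + 2)]→L[ℝ] ℂ)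
    (hζ : ∀ (h₁ h₂ : V) (v : Fin m → V), (∀ i, p (v i) = 0) → LinearIndependent ℝ v →
      ζ (Fin.cons h₁ (Fin.cons h₂ v)) = 0)
    (x : Fin (m + 2) → V) (hx : LinearIndependent ℝ x) (i j : Fin (m + 2)) (hij : i ≠ j)
    (hv : ∀ k, k ≠ i → k ≠ j → p (x k) = 0) : ζ x = 0 := by
  obtain ⟨τ, h0, h1⟩ := exists_perm_map_zero_one hij
  have h2 : ζ (x ∘ τ) = Equiv.Perm.sign τ • ζ x := ζ.toAlternatingMap.map_perm x τ
  have h3 : x ∘ τ = Fin.cons (x i) (Fin.cons (x j) fun k => x (τ k.succ.succ)) := by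
    ext k
    refine Fin.cases ?_ (fun k => Fin.cases ?_ (fun k => ?_) k) k
    · simp [h0]
    · simp [h1]
    · simp
  rw [h3, hζ] at h2
  · rcases Int.units_eq_one_or (Equiv.Perm.sign τ) with hs | hs <;> simpa [hs] using h2.symm
  · intro k
    refine hv _ ?_ ?_
    · rw [← h0]; exact τ.injective.ne (Fin.succ_ne_zero _)
    · rw [← h1]
      refine τ.injective.ne ?_
      rw [← Fin.succ_zero_eq_one]
      exact fun h => Fin.succ_ne_zero _ (Fin.succ_injective _ h)
  · exact hx.comp _ (τ.injective.comp ((Fin.succ_injective _).comp (Fin.succ_injective _)))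

/-- Only the values of `ζ` on two arbitrary and otherwise vertical vectors matter for the product of `ζ`
with a form of degree at least `dim - 2` on the base. -/
theorem wedge_pullForm_eq_zero {m l : ℕ} {ι κ : Type*} [Fintype κ] (p : V →L[ℂ] W)
    (b : Basis (ι ⊕ κ) ℝ V) (hb : ∀ i, p (b (Sum.inl i)) = 0) (hκ : Fintype.card κ ≤ l + 2)
    (ζ : V [⋀^Fin (m + 2)]→L[ℝ] ℂ)
    (hζ : ∀ (h₁ h₂ : V) (v : Fin m → V), (∀ i, p (v i) = 0) → LinearIndependent ℝ v →
      ζ (Fin.cons h₁ (Fin.cons h₂ v)) = 0) (β : W [⋀^Fin l]→L[ℝ] ℂ) :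
    wedge ζ (pullForm β p) = 0 := by
  classical
  suffices h : (wedge ζ (pullForm β p)).toAlternatingMap = 0 by
    ext v
    exact congrArg (fun g => g v) h
  refine Basis.ext_alternating b fun f hf => ?_
  simp only [ContinuousAlternatingMap.coe_toAlternatingMap, AlternatingMap.zero_apply, wedge_apply]
  rw [Finset.sum_eq_zero, smul_zero]
  intro σ _
  have hσ : Function.Injective fun i => f (σ i) := hf.comp σ.injective
  by_cases hβ : ∃ i k, f (σ (Fin.natAdd (m + 2) i)) = Sum.inl k
  · obtain ⟨i, k, hik⟩ := hβ
    have : pullForm β p (fun i => b (f (σ (Fin.natAdd (m + 2) i)))) = 0 := by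
      rw [pullForm_apply]
      exact β.map_coord_zero i (by rw [hik, hb])
    rw [this, mul_zero, smul_zero]
  · push Not at hβ
    have hr : ∀ i, ∃ k, f (σ (Fin.natAdd (m + 2) i)) = Sum.inr k := fun i => by
      rcases hx : f (σ (Fin.natAdd (m + 2) i)) with k | k
      · exact absurd hx (hβ i k)
      · exact ⟨k, rfl⟩
    choose g hg using hr
    set x : Fin (m + 2) → ι ⊕ κ := fun i => f (σ (Fin.castAdd l i)) with hx
    have hxi : Function.Injective x := hσ.comp (Fin.castAdd_injective _ _)
    set S := Finset.univ.filter fun i => (x i).isRight with hS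
    -- `β` takes `l` distinct horizontal basis vectors, and there are at most `l + 2` of them
    have hScard : S.card ≤ 2 := by
      have hmaps : ∃ q : {i // i ∈ S} ⊕ Fin l → κ, Function.Injective q := by
        have hr : ∀ i : {i // i ∈ S}, ∃ k, x i = Sum.inr k := fun i =>
          Sum.isRight_iff.mp (Finset.mem_filter.mp i.2).2
        choose q hq using hr
        refine ⟨Sum.elim q g, ?_⟩
        rintro (a | a) (c | c) hac
        · simp only [Sum.elim_inl] at hac
          have : x a = x c := by rw [hq, hq, hac]
          exact congrArg _ (Subtype.ext (hxi this))
        · simp only [Sum.elim_inl, Sum.elim_inr] at hac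
          have : x a = f (σ (Fin.natAdd (m + 2) c)) := by rw [hq, hg, hac]
          have h5 := hσ this
          simp [Fin.ext_iff] at h5
          omega
        · simp only [Sum.elim_inl, Sum.elim_inr] at hac
          have : x c = f (σ (Fin.natAdd (m + 2) a)) := by rw [hq, hg, hac]
          have h5 := hσ this
          simp [Fin.ext_iff] at h5
          omega
        · simp only [Sum.elim_inr] at hac
          have : f (σ (Fin.natAdd (m + 2) a)) = f (σ (Fin.natAdd (m + 2) c)) := by rw [hg, hg, hac]
          exact congrArg _ (Fin.natAdd_injective _ _ (hσ this))
      obtain ⟨q, hq⟩ := hmaps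
      have := Fintype.card_le_of_injective q hq
      simp at this
      omega
    obtain ⟨T, hST, -, hT⟩ := Finset.exists_subsuperset_card_eq (Finset.subset_univ S) hScard
      (by simp)
    obtain ⟨i, j, hij, rfl⟩ := Finset.card_eq_two.mp hT
    have hz : ζ (fun i => b (x i)) = 0 := by
      refine eq_zero_of_two_horizontal p ζ hζ _ (b.linearIndependent.comp _ hxi) i j hij ?_
      intro k hki hkj
      rcases hxk : x k with a | a
      · exact hb a
      · exfalso
        have : k ∈ S := by simp [hS, hxk]
        have := hST this
        simp [hki, hkj] at this
    have hz' : ζ (fun i => b (f (σ (Fin.castAdd l i)))) = 0 := hz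
    rw [hz', zero_mul, smul_zero]

/-- The value of `η ∧ θ` when `θ` only involves the first two vectors. -/
theorem wedge_cons_cons {m : ℕ} (p : V →L[ℂ] W) (η : V [⋀^Fin m]→L[ℝ] ℂ)
    (θ : W [⋀^Fin 2]→L[ℝ] ℂ) (h₁ h₂ : V) (v : Fin m → V) (hv : ∀ i, p (v i) = 0) :
    wedge η (pullForm θ p) (Fin.cons h₁ (Fin.cons h₂ v)) = η v * θ ![p h₁, p h₂] := by
  set w : Fin (m + 2) → V := Fin.cons h₁ (Fin.cons h₂ v) with hw
  have h1 : wedge η (pullForm θ p) (w ∘ (finRotate (m + 2) * finRotate (m + 2) : Equiv.Perm _)) =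
      wedge η (pullForm θ p) w := by
    refine ((wedge η (pullForm θ p)).toAlternatingMap.map_perm w _).trans ?_
    rw [map_mul, Int.units_mul_self, one_smul]
    rfl
  have hc : ∀ i : Fin m, (finRotate (m + 2)) ((finRotate (m + 2)) (Fin.castAdd 2 i)) =
      i.succ.succ := fun i => by
    simp only [finRotate_apply]
    ext
    simp [Fin.val_add]
  have hn0 : (finRotate (m + 2)) ((finRotate (m + 2)) (Fin.natAdd m (0 : Fin 2))) = 0 := by
    simp only [finRotate_apply]
    ext
    simp [Fin.val_add]
  have hn1 : (finRotate (m + 2)) ((finRotate (m + 2)) (Fin.natAdd m (1 : Fin 2))) = 1 := by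
    simp only [finRotate_apply]
    ext
    simp [Fin.val_add]
  rw [← h1, wedge_apply_of_vanish]
  · congr 1
    · congr 1
      ext i
      simp only [Function.comp_apply, Equiv.Perm.mul_apply, hc]
      simp [hw]
    · rw [pullForm_apply]
      congr 1
      ext i
      fin_cases i
      · simp only [Function.comp_apply, Equiv.Perm.mul_apply]
        exact congrArg (fun k => p (w k)) hn0
      · simp only [Function.comp_apply, Equiv.Perm.mul_apply]
        exact congrArg (fun k => p (w k)) hn1
  · rintro u ⟨i, j, hij⟩
    rw [pullForm_apply]
    refine θ.map_coord_zero i ?_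
    rw [hij]
    simp only [Function.comp_apply, Equiv.Perm.mul_apply, hc]
    simp [hw, hv]

end WedgeAlgebra

/-! ### Triangular matrices and flag coordinates -/

section Triangular
variable {r : ℕ}

/-- The strictly upper triangular matrix with given entries. -/
def strictUpper (N : PairIdx r → ℂ) : Matrix (Fin r) (Fin r) ℂ :=
  fun i j => if h : i < j then N ⟨(i, j), h⟩ else 0

/-- The strictly upper triangular part of a matrix. -/
def upperPart (X : Matrix (Fin r) (Fin r) ℂ) : PairIdx r → ℂ := fun p => X p.1.1 p.1.2

/-- The unipotent upper triangular matrix with given entries above the diagonal. -/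
def unipotent (ξ : PairIdx r → ℂ) : Matrix (Fin r) (Fin r) ℂ := 1 + strictUpper ξ

/-- Lower triangular matrices. -/
abbrev LowerTri (A : Matrix (Fin r) (Fin r) ℂ) : Prop := A.BlockTriangular OrderDual.toDual

theorem LowerTri.apply {A : Matrix (Fin r) (Fin r) ℂ} (hA : LowerTri A) {i j : Fin r} (h : i < j) :
    A i j = 0 := hA (OrderDual.toDual_lt_toDual.mpr h)

theorem lowerTri_of {A : Matrix (Fin r) (Fin r) ℂ} (h : ∀ i j, i < j → A i j = 0) : LowerTri A :=
  fun i j hij => h i j (OrderDual.toDual_lt_toDual.mp hij)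

theorem LowerTri.inv {A : Matrix (Fin r) (Fin r) ℂ} (hA : LowerTri A) (hd : IsUnit A.det) :
    LowerTri A⁻¹ := by
  have := A.invertibleOfIsUnitDet hd
  exact Matrix.blockTriangular_inv_of_blockTriangular hA

theorem LowerTri.det {A : Matrix (Fin r) (Fin r) ℂ} (hA : LowerTri A) : A.det = ∏ i, A i i :=
  Matrix.det_of_isLowerTriangular A hA

theorem LowerTri.diag_ne_zero {A : Matrix (Fin r) (Fin r) ℂ} (hA : LowerTri A) (hd : IsUnit A.det)
    (i : Fin r) : A i i ≠ 0 := by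
  rw [hA.det, isUnit_iff_ne_zero, Finset.prod_ne_zero_iff] at hd
  exact hd i (Finset.mem_univ i)

theorem LowerTri.mul_diag {A B : Matrix (Fin r) (Fin r) ℂ} (hA : LowerTri A) (hB : LowerTri B)
    (i : Fin r) : (A * B) i i = A i i * B i i := by
  rw [Matrix.mul_apply, Finset.sum_eq_single i]
  · intro j _ hj
    rcases lt_or_gt_of_ne hj with h | h
    · rw [hB.apply h, mul_zero]
    · rw [hA.apply h, zero_mul]
  · simp

theorem LowerTri.inv_diag {A : Matrix (Fin r) (Fin r) ℂ} (hA : LowerTri A) (hd : IsUnit A.det)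
    (i : Fin r) : A⁻¹ i i = (A i i)⁻¹ := by
  have h := (hA.inv hd).mul_diag hA i
  rw [Matrix.nonsing_inv_mul _ hd, Matrix.one_apply_eq] at h
  exact eq_inv_of_mul_eq_one_left h.symm

theorem unipotent_apply (ξ : PairIdx r → ℂ) (i j : Fin r) :
    unipotent ξ i j = if i = j then 1 else if h : i < j then ξ ⟨(i, j), h⟩ else 0 := by
  by_cases hij : i = j
  · subst hij
    simp [unipotent, strictUpper]
  · simp [unipotent, strictUpper, hij]

theorem unipotent_zero : unipotent (0 : PairIdx r → ℂ) = 1 := by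
  ext i j
  simp [unipotent, strictUpper]

theorem det_unipotent (ξ : PairIdx r → ℂ) : (unipotent ξ).det = 1 := by
  rw [Matrix.det_of_isUpperTriangular]
  · simp [unipotent_apply]
  · intro i j hij
    have : ¬ i < j := not_lt.mpr (le_of_lt hij)
    simp [unipotent_apply, (show j < i from hij).ne', this]

theorem isUnit_det_unipotent (ξ : PairIdx r → ℂ) : IsUnit (unipotent ξ).det := by
  rw [det_unipotent]; exact isUnit_one

theorem sum_pairs {G : Type*} [AddCommMonoid G] (g : Fin r → Fin r → G) :
    ∑ p : PairIdx r, g p.1.1 p.1.2 = ∑ i, ∑ j, if i < j then g i j else 0 := by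
  rw [← Fintype.sum_prod_type' (f := fun i j => if i < j then g i j else 0), ← Finset.sum_filter]
  exact (Finset.sum_subtype _ (by simp) fun p : Fin r × Fin r => g p.1 p.2).symm

theorem mul_strictUpper_mul_apply (X Y : Matrix (Fin r) (Fin r) ℂ) (N : PairIdx r → ℂ)
    (i j : Fin r) : (X * strictUpper N * Y) i j = ∑ q : PairIdx r, X i q.1.1 * N q * Y q.1.2 j := by
  have h : ∀ q : PairIdx r, X i q.1.1 * N q * Y q.1.2 j =
      (fun k l => X i k * strictUpper N k l * Y l j) q.1.1 q.1.2 := fun q => by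
    simp [strictUpper, q.2]
  rw [Finset.sum_congr rfl fun q _ => h q]
  refine Eq.trans ?_ (sum_pairs fun k l => X i k * strictUpper N k l * Y l j).symm
  simp only [Matrix.mul_apply, Finset.sum_mul]
  rw [Finset.sum_comm]
  refine Finset.sum_congr rfl fun k _ => Finset.sum_congr rfl fun l _ => ?_
  by_cases hkl : k < l <;> simp [strictUpper, hkl]

/-- The linear map `N ↦ upperPart (X * N * Y)` on strictly upper triangular matrices. -/
def conjUpper (X Y : Matrix (Fin r) (Fin r) ℂ) : (PairIdx r → ℂ) →L[ℂ] (PairIdx r → ℂ) :=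
  LinearMap.toContinuousLinearMap
    (Matrix.toLin' (Matrix.of fun p q : PairIdx r => X p.1.1 q.1.1 * Y q.1.2 p.1.2))

theorem conjUpper_apply (X Y : Matrix (Fin r) (Fin r) ℂ) (N : PairIdx r → ℂ) :
    conjUpper X Y N = upperPart (X * strictUpper N * Y) := by
  ext p
  rw [upperPart, mul_strictUpper_mul_apply]
  simp only [conjUpper, LinearMap.coe_toContinuousLinearMap', Matrix.toLin'_apply, Matrix.mulVec,
    dotProduct, Matrix.of_apply]
  exact Finset.sum_congr rfl fun q _ => by ring

/-- The determinant of a matrix that is triangular with respect to the partial order given by `key`. -/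
theorem det_of_key {ι : Type*} [Fintype ι] [DecidableEq ι] (A : Matrix ι ι ℂ) (key : ι → ℕ)
    (h : ∀ p q, p ≠ q → A p q ≠ 0 → key p < key q) : A.det = ∏ p, A p p := by
  rw [Matrix.det_apply, Finset.sum_eq_single 1]
  · simp
  · intro σ _ hσ
    by_cases hz : ∃ i, A (σ i) i = 0
    · obtain ⟨i, hi⟩ := hz
      have : ∏ i, A (σ i) i = 0 := Finset.prod_eq_zero (Finset.mem_univ i) hi
      exact smul_eq_zero_of_right _ this
    · exfalso
      push Not at hz
      obtain ⟨i, hi⟩ : ∃ i, σ i ≠ i := by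
        by_contra! hc
        exact hσ (Equiv.ext hc)
      have : ∑ i, key (σ i) < ∑ i, key i := by
        refine Finset.sum_lt_sum (fun j _ => ?_) ⟨i, Finset.mem_univ i, h _ _ hi (hz i)⟩
        by_cases hj : σ j = j
        · rw [hj]
        · exact (h _ _ hj (hz j)).le
      rw [Equiv.sum_comp σ key] at this
      exact lt_irrefl _ this
  · simp

theorem pairIdx_ext {p q : PairIdx r} (h₁ : p.1.1 = q.1.1) (h₂ : p.1.2 = q.1.2) : p = q :=
  Subtype.ext (Prod.ext h₁ h₂)

theorem det_conjUpper_of_lower {X Y : Matrix (Fin r) (Fin r) ℂ} (hX : LowerTri X) (hY : LowerTri Y) :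
    LinearMap.det (conjUpper X Y : (PairIdx r → ℂ) →ₗ[ℂ] (PairIdx r → ℂ)) =
      ∏ p : PairIdx r, X p.1.1 p.1.1 * Y p.1.2 p.1.2 := by
  rw [conjUpper, LinearMap.coe_toContinuousLinearMap, LinearMap.det_toLin',
    det_of_key _ fun p => (p.1.2 : ℕ) - p.1.1]
  · simp
  · intro p q hpq h0
    rw [Matrix.of_apply] at h0
    have h1 : q.1.1 ≤ p.1.1 := by
      by_contra! h; exact h0 (by rw [hX.apply h, zero_mul])
    have h2 : p.1.2 ≤ q.1.2 := by
      by_contra! h; exact h0 (by rw [hY.apply h, mul_zero])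
    have h3 := p.2
    have h4 : ¬ (p.1.1 = q.1.1 ∧ p.1.2 = q.1.2) := fun h => hpq (pairIdx_ext h.1 h.2)
    have h5 := q.2
    simp only [Fin.lt_def, Fin.le_def, Fin.ext_iff] at *
    omega

theorem det_conjUpper_one_upper {Y : Matrix (Fin r) (Fin r) ℂ} (hY : Y.BlockTriangular id) :
    LinearMap.det (conjUpper 1 Y : (PairIdx r → ℂ) →ₗ[ℂ] (PairIdx r → ℂ)) =
      ∏ p : PairIdx r, Y p.1.2 p.1.2 := by
  rw [conjUpper, LinearMap.coe_toContinuousLinearMap, LinearMap.det_toLin',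
    det_of_key _ fun p => r - p.1.2]
  · simp
  · intro p q hpq h0
    rw [Matrix.of_apply] at h0
    have h1 : p.1.1 = q.1.1 := by
      by_contra! h; exact h0 (by rw [Matrix.one_apply_ne h, zero_mul])
    have h2 : q.1.2 ≤ p.1.2 := by
      by_contra! h; exact h0 (by rw [hY h, mul_zero])
    have h4 : p.1.2 ≠ q.1.2 := fun h => hpq (pairIdx_ext h1 h)
    have h5 := p.1.2.2
    simp only [Fin.le_def, ne_eq, Fin.ext_iff] at *
    omega

theorem prod_pairs_fst {G : Type*} [CommMonoid G] (g : Fin r → G) :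
    ∏ p : PairIdx r, g p.1.1 = ∏ i, g i ^ (r - 1 - (i : ℕ)) := by
  have h : ∏ p : PairIdx r, g p.1.1 =
      ∏ p ∈ Finset.univ.filter (fun p : Fin r × Fin r => p.1 < p.2), g p.1 :=
    (Finset.prod_subtype _ (by simp) fun p : Fin r × Fin r => g p.1).symm
  refine h.trans ?_
  rw [Finset.prod_filter, Fintype.prod_prod_type]
  refine Finset.prod_congr rfl fun i _ => ?_
  rw [← Finset.prod_filter]
  change ∏ j ∈ Finset.univ.filter (fun j => i < j), g i = _
  rw [Finset.prod_const]
  congr 1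
  rw [show (Finset.univ.filter fun j => i < j) = Finset.Ioi i by ext; simp, Fin.card_Ioi]

theorem prod_pairs_snd {G : Type*} [CommMonoid G] (g : Fin r → G) :
    ∏ p : PairIdx r, g p.1.2 = ∏ i, g i ^ (i : ℕ) := by
  have h : ∏ p : PairIdx r, g p.1.2 =
      ∏ p ∈ Finset.univ.filter (fun p : Fin r × Fin r => p.1 < p.2), g p.2 :=
    (Finset.prod_subtype _ (by simp) fun p : Fin r × Fin r => g p.2).symm
  refine h.trans ?_
  rw [Finset.prod_filter, Fintype.prod_prod_type, Finset.prod_comm]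
  refine Finset.prod_congr rfl fun i _ => ?_
  rw [← Finset.prod_filter]
  change ∏ j ∈ Finset.univ.filter (fun j => j < i), g i = _
  rw [Finset.prod_const]
  congr 1
  rw [show (Finset.univ.filter fun j => j < i) = Finset.Iio i by ext; simp, Fin.card_Iio]

/-- This identity is the origin of the canonical weight. -/
theorem prod_pairs_div (g : Fin r → ℂ) (hg : ∀ i, g i ≠ 0) :
    ∏ p : PairIdx r, g p.1.1 * (g p.1.2)⁻¹ = ∏ i, (g i)⁻¹ ^ canonicalWeight r i := by
  rw [Finset.prod_mul_distrib, prod_pairs_fst, prod_pairs_snd fun i => (g i)⁻¹,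
    ← Finset.prod_mul_distrib]
  refine Finset.prod_congr rfl fun i _ => ?_
  rw [inv_pow, ← zpow_natCast, ← zpow_natCast, inv_zpow, ← zpow_neg, ← zpow_neg,
    ← zpow_add₀ (hg i)]
  congr 1
  have := i.2
  rw [canonicalWeight]
  omega

theorem sum_pairs_sub (g : Fin r → ℂ) :
    ∑ p : PairIdx r, (g p.1.1 - g p.1.2) = -∑ i, (canonicalWeight r i : ℂ) * g i := by
  have h1 := congrArg Multiplicative.toAdd (prod_pairs_fst fun i => Multiplicative.ofAdd (g i))
  have h2 := congrArg Multiplicative.toAdd (prod_pairs_snd fun i => Multiplicative.ofAdd (g i))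
  simp only [toAdd_prod, toAdd_pow, toAdd_ofAdd] at h1 h2
  rw [Finset.sum_sub_distrib, h1, h2, ← Finset.sum_sub_distrib, ← Finset.sum_neg_distrib]
  refine Finset.sum_congr rfl fun i _ => ?_
  have h3 : ((r - 1 - (i : ℕ) : ℕ) : ℂ) = r - 1 - i := by
    have := i.2
    rw [Nat.sub_sub, Nat.cast_sub (by omega)]
    push_cast
    ring
  rw [nsmul_eq_mul, nsmul_eq_mul, h3, canonicalWeight]
  push_cast
  ring

theorem leadBlock_mul {A B : Matrix (Fin r) (Fin r) ℂ} (hA : LowerTri A) (k : Fin r) :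
    leadBlock (A * B) k = leadBlock A k * leadBlock B k := by
  ext i j
  rw [Matrix.mul_apply]
  simp only [leadBlock, Matrix.submatrix_apply, Matrix.mul_apply]
  rw [← Finset.sum_subset (Finset.subset_univ (Finset.univ.filter fun l : Fin r => l ≤ k))]
  · exact Finset.sum_subtype _ (by simp) _
  · intro l _ hl
    have hl' : k < l := by simpa using hl
    rw [hA.apply (lt_of_le_of_lt i.2 hl'), zero_mul]

theorem leadBlock_one (k : Fin r) : leadBlock (1 : Matrix (Fin r) (Fin r) ℂ) k = 1 := by
  ext i j
  simp [leadBlock, Matrix.one_apply, Subtype.ext_iff]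

theorem leadBlock_inv {A : Matrix (Fin r) (Fin r) ℂ} (hA : LowerTri A) (hd : IsUnit A.det)
    (k : Fin r) : (leadBlock A k)⁻¹ = leadBlock A⁻¹ k := by
  refine Matrix.inv_eq_left_inv ?_
  rw [← leadBlock_mul (hA.inv hd), Matrix.nonsing_inv_mul _ hd, leadBlock_one]

theorem det_leadBlock_ne_zero {A : Matrix (Fin r) (Fin r) ℂ} (hA : LowerTri A) (hd : IsUnit A.det)
    (k : Fin r) : (leadBlock A k).det ≠ 0 := by
  have h : leadBlock A⁻¹ k * leadBlock A k = 1 := by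
    rw [← leadBlock_mul (hA.inv hd), Matrix.nonsing_inv_mul _ hd, leadBlock_one]
  have h2 := congrArg Matrix.det h
  rw [Matrix.det_mul, Matrix.det_one] at h2
  exact right_ne_zero_of_mul_eq_one h2

end Triangular

section MatrixCalculus
variable {𝕜 : Type*} [NontriviallyNormedField 𝕜] [NormedAlgebra 𝕜 ℂ]
  {G : Type*} [NormedAddCommGroup G] [NormedSpace 𝕜 G] {ι : Type*} [Fintype ι] [DecidableEq ι]

theorem contDiffAt_det {A : G → Matrix ι ι ℂ} {x : G} {m : ℕ∞ω}
    (hA : ∀ i j, ContDiffAt 𝕜 m (fun u => A u i j) x) :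
    ContDiffAt 𝕜 m (fun u => (A u).det) x := by
  simp only [Matrix.det_apply]
  refine ContDiffAt.sum fun σ _ => ?_
  have h : ContDiffAt 𝕜 m (fun u => ∏ i, A u (σ i) i) x := contDiffAt_prod fun i _ => hA _ _
  rcases Int.units_eq_one_or (Equiv.Perm.sign σ) with hs | hs
  · simpa [hs] using h
  · simpa [hs] using h.neg

theorem contDiffAt_matrix_inv {A : G → Matrix ι ι ℂ} {x : G} {m : ℕ∞ω}
    (hA : ∀ i j, ContDiffAt 𝕜 m (fun u => A u i j) x) (hd : (A x).det ≠ 0) (i j : ι) :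
    ContDiffAt 𝕜 m (fun u => (A u)⁻¹ i j) x := by
  simp only [Matrix.inv_def, Matrix.smul_apply, Ring.inverse_eq_inv', smul_eq_mul,
    Matrix.adjugate_apply]
  refine ((contDiffAt_det hA).inv hd).mul (contDiffAt_det fun k l => ?_)
  simp only [Matrix.updateRow_apply]
  split_ifs
  · exact contDiffAt_const
  · exact hA _ _

theorem contDiffAt_matrix_mul {A B : G → Matrix ι ι ℂ} {x : G} {m : ℕ∞ω}
    (hA : ∀ i j, ContDiffAt 𝕜 m (fun u => A u i j) x)
    (hB : ∀ i j, ContDiffAt 𝕜 m (fun u => B u i j) x) (i j : ι) :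
    ContDiffAt 𝕜 m (fun u => (A u * B u) i j) x := by
  simp only [Matrix.mul_apply]
  exact ContDiffAt.sum fun k _ => (hA i k).mul (hB k j)

theorem contDiffAt_blockCoord {r : ℕ} {A : G → Matrix (Fin r) (Fin r) ℂ} {x : G} {m : ℕ∞ω}
    (hA : ∀ i j, ContDiffAt 𝕜 m (fun u => A u i j) x) (hd : ∀ k, (leadBlock (A x) k).det ≠ 0) :
    ContDiffAt 𝕜 m (fun u => blockCoord (A u)) x := by
  rw [contDiffAt_pi]
  intro p
  exact ContDiffAt.sum fun ν _ =>
    (contDiffAt_matrix_inv (A := fun u => leadBlock (A u) p.1.1) (fun _ _ => hA _ _) (hd _) _ _).mul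
      (hA _ _)

/-- The derivative of the flag coordinates at a lower triangular matrix `A` is the strictly upper
triangular part of `A⁻¹ dA`. -/
theorem hasFDerivAt_blockCoord {r : ℕ} {A : G → Matrix (Fin r) (Fin r) ℂ} {x : G}
    (hA : ∀ i j, ContDiffAt 𝕜 1 (fun u => A u i j) x) {A' : Fin r → Fin r → G →L[𝕜] ℂ}
    (hA' : ∀ i j, HasFDerivAt (fun u => A u i j) (A' i j) x) (hl : LowerTri (A x))
    (hd : IsUnit (A x).det) (p : PairIdx r) :
    HasFDerivAt (fun u => blockCoord (A u) p) (∑ k, (A x)⁻¹ p.1.1 k • A' k p.1.2) x := by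
  have h1 : ∀ ν : {j : Fin r // j ≤ p.1.1}, HasFDerivAt
      (fun u => (leadBlock (A u) p.1.1)⁻¹ ⟨p.1.1, le_refl _⟩ ν * A u ν p.1.2)
      ((A x)⁻¹ p.1.1 ν • A' ν p.1.2) x := fun ν => by
    have hB := (contDiffAt_matrix_inv (A := fun u => leadBlock (A u) p.1.1) (x := x) (m := 1)
      (fun _ _ => hA _ _) (det_leadBlock_ne_zero hl hd _) ⟨p.1.1, le_refl _⟩ ν).differentiableAt
      (by simp)
    have h := hB.hasFDerivAt.mul (hA' ν p.1.2)
    have h0 : A x ν p.1.2 = 0 := hl.apply (lt_of_le_of_lt ν.2 p.2)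
    have h1 : (leadBlock (A x) p.1.1)⁻¹ ⟨p.1.1, le_refl _⟩ ν = (A x)⁻¹ p.1.1 ν := by
      rw [leadBlock_inv hl hd]; rfl
    refine h.congr_fderiv ?_
    simp only [h0, h1]
    ext v
    simp
  have h2 := HasFDerivAt.fun_sum (u := Finset.univ) fun ν _ => h1 ν
  refine h2.congr_fderiv ?_
  refine Eq.trans ?_ (Finset.sum_subset (Finset.subset_univ
    (Finset.univ.filter fun l : Fin r => l ≤ p.1.1)) ?_)
  · exact (Finset.sum_subtype (p := fun l => l ≤ p.1.1) _ (by simp)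
      fun k => (A x)⁻¹ p.1.1 k • A' k p.1.2).symm
  · intro l _ hl'
    have hl' : p.1.1 < l := by simpa using hl'
    have h0 : (A x)⁻¹ p.1.1 l = 0 := (hl.inv hd).apply hl'
    simp only [h0]
    exact zero_smul _ _

end MatrixCalculus

/-! ### Changes of frames and adapted frames -/

section Frames
variable {r : ℕ} {V : Type*} [AddCommGroup V] [Module ℂ V]

/-- The family of vectors `∑ j, A_{ij} w_j`. -/
def matAct (A : Matrix (Fin r) (Fin r) ℂ) (w : Fin r → V) (i : Fin r) : V := ∑ j, A i j • w j

theorem matAct_mul (A B : Matrix (Fin r) (Fin r) ℂ) (w : Fin r → V) :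
    matAct (A * B) w = matAct A (matAct B w) := by
  ext i
  simp only [matAct, Matrix.mul_apply, Finset.sum_smul, Finset.smul_sum, smul_smul]
  exact Finset.sum_comm

theorem matAct_one (w : Fin r → V) : matAct 1 w = w := by
  ext i
  simp [matAct, Matrix.one_apply]

theorem tildeFrame_eq_matAct (e : Fin r → V) (ξ : PairIdx r → ℂ) :
    tildeFrame e ξ = matAct (unipotent ξ) e := by
  ext i
  have h : ∀ j, unipotent ξ i j • e j =
      (if i = j then e j else 0) + if h : i < j then ξ ⟨(i, j), h⟩ • e j else 0 := fun j => by
    by_cases hij : i = j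
    · simp [unipotent_apply, hij]
    · by_cases hlt : i < j <;> simp [unipotent_apply, hij, hlt]
  simp only [tildeFrame, matAct, h, Finset.sum_add_distrib, Finset.sum_ite_eq, Finset.mem_univ,
    if_true]

theorem matAct_injective {w : Fin r → V} (hw : LinearIndependent ℂ w)
    {A B : Matrix (Fin r) (Fin r) ℂ} (h : matAct A w = matAct B w) : A = B := by
  ext i j
  have h1 : ∑ j, (A i j - B i j) • w j = 0 := by
    simp only [sub_smul, Finset.sum_sub_distrib]
    exact sub_eq_zero.mpr (congrFun h i)
  exact sub_eq_zero.mp (Fintype.linearIndependent_iff.mp hw _ h1 j)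

theorem linearIndependent_matAct {w : Fin r → V} (hw : LinearIndependent ℂ w)
    {A : Matrix (Fin r) (Fin r) ℂ} (hA : IsUnit A.det) : LinearIndependent ℂ (matAct A w) := by
  rw [Fintype.linearIndependent_iff]
  intro g hg
  have h1 : ∑ j, Matrix.vecMul g A j • w j = 0 := by
    rw [← hg]
    simp only [matAct, Matrix.vecMul, dotProduct, Finset.sum_smul, Finset.smul_sum, smul_smul]
    exact Finset.sum_comm
  have h2 : Matrix.vecMul g A = 0 := funext (Fintype.linearIndependent_iff.mp hw _ h1)
  have h3 : Matrix.vecMul (Matrix.vecMul g A) A⁻¹ = 0 := by rw [h2, Matrix.zero_vecMul]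
  rw [Matrix.vecMul_vecMul, Matrix.mul_nonsing_inv _ hA, Matrix.vecMul_one] at h3
  exact congrFun h3

theorem isUnit_det_of_matAct {w : Fin r → V} {A : Matrix (Fin r) (Fin r) ℂ}
    (h : LinearIndependent ℂ (matAct A w)) : IsUnit A.det := by
  rw [← Matrix.isUnit_iff_isUnit_det, ← Matrix.linearIndependent_rows_iff_isUnit,
    Fintype.linearIndependent_iff]
  intro g hg
  refine Fintype.linearIndependent_iff.mp h g ?_
  have h1 : ∀ j, ∑ i, g i * A i j = 0 := fun j => by
    have := congrFun hg j
    simpa using this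
  simp only [matAct, Finset.smul_sum, smul_smul]
  rw [Finset.sum_comm]
  simp only [← Finset.sum_smul, h1, zero_smul, Finset.sum_const_zero]

/-- Two families giving the same flag are related by a lower triangular matrix. -/
theorem Adapted.exists_lowerTri {w w' : Fin r → V} {f : FullFlag r (Dual ℂ V)} (h : Adapted w f)
    (h' : Adapted w' f) : ∃ L, LowerTri L ∧ w = matAct L w' := by
  have hsp : ∀ i, leadSpan w i = leadSpan w' i := fun i =>
    Subspace.dualAnnihilator_inj.mp ((h i).symm.trans (h' i))
  have hc : ∀ k : Fin r, ∃ c : {j : Fin r // j ≤ k} → ℂ, w k = ∑ ν, c ν • w' ν :=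
    fun k => mem_leadSpan_succ (by rw [← hsp]; exact mem_leadSpan _ (Fin.castSucc_lt_succ))
  choose c hc using hc
  refine ⟨fun i j => if h : j ≤ i then c i ⟨j, h⟩ else 0, lowerTri_of fun i j hij => ?_, ?_⟩
  · exact dif_neg (not_le.mpr hij)
  · ext k
    refine (hc k).trans ?_
    change _ = ∑ j, (if h : j ≤ k then c k ⟨j, h⟩ else 0) • w' j
    rw [← Finset.sum_subset (Finset.subset_univ (Finset.univ.filter fun j => j ≤ k))]
    · rw [Finset.sum_subtype (p := fun j => j ≤ k) _ (by simp)]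
      exact Finset.sum_congr rfl fun ν _ => by rw [dif_pos ν.2]
    · intro j _ hj
      have hj' : ¬ j ≤ k := by simpa using hj
      rw [dif_neg hj', zero_smul]

theorem leadSpan_matAct_le {w : Fin r → V} {L : Matrix (Fin r) (Fin r) ℂ} (hL : LowerTri L)
    (i : Fin (r + 1)) : leadSpan (matAct L w) i ≤ leadSpan w i := by
  rw [leadSpan, Submodule.span_le]
  rintro _ ⟨k, hk, rfl⟩
  refine Submodule.sum_mem _ fun j _ => ?_
  by_cases hj : k < j
  · rw [hL.apply hj, zero_smul]; exact Submodule.zero_mem _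
  · refine Submodule.smul_mem _ _ (mem_leadSpan w (lt_of_le_of_lt ?_ hk))
    simpa using hj

theorem Adapted.matAct {w : Fin r → V} {f : FullFlag r (Dual ℂ V)} (h : Adapted w f)
    {L : Matrix (Fin r) (Fin r) ℂ} (hL : LowerTri L) (hd : IsUnit L.det) :
    Adapted (matAct L w) f := by
  intro i
  rw [h i]
  congr 1
  refine le_antisymm ?_ (leadSpan_matAct_le hL i)
  have h1 := leadSpan_matAct_le (w := _root_.matAct L w) (hL.inv hd) i
  rwa [← matAct_mul, Matrix.nonsing_inv_mul _ hd, matAct_one] at h1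

theorem coordMatrix_matAct (e : Basis (Fin r) ℂ V) (A : Matrix (Fin r) (Fin r) ℂ) :
    coordMatrix e (matAct A e) = A := by
  ext i j
  simp [coordMatrix, matAct, Finsupp.single_apply]

/-- The flag coordinates of the flag given by the family `∑ j, A_{ij} e_j`. -/
theorem Adapted.flagCoord_eq_blockCoord (e : Basis (Fin r) ℂ V) {f : FullFlag r (Dual ℂ V)}
    {A : Matrix (Fin r) (Fin r) ℂ} (h : Adapted (_root_.matAct A e) f) (hd : IsUnit A.det)
    (hk : ∀ k, (leadBlock A k).det ≠ 0) :
    flagCoord e f = blockCoord A ∧ Adapted (tildeFrame e (flagCoord e f)) f := by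
  have h1 := adapted_of_det_ne_zero e (linearIndependent_matAct e.linearIndependent hd) h
    (by rwa [coordMatrix_matAct])
  rw [coordMatrix_matAct] at h1
  have h2 := flagCoord_eq e h1
  exact ⟨h2, by rwa [h2]⟩

end Frames

/-! ### Holomorphic frames in local coordinates -/

section Geometry
variable {n r : ℕ} {X : Type*} [TopologicalSpace X] [ChartedSpace (Fin n → ℂ) X]
  {E : X → Type*} [TopologicalSpace (TotalSpace (Fin r → ℂ) E)]
  [∀ x, AddCommGroup (E x)] [∀ x, Module ℂ (E x)] [∀ x, TopologicalSpace (E x)]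
  [FiberBundle (Fin r → ℂ) E] [VectorBundle ℂ (Fin r → ℂ) E]

open FlagBundle

local notation "flagChart" => chartAt (FlagModel n r)
local notation "baseChart" => chartAt (Fin n → ℂ)

section HolFrames
variable (E) in
/-- The holomorphic frame given by the trivialization at `x₀`. -/
def refFrame (x₀ : X) (i : Fin r) (x : X) : E x := stdFrame E x₀ (Pi.basisFun ℂ (Fin r)) i x

/-- The coordinates of a family of sections in the trivialization at `x₀`. -/
def frameCoords (x₀ : X) (e : Fin r → ∀ x, E x) (x : X) : Matrix (Fin r) (Fin r) ℂ :=
  fun i j => (trivializationAt (Fin r → ℂ) E x₀ ⟨x, e i x⟩).2 j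

theorem exists_basis_refFrame {x₀ x : X}
    (hx : x ∈ (trivializationAt (Fin r → ℂ) E x₀).baseSet) :
    ∃ B : Basis (Fin r) ℂ (E x), ⇑B = fun i => refFrame E x₀ i x :=
  ⟨_, (stdFrame_eq (Pi.basisFun ℂ (Fin r)) hx).symm⟩

theorem matAct_frameCoords {x₀ x : X} (hx : x ∈ (trivializationAt (Fin r → ℂ) E x₀).baseSet)
    (e : Fin r → ∀ x, E x) :
    (fun i => e i x) = matAct (frameCoords x₀ e x) fun i => refFrame E x₀ i x := by
  ext i
  have h1 : (fun i => refFrame E x₀ i x) =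
      (trivializationAt (Fin r → ℂ) E x₀).basisAt (Pi.basisFun ℂ (Fin r)) hx :=
    stdFrame_eq (Pi.basisFun ℂ (Fin r)) hx
  rw [h1]
  refine (Basis.sum_repr ((trivializationAt (Fin r → ℂ) E x₀).basisAt (Pi.basisFun ℂ (Fin r)) hx)
    (e i x)).symm.trans (Finset.sum_congr rfl fun j _ => ?_)
  congr 1

theorem frameCoords_matAct {x₀ x : X} (hx : x ∈ (trivializationAt (Fin r → ℂ) E x₀).baseSet)
    (A : X → Matrix (Fin r) (Fin r) ℂ) (e : Fin r → ∀ x, E x) :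
    frameCoords x₀ (fun i x => matAct (A x) (fun j => e j x) i) x = A x * frameCoords x₀ e x := by
  obtain ⟨B, hB⟩ := exists_basis_refFrame (E := E) hx
  refine matAct_injective (w := fun i => refFrame E x₀ i x) (hB ▸ B.linearIndependent) ?_
  rw [← matAct_frameCoords hx, matAct_mul, ← matAct_frameCoords hx]

theorem IsHolFrameNear.exists_basis {e : Fin r → ∀ x, E x} {x : X} (he : IsHolFrameNear n e x) :
    ∃ B : Basis (Fin r) ℂ (E x), ⇑B = fun i => e i x := by
  obtain ⟨U, _, hx, hU⟩ := he
  exact ⟨Basis.mk (hU.linearIndependent hx) (hU.generating hx), Basis.coe_mk _ _⟩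

theorem IsHolFrameNear.eventually {e : Fin r → ∀ x, E x} {x : X} (he : IsHolFrameNear n e x) :
    ∀ᶠ x' in 𝓝 x, IsHolFrameNear n e x' := by
  obtain ⟨U, hU, hx, h⟩ := he
  exact (hU.eventually_mem hx).mono fun x' hx' => ⟨U, hU, hx', h⟩

theorem IsHolFrameNear.isUnit_det {e : Fin r → ∀ x, E x} {x x₀ : X} (he : IsHolFrameNear n e x)
    (hx : x ∈ (trivializationAt (Fin r → ℂ) E x₀).baseSet) : IsUnit (frameCoords x₀ e x).det := by
  obtain ⟨B, hB⟩ := he.exists_basis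
  refine isUnit_det_of_matAct (w := fun i => refFrame E x₀ i x) ?_
  rw [← matAct_frameCoords hx, ← hB]
  exact B.linearIndependent

theorem isOpen_baseDomain (x₀ : X) : IsOpen (baseDomain n r E x₀) :=
  (baseChart x₀).open_source.inter (trivializationAt (Fin r → ℂ) E x₀).open_baseSet

theorem mem_baseDomain (x₀ : X) : x₀ ∈ baseDomain n r E x₀ :=
  ⟨mem_chart_source _ _, FiberBundle.mem_baseSet_trivializationAt' x₀⟩

variable [IsManifold 𝓘(ℂ, Fin n → ℂ) ω X]
  [ContMDiffVectorBundle ω (Fin r → ℂ) E 𝓘(ℂ, Fin n → ℂ)]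

theorem contMDiffAt_iff_chart {F : Type*} [NormedAddCommGroup F] [NormedSpace ℂ F] {f : X → F}
    {x x₀ : X} (hx : x ∈ (baseChart x₀).source) :
    ContMDiffAt 𝓘(ℂ, Fin n → ℂ) 𝓘(ℂ, F) ω f x ↔
      ContDiffAt ℂ ω (fun z => f ((baseChart x₀).symm z)) (baseChart x₀ x) := by
  set c := baseChart x₀ with hc
  rw [← contMDiffAt_iff_contDiffAt]
  constructor
  · intro h
    have h1 : ContMDiffAt 𝓘(ℂ, Fin n → ℂ) 𝓘(ℂ, Fin n → ℂ) ω c.symm (c x) :=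
      (contMDiffOn_chart_symm (x := x₀)).contMDiffAt (c.open_target.mem_nhds (c.map_source hx))
    refine ContMDiffAt.comp (c x) (g := f) ?_ h1
    rwa [c.left_inv hx]
  · intro h
    have h1 : ContMDiffAt 𝓘(ℂ, Fin n → ℂ) 𝓘(ℂ, Fin n → ℂ) ω c x :=
      (contMDiffOn_chart (x := x₀)).contMDiffAt (c.open_source.mem_nhds hx)
    refine (ContMDiffAt.comp x h h1).congr_of_eventuallyEq ?_
    filter_upwards [c.open_source.mem_nhds hx] with x' hx'
    simp [c.left_inv hx']

theorem IsHolFrameNear.contDiffAt_frameCoords {e : Fin r → ∀ x, E x} {x x₀ : X}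
    (he : IsHolFrameNear n e x) (hx : x ∈ baseDomain n r E x₀) (i j : Fin r) :
    ContDiffAt ℂ ω (fun z => frameCoords x₀ e ((baseChart x₀).symm z) i j)
      (baseChart x₀ x) := by
  obtain ⟨U, hU, hxU, h⟩ := he
  have h1 := ((trivializationAt (Fin r → ℂ) E x₀).contMDiffAt_section_iff hx.2).mp
    (h.contMDiffAt hU hxU i)
  have h2 := (contMDiffAt_iff_chart hx.1).mp h1
  exact contDiffAt_pi.mp h2 j

/-- A holomorphic change of frame leads to a holomorphic frame. -/
theorem IsHolFrameNear.matAct {e : Fin r → ∀ x, E x} {x x₀ : X} (he : IsHolFrameNear n e x)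
    (hx : x ∈ baseDomain n r E x₀) {A : (Fin n → ℂ) → Matrix (Fin r) (Fin r) ℂ}
    (hA : ∀ i j, ContDiffAt ℂ ω (fun z => A z i j) (baseChart x₀ x))
    (hd : (A (baseChart x₀ x)).det ≠ 0) :
    IsHolFrameNear n (fun i x' => matAct (A (baseChart x₀ x')) (fun j => e j x') i) x := by
  set c := baseChart x₀ with hc
  obtain ⟨U, hU, hxU, h⟩ := he
  have hcc : ContinuousAt c x := c.continuousAt hx.1
  have h1 : ∀ᶠ x' in 𝓝 x, ∀ i j, ContDiffAt ℂ ω (fun z => A z i j) (c x') := by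
    refine eventually_all.mpr fun i => eventually_all.mpr fun j => ?_
    exact hcc.eventually ((hA i j).eventually (by simp))
  have h2 : ∀ᶠ x' in 𝓝 x, (A (c x')).det ≠ 0 :=
    hcc.eventually ((contDiffAt_det hA).continuousAt.eventually_ne hd)
  obtain ⟨W, hW, hWo, hxW⟩ := eventually_nhds_iff.mp (h1.and h2)
  refine ⟨U ∩ baseDomain n r E x₀ ∩ W, (hU.inter (isOpen_baseDomain x₀)).inter hWo,
    ⟨⟨hxU, hx⟩, hxW⟩, ?_, ?_, ?_⟩
  · rintro x' ⟨⟨h3, _⟩, h4⟩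
    exact linearIndependent_matAct (h.linearIndependent h3) (isUnit_iff_ne_zero.mpr (hW x' h4).2)
  · rintro x' ⟨⟨h3, _⟩, h4⟩
    have h5 := matAct_mul (A (c x'))⁻¹ (A (c x')) fun j => e j x'
    rw [Matrix.nonsing_inv_mul _ (isUnit_iff_ne_zero.mpr (hW x' h4).2), matAct_one] at h5
    refine (h.generating h3).trans (Submodule.span_le.mpr ?_)
    rintro _ ⟨i, rfl⟩
    have h6 : e i x' = _ := congrFun h5 i
    change e i x' ∈ _
    rw [h6]
    exact Submodule.sum_mem _ fun j _ => Submodule.smul_mem _ _ (Submodule.subset_span ⟨j, rfl⟩)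
  · intro i x' hx'
    obtain ⟨⟨h3, h5⟩, h4⟩ := hx'
    refine ContMDiffAt.contMDiffWithinAt ?_
    rw [(trivializationAt (Fin r → ℂ) E x₀).contMDiffAt_section_iff h5.2, contMDiffAt_iff_chart h5.1]
    refine contDiffAt_pi.mpr fun j => ?_
    have he' : IsHolFrameNear n e x' := ⟨U, hU, h3, h⟩
    refine (contDiffAt_matrix_mul (hW x' h4).1 (fun k l => he'.contDiffAt_frameCoords h5 k l)
      i j).congr_of_eventuallyEq ?_
    have h6 : ∀ᶠ z in 𝓝 (c x'), c.symm z ∈ (trivializationAt (Fin r → ℂ) E x₀).baseSet := by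
      refine (c.continuousAt_symm (c.map_source h5.1)).eventually ?_
      rw [c.left_inv h5.1]
      exact (trivializationAt (Fin r → ℂ) E x₀).open_baseSet.eventually_mem h5.2
    filter_upwards [h6, c.open_target.mem_nhds (c.map_source h5.1)] with z hz hz'
    have h7 := frameCoords_matAct hz (fun x' => A (c x')) e
    have h8 := congrFun (congrFun h7 i) j
    simp only [c.right_inv hz'] at h8
    rw [← h8]
    rfl

theorem isHolFrameNear_stdFrame {x x₀ : X} (hx : x ∈ (trivializationAt (Fin r → ℂ) E x₀).baseSet)
    (b : Basis (Fin r) ℂ (Fin r → ℂ)) : IsHolFrameNear n (stdFrame E x₀ b) x :=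
  ⟨_, (trivializationAt (Fin r → ℂ) E x₀).open_baseSet, hx,
    (trivializationAt (Fin r → ℂ) E x₀).isLocalFrameOn_localFrame_baseSet _ _ b⟩

end HolFrames

/-! ### Calculus in the charts of the flag bundle -/

section ChartCalculus
variable {M : Type*} [NormedAddCommGroup M] [NormedSpace ℂ M]
  {Y : Type*} [TopologicalSpace Y] [ChartedSpace M Y] [IsManifold 𝓘(ℂ, M) ω Y]
  {F : Type*} [NormedAddCommGroup F] [NormedSpace ℂ F]

theorem mdifferentiableAt_chart_symm {y₀ : Y} {u : M} (hu : u ∈ (chartAt M y₀).target) :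
    MDifferentiableAt 𝓘(ℂ, M) 𝓘(ℂ, M) (chartAt M y₀).symm u :=
  haveI : IsManifold 𝓘(ℂ, M) 1 Y := IsManifold.of_le (n := ω) (by simp)
  (mdifferentiable_chart (I := 𝓘(ℂ, M)) y₀).mdifferentiableAt_symm hu

theorem bijective_mfderiv_chart_symm {y₀ : Y} {u : M} (hu : u ∈ (chartAt M y₀).target) :
    Function.Bijective (mfderiv 𝓘(ℂ, M) 𝓘(ℂ, M) (chartAt M y₀).symm u) :=
  haveI : IsManifold 𝓘(ℂ, M) 1 Y := IsManifold.of_le (n := ω) (by simp)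
  (mdifferentiable_chart (I := 𝓘(ℂ, M)) y₀).symm.mfderiv_bijective hu

theorem mdifferentiableAt_iff_chart {f : Y → F} {y₀ y : Y} (hy : y ∈ (chartAt M y₀).source) :
    MDifferentiableAt 𝓘(ℂ, M) 𝓘(ℂ, F) f y ↔
      DifferentiableAt ℂ (fun u => f ((chartAt M y₀).symm u)) (chartAt M y₀ y) := by
  have : IsManifold 𝓘(ℂ, M) 1 Y := IsManifold.of_le (n := ω) (by simp)
  set c := chartAt M y₀ with hc
  rw [← mdifferentiableAt_iff_differentiableAt]
  constructor
  · intro h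
    refine MDifferentiableAt.comp (c y) (g := f) ?_ (mdifferentiableAt_chart_symm (c.map_source hy))
    rwa [c.left_inv hy]
  · intro h
    have h1 := (mdifferentiable_chart (I := 𝓘(ℂ, M)) y₀).mdifferentiableAt hy
    refine (MDifferentiableAt.comp y h h1).congr_of_eventuallyEq ?_
    filter_upwards [c.open_source.mem_nhds hy] with x' hx'
    simp [c.left_inv hx']

theorem mdifferentiableAt_of_chart {f : Y → F} {y₀ : Y} {u : M} (hu : u ∈ (chartAt M y₀).target)
    (hf : DifferentiableAt ℂ (fun v => f ((chartAt M y₀).symm v)) u) :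
    MDifferentiableAt 𝓘(ℂ, M) 𝓘(ℂ, F) f ((chartAt M y₀).symm u) := by
  rw [mdifferentiableAt_iff_chart ((chartAt M y₀).map_target hu), (chartAt M y₀).right_inv hu]
  exact hf

theorem mfderiv_comp_chart_symm {f : Y → F} {y₀ : Y} {u : M} (hu : u ∈ (chartAt M y₀).target)
    (hf : DifferentiableAt ℂ (fun v => f ((chartAt M y₀).symm v)) u) :
    (mfderiv 𝓘(ℂ, M) 𝓘(ℂ, F) f ((chartAt M y₀).symm u)).comp
      (mfderiv 𝓘(ℂ, M) 𝓘(ℂ, M) (chartAt M y₀).symm u) =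
    fderiv ℂ (fun v => f ((chartAt M y₀).symm v)) u := by
  rw [← mfderiv_eq_fderiv]
  exact (mfderiv_comp u (mdifferentiableAt_of_chart hu hf) (mdifferentiableAt_chart_symm hu)).symm

theorem mfderiv_eq_fderiv_chart {f : Y → F} (y : Y)
    (hf : DifferentiableAt ℂ (fun v => f ((chartAt M y).symm v)) (chartAt M y y)) :
    mfderiv 𝓘(ℂ, M) 𝓘(ℂ, F) f y = fderiv ℂ (fun v => f ((chartAt M y).symm v)) (chartAt M y y) := by
  have h := (mdifferentiableAt_iff_chart (mem_chart_source M y)).mpr hf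
  rw [h.mfderiv]
  simp only [writtenInExtChartAt, Function.comp_def, mfld_simps, fderivWithin_univ]
  rfl

theorem holomorphicNear_iff {f : Y → ℂ} {y₀ : Y} : HolomorphicNear M f y₀ ↔
    ∀ᶠ u in 𝓝 (chartAt M y₀ y₀), DifferentiableAt ℂ (fun v => f ((chartAt M y₀).symm v)) u := by
  set c := chartAt M y₀ with hc
  have hy := mem_chart_source M y₀
  constructor
  · intro h
    have h1 := (c.continuousAt_symm (c.map_source hy)).eventually (p := fun y =>
      MDifferentiableAt 𝓘(ℂ, M) 𝓘(ℂ, ℂ) f y) (by rw [c.left_inv hy]; exact h)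
    filter_upwards [h1, c.open_target.mem_nhds (c.map_source hy)] with u hu hu'
    have h2 := (mdifferentiableAt_iff_chart (y₀ := y₀) (c.map_target hu')).mp hu
    rwa [← hc, c.right_inv hu'] at h2
  · intro h
    filter_upwards [(c.continuousAt hy).eventually h, c.open_source.mem_nhds hy] with y h1 h2
    exact (mdifferentiableAt_iff_chart h2).mpr h1

end ChartCalculus

section FlagCharts
theorem eventually_chart_symm {Z : Type*} [TopologicalSpace Z] {M : Type*} [TopologicalSpace M]
    [ChartedSpace M Z] {x₀ x : Z} (hx : x ∈ (chartAt M x₀).source) {p : Z → Prop}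
    (h : ∀ᶠ x' in 𝓝 x, p x') : ∀ᶠ z in 𝓝 (chartAt M x₀ x), p ((chartAt M x₀).symm z) := by
  refine ((chartAt M x₀).continuousAt_symm ((chartAt M x₀).map_source hx)).eventually ?_
  rwa [(chartAt M x₀).left_inv hx]

/-- The basis of `ℂ^r` that gives the frame used in the preferred chart at `y`. -/
def chartBasis (y : FlagBundle n r E) : Basis (Fin r) ℂ (Fin r → ℂ) := (exists_mem_chartDom y).choose

/-- The frame of `E` used in the preferred chart at `y`. -/
def chartFrame (y : FlagBundle n r E) : Fin r → ∀ x, E x := stdFrame E y.base (chartBasis y)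

/-- The domain of the base coordinates of the preferred chart at `y`. -/
theorem baseDomain_mem_nhds (y : FlagBundle n r E) : baseDomain n r E y.base ∈ 𝓝 y.base :=
  (isOpen_baseDomain y.base).mem_nhds (mem_baseDomain y.base)

variable [IsManifold 𝓘(ℂ, Fin n → ℂ) ω X]
  [ContMDiffVectorBundle ω (Fin r → ℂ) E 𝓘(ℂ, Fin n → ℂ)]

theorem isHolFrameNear_chartFrame {y : FlagBundle n r E} {x : X}
    (hx : x ∈ baseDomain n r E y.base) : IsHolFrameNear n (chartFrame y) x :=
  isHolFrameNear_stdFrame hx.2 _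

theorem mem_chart_target_iff {y₀ : FlagBundle n r E} {u : FlagModel n r} :
    u ∈ (flagChart y₀).target ↔ u.1 ∈ (baseChart y₀.base).target ∧
      (baseChart y₀.base).symm u.1 ∈ (trivializationAt (Fin r → ℂ) E y₀.base).baseSet :=
  Iff.rfl

theorem chart_symm_base {y₀ : FlagBundle n r E} {u : FlagModel n r}
    (hu : u ∈ (flagChart y₀).target) :
    ((flagChart y₀).symm u).base = (baseChart y₀.base).symm u.1 := by
  have h1 : (flagChart y₀).symm u ∈ chartDom y₀.base (chartBasis y₀) :=
    (flagChart y₀).map_target hu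
  have h2 : baseChart y₀.base ((flagChart y₀).symm u).base = u.1 :=
    congrArg Prod.fst ((flagChart y₀).right_inv hu)
  rw [← h2, (baseChart y₀.base).left_inv h1.1.1]

theorem chart_symm_mem {y₀ : FlagBundle n r E} {u : FlagModel n r}
    (hu : u ∈ (flagChart y₀).target) :
    ((flagChart y₀).symm u).base ∈ baseDomain n r E y₀.base := by
  have h1 : (flagChart y₀).symm u ∈ chartDom y₀.base (chartBasis y₀) :=
    (flagChart y₀).map_target hu
  exact h1.1

theorem chart_symm_adapted {y₀ : FlagBundle n r E} {u : FlagModel n r}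
    (hu : u ∈ (flagChart y₀).target) :
    Adapted (tildeFrame (fun i => chartFrame y₀ i ((flagChart y₀).symm u).base) u.2)
      ((flagChart y₀).symm u).flag := by
  have h1 : (flagChart y₀).symm u ∈ chartDom y₀.base (chartBasis y₀) :=
    (flagChart y₀).map_target hu
  have h2 : chartFun y₀.base (chartBasis y₀) ((flagChart y₀).symm u) = u :=
    (flagChart y₀).right_inv hu
  have h4 := adapted_chartFun h1
  rwa [h2] at h4

theorem chart_apply_self (y₀ : FlagBundle n r E) :
    flagChart y₀ y₀ = (baseChart y₀.base y₀.base, 0) := by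
  have h : (chartFun y₀.base (chartBasis y₀) y₀).2 = 0 := (exists_mem_chartDom y₀).choose_spec.2
  exact Prod.ext rfl h

theorem chart_self_mem_target (y₀ : FlagBundle n r E) :
    flagChart y₀ y₀ ∈ (flagChart y₀).target :=
  (flagChart y₀).map_source (mem_chart_source _ _)

theorem adapted_chartFrame (y₀ : FlagBundle n r E) :
    Adapted (fun i => chartFrame y₀ i y₀.base) y₀.flag := by
  have h : y₀ ∈ chartDom y₀.base (chartBasis y₀) ∧ (chartFun y₀.base (chartBasis y₀) y₀).2 = 0 :=
    (exists_mem_chartDom y₀).choose_spec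
  have h1 := adapted_chartFun h.1
  rwa [h.2, tildeFrame_zero] at h1

theorem mdifferentiableAt_base_chart {y₀ : FlagBundle n r E} {u : FlagModel n r}
    (hu : u ∈ (flagChart y₀).target) :
    MDifferentiableAt 𝓘(ℂ, FlagModel n r) 𝓘(ℂ, Fin n → ℂ) (FlagBundle.base (n := n) (E := E))
      ((flagChart y₀).symm u) := by
  have : IsManifold 𝓘(ℂ, FlagModel n r) 1 (FlagBundle n r E) := IsManifold.of_le (n := ω) (by simp)
  set φ := flagChart y₀ with hφ
  have h1 := (mdifferentiable_chart (I := 𝓘(ℂ, FlagModel n r)) y₀).mdifferentiableAt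
    (φ.map_target hu)
  have h2 : MDifferentiableAt 𝓘(ℂ, FlagModel n r) 𝓘(ℂ, Fin n → ℂ)
      (fun v : FlagModel n r => (baseChart y₀.base).symm v.1) (φ (φ.symm u)) := by
    rw [φ.right_inv hu]
    exact MDifferentiableAt.comp u (g := (baseChart y₀.base).symm)
      (mdifferentiableAt_chart_symm (mem_chart_target_iff.mp hu).1)
      (mdifferentiableAt_iff_differentiableAt.mpr differentiableAt_fst)
  refine (h2.comp _ h1).congr_of_eventuallyEq ?_
  filter_upwards [φ.open_source.mem_nhds (φ.map_target hu)] with y hy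
  have h3 := chart_symm_base (φ.map_source hy)
  rwa [φ.left_inv hy] at h3

theorem mdifferentiableAt_base (y : FlagBundle n r E) :
    MDifferentiableAt 𝓘(ℂ, FlagModel n r) 𝓘(ℂ, Fin n → ℂ) (FlagBundle.base (n := n) (E := E)) y := by
  have h := mdifferentiableAt_base_chart (chart_self_mem_target y)
  rwa [(flagChart y).left_inv (mem_chart_source _ _)] at h

theorem mfderiv_fst_comp_chart_symm {y₀ : FlagBundle n r E} {u : FlagModel n r}
    (hu : u ∈ (flagChart y₀).target) (v : FlagModel n r) :
    projDeriv ((flagChart y₀).symm u)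
      (mfderiv 𝓘(ℂ, FlagModel n r) 𝓘(ℂ, FlagModel n r) (flagChart y₀).symm u v) =
    mfderiv 𝓘(ℂ, FlagModel n r) 𝓘(ℂ, Fin n → ℂ)
      (fun v : FlagModel n r => ((flagChart y₀).symm v).base) u v :=
  (mfderiv_comp_apply u (mdifferentiableAt_base_chart hu) (mdifferentiableAt_chart_symm hu) v).symm

/-- The vertical tangent vectors are those with vanishing base component in the preferred chart at a
nearby point. -/
theorem chart_mem_verticalSpace_iff {y₀ : FlagBundle n r E} {u : FlagModel n r}
    (hu : u ∈ (flagChart y₀).target) (v : FlagModel n r) :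
    mfderiv 𝓘(ℂ, FlagModel n r) 𝓘(ℂ, FlagModel n r) (flagChart y₀).symm u v ∈
      verticalSpace ((flagChart y₀).symm u) ↔ v.1 = 0 := by
  have h1 : mfderiv 𝓘(ℂ, FlagModel n r) 𝓘(ℂ, Fin n → ℂ)
      (fun v : FlagModel n r => ((flagChart y₀).symm v).base) u v = 0 ↔ v.1 = 0 := by
    have h2 : (fun v : FlagModel n r => ((flagChart y₀).symm v).base) =ᶠ[𝓝 u]
        fun v => (baseChart y₀.base).symm v.1 := by
      filter_upwards [(flagChart y₀).open_target.mem_nhds hu] with w hw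
      exact chart_symm_base hw
    rw [h2.mfderiv_eq]
    have h3 := mfderiv_comp_apply u (g := (baseChart y₀.base).symm)
      (mdifferentiableAt_chart_symm (mem_chart_target_iff.mp hu).1)
      (mdifferentiableAt_iff_differentiableAt.mpr
        (differentiableAt_fst (𝕜 := ℂ) (E := Fin n → ℂ) (F := PairIdx r → ℂ))) v
    have h4 : mfderiv 𝓘(ℂ, FlagModel n r) 𝓘(ℂ, Fin n → ℂ) (Prod.fst : FlagModel n r → _) u v = v.1 := by
      rw [mfderiv_eq_fderiv, fderiv_fst]; rfl
    rw [h4] at h3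
    refine Iff.trans (Eq.congr_left h3) ?_
    constructor
    · intro h0
      exact (bijective_mfderiv_chart_symm (mem_chart_target_iff.mp hu).1).1 (h0.trans (map_zero _).symm)
    · intro h0
      exact (congrArg _ h0).trans (map_zero _)
  rw [← h1, ← mfderiv_fst_comp_chart_symm hu]
  rfl

theorem projDeriv_apply (y : FlagBundle n r E) (v : FlagModel n r) : projDeriv y v = v.1 := by
  have h : projDeriv y = _ := (mdifferentiableAt_base y).mfderiv
  rw [h]
  have h2 : writtenInExtChartAt 𝓘(ℂ, FlagModel n r) 𝓘(ℂ, Fin n → ℂ) y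
      (FlagBundle.base (n := n) (E := E)) =ᶠ[𝓝 (flagChart y y)] Prod.fst := by
    filter_upwards [(flagChart y).open_target.mem_nhds (chart_self_mem_target y)]
      with u hu
    simp only [writtenInExtChartAt, Function.comp_def, mfld_simps]
    rw [chart_symm_base hu, (baseChart y.base).right_inv (mem_chart_target_iff.mp hu).1]
  simp only [mfld_simps, fderivWithin_univ]
  have h3 := h2.fderiv_eq (𝕜 := ℂ)
  rw [fderiv_fst] at h3
  exact DFunLike.congr_fun h3 v

/-- The family of coordinates of the flags near `y₀` in a frame with given coordinates. -/
theorem flagCoord_eq_blockCoord {x₀ : X} {y : FlagBundle n r E}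
    (hy : y.base ∈ (trivializationAt (Fin r → ℂ) E x₀).baseSet) {e g : Fin r → ∀ x, E x}
    (he : IsHolFrameNear n e y.base) (hg : IsHolFrameNear n g y.base) {ξ : PairIdx r → ℂ}
    (had : Adapted (tildeFrame (fun i => g i y.base) ξ) y.flag)
    (hk : ∀ k, (leadBlock (unipotent ξ *
      (frameCoords x₀ g y.base * (frameCoords x₀ e y.base)⁻¹)) k).det ≠ 0) :
    flagCoord (fun i => e i y.base) y.flag =
      blockCoord (unipotent ξ * (frameCoords x₀ g y.base * (frameCoords x₀ e y.base)⁻¹)) ∧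
    Adapted (tildeFrame (fun i => e i y.base) (flagCoord (fun i => e i y.base) y.flag)) y.flag := by
  obtain ⟨B, hB⟩ := he.exists_basis
  have hde := he.isUnit_det hy
  have hdg := hg.isUnit_det hy
  have h1 : (fun i => g i y.base) =
      matAct (frameCoords x₀ g y.base * (frameCoords x₀ e y.base)⁻¹) fun i => e i y.base := by
    rw [matAct_frameCoords hy g, matAct_frameCoords hy e, ← matAct_mul, Matrix.mul_assoc,
      Matrix.nonsing_inv_mul _ hde, Matrix.mul_one]
  rw [tildeFrame_eq_matAct, h1, ← matAct_mul] at had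
  rw [← hB] at had ⊢
  refine had.flagCoord_eq_blockCoord B ?_ hk
  rw [Matrix.det_mul, Matrix.det_mul, det_unipotent, one_mul]
  exact hdg.mul (Matrix.isUnit_nonsing_inv_det _ hde)

end FlagCharts

/-! ### Derivatives of matrix-valued functions -/

section MatrixDerivative
variable {𝕜 : Type*} [NontriviallyNormedField 𝕜] [NormedAlgebra 𝕜 ℂ]
  {G : Type*} [NormedAddCommGroup G] [NormedSpace 𝕜 G]
  {ι : Type*} [Fintype ι] [DecidableEq ι]

variable (𝕜) in
/-- The derivative at `x` along `v` of a matrix-valued function, taken entry by entry. -/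
def dMat (A : G → Matrix ι ι ℂ) (x v : G) : Matrix ι ι ℂ := fun i j => fderiv 𝕜 (fun u => A u i j) x v

theorem dMat_congr {A B : G → Matrix ι ι ℂ} {x : G} (h : A =ᶠ[𝓝 x] B) (v : G) :
    dMat 𝕜 A x v = dMat 𝕜 B x v := by
  ext i j
  have h1 : (fun u => A u i j) =ᶠ[𝓝 x] fun u => B u i j := h.mono fun u hu => by simp only [hu]
  rw [dMat, dMat, h1.fderiv_eq]

theorem dMat_const (A : Matrix ι ι ℂ) (x v : G) : dMat 𝕜 (fun _ => A) x v = 0 := by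
  ext i j
  simp [dMat]

theorem dMat_mul {A B : G → Matrix ι ι ℂ} {x : G}
    (hA : ∀ i j, DifferentiableAt 𝕜 (fun u => A u i j) x)
    (hB : ∀ i j, DifferentiableAt 𝕜 (fun u => B u i j) x) (v : G) :
    dMat 𝕜 (fun u => A u * B u) x v = dMat 𝕜 A x v * B x + A x * dMat 𝕜 B x v := by
  ext i j
  have h := HasFDerivAt.fun_sum (u := Finset.univ) fun k _ =>
    ((hA i k).hasFDerivAt).mul ((hB k j).hasFDerivAt)
  have h1 : dMat 𝕜 (fun u => A u * B u) x v i j = _ := congrArg (fun D => D v)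
    (h.congr_of_eventuallyEq (f₁ := fun u => (A u * B u) i j)
      (Eventually.of_forall fun u => Matrix.mul_apply)).fderiv
  rw [h1]
  simp only [sum_apply, add_apply, smul_apply, smul_eq_mul,
    Finset.sum_add_distrib, Matrix.add_apply, Matrix.mul_apply]
  rw [add_comm]
  congr 1
  exact Finset.sum_congr rfl fun k _ => mul_comm _ _

theorem differentiableAt_matrix_inv {A : G → Matrix ι ι ℂ} {x : G}
    (hA : ∀ i j, ContDiffAt 𝕜 1 (fun u => A u i j) x) (hd : (A x).det ≠ 0) (i j : ι) :
    DifferentiableAt 𝕜 (fun u => (A u)⁻¹ i j) x :=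
  (contDiffAt_matrix_inv hA hd i j).differentiableAt (by simp)

theorem dMat_inv {A : G → Matrix ι ι ℂ} {x : G}
    (hA : ∀ i j, ContDiffAt 𝕜 1 (fun u => A u i j) x) (hd : (A x).det ≠ 0) (v : G) :
    dMat 𝕜 (fun u => (A u)⁻¹) x v = -((A x)⁻¹ * dMat 𝕜 A x v * (A x)⁻¹) := by
  have h1 := dMat_mul (fun i j => (hA i j).differentiableAt (by simp))
    (differentiableAt_matrix_inv hA hd) v
  have h2 : (fun u => A u * (A u)⁻¹) =ᶠ[𝓝 x] fun _ => 1 := by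
    filter_upwards [(contDiffAt_det hA).continuousAt.eventually_ne hd] with u hu
    exact Matrix.mul_nonsing_inv _ (isUnit_iff_ne_zero.mpr hu)
  rw [dMat_congr h2, dMat_const] at h1
  have h3 : A x * dMat 𝕜 (fun u => (A u)⁻¹) x v = -(dMat 𝕜 A x v * (A x)⁻¹) :=
    eq_neg_of_add_eq_zero_right h1.symm
  have h4 : (A x)⁻¹ * (A x * dMat 𝕜 (fun u => (A u)⁻¹) x v) = _ := congrArg ((A x)⁻¹ * ·) h3
  rw [← Matrix.mul_assoc, Matrix.nonsing_inv_mul _ (isUnit_iff_ne_zero.mpr hd), Matrix.one_mul] at h4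
  rw [h4, Matrix.mul_neg, Matrix.mul_assoc]

theorem dMat_smul_right (A : G → Matrix ι ι ℂ) (x v : G) (c : 𝕜) :
    dMat 𝕜 A x (c • v) = c • dMat 𝕜 A x v := by
  ext i j
  simp [dMat]

theorem dMat_unipotent {r : ℕ} {ψ : G → PairIdx r → ℂ} {x : G} (hψ : DifferentiableAt 𝕜 ψ x) (v : G) :
    dMat 𝕜 (fun u => unipotent (ψ u)) x v = strictUpper (fderiv 𝕜 ψ x v) := by
  ext i j
  simp only [dMat, unipotent_apply, strictUpper]
  by_cases hij : i = j
  · subst hij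
    simp
  · by_cases hlt : i < j
    · simp only [hij, hlt, dif_pos, if_false]
      have h := (hasFDerivAt_pi'.mp hψ.hasFDerivAt ⟨(i, j), hlt⟩).fderiv
      exact congrArg (fun D => D v) h
    · simp [hij, hlt]

theorem differentiableAt_unipotent {r : ℕ} {ψ : G → PairIdx r → ℂ} {x : G}
    (hψ : DifferentiableAt 𝕜 ψ x) (i j : Fin r) :
    DifferentiableAt 𝕜 (fun u => unipotent (ψ u) i j) x := by
  simp only [unipotent_apply]
  split_ifs with h1 h2
  · exact differentiableAt_const _
  · exact differentiableAt_pi.mp hψ _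
  · exact differentiableAt_const _

theorem contDiffAt_unipotent {r : ℕ} {ψ : G → PairIdx r → ℂ} {x : G} {m : ℕ∞ω}
    (hψ : ContDiffAt 𝕜 m ψ x) (i j : Fin r) :
    ContDiffAt 𝕜 m (fun u => unipotent (ψ u) i j) x := by
  simp only [unipotent_apply]
  split_ifs with h1 h2
  · exact contDiffAt_const
  · exact contDiffAt_pi.mp hψ _
  · exact contDiffAt_const

end MatrixDerivative

section HermitianDerivative
variable {G : Type*} [NormedAddCommGroup G] [NormedSpace ℂ G]
  {ι : Type*} [Fintype ι] [DecidableEq ι]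

theorem dMat_conjTranspose (A : G → Matrix ι ι ℂ) (x v : G) :
    dMat ℝ (fun u => (A u)ᴴ) x v = (dMat ℝ A x v)ᴴ := by
  ext i j
  have h := (Complex.conjCLE : ℂ ≃L[ℝ] ℂ).comp_fderiv (f := fun u => A u j i) (x := x)
  exact congrArg (fun D => D v) h

theorem dMat_restrictScalars {A : G → Matrix ι ι ℂ} {x : G}
    (hA : ∀ i j, DifferentiableAt ℂ (fun u => A u i j) x) (v : G) :
    dMat ℝ A x v = dMat ℂ A x v := by
  ext i j
  rw [dMat, dMat, (hA i j).fderiv_restrictScalars ℝ]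
  rfl

/-- The matrix of the Chern connection along `v`, in a frame with Gram matrix `H`. -/
def connMat (H : G → Matrix ι ι ℂ) (x v : G) : Matrix ι ι ℂ :=
  ((1 / 2 : ℂ) • (dMat ℝ H x v - Complex.I • dMat ℝ H x (Complex.I • v))) * (H x)⁻¹

theorem connectionMatrix_apply {r : ℕ} {H : G → Matrix (Fin r) (Fin r) ℂ} {x : G}
    (hH : ∀ i j, DifferentiableAt ℝ (fun u => H u i j) x) (i j : Fin r) (v : G) :
    connectionMatrix H i j x ![v] = connMat H x v i j := by
  simp only [connectionMatrix, connMat, Matrix.mul_apply, ContinuousAlternatingMap.sum_apply,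
    ContinuousAlternatingMap.smul_apply, smul_eq_mul]
  refine Finset.sum_congr rfl fun k _ => ?_
  have h := del_constOfIsEmpty (fun w => H w i k) x v (hH i k)
  rw [linPart_apply] at h
  rw [h, mul_comm]
  rfl

theorem connectionMatrix_eq_zero_iff {r : ℕ} {H : G → Matrix (Fin r) (Fin r) ℂ} {x : G}
    (hH : ∀ i j, DifferentiableAt ℝ (fun u => H u i j) x) :
    (∀ i j, connectionMatrix H i j x = 0) ↔ ∀ v, connMat H x v = 0 := by
  constructor
  · intro h v
    ext i j
    rw [← connectionMatrix_apply hH, h]; rfl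
  · intro h i j
    ext v
    have : v = ![v 0] := by ext k; fin_cases k; rfl
    rw [this, connectionMatrix_apply hH, h]; rfl

/-- The connection matrix after the holomorphic change of frame `Q`. -/
theorem connMat_conj {Q H : G → Matrix ι ι ℂ} {x : G}
    (hQ : ∀ i j, DifferentiableAt ℂ (fun u => Q u i j) x)
    (hH : ∀ i j, DifferentiableAt ℝ (fun u => H u i j) x) (hQd : IsUnit (Q x).det) (v : G) :
    connMat (fun u => Q u * H u * (Q u)ᴴ) x v =
      dMat ℂ Q x v * H x * (H x)⁻¹ * (Q x)⁻¹ + Q x * connMat H x v * (Q x)⁻¹ := by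
  have hQ' : ∀ i j, DifferentiableAt ℝ (fun u => Q u i j) x := fun i j => (hQ i j).restrictScalars ℝ
  have hQs : ∀ i j, DifferentiableAt ℝ (fun u => (Q u)ᴴ i j) x := fun i j =>
    (Complex.conjCLE : ℂ ≃L[ℝ] ℂ).differentiableAt.comp x (hQ' j i)
  have hQH : ∀ i j, DifferentiableAt ℝ (fun u => (Q u * H u) i j) x := fun i j => by
    simp only [Matrix.mul_apply]
    exact DifferentiableAt.fun_sum fun k _ => (hQ' i k).mul (hH k j)
  have hd : ∀ w, dMat ℝ (fun u => Q u * H u * (Q u)ᴴ) x w =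
      (dMat ℂ Q x w * H x + Q x * dMat ℝ H x w) * (Q x)ᴴ +
        Q x * H x * (dMat ℂ Q x w)ᴴ := fun w => by
    rw [dMat_mul hQH hQs, dMat_mul hQ' hH, dMat_conjTranspose, dMat_restrictScalars hQ]
  have hu3 : IsUnit (Q x)ᴴ.det := by
    rw [Matrix.det_conjTranspose]; exact hQd.star
  have h1 : (1 / 2 : ℂ) • (dMat ℝ (fun u => Q u * H u * (Q u)ᴴ) x v -
      Complex.I • dMat ℝ (fun u => Q u * H u * (Q u)ᴴ) x (Complex.I • v)) =
      (dMat ℂ Q x v * H x + Q x * ((1 / 2 : ℂ) • (dMat ℝ H x v -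
        Complex.I • dMat ℝ H x (Complex.I • v)))) * (Q x)ᴴ := by
    -- the antiholomorphic factor `Qᴴ` does not contribute to the complex linear part
    rw [hd, hd, dMat_smul_right]
    simp only [Matrix.conjTranspose_smul, Matrix.mul_smul, Matrix.smul_mul, Matrix.add_mul,
      Matrix.mul_sub, Matrix.sub_mul, smul_add, smul_sub, smul_smul,
      Complex.star_def, Complex.conj_I]
    simp only [show (1 / 2 * (Complex.I * Complex.I) : ℂ) = -(1 / 2) by rw [Complex.I_mul_I]; ring,
      show (1 / 2 * (Complex.I * -Complex.I) : ℂ) = 1 / 2 by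
        rw [mul_neg, Complex.I_mul_I]; ring]
    module
  rw [connMat, connMat, h1, Matrix.mul_inv_rev, Matrix.mul_inv_rev, ← Matrix.mul_assoc,
    Matrix.mul_assoc _ (Q x)ᴴ, Matrix.mul_nonsing_inv _ hu3, Matrix.mul_one]
  simp only [Matrix.add_mul, Matrix.mul_assoc]

/-- If `Q` changes a frame with Gram matrix `H` into one that is parallel at `x`, then
`dQ = -Q A` at `x`, where `A` is the connection matrix of the first frame. -/
theorem dMat_of_parallel {Q H : G → Matrix ι ι ℂ} {x : G}
    (hQ : ∀ i j, DifferentiableAt ℂ (fun u => Q u i j) x)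
    (hH : ∀ i j, DifferentiableAt ℝ (fun u => H u i j) x) (hQd : IsUnit (Q x).det)
    (hHd : IsUnit (H x).det) {v : G}
    (hp : connMat (fun u => Q u * H u * (Q u)ᴴ) x v = 0) :
    dMat ℂ Q x v = -(Q x * connMat H x v) := by
  rw [connMat_conj hQ hH hQd, Matrix.mul_assoc (dMat ℂ Q x v), Matrix.mul_nonsing_inv _ hHd,
    Matrix.mul_one, ← Matrix.add_mul] at hp
  have h5 : (dMat ℂ Q x v + Q x * connMat H x v) * (Q x)⁻¹ * Q x = _ := congrArg (· * Q x) hp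
  rw [Matrix.mul_assoc, Matrix.nonsing_inv_mul _ hQd, Matrix.mul_one, Matrix.zero_mul] at h5
  exact eq_neg_of_add_eq_zero_left h5

end HermitianDerivative

/-! ### Gram matrices -/

section GramAlgebra
open scoped ComplexOrder in
/-- A positive definite matrix becomes the identity under a lower triangular change of basis. -/
theorem exists_lowerTri_conj_eq_one {S : Matrix (Fin r) (Fin r) ℂ} (hS : S.PosDef) :
    ∃ L, LowerTri L ∧ IsUnit L.det ∧ L * S * Lᴴ = 1 := by
  set K := LDL.lowerInv hS with hK
  have hKl : LowerTri K := lowerTri_of fun i j hij => LDL.lowerInv_triangular hS hij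
  have hKu : IsUnit K.det := Matrix.isUnit_det_of_invertible K
  have hD : (LDL.diag hS).PosDef := by
    rw [LDL.diag_eq_lowerInv_conj]
    refine hS.mul_mul_conjTranspose_same (Function.LeftInverse.injective
      (g := fun x => Matrix.vecMul x K⁻¹) fun x => ?_)
    simp only [Matrix.vecMul_vecMul]
    rw [Matrix.mul_nonsing_inv K hKu, Matrix.vecMul_one]
  have hd : ∀ i, 0 < LDL.diagEntries hS i := fun i => by
    have h := hD.diag_pos (i := i)
    rwa [LDL.diag, Matrix.diagonal_apply_eq] at h
  have hd' : ∀ i, ∃ t : ℝ, 0 < t ∧ LDL.diagEntries hS i = t := fun i =>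
    ⟨_, (Complex.pos_iff.mp (hd i)).1, Complex.ext rfl (Complex.pos_iff.mp (hd i)).2.symm⟩
  choose t ht0 ht using hd'
  let s : Fin r → ℂ := fun i => ((Real.sqrt (t i))⁻¹ : ℝ)
  have hs : ∀ i, s i * LDL.diagEntries hS i * star (s i) = 1 := fun i => by
    have h1 : star (s i) = s i := Complex.conj_ofReal _
    rw [h1, ht]
    simp only [s]
    rw [← Complex.ofReal_mul, ← Complex.ofReal_mul, ← Complex.ofReal_one]
    congr 1
    have h2 := Real.mul_self_sqrt (ht0 i).le
    have h3 := (Real.sqrt_pos.mpr (ht0 i)).ne'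
    field_simp
    nlinarith
  have hsl : LowerTri (Matrix.diagonal s) :=
    lowerTri_of fun i j hij => Matrix.diagonal_apply_ne _ hij.ne
  have hsu : IsUnit (Matrix.diagonal s).det := by
    rw [Matrix.det_diagonal, isUnit_iff_ne_zero, Finset.prod_ne_zero_iff]
    intro i _ h0
    have := hs i
    rw [h0] at this
    simp at this
  refine ⟨Matrix.diagonal s * K, hsl.mul hKl, ?_, ?_⟩
  · rw [Matrix.det_mul]; exact hsu.mul hKu
  · have h1 : Matrix.diagonal s * K * S * (Matrix.diagonal s * K)ᴴ =
        Matrix.diagonal s * LDL.diag hS * (Matrix.diagonal s)ᴴ := by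
      rw [LDL.diag_eq_lowerInv_conj, Matrix.conjTranspose_mul]
      simp only [Matrix.mul_assoc]
      rfl
    rw [h1, LDL.diag, Matrix.diagonal_conjTranspose, Matrix.diagonal_mul_diagonal,
      Matrix.diagonal_mul_diagonal, ← Matrix.diagonal_one]
    congr 1
    ext i
    exact hs i

end GramAlgebra

section Gram
variable (h : HermitianMetric n r E)

/-- The Gram matrix of a family of vectors of a fibre. -/
def gramMat (x : X) (w : Fin r → E x) : Matrix (Fin r) (Fin r) ℂ := fun i j => h.inner x (w i) (w j)

theorem gramMat_matAct (x : X) (A : Matrix (Fin r) (Fin r) ℂ) (w : Fin r → E x) :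
    gramMat h x (matAct A w) = A * gramMat h x w * Aᴴ := by
  ext i j
  simp only [gramMat, matAct, Matrix.mul_apply, map_sum, LinearMap.sum_apply, map_smul,
    LinearMap.map_smulₛₗ, LinearMap.smul_apply, smul_eq_mul, Matrix.conjTranspose_apply,
    Finset.sum_mul, Finset.mul_sum, Complex.star_def]
  refine Finset.sum_congr rfl fun k _ => Finset.sum_congr rfl fun l _ => by ring

theorem conjTranspose_gramMat (x : X) (w : Fin r → E x) :
    (gramMat h x w)ᴴ = gramMat h x w := by
  ext i j
  exact h.conj_symm x _ _

open scoped ComplexOrder in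
theorem posDef_gramMat {x : X} {w : Fin r → E x} (hw : LinearIndependent ℂ w) :
    (gramMat h x w).PosDef := by
  refine Matrix.PosDef.of_dotProduct_mulVec_pos (conjTranspose_gramMat h x w) fun c hc => ?_
  set v := ∑ i, star (c i) • w i with hv
  have hne : v ≠ 0 := fun h0 => by
    refine hc (funext fun i => ?_)
    have := Fintype.linearIndependent_iff.mp hw _ h0 i
    simpa using this
  have h1 : star c ⬝ᵥ (gramMat h x w).mulVec c = h.inner x v v := by
    simp only [hv, dotProduct, Matrix.mulVec, gramMat, map_sum, LinearMap.sum_apply, map_smul,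
      LinearMap.map_smulₛₗ, LinearMap.smul_apply, smul_eq_mul, Pi.star_apply, Finset.mul_sum,
      Complex.star_def, Complex.conj_conj]
    rw [Finset.sum_comm]
    refine Finset.sum_congr rfl fun k _ => Finset.sum_congr rfl fun l _ => by ring
  rw [h1, Complex.pos_iff]
  refine ⟨h.pos x v hne, ?_⟩
  have h2 := congrArg Complex.im (h.conj_symm x v v)
  rw [Complex.conj_im] at h2
  linarith

theorem isUnit_det_gramMat {x : X} {w : Fin r → E x} (hw : LinearIndependent ℂ w) :
    IsUnit (gramMat h x w).det := by
  obtain ⟨L, _, _, h1⟩ := exists_lowerTri_conj_eq_one (posDef_gramMat h hw)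
  have h2 := congrArg Matrix.det h1
  rw [Matrix.det_mul, Matrix.det_mul, Matrix.det_one] at h2
  exact isUnit_iff_ne_zero.mpr (right_ne_zero_of_mul (left_ne_zero_of_mul_eq_one h2))

variable [IsManifold 𝓘(ℂ, Fin n → ℂ) ω X]
  [ContMDiffVectorBundle ω (Fin r → ℂ) E 𝓘(ℂ, Fin n → ℂ)]

theorem contDiffAt_chart_trans {x x₀ x₁ : X} (hx : x ∈ (baseChart x₀).source)
    (hx₁ : x ∈ (baseChart x₁).source) :
    ContDiffAt ℂ ω (fun z => baseChart x₁ ((baseChart x₀).symm z))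
      (baseChart x₀ x) :=
  (contMDiffAt_iff_chart hx).mp ((contMDiffOn_chart (I := 𝓘(ℂ, Fin n → ℂ)) (n := ω)
    (x := x₁)).contMDiffAt ((baseChart x₁).open_source.mem_nhds hx₁))

theorem contDiffAt_gramMat {e : Fin r → ∀ x, E x} {x x₀ : X} (he : IsHolFrameNear n e x)
    (hx : x ∈ baseDomain n r E x₀) (i j : Fin r) :
    ContDiffAt ℝ ∞ (fun z => gramMat h ((baseChart x₀).symm z) (fun k => e k _) i j)
      (baseChart x₀ x) := by
  set c := baseChart x₀ with hc
  set c₁ := baseChart x with hc₁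
  have hS : ∀ i j, ContDiffAt ℝ ∞ (fun z => gramMat h (c.symm z) (fun k => refFrame E x₀ k _) i j)
      (c x) := fun i j => by
    have h1 : ContMDiffAt 𝓘(ℝ, Fin n → ℂ) 𝓘(ℝ, ℂ) ∞ (fun x => gramMat h x
        (fun k => refFrame E x₀ k x) i j) x :=
      (h.smooth x₀ i j x hx.2).contMDiffAt
        ((trivializationAt (Fin r → ℂ) E x₀).open_baseSet.mem_nhds hx.2)
    have h2 : ContDiffAt ℝ ∞ (fun z => gramMat h (c₁.symm z)
        (fun k => refFrame E x₀ k (c₁.symm z)) i j) (c₁ x) := by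
      have := contMDiffAt_iff.mp h1
      have h3 := this.2
      simp only [mfld_simps, contDiffWithinAt_univ] at h3
      exact h3
    have h4 := ((contDiffAt_chart_trans (n := n) hx.1 (mem_chart_source _ x)).restrict_scalars ℝ).of_le
      (m := ∞) (by simp)
    have h5 : ContDiffAt ℝ ∞ (fun z => gramMat h (c₁.symm (c₁ (c.symm z)))
        (fun k => refFrame E x₀ k (c₁.symm (c₁ (c.symm z)))) i j) (c x) := by
      refine ContDiffAt.comp (c x) (g := fun z => gramMat h (c₁.symm z)
        (fun k => refFrame E x₀ k (c₁.symm z)) i j) ?_ h4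
      rw [c.left_inv hx.1]
      exact h2
    refine h5.congr_of_eventuallyEq ?_
    filter_upwards [eventually_chart_symm hx.1 (c₁.open_source.eventually_mem (mem_chart_source _ x))]
      with z hz
    rw [c₁.left_inv hz]
  have hK : ∀ i j, ContDiffAt ℝ ∞ (fun z => frameCoords x₀ e (c.symm z) i j) (c x) := fun i j =>
    ((he.contDiffAt_frameCoords hx i j).restrict_scalars ℝ).of_le (by simp)
  have hKs : ∀ i j, ContDiffAt ℝ ∞ (fun z => (frameCoords x₀ e (c.symm z))ᴴ i j) (c x) :=
    fun i j => (Complex.conjCLE : ℂ ≃L[ℝ] ℂ).contDiff.contDiffAt.comp _ (hK j i)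
  refine (contDiffAt_matrix_mul (contDiffAt_matrix_mul hK hS) hKs i j).congr_of_eventuallyEq ?_
  filter_upwards [eventually_chart_symm hx.1
    ((trivializationAt (Fin r → ℂ) E x₀).open_baseSet.eventually_mem hx.2)] with z hz
  rw [matAct_frameCoords hz e, gramMat_matAct]

end Gram

/-! ### The curvature in a frame that is parallel at a point -/

section Curvature
variable {G : Type*} [NormedAddCommGroup G] [NormedSpace ℂ G]
  {ι : Type*} [Fintype ι] [DecidableEq ι]

/-- The conjugate linear part of the derivative of a matrix-valued function. -/
def dbarMat (B : G → Matrix ι ι ℂ) (x u : G) : Matrix ι ι ℂ :=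
  (1 / 2 : ℂ) • (dMat ℝ B x u + Complex.I • dMat ℝ B x (Complex.I • u))

theorem dbarMat_congr {A B : G → Matrix ι ι ℂ} {x : G} (h : A =ᶠ[𝓝 x] B) (u : G) :
    dbarMat A x u = dbarMat B x u := by
  rw [dbarMat, dbarMat, dMat_congr h, dMat_congr h]

theorem dbarMat_add {A B : G → Matrix ι ι ℂ} {x : G}
    (hA : ∀ i j, DifferentiableAt ℝ (fun u => A u i j) x)
    (hB : ∀ i j, DifferentiableAt ℝ (fun u => B u i j) x) (u : G) :
    dbarMat (fun z => A z + B z) x u = dbarMat A x u + dbarMat B x u := by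
  have h : ∀ v, dMat ℝ (fun z => A z + B z) x v = dMat ℝ A x v + dMat ℝ B x v := fun v => by
    ext i j
    exact congrArg (fun D => D v) (fderiv_fun_add (hA i j) (hB i j))
  rw [dbarMat, dbarMat, dbarMat, h, h]
  module

theorem dbarMat_mul {A B : G → Matrix ι ι ℂ} {x : G}
    (hA : ∀ i j, DifferentiableAt ℝ (fun u => A u i j) x)
    (hB : ∀ i j, DifferentiableAt ℝ (fun u => B u i j) x) (u : G) :
    dbarMat (fun z => A z * B z) x u = dbarMat A x u * B x + A x * dbarMat B x u := by
  rw [dbarMat, dbarMat, dbarMat, dMat_mul hA hB, dMat_mul hA hB]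
  simp only [Matrix.smul_mul, Matrix.mul_smul, Matrix.add_mul, Matrix.mul_add]
  module

theorem dbarMat_of_holomorphic {A : G → Matrix ι ι ℂ} {x : G}
    (hA : ∀ i j, DifferentiableAt ℂ (fun u => A u i j) x) (u : G) : dbarMat A x u = 0 := by
  rw [dbarMat, dMat_restrictScalars hA, dMat_restrictScalars hA, dMat_smul_right, smul_smul,
    Complex.I_mul_I, neg_one_smul, add_neg_cancel, smul_zero]

theorem delbar_one_apply {α : G → G [⋀^Fin 1]→L[ℝ] ℂ} {x : G} (hα : DifferentiableAt ℝ α x)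
    (u v : G) : delbar α x ![u, v] =
      antilinPart (fderiv ℝ (fun y => α y ![v]) x) u -
        antilinPart (fderiv ℝ (fun y => α y ![u]) x) v := by
  have h : ∀ w : G, fderiv ℝ (fun y => α y ![w]) x =
      ((evalForm ![w]).restrictScalars ℝ).comp (fderiv ℝ α x) := fun w =>
    (((evalForm ![w]).restrictScalars ℝ).hasFDerivAt.comp x hα.hasFDerivAt).fderiv
  have h1 : Fin.removeNth (0 : Fin 2) ![u, v] = ![v] := by ext j; fin_cases j; rfl
  have h2 : Fin.removeNth (1 : Fin 2) ![u, v] = ![u] := by ext j; fin_cases j; rfl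
  rw [delbar, ContinuousAlternatingMap.alternatizeUncurryFin_apply, h, h]
  refine (Fin.sum_univ_two _).trans ?_
  rw [h1, h2]
  have h3 : ∀ (w : Fin 1 → G) β, evalForm w β = β w := fun w β => rfl
  simp [antilinPart_apply, h3, sub_eq_add_neg]
  ring

theorem differentiableAt_map_linPart {F F' : Type*} [NormedAddCommGroup F] [NormedSpace ℂ F]
    [NormedAddCommGroup F'] [NormedSpace ℝ F'] (A : (G →L[ℝ] F) →L[ℝ] F') {α : G → F} {x : G}
    (hα : ContDiffAt ℝ 2 α x) : DifferentiableAt ℝ (fun y => A (linPart (fderiv ℝ α y))) x :=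
  A.differentiableAt.comp x ((linPartL G F).differentiableAt.comp x
    ((hα.fderiv_right (m := 1) (by norm_num)).differentiableAt (by simp)))

theorem differentiableAt_del {k : ℕ} {α : G → G [⋀^Fin k]→L[ℝ] ℂ} {x : G}
    (hα : ContDiffAt ℝ 2 α x) : DifferentiableAt ℝ (del α) x :=
  differentiableAt_map_linPart (ContinuousAlternatingMap.alternatizeUncurryFinCLM ℝ G ℂ) hα

theorem differentiableAt_fderiv_apply {f : G → ℂ} {x : G} (hf : ContDiffAt ℝ 2 f x) (v : G) :
    HasFDerivAt (fun z => fderiv ℝ f z v) ((fderiv ℝ (fderiv ℝ f) x).flip v) x :=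
  (((hf.fderiv_right (m := 1) (by norm_num)).differentiableAt (by simp)).hasFDerivAt.clm_apply
    (hasFDerivAt_const v x)).congr_fderiv (by ext w; simp)

theorem differentiableAt_connMat {H : G → Matrix ι ι ℂ} {x : G}
    (hH : ∀ i j, ContDiffAt ℝ 2 (fun u => H u i j) x) (hd : (H x).det ≠ 0) (v : G) (i j : ι) :
    DifferentiableAt ℝ (fun z => connMat H z v i j) x := by
  have h1 : ∀ w i j, DifferentiableAt ℝ (fun z => dMat ℝ H z w i j) x := fun w i j =>
    (differentiableAt_fderiv_apply (hH i j) w).differentiableAt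
  simp only [connMat, Matrix.mul_apply]
  exact DifferentiableAt.fun_sum fun k _ => (((h1 v i k).sub
    ((h1 (Complex.I • v) i k).const_smul Complex.I)).const_smul (1 / 2 : ℂ)).mul
      (differentiableAt_matrix_inv (fun i j => (hH i j).of_le (by norm_num)) hd k j)

theorem curvatureMatrix_apply {r : ℕ} {H : G → Matrix (Fin r) (Fin r) ℂ} {x : G}
    (hH : ∀ i j, ContDiffAt ℝ 2 (fun u => H u i j) x) (hd : (H x).det ≠ 0) (i j : Fin r) (u v : G) :
    curvatureMatrix H i j x ![u, v] =
      dbarMat (fun z => connMat H z v) x u i j - dbarMat (fun z => connMat H z u) x v i j := by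
  have h1 : DifferentiableAt ℝ (connectionMatrix H i j) x := by
    unfold connectionMatrix
    refine DifferentiableAt.fun_sum fun k _ => ?_
    exact (differentiableAt_matrix_inv (fun i j => (hH i j).of_le (by norm_num)) hd k j).smul
      (differentiableAt_del (contDiffAt_constOfIsEmpty (hH i k)))
  have h2 : ∀ w, fderiv ℝ (fun z => connectionMatrix H i j z ![w]) x =
      fderiv ℝ (fun z => connMat H z w i j) x := fun w => by
    refine Filter.EventuallyEq.fderiv_eq ?_
    have h3 : ∀ᶠ z in 𝓝 x, ∀ i j, ContDiffAt ℝ 2 (fun u => H u i j) z :=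
      eventually_all.mpr fun i => eventually_all.mpr fun j => (hH i j).eventually (by simp)
    filter_upwards [h3] with z hz
    exact connectionMatrix_apply (fun i j => (hz i j).differentiableAt (by simp)) i j w
  rw [curvatureMatrix, delbar_one_apply h1, h2, h2]
  rfl

/-- The curvature after the holomorphic change of frame `Q`. -/
theorem dbarMat_connMat_conj {Q H : G → Matrix ι ι ℂ} {x : G}
    (hQ : ∀ i j, ContDiffAt ℂ 2 (fun u => Q u i j) x)
    (hH : ∀ i j, ContDiffAt ℝ 2 (fun u => H u i j) x) (hQd : (Q x).det ≠ 0) (hHd : (H x).det ≠ 0)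
    (u v : G) :
    dbarMat (fun z => connMat (fun w => Q w * H w * (Q w)ᴴ) z v) x u =
      Q x * dbarMat (fun z => connMat H z v) x u * (Q x)⁻¹ := by
  have hQ1 : ∀ i j, ContDiffAt ℂ 1 (fun u => Q u i j) x := fun i j => (hQ i j).of_le (by norm_num)
  have hH1 : ∀ i j, ContDiffAt ℝ 1 (fun u => H u i j) x := fun i j => (hH i j).of_le (by norm_num)
  have hev : ∀ᶠ z in 𝓝 x, (∀ i j, ContDiffAt ℂ 2 (fun u => Q u i j) z) ∧
      (∀ i j, ContDiffAt ℝ 2 (fun u => H u i j) z) ∧ (Q z).det ≠ 0 ∧ (H z).det ≠ 0 :=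
    (eventually_all.mpr fun i => eventually_all.mpr fun j => (hQ i j).eventually (by simp)).and
      ((eventually_all.mpr fun i => eventually_all.mpr fun j => (hH i j).eventually (by simp)).and
        (((contDiffAt_det hQ1).continuousAt.eventually_ne hQd).and
          ((contDiffAt_det hH1).continuousAt.eventually_ne hHd)))
  have h1 : (fun z => connMat (fun w => Q w * H w * (Q w)ᴴ) z v) =ᶠ[𝓝 x]
      fun z => dMat ℂ Q z v * (Q z)⁻¹ + Q z * connMat H z v * (Q z)⁻¹ := by
    filter_upwards [hev] with z hz
    rw [connMat_conj (fun i j => (hz.1 i j).differentiableAt (by simp))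
      (fun i j => (hz.2.1 i j).differentiableAt (by simp)) (isUnit_iff_ne_zero.mpr hz.2.2.1),
      Matrix.mul_assoc (dMat ℂ Q z v), Matrix.mul_nonsing_inv _ (isUnit_iff_ne_zero.mpr hz.2.2.2),
      Matrix.mul_one]
  have hQc : ∀ i j, DifferentiableAt ℂ (fun z => Q z i j) x := fun i j =>
    (hQ i j).differentiableAt (by simp)
  have hQi : ∀ i j, DifferentiableAt ℂ (fun z => (Q z)⁻¹ i j) x :=
    differentiableAt_matrix_inv hQ1 hQd
  have hdQ : ∀ i j, DifferentiableAt ℂ (fun z => dMat ℂ Q z v i j) x := fun i j =>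
    (((hQ i j).fderiv_right (m := 1) (by norm_num)).differentiableAt (by simp)).clm_apply
      (differentiableAt_const v)
  have hmul : ∀ {𝕜 : Type} [NontriviallyNormedField 𝕜] [NormedAlgebra 𝕜 ℂ] [NormedSpace 𝕜 G]
      {A B : G → Matrix ι ι ℂ}, (∀ i j, DifferentiableAt 𝕜 (fun z => A z i j) x) →
      (∀ i j, DifferentiableAt 𝕜 (fun z => B z i j) x) →
      ∀ i j, DifferentiableAt 𝕜 (fun z => (A z * B z) i j) x := fun hA hB i j => by
    simp only [Matrix.mul_apply]
    exact DifferentiableAt.fun_sum fun k _ => (hA i k).mul (hB k j)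
  have hC := differentiableAt_connMat hH hHd v
  have hQr : ∀ i j, DifferentiableAt ℝ (fun z => Q z i j) x := fun i j => (hQc i j).restrictScalars ℝ
  have hQir : ∀ i j, DifferentiableAt ℝ (fun z => (Q z)⁻¹ i j) x := fun i j =>
    (hQi i j).restrictScalars ℝ
  rw [dbarMat_congr h1, dbarMat_add (fun i j => (hmul hdQ hQi i j).restrictScalars ℝ)
    (hmul (hmul hQr hC) hQir), dbarMat_of_holomorphic (hmul hdQ hQi),
    dbarMat_mul (hmul hQr hC) hQir, dbarMat_mul hQr hC, dbarMat_of_holomorphic hQc,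
    dbarMat_of_holomorphic hQi]
  simp

/-- The curvature in a frame that is orthonormal and parallel at a point is `-∂ ∂bar H` there, where
`H` is the Gram matrix. -/
theorem dbarMat_connMat_of_normal {H : G → Matrix ι ι ℂ} {x : G}
    (hH : ∀ i j, ContDiffAt ℝ 2 (fun u => H u i j) x) (h1 : H x = 1)
    (h0 : ∀ v, dMat ℝ H x v = 0) (u v : G) (i j : ι) :
    dbarMat (fun z => connMat H z v) x u i j =
      leviPart (fderiv ℝ (fderiv ℝ fun z => H z i j) x) v u := by
  have hdH : ∀ w i j, DifferentiableAt ℝ (fun z => dMat ℝ H z w i j) x := fun w i j =>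
    (differentiableAt_fderiv_apply (hH i j) w).differentiableAt
  have hd : (H x).det ≠ 0 := by rw [h1]; simp
  set D : G → Matrix ι ι ℂ := fun z =>
    (1 / 2 : ℂ) • (dMat ℝ H z v - Complex.I • dMat ℝ H z (Complex.I • v)) with hD
  have hDd : ∀ i j, DifferentiableAt ℝ (fun z => D z i j) x := fun i j =>
    ((hdH v i j).sub ((hdH (Complex.I • v) i j).const_smul Complex.I)).const_smul (1 / 2 : ℂ)
  have hD0 : D x = 0 := by simp [hD, h0]
  have h2 : ∀ w i j, dMat ℝ D x w i j = (1 / 2 : ℂ) •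
      (fderiv ℝ (fderiv ℝ fun z => H z i j) x w v -
        Complex.I • fderiv ℝ (fderiv ℝ fun z => H z i j) x w (Complex.I • v)) := fun w i j => by
    have h3 := ((differentiableAt_fderiv_apply (hH i j) v).sub
      ((differentiableAt_fderiv_apply (hH i j) (Complex.I • v)).const_smul
        Complex.I)).const_smul (1 / 2 : ℂ)
    exact congrArg (fun D => D w) h3.fderiv
  have h4 : dbarMat (fun z => connMat H z v) x u = dbarMat D x u := by
    have h5 := dbarMat_mul hDd
      (differentiableAt_matrix_inv (fun i j => (hH i j).of_le (by norm_num)) hd) u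
    rw [hD0, Matrix.zero_mul, add_zero, h1, inv_one, Matrix.mul_one] at h5
    exact h5
  have hsym : ∀ a b, fderiv ℝ (fderiv ℝ fun z => H z i j) x a b =
      fderiv ℝ (fderiv ℝ fun z => H z i j) x b a := fun a b =>
    ((hH i j).isSymmSndFDerivAt (by simp)).eq a b
  rw [h4, dbarMat]
  simp only [Matrix.smul_apply, Matrix.add_apply, h2]
  rw [leviPart, hsym u v, hsym u (Complex.I • v), hsym (Complex.I • u) v,
    hsym (Complex.I • u) (Complex.I • v)]
  simp only [smul_eq_mul]
  linear_combination (-1 / 4 * (fderiv ℝ (fderiv ℝ fun z => H z i j) x (Complex.I • v))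
    (Complex.I • u)) * Complex.I_mul_I

end Curvature

section Pairing
variable [IsManifold 𝓘(ℂ, Fin n → ℂ) ω X] [ContMDiffVectorBundle ω (Fin r → ℂ) E 𝓘(ℂ, Fin n → ℂ)]

variable (h : HermitianMetric n r E)

theorem isHolFrameNear_refFrame {x x₀ : X} (hx : x ∈ (trivializationAt (Fin r → ℂ) E x₀).baseSet) :
    
    IsHolFrameNear n (refFrame E x₀ : Fin r → ∀ x, E x) x := isHolFrameNear_stdFrame hx _

theorem gramMat_eq_conj {x₀ x : X} (hx : x ∈ (trivializationAt (Fin r → ℂ) E x₀).baseSet)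
    (e : Fin r → ∀ x, E x) :
    gramMat h x (fun i => e i x) = frameCoords x₀ e x * gramMat h x (fun i => refFrame E x₀ i x) *
      (frameCoords x₀ e x)ᴴ := by
  rw [matAct_frameCoords hx e, gramMat_matAct]

/-- The curvature in a holomorphic frame `e` that is orthonormal and parallel at `x`. -/
theorem curvaturePairing_of_normal {e : Fin r → ∀ x, E x} {x : X} (he : IsHolFrameNear n e x)
    (h1 : gramMat h x (fun i => e i x) = 1)
    (h0 : ∀ v, dMat ℝ (gramInChart h e x) (baseChart x x) v = 0)
    (i j : Fin r) (u v : Fin n → ℂ) :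
    curvaturePairing h x (e i x) (e j x) ![u, v] =
      leviPart (fderiv ℝ (fderiv ℝ fun z => gramInChart h e x z i j) (baseChart x x)) v u -
      leviPart (fderiv ℝ (fderiv ℝ fun z => gramInChart h e x z i j) (baseChart x x)) u v := by
  set c := baseChart x with hc
  have hx : x ∈ baseDomain n r E x := mem_baseDomain x
  set Q : (Fin n → ℂ) → Matrix (Fin r) (Fin r) ℂ := fun z => frameCoords x e (c.symm z) with hQ
  set S : (Fin n → ℂ) → Matrix (Fin r) (Fin r) ℂ := gramInChart h (refFrame E x) x with hS
  have hcx : c.symm (c x) = x := c.left_inv hx.1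
  have hQs : ∀ i j, ContDiffAt ℂ 2 (fun z => Q z i j) (c x) := fun i j =>
    (he.contDiffAt_frameCoords hx i j).of_le (by simp)
  have hSs : ∀ i j, ContDiffAt ℝ 2 (fun z => S z i j) (c x) := fun i j =>
    (contDiffAt_gramMat h (isHolFrameNear_refFrame hx.2) hx i j).of_le (WithTop.coe_le_coe.mpr le_top)
  have hQu : IsUnit (frameCoords x e x).det := he.isUnit_det hx.2
  have hQx : Q (c x) = frameCoords x e x := by simp only [hQ, hcx]
  have hSx : S (c x) = gramMat h x fun i => refFrame E x i x := by
    have : ∀ x', x' = x → gramMat h x' (fun i => refFrame E x i x') =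
      gramMat h x fun i => refFrame E x i x := by rintro _ rfl; rfl
    exact this _ hcx
  have hone : frameCoords x e x * S (c x) * (frameCoords x e x)ᴴ = 1 := by
    rw [hSx, ← gramMat_eq_conj h hx.2, h1]
  have hSK : S (c x) * (frameCoords x e x)ᴴ = (frameCoords x e x)⁻¹ := by
    rw [Matrix.mul_assoc] at hone
    exact (Matrix.inv_eq_right_inv hone).symm
  have hSd : (S (c x)).det ≠ 0 := by
    have h2 := congrArg Matrix.det hone
    rw [Matrix.det_mul, Matrix.det_mul, Matrix.det_one] at h2
    exact right_ne_zero_of_mul (left_ne_zero_of_mul_eq_one h2)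
  have hH : gramInChart h e x =ᶠ[𝓝 (c x)] fun z => Q z * S z * (Q z)ᴴ := by
    filter_upwards [eventually_chart_symm hx.1
      ((trivializationAt (Fin r → ℂ) E x).open_baseSet.eventually_mem hx.2)] with z hz
    exact gramMat_eq_conj h hz e
  have hHs : ∀ i j, ContDiffAt ℝ 2 (fun z => gramInChart h e x z i j) (c x) := fun i j =>
    (contDiffAt_gramMat h he hx i j).of_le (WithTop.coe_le_coe.mpr le_top)
  have hH1 : gramInChart h e x (c x) = 1 := by
    rw [hH.self_of_nhds]
    change Q (c x) * S (c x) * (Q (c x))ᴴ = 1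
    rw [hQx]; exact hone
  have hpair : curvaturePairing h x (e i x) (e j x) ![u, v] =
      (frameCoords x e x * (dbarMat (fun z => connMat S z v) (c x) u -
        dbarMat (fun z => connMat S z u) (c x) v) * (frameCoords x e x)⁻¹) i j := by
    have h3 : ∀ l, h.inner x (refFrame E x l x) (e j x) = (frameCoords x e x)⁻¹ l j := fun l => by
      rw [← hSK, hSx]
      have h4 : e j x = matAct (frameCoords x e x) (fun i => refFrame E x i x) j :=
        congrFun (matAct_frameCoords hx.2 e) j
      rw [h4]
      simp only [matAct, gramMat, Matrix.mul_apply, map_sum, LinearMap.map_smulₛₗ,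
        Matrix.conjTranspose_apply, smul_eq_mul, Complex.star_def]
      exact Finset.sum_congr rfl fun k _ => mul_comm _ _
    have h5 : curvaturePairing h x (e i x) (e j x) ![u, v] =
        ∑ k, ∑ l, (frameCoords x e x i k * h.inner x (refFrame E x l x) (e j x)) *
          curvatureMatrix S k l (c x) ![u, v] :=
      (ContinuousAlternatingMap.sum_apply _ _).trans (Finset.sum_congr rfl fun k _ =>
        (ContinuousAlternatingMap.sum_apply _ _).trans (Finset.sum_congr rfl fun l _ => rfl))
    rw [h5, Matrix.mul_apply, Finset.sum_comm]
    refine Finset.sum_congr rfl fun l _ => ?_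
    rw [Matrix.mul_apply, Finset.sum_mul]
    refine Finset.sum_congr rfl fun k _ => ?_
    rw [curvatureMatrix_apply hSs hSd, h3, Matrix.sub_apply]
    ring
  have hcurv : ∀ a b, dbarMat (fun z => connMat (gramInChart h e x) z b) (c x) a =
      frameCoords x e x * dbarMat (fun z => connMat S z b) (c x) a * (frameCoords x e x)⁻¹ :=
    fun a b => by
      have h6 := dbarMat_connMat_conj hQs hSs (by rw [hQx]; exact hQu.ne_zero) hSd a b
      rw [hQx] at h6
      rw [← h6]
      refine dbarMat_congr ?_ a
      filter_upwards [hH.eventuallyEq_nhds] with z hz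
      rw [connMat, connMat, dMat_congr hz, dMat_congr hz, hz.self_of_nhds]
  rw [hpair, Matrix.mul_sub, Matrix.sub_mul, ← hcurv, ← hcurv, Matrix.sub_apply,
    dbarMat_connMat_of_normal hHs hH1 h0, dbarMat_connMat_of_normal hHs hH1 h0]

end Pairing

/-! ### Existence of normal frames -/

section Taylor
variable {M : Type*} [NormedAddCommGroup M] [NormedSpace ℝ M]
  {F : Type*} [NormedAddCommGroup F] [NormedSpace ℝ F]

theorem isBigO_pow_succ_of_fderiv {f : M → F} {x : M} {k : ℕ}
    (hd : ∀ᶠ z in 𝓝 x, DifferentiableAt ℝ f z) (h0 : f x = 0)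
    (hf : (fun z => fderiv ℝ f z) =O[𝓝 x] fun z => ‖z - x‖ ^ k) :
    f =O[𝓝 x] fun z => ‖z - x‖ ^ (k + 1) := by
  obtain ⟨C, hC⟩ := hf.bound
  obtain ⟨ε, hε, hball⟩ := Metric.eventually_nhds_iff_ball.mp (hd.and hC)
  refine Asymptotics.IsBigO.of_bound C ?_
  filter_upwards [Metric.ball_mem_nhds x hε] with z hz
  have h1 : Metric.closedBall x ‖z - x‖ ⊆ Metric.ball x ε :=
    Metric.closedBall_subset_ball (by rwa [← dist_eq_norm])
  have h2 : ∀ w ∈ Metric.closedBall x ‖z - x‖, ‖fderiv ℝ f w‖ ≤ C * ‖z - x‖ ^ k := fun w hw => by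
    have h3 := (hball w (h1 hw)).2
    have h4 : ‖w - x‖ ≤ ‖z - x‖ := by rw [← dist_eq_norm]; exact hw
    rw [norm_pow, norm_norm] at h3
    have hC0 : 0 ≤ C ∨ ‖w - x‖ ^ k = 0 := by
      by_contra! hc
      have h5 : 0 < ‖w - x‖ ^ k := lt_of_le_of_ne (by positivity) hc.2.symm
      nlinarith [norm_nonneg (fderiv ℝ f w)]
    rcases hC0 with hC0 | hC0
    · exact h3.trans (mul_le_mul_of_nonneg_left (pow_le_pow_left₀ (norm_nonneg _) h4 k) hC0)
    · by_cases hC1 : 0 ≤ C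
      · exact h3.trans (mul_le_mul_of_nonneg_left (pow_le_pow_left₀ (norm_nonneg _) h4 k) hC1)
      · have h6 := (hball z hz).2
        rw [norm_pow, norm_norm] at h6
        rw [hC0, mul_zero] at h3
        exact h3.trans ((norm_nonneg _).trans h6)
  have h3 := (convex_closedBall x ‖z - x‖).norm_image_sub_le_of_norm_fderiv_le (𝕜 := ℝ)
    (fun w hw => (hball w (h1 hw)).1) h2 (Metric.mem_closedBall_self (norm_nonneg _))
    (show z ∈ _ by rw [Metric.mem_closedBall, dist_eq_norm])
  rw [h0, sub_zero] at h3
  rw [norm_pow, norm_norm, pow_succ, ← mul_assoc]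
  exact h3

theorem fderiv_sub_isBigO {f : M → F} {x : M} (hf : ContDiffAt ℝ 2 f x) :
    (fun z => fderiv ℝ f z - fderiv ℝ f x) =O[𝓝 x] fun z => z - x :=
  ((hf.fderiv_right (m := 1) (by norm_num)).differentiableAt (by simp)).hasFDerivAt.isBigO_sub

theorem taylor_two_isBigO {f : M → F} {x : M} (hf : ContDiffAt ℝ 3 f x) (h1 : fderiv ℝ f x = 0) :
    (fun z => f z - f x - (1 / 2 : ℝ) • fderiv ℝ (fderiv ℝ f) x (z - x) (z - x)) =O[𝓝 x]
      fun z => ‖z - x‖ ^ 3 := by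
  set B := fderiv ℝ (fderiv ℝ f) x with hB
  have hsym : ∀ a b, B a b = B b a := fun a b => (hf.isSymmSndFDerivAt (by simp; norm_num)).eq a b
  have hev : ∀ᶠ z in 𝓝 x, ContDiffAt ℝ 3 f z := hf.eventually (by simp)
  have hR : ∀ᶠ z in 𝓝 x, HasFDerivAt (fun z => f z - f x - (1 / 2 : ℝ) • B (z - x) (z - x))
      (fderiv ℝ f z - B (z - x)) z := by
    filter_upwards [hev] with z hz
    have h2 : HasFDerivAt (fun z => z - x) (ContinuousLinearMap.id ℝ M) z :=
      (hasFDerivAt_id z).sub_const x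
    have h3 := (B.hasFDerivAt.comp z h2).clm_apply h2
    refine (((hz.differentiableAt (by simp)).hasFDerivAt.sub_const (f x)).sub
      (h3.const_smul (1 / 2 : ℝ))).congr_fderiv ?_
    ext v
    simp only [sub_apply, smul_apply, add_apply,
      ContinuousLinearMap.comp_apply, ContinuousLinearMap.flip_apply, ContinuousLinearMap.coe_id',
      id_eq, Function.comp_apply]
    rw [hsym v (z - x), ← two_smul ℝ, smul_smul]
    norm_num
  refine isBigO_pow_succ_of_fderiv (hR.mono fun z hz => hz.differentiableAt) (by simp) ?_
  have h2 : (fun z => fderiv ℝ f z - B (z - x)) =O[𝓝 x] fun z => ‖z - x‖ ^ 2 := by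
    have hd2 : ∀ᶠ z in 𝓝 x, DifferentiableAt ℝ (fderiv ℝ f) z := by
      filter_upwards [hev] with z hz
      exact (hz.fderiv_right (m := 2) (by norm_num)).differentiableAt (by simp)
    have hS : ∀ᶠ z in 𝓝 x, HasFDerivAt (fun z => fderiv ℝ f z - B (z - x))
        (fderiv ℝ (fderiv ℝ f) z - B) z := by
      filter_upwards [hd2] with z hz
      have h2 : HasFDerivAt (fun z => z - x) (ContinuousLinearMap.id ℝ M) z :=
        (hasFDerivAt_id z).sub_const x
      exact hz.hasFDerivAt.sub ((B.hasFDerivAt.comp z h2).congr_fderiv (by ext; simp))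
    refine isBigO_pow_succ_of_fderiv (hS.mono fun z hz => hz.differentiableAt) (by simp [h1]) ?_
    have h5 := fderiv_sub_isBigO (hf.fderiv_right (m := 2) (by norm_num))
    refine (h5.norm_right.congr' (hS.mono fun z hz => hz.fderiv.symm) ?_)
    exact Eventually.of_forall fun z => by simp
  exact h2.congr' (hR.mono fun z hz => hz.fderiv.symm) (Eventually.of_forall fun z => rfl)

end Taylor

section ComplexParts
variable {M : Type*} [NormedAddCommGroup M] [NormedSpace ℂ M]

theorem complex_smul_eq (c : ℂ) (u : M) : c • u = c.re • u + c.im • (Complex.I • u) := by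
  conv_lhs => rw [← Complex.re_add_im c]
  rw [add_smul, mul_smul]
  rfl

/-- A real bilinear form is complex bilinear up to terms that are conjugate linear in one variable;
this is the complex bilinear part. -/
def bilinPart (B : M →L[ℝ] M →L[ℝ] ℂ) (u v : M) : ℂ :=
  (1 / 4 : ℂ) * (B u v - Complex.I * B (Complex.I • u) v - Complex.I * B u (Complex.I • v)
    - B (Complex.I • u) (Complex.I • v))

theorem linPart_smul (D : M →L[ℝ] ℂ) (c : ℂ) (u : M) : linPart D (c • u) = c * linPart D u := by
  rw [complex_smul_eq]
  simp only [linPart_apply, smul_smul Complex.I Complex.I,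
    Complex.I_mul_I, neg_one_smul, map_add, map_smul, map_neg, smul_eq_mul, Complex.real_smul]
  conv_rhs => rw [← Complex.re_add_im c]
  linear_combination ((1 / 2) * c.im * D (Complex.I • u)) * Complex.I_mul_I

theorem leviPart_smul_left (B : M →L[ℝ] M →L[ℝ] ℂ) (c : ℂ) (u v : M) :
    leviPart B (c • u) v = c * leviPart B u v := by
  rw [complex_smul_eq]
  simp only [leviPart, smul_add, smul_comm Complex.I, smul_smul Complex.I Complex.I,
    Complex.I_mul_I, neg_one_smul, map_add, map_smul, map_neg, add_apply, smul_apply, neg_apply,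
    smul_eq_mul, Complex.real_smul, smul_neg]
  conv_rhs => rw [← Complex.re_add_im c]
  linear_combination ((1 / 4) * c.im * (B (Complex.I • u) v - B u (Complex.I • v))) * Complex.I_mul_I

theorem leviPart_smul_right (B : M →L[ℝ] M →L[ℝ] ℂ) (c : ℂ) (u v : M) :
    leviPart B u (c • v) = (starRingEnd ℂ) c * leviPart B u v := by
  rw [complex_smul_eq c v]
  simp only [leviPart, smul_add, smul_comm Complex.I, smul_smul Complex.I Complex.I,
    Complex.I_mul_I, neg_one_smul, map_add, map_smul, map_neg,
    smul_eq_mul, Complex.real_smul, smul_neg]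
  have hc : (starRingEnd ℂ) c = c.re - c.im * Complex.I := by
    apply Complex.ext <;> simp
  rw [hc]
  linear_combination ((1 / 4) * c.im * (B u (Complex.I • v) - B (Complex.I • u) v)) * Complex.I_mul_I

theorem leviPart_add_left (B : M →L[ℝ] M →L[ℝ] ℂ) (u u' v : M) :
    leviPart B (u + u') v = leviPart B u v + leviPart B u' v := by
  simp only [leviPart, smul_add, map_add, add_apply, smul_eq_mul]
  ring

theorem leviPart_add_right (B : M →L[ℝ] M →L[ℝ] ℂ) (u v v' : M) :
    leviPart B u (v + v') = leviPart B u v + leviPart B u v' := by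
  simp only [leviPart, smul_add, map_add, smul_eq_mul]
  ring

theorem bilinPart_smul_left (B : M →L[ℝ] M →L[ℝ] ℂ) (c : ℂ) (u v : M) :
    bilinPart B (c • u) v = c * bilinPart B u v := by
  rw [complex_smul_eq]
  simp only [bilinPart, smul_add, smul_comm Complex.I, smul_smul Complex.I Complex.I,
    Complex.I_mul_I, neg_one_smul, map_add, map_smul, map_neg, add_apply, smul_apply, neg_apply,
    Complex.real_smul]
  conv_rhs => rw [← Complex.re_add_im c]
  linear_combination ((1 / 4) * c.im * (B (Complex.I • u) v + B u (Complex.I • v))) * Complex.I_mul_I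

theorem bilinPart_comm {B : M →L[ℝ] M →L[ℝ] ℂ} (hB : ∀ u v, B u v = B v u) (u v : M) :
    bilinPart B u v = bilinPart B v u := by
  simp only [bilinPart, hB u, hB (Complex.I • u)]
  ring

theorem bilinPart_add_left (B : M →L[ℝ] M →L[ℝ] ℂ) (u u' v : M) :
    bilinPart B (u + u') v = bilinPart B u v + bilinPart B u' v := by
  simp only [bilinPart, smul_add, map_add, add_apply]
  ring

/-- The part of type `(1,1)` of a real quadratic form. -/
theorem half_sub_bilinPart {B B' : M →L[ℝ] M →L[ℝ] ℂ} (hB : ∀ u v, B u v = B v u)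
    (hB' : ∀ u v, (starRingEnd ℂ) (B' u v) = B u v) (u : M) :
    (1 / 2 : ℝ) • B u u - (1 / 2) * bilinPart B u u -
      (starRingEnd ℂ) ((1 / 2) * bilinPart B' u u) = leviPart B u u := by
  simp only [bilinPart, leviPart, map_mul, map_sub, hB', Complex.conj_I, map_div₀, map_one,
    map_ofNat, hB (Complex.I • u) u, Complex.real_smul, smul_eq_mul]
  push_cast
  ring

theorem eq_sum_single {n : ℕ} {f : (Fin n → ℂ) → ℂ} {σ : ℂ → ℂ} (hadd : ∀ u v, f (u + v) = f u + f v)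
    (hsmul : ∀ (c : ℂ) u, f (c • u) = σ c * f u) (u : Fin n → ℂ) :
    f u = ∑ k, σ (u k) * f (Pi.single k 1) := by
  have h0 : f 0 = 0 := by simpa using hadd 0 0
  let g : (Fin n → ℂ) →+ ℂ := ⟨⟨f, h0⟩, hadd⟩
  have h1 : u = ∑ k, u k • (Pi.single k 1 : Fin n → ℂ) := by
    ext j
    simp [Finset.sum_apply, Pi.single_apply]
  have h2 : g u = ∑ k, g (u k • (Pi.single k 1 : Fin n → ℂ)) := by
    conv_lhs => rw [h1]
    rw [map_sum]
  refine h2.trans (Finset.sum_congr rfl fun k _ => hsmul _ _)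

end ComplexParts

section NormalFrames
variable {h : HermitianMetric n r E}

theorem IsNormalFrame.gramMat_eq_one {e : Fin r → ∀ x, E x} {y : FlagBundle n r E}
    (he : IsNormalFrame h e y) : gramMat h y.base (fun i => e i y.base) = 1 := by
  obtain ⟨_, _, c, hc⟩ := he
  ext i j
  obtain ⟨C, hC⟩ := (hc i j).bound
  have h1 := hC.self_of_nhds
  simp only [sub_self, norm_zero, Pi.zero_apply, map_zero, mul_zero, Finset.sum_const_zero,
    sub_zero] at h1
  simp only [ne_eq, OfNat.ofNat_ne_zero, not_false_eq_true, zero_pow, norm_zero, mul_zero,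
    norm_le_zero_iff] at h1
  rw [Matrix.one_apply]
  exact sub_eq_zero.mp h1

variable [IsManifold 𝓘(ℂ, Fin n → ℂ) ω X]
  [ContMDiffVectorBundle ω (Fin r → ℂ) E 𝓘(ℂ, Fin n → ℂ)]

/-- The Gram matrix of a normal frame is stationary at the point, in any chart. -/
theorem IsNormalFrame.hasFDerivAt {e : Fin r → ∀ x, E x} {y : FlagBundle n r E}
    (he : IsNormalFrame h e y) {x₀ : X} (hx : y.base ∈ (baseChart x₀).source)
    (i j : Fin r) :
    HasFDerivAt (𝕜 := ℝ) (fun z => gramInChart h e x₀ z i j) 0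
      (baseChart x₀ y.base) := by
  have hone := he.gramMat_eq_one
  obtain ⟨_, _, a, ha⟩ := he
  set x := y.base with hxdef
  set c := baseChart x with hc
  set c₀ := baseChart x₀ with hc₀
  have hO : (fun x' => h.inner x' (e i x') (e j x') - if i = j then 1 else 0) =O[𝓝 x]
      fun x' => ‖c x' - c x‖ ^ 2 := by
    have h1 : (fun x' => ∑ k, ∑ l, a k l i j * (c x' - c x) k *
        (starRingEnd ℂ) ((c x' - c x) l)) =O[𝓝 x] fun x' => ‖c x' - c x‖ ^ 2 := by
      refine Asymptotics.IsBigO.fun_sum fun k _ => Asymptotics.IsBigO.fun_sum fun l _ => ?_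
      refine Asymptotics.IsBigO.of_bound ‖a k l i j‖ (Eventually.of_forall fun x' => ?_)
      rw [norm_mul, norm_mul, RCLike.norm_conj, norm_pow, norm_norm, mul_assoc, sq]
      gcongr
      · exact norm_le_pi_norm _ k
      · exact norm_le_pi_norm _ l
    have h2 : (fun x' => ‖c x' - c x‖ ^ 3) =O[𝓝 x] fun x' => ‖c x' - c x‖ ^ 2 := by
      have h3 : Tendsto (fun x' => ‖c x' - c x‖) (𝓝 x) (𝓝 0) := by
        have h5 : ContinuousAt (fun x' => ‖c x' - c x‖) x :=
          (ContinuousAt.sub (c.continuousAt (mem_chart_source _ x)) continuousAt_const).norm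
        simpa [ContinuousAt] using h5
      have h4 : (fun x' => ‖c x' - c x‖ ^ 2 * ‖c x' - c x‖) =O[𝓝 x] fun x' => ‖c x' - c x‖ ^ 2 * 1 :=
        (Asymptotics.isBigO_refl _ _).mul (h3.isBigO_one ℝ)
      simpa [pow_succ] using h4
    refine (((ha i j).trans h2).sub h1).congr_left fun x' => ?_
    ring
  have hcx : c₀.symm (c₀ x) = x := c₀.left_inv hx
  have hO2 : (fun z => gramInChart h e x₀ z i j - if i = j then 1 else 0) =O[𝓝 (c₀ x)]
      fun z => ‖z - c₀ x‖ ^ 2 := by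
    have ht : Tendsto c₀.symm (𝓝 (c₀ x)) (𝓝 x) := by
      have := c₀.continuousAt_symm (c₀.map_source hx)
      rwa [ContinuousAt, hcx] at this
    refine (hO.comp_tendsto ht).trans ?_
    have hd : (fun z => c (c₀.symm z) - c (c₀.symm (c₀ x))) =O[𝓝 (c₀ x)] fun z => z - c₀ x :=
      ((contDiffAt_chart_trans (n := n) hx (mem_chart_source _ x)).differentiableAt
        (by simp)).hasFDerivAt.isBigO_sub
    rw [hcx] at hd
    exact hd.norm_norm.pow 2
  have h5 : gramInChart h e x₀ (c₀ x) i j = if i = j then 1 else 0 := by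
    have h6 : ∀ x', x' = x → h.inner x' (e i x') (e j x') = h.inner x (e i x) (e j x) := by
      rintro _ rfl; rfl
    refine (h6 _ hcx).trans ?_
    rw [← Matrix.one_apply, ← hone]; rfl
  have h7 := hO2.hasFDerivAt (𝕜 := ℝ) (by norm_num)
  exact (h7.add_const (if i = j then 1 else 0)).congr_of_eventuallyEq
    (Eventually.of_forall fun z => (sub_add_cancel _ _).symm)

theorem IsNormalFrame.dMat_eq_zero {e : Fin r → ∀ x, E x} {y : FlagBundle n r E}
    (he : IsNormalFrame h e y) {x₀ : X} (hx : y.base ∈ (baseChart x₀).source)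
    (v : Fin n → ℂ) :
    dMat ℝ (gramInChart h e x₀) (baseChart x₀ y.base) v = 0 := by
  ext i j
  rw [dMat, (he.hasFDerivAt hx i j).fderiv]
  rfl

theorem gramInChart_self (e : Fin r → ∀ x, E x) {x x₀ : X}
    (hx : x ∈ (baseChart x₀).source) :
    gramInChart h e x₀ (baseChart x₀ x) = gramMat h x fun i => e i x := by
  have : ∀ x', x' = x → gramMat h x' (fun i => e i x') = gramMat h x fun i => e i x := by
    rintro _ rfl; rfl
  exact this _ ((baseChart x₀).left_inv hx)

theorem gramInChart_matAct (A : (Fin n → ℂ) → Matrix (Fin r) (Fin r) ℂ) (e : Fin r → ∀ x, E x)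
    {x x₀ : X} (hx : x ∈ (baseChart x₀).source) :
    gramInChart h (fun i x' => matAct (A (baseChart x₀ x')) (fun j => e j x') i) x₀
      =ᶠ[𝓝 (baseChart x₀ x)]
    fun z => A z * gramInChart h e x₀ z * (A z)ᴴ := by
  filter_upwards [(baseChart x₀).open_target.mem_nhds
    ((baseChart x₀).map_source hx)] with z hz
  have h1 := gramMat_matAct h ((baseChart x₀).symm z) (A z) fun j => e j _
  have h2 := (baseChart x₀).right_inv hz
  refine Eq.trans ?_ h1
  ext i j
  simp only [gramInChart, gramMat, h2]

variable (h) in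
theorem exists_frame_gramMat_eq_one (y : FlagBundle n r E) : ∃ e : Fin r → ∀ x, E x,
    IsHolFrameNear n e y.base ∧ Adapted (fun i => e i y.base) y.flag ∧
      gramMat h y.base (fun i => e i y.base) = 1 := by
  have h1 := isHolFrameNear_chartFrame (mem_baseDomain (n := n) (r := r) (E := E) y.base)
    (y := y)
  obtain ⟨B, hB⟩ := h1.exists_basis
  obtain ⟨L, hL, hLu, hLG⟩ := exists_lowerTri_conj_eq_one
    (posDef_gramMat h (x := y.base) (w := fun i => chartFrame y i y.base)
      (hB ▸ B.linearIndependent))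
  refine ⟨fun i x' => matAct L (fun j => chartFrame y j x') i,
    h1.matAct (A := fun _ => L) (mem_baseDomain y.base) (fun i j => contDiffAt_const) hLu.ne_zero,
    (adapted_chartFrame y).matAct hL hLu, ?_⟩
  have h2 := gramMat_matAct h y.base L fun j => chartFrame y j y.base
  exact h2.trans hLG

theorem matAct_adapted_one {e : Fin r → ∀ x, E x} {y : FlagBundle n r E}
    (had : Adapted (fun i => e i y.base) y.flag) {A : (Fin n → ℂ) → Matrix (Fin r) (Fin r) ℂ}
    (hA : A (baseChart y.base y.base) = 1) :
    Adapted (fun i => matAct (A (baseChart y.base y.base)) (fun j => e j y.base) i)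
      y.flag := by
  rw [hA, matAct_one]
  exact had

theorem contDiffAt_gramInChart {e : Fin r → ∀ x, E x} {x x₀ : X} (he : IsHolFrameNear n e x)
    (hx : x ∈ baseDomain n r E x₀) (i j : Fin r) :
    ContDiffAt ℝ ∞ (fun z => gramInChart h e x₀ z i j) (baseChart x₀ x) :=
  contDiffAt_gramMat h he hx i j

theorem conjTranspose_gramInChart (e : Fin r → ∀ x, E x) (x₀ : X) (z : Fin n → ℂ) :
    (gramInChart h e x₀ z)ᴴ = gramInChart h e x₀ z :=
  conjTranspose_gramMat h _ _

variable (h) in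
/-- The terms of first order of the Gram matrix are removed by a change of frame of first order. -/
theorem exists_frame_dMat_eq_zero (y : FlagBundle n r E) : ∃ e : Fin r → ∀ x, E x,
    IsHolFrameNear n e y.base ∧ Adapted (fun i => e i y.base) y.flag ∧
      gramMat h y.base (fun i => e i y.base) = 1 ∧
      ∀ i j, fderiv ℝ (fun z => gramInChart h e y.base z i j)
        (baseChart y.base y.base) = 0 := by
  obtain ⟨e, he, had, hone⟩ := exists_frame_gramMat_eq_one h y
  have hx := mem_baseDomain (n := n) (r := r) (E := E) y.base
  set c := baseChart y.base with hc
  set x := y.base with hxdef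
  set H := gramInChart h e x with hH
  have hHs : ∀ i j, DifferentiableAt ℝ (fun z => H z i j) (c x) := fun i j =>
    (contDiffAt_gramInChart he hx i j).differentiableAt (by simp)
  let P : (Fin n → ℂ) → Matrix (Fin r) (Fin r) ℂ := fun z i j =>
    (1 : Matrix (Fin r) (Fin r) ℂ) i j - ∑ k, (z k - c x k) *
      linPart (fderiv ℝ (fun z => H z i j) (c x)) (Pi.single k 1)
  have hPs : ∀ i j, ContDiffAt ℂ ω (fun z => P z i j) (c x) := fun i j => by
    refine contDiffAt_const.sub (ContDiffAt.sum fun k _ => ContDiffAt.mul ?_ contDiffAt_const)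
    exact (contDiff_apply ℂ ℂ k).contDiffAt.sub contDiffAt_const
  have hP1 : P (c x) = 1 := by
    ext i j
    simp [P]
  -- `P` cancels the complex linear part of `dH`, and `Pᴴ` the conjugate linear part, as `H` is Hermitian
  have hP' : ∀ v, dMat ℂ P (c x) v =
      -((1 / 2 : ℂ) • (dMat ℝ H (c x) v - Complex.I • dMat ℝ H (c x) (Complex.I • v))) := fun v => by
    ext i j
    have h1 : HasFDerivAt (𝕜 := ℂ) (fun z => P z i j) (-∑ k, (linPart (fderiv ℝ (fun z => H z i j) (c x))
        (Pi.single k 1)) • ContinuousLinearMap.proj (R := ℂ) (φ := fun _ : Fin n => ℂ) k) (c x) := by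
      refine (HasFDerivAt.fun_sum fun k _ => ?_).const_sub _
      exact ((hasFDerivAt_apply k (c x)).sub_const (c x k)).mul_const _
    rw [dMat, h1.fderiv]
    have h2 := eq_sum_single (σ := id) (f := linPart (fderiv ℝ (fun z => H z i j) (c x)))
      (fun u v => map_add _ u v) (fun a u => linPart_smul _ a u) v
    simp only [neg_apply, sum_apply, smul_apply, ContinuousLinearMap.proj_apply, smul_eq_mul,
      Matrix.neg_apply, neg_inj]
    refine Eq.trans ?_ h2.symm
    exact Finset.sum_congr rfl fun k _ => mul_comm _ _
  have hg := gramInChart_matAct (h := h) P e hx.1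
  refine ⟨fun i x' => matAct (P (c x')) (fun j => e j x') i, he.matAct hx hPs (by rw [hP1]; simp),
    matAct_adapted_one had hP1, ?_, fun i j => ?_⟩
  · have h3 := gramMat_matAct h x (P (c x)) fun j => e j x
    rw [hP1, hone] at h3
    have h5 : (fun i => matAct (P (c x)) (fun j => e j x) i) = matAct 1 fun j => e j x := by
      rw [hP1]
    refine (congrArg (gramMat h x) h5).trans (h3.trans ?_)
    simp
  · ext v
    have hPr : ∀ i j, DifferentiableAt ℝ (fun z => P z i j) (c x) := fun i j =>
      ((hPs i j).differentiableAt (by simp)).restrictScalars ℝ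
    have hPc : ∀ i j, DifferentiableAt ℝ (fun z => (P z)ᴴ i j) (c x) := fun i j =>
      (Complex.conjCLE : ℂ ≃L[ℝ] ℂ).differentiableAt.comp _ (hPr j i)
    have hPH : ∀ i j, DifferentiableAt ℝ (fun z => (P z * H z) i j) (c x) := fun i j => by
      simp only [Matrix.mul_apply]
      exact DifferentiableAt.fun_sum fun k _ => (hPr i k).mul (hHs k j)
    have hH1 : H (c x) = 1 := (gramInChart_self e hx.1).trans hone
    have hHc : ∀ v, (dMat ℝ H (c x) v)ᴴ = dMat ℝ H (c x) v := fun v => by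
      rw [← dMat_conjTranspose]
      exact dMat_congr (Eventually.of_forall fun z => conjTranspose_gramInChart e x z) v
    have h4 : dMat ℝ (fun z => P z * H z * (P z)ᴴ) (c x) v = 0 := by
      rw [dMat_mul hPH hPc, dMat_mul hPr hHs, dMat_conjTranspose,
        dMat_restrictScalars (fun i j => (hPs i j).differentiableAt (by simp)), hP', hP1, hH1]
      simp only [Matrix.conjTranspose_neg, Matrix.conjTranspose_smul, Matrix.conjTranspose_sub, hHc,
        Matrix.conjTranspose_one, Matrix.mul_one, Matrix.one_mul, Complex.star_def, Complex.conj_I,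
        map_div₀, map_one, map_ofNat]
      module
    have h5 := congrFun (congrFun (dMat_congr (𝕜 := ℝ) hg v) i) j
    exact h5.trans (congrFun (congrFun h4 i) j)

variable (h) in
/-- Normal frames exist at every point. -/
theorem exists_isNormalFrame (y : FlagBundle n r E) : ∃ e, IsNormalFrame h e y := by
  obtain ⟨e, he, had, hone, hD⟩ := exists_frame_dMat_eq_zero h y
  have hx := mem_baseDomain (n := n) (r := r) (E := E) y.base
  set c := baseChart y.base with hc
  set x := y.base with hxdef
  set H := gramInChart h e x with hH
  have hHs : ∀ i j, ContDiffAt ℝ 3 (fun z => H z i j) (c x) := fun i j =>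
    (contDiffAt_gramInChart he hx i j).of_le (WithTop.coe_le_coe.mpr le_top)
  set B : Fin r → Fin r → (Fin n → ℂ) →L[ℝ] (Fin n → ℂ) →L[ℝ] ℂ := fun i j =>
    fderiv ℝ (fderiv ℝ fun z => H z i j) (c x) with hB
  have hBs : ∀ i j u v, B i j u v = B i j v u := fun i j u v =>
    ((hHs i j).isSymmSndFDerivAt (by simp; norm_num)).eq u v
  have hBc : ∀ i j u v, (starRingEnd ℂ) (B j i u v) = B i j u v := fun i j u v => by
    have h1 : (fun z => H z i j) = fun z => (Complex.conjCLE : ℂ ≃L[ℝ] ℂ) (H z j i) := by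
      funext z
      exact (congrFun (congrFun (conjTranspose_gramInChart e x z) i) j).symm
    simp only [hB]
    rw [h1]
    exact (fderiv_fderiv_clm_comp ((Complex.conjCLE : ℂ ≃L[ℝ] ℂ) : ℂ →L[ℝ] ℂ)
      ((hHs j i).of_le (by norm_num)) u v).symm
  -- the quadratic terms in `z` are removed by `1 + q`, those in `conj z` by its adjoint; mixed terms remain
  let q : Fin r → Fin r → (Fin n → ℂ) → ℂ := fun i j z => ∑ k, ∑ l, (z k - c x k) * (z l - c x l) *
    (-(1 / 2) * bilinPart (B i j) (Pi.single k 1) (Pi.single l 1))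
  have hq : ∀ i j z, q i j z = -((1 / 2) * bilinPart (B i j) (z - c x) (z - c x)) := fun i j z => by
    have h1 := eq_sum_single (σ := id) (f := fun u => bilinPart (B i j) u (z - c x))
      (fun u v => bilinPart_add_left _ u v _) (fun a u => bilinPart_smul_left _ a u _) (z - c x)
    have h2 : ∀ k, bilinPart (B i j) (Pi.single k 1) (z - c x) = ∑ l, (z l - c x l) *
        bilinPart (B i j) (Pi.single k 1) (Pi.single l 1) := fun k => by
      have h3 := eq_sum_single (σ := id) (f := fun u => bilinPart (B i j) u (Pi.single k 1))
        (fun u v => bilinPart_add_left _ u v _) (fun a u => bilinPart_smul_left _ a u _) (z - c x)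
      rw [bilinPart_comm (hBs i j)]
      refine h3.trans (Finset.sum_congr rfl fun l _ => ?_)
      rw [bilinPart_comm (hBs i j) (Pi.single l 1)]
      rfl
    have h4 : bilinPart (B i j) (z - c x) (z - c x) =
      ∑ k, (z - c x) k * bilinPart (B i j) (Pi.single k 1) (z - c x) := h1
    rw [h4, Finset.mul_sum, ← Finset.sum_neg_distrib]
    refine Finset.sum_congr rfl fun k _ => ?_
    rw [h2, Finset.mul_sum, Finset.mul_sum, ← Finset.sum_neg_distrib]
    refine Finset.sum_congr rfl fun l _ => ?_
    simp only [Pi.sub_apply]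
    ring
  let P : (Fin n → ℂ) → Matrix (Fin r) (Fin r) ℂ := fun z i j =>
    (1 : Matrix (Fin r) (Fin r) ℂ) i j + q i j z
  have hzk : ∀ k, ContDiffAt ℂ ω (fun z : Fin n → ℂ => z k - c x k) (c x) := fun k =>
    (contDiff_apply ℂ ℂ k).contDiffAt.sub contDiffAt_const
  have hPs : ∀ i j, ContDiffAt ℂ ω (fun z => P z i j) (c x) := fun i j =>
    contDiffAt_const.add (ContDiffAt.sum fun k _ => ContDiffAt.sum fun l _ =>
      ((hzk k).mul (hzk l)).mul contDiffAt_const)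
  have hP1 : P (c x) = 1 := by
    ext i j
    simp [P, q]
  have hqO : ∀ i j, (fun z => q i j z) =O[𝓝 (c x)] fun z => ‖z - c x‖ ^ 2 := fun i j => by
    refine Asymptotics.IsBigO.fun_sum fun k _ => Asymptotics.IsBigO.fun_sum fun l _ => ?_
    refine Asymptotics.IsBigO.of_bound
      ‖(-(1 / 2) * bilinPart (B i j) (Pi.single k 1) (Pi.single l 1))‖
      (Eventually.of_forall fun z => ?_)
    rw [norm_mul, norm_mul, norm_pow, norm_norm, mul_comm, sq]
    gcongr
    · exact norm_le_pi_norm (z - c x) k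
    · exact norm_le_pi_norm (z - c x) l
  have hH1 : H (c x) = 1 := (gramInChart_self e hx.1).trans hone
  have hTO : ∀ i j, (fun z => H z i j - (1 : Matrix (Fin r) (Fin r) ℂ) i j) =O[𝓝 (c x)]
      fun z => ‖z - c x‖ := fun i j => by
    have h1 := ((hHs i j).differentiableAt (by simp)).hasFDerivAt.isBigO_sub
    rw [hH1] at h1
    exact h1.norm_right
  have hle : (fun z => ‖z - c x‖ ^ 2) =O[𝓝 (c x)] fun z => ‖z - c x‖ := by
    have h3 : Tendsto (fun z => ‖z - c x‖) (𝓝 (c x)) (𝓝 0) := by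
      have h5 : Continuous fun z => ‖z - c x‖ := (continuous_id.sub continuous_const).norm
      simpa using h5.tendsto (c x)
    have h4 : (fun z => ‖z - c x‖ * ‖z - c x‖) =O[𝓝 (c x)] fun z => ‖z - c x‖ * 1 :=
      (Asymptotics.isBigO_refl _ _).mul (h3.isBigO_one ℝ)
    simpa [sq] using h4
  -- `V` is the deviation of `H Pᴴ` from the identity
  let V : (Fin n → ℂ) → Matrix (Fin r) (Fin r) ℂ := fun z => H z * (P z)ᴴ - 1
  have hPe : ∀ z, P z = 1 + Matrix.of fun i j => q i j z := fun z => rfl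
  have hconj : ∀ i j, (fun z => (starRingEnd ℂ) (q i j z)) =O[𝓝 (c x)] fun z => ‖z - c x‖ ^ 2 :=
    fun i j => (Asymptotics.isBigO_of_le _ fun z => (RCLike.norm_conj (q i j z)).le).trans (hqO i j)
  have hVO : ∀ i j, (fun z => V z i j) =O[𝓝 (c x)] fun z => ‖z - c x‖ := fun i j => by
    have h1 : (fun z => V z i j) = fun z => (H z i j - (1 : Matrix (Fin r) (Fin r) ℂ) i j) +
        ∑ k, H z i k * (starRingEnd ℂ) (q j k z) := by
      funext z
      simp only [V, hPe, Matrix.conjTranspose_add, Matrix.conjTranspose_one, Matrix.mul_add,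
        Matrix.mul_one, Matrix.sub_apply, Matrix.add_apply, Matrix.mul_apply,
        Matrix.conjTranspose_apply, Matrix.of_apply, Complex.star_def]
      ring
    rw [h1]
    refine (hTO i j).add (Asymptotics.IsBigO.fun_sum fun k _ => ?_)
    have h2 : (fun z => H z i k) =O[𝓝 (c x)] fun _ => (1 : ℝ) :=
      (hHs i k).continuousAt.isBigO_one ℝ
    simpa using h2.mul ((hconj j k).trans hle)
  have hmain : ∀ i j, (fun z => (P z * H z * (P z)ᴴ) i j -
      ((1 : Matrix (Fin r) (Fin r) ℂ) i j + leviPart (B i j) (z - c x) (z - c x))) =O[𝓝 (c x)]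
        fun z => ‖z - c x‖ ^ 3 := fun i j => by
    have h1 : ∀ z, P z * H z * (P z)ᴴ = 1 + (H z - 1) + Matrix.of (fun i j => q i j z) +
        (Matrix.of fun i j => q i j z)ᴴ +
        (H z - 1) * (Matrix.of fun i j => q i j z)ᴴ +
        (Matrix.of fun i j => q i j z) * V z := fun z => by
      simp only [V, hPe, Matrix.conjTranspose_add, Matrix.conjTranspose_one]
      noncomm_ring
    have h2 : (fun z => (P z * H z * (P z)ᴴ) i j -
        ((1 : Matrix (Fin r) (Fin r) ℂ) i j + leviPart (B i j) (z - c x) (z - c x))) =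
        fun z => (H z i j - H (c x) i j - (1 / 2 : ℝ) • B i j (z - c x) (z - c x)) +
          (∑ k, (H z i k - (1 : Matrix (Fin r) (Fin r) ℂ) i k) * (starRingEnd ℂ) (q j k z)) +
          ∑ k, q i k z * V z k j := by
      funext z
      rw [← half_sub_bilinPart (hBs i j) (hBc i j), h1, hH1]
      have h3 := hq i j z
      have h4 := congrArg (starRingEnd ℂ) (hq j i z)
      rw [map_neg] at h4
      simp only [Matrix.add_apply, Matrix.sub_apply, Matrix.mul_apply, Matrix.conjTranspose_apply,
        Matrix.of_apply, Complex.star_def]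
      linear_combination h3 + h4
    rw [h2]
    have h5 : ∀ z, ‖z - c x‖ ^ 3 = ‖z - c x‖ * ‖z - c x‖ ^ 2 := fun z => by ring
    have h6 : ∀ z, ‖z - c x‖ ^ 3 = ‖z - c x‖ ^ 2 * ‖z - c x‖ := fun z => by ring
    refine ((taylor_two_isBigO (hHs i j) (hD i j)).add ?_).add ?_
    · refine Asymptotics.IsBigO.fun_sum fun k _ => ?_
      simp only [h5]
      exact (hTO i k).mul (hconj j k)
    · refine Asymptotics.IsBigO.fun_sum fun k _ => ?_
      simp only [h6]
      exact (hqO i k).mul (hVO k j)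
  have hg := gramInChart_matAct (h := h) P e hx.1
  have hct : Tendsto c (𝓝 x) (𝓝 (c x)) := c.continuousAt (mem_chart_source _ x)
  refine ⟨fun i x' => matAct (P (c x')) (fun j => e j x') i,
    he.matAct hx hPs (by rw [hP1]; simp), matAct_adapted_one had hP1,
    fun k l i j => -leviPart (B i j) (Pi.single k 1) (Pi.single l 1), fun i j => ?_⟩
  refine ((hmain i j).comp_tendsto hct).congr' ?_ EventuallyEq.rfl
  filter_upwards [hct.eventually hg, c.open_source.mem_nhds (mem_chart_source _ x)] with x' h1 h2
  have h3 := gramInChart_self (h := h)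
    (fun i x' => matAct (P (c x')) (fun j => e j x') i) (x₀ := x) h2
  have h4 := congrFun (congrFun (h3.symm.trans h1) i) j
  have h5 : leviPart (B i j) (c x' - c x) (c x' - c x) = ∑ k, ∑ l,
      (c x' - c x) k * ((starRingEnd ℂ) ((c x' - c x) l) *
        leviPart (B i j) (Pi.single k 1) (Pi.single l 1)) := by
    refine (eq_sum_single (σ := id) (f := fun u => leviPart (B i j) u (c x' - c x))
      (fun u v => leviPart_add_left _ u v _) (fun a u => leviPart_smul_left _ a u _) _).trans ?_
    refine Finset.sum_congr rfl fun k _ => ?_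
    rw [← Finset.mul_sum]
    refine congrArg (fun t : ℂ => (c x' - c x) k * t) ?_
    exact eq_sum_single (σ := starRingEnd ℂ) (f := fun u => leviPart (B i j) (Pi.single k 1) u)
      (fun u v => leviPart_add_right _ _ u v) (fun a u => leviPart_smul_right _ a _ u) _
  refine (congrArg₂ (· - ·) h4.symm ?_)
  rw [h5, Matrix.one_apply, sub_eq_add_neg (G := ℂ), ← Finset.sum_neg_distrib]
  refine congrArg _ (Finset.sum_congr rfl fun k _ => ?_)
  rw [← Finset.sum_neg_distrib]
  refine Finset.sum_congr rfl fun l _ => ?_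
  ring

end NormalFrames

/-! ### Differentials of the flag coordinates -/

section CoordinateDerivatives
/-- The matrix `Q` with `e = Q g` for two frames `e` and `g`, in the chart of `X` at `x₀`. -/
def transMat (x₀ : X) (e g : Fin r → ∀ x, E x) (z : Fin n → ℂ) : Matrix (Fin r) (Fin r) ℂ :=
  frameCoords x₀ e ((baseChart x₀).symm z) *
    (frameCoords x₀ g ((baseChart x₀).symm z))⁻¹

theorem matAct_transMat {x₀ : X} {e g : Fin r → ∀ x, E x} {z : Fin n → ℂ}
    (hx : (baseChart x₀).symm z ∈ (trivializationAt (Fin r → ℂ) E x₀).baseSet)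
    (hg : IsHolFrameNear n g ((baseChart x₀).symm z)) :
    (fun i => e i ((baseChart x₀).symm z)) =
      matAct (transMat x₀ e g z) fun i => g i ((baseChart x₀).symm z) := by
  rw [matAct_frameCoords hx g, matAct_frameCoords hx e, ← matAct_mul, transMat, Matrix.mul_assoc,
    Matrix.nonsing_inv_mul _ (hg.isUnit_det hx), Matrix.mul_one]

variable [IsManifold 𝓘(ℂ, Fin n → ℂ) ω X]
  [ContMDiffVectorBundle ω (Fin r → ℂ) E 𝓘(ℂ, Fin n → ℂ)]

theorem contDiffAt_transMat {x₀ x : X} {e g : Fin r → ∀ x, E x} (he : IsHolFrameNear n e x)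
    (hg : IsHolFrameNear n g x) (hx : x ∈ baseDomain n r E x₀) (i j : Fin r) :
    ContDiffAt ℂ ω (fun z => transMat x₀ e g z i j) (baseChart x₀ x) :=
  contDiffAt_matrix_mul (he.contDiffAt_frameCoords hx)
    (contDiffAt_matrix_inv (hg.contDiffAt_frameCoords hx)
      (by rw [(baseChart x₀).left_inv hx.1]; exact (hg.isUnit_det hx.2).ne_zero)) i j

theorem isUnit_det_transMat {x₀ x : X} {e g : Fin r → ∀ x, E x} (he : IsHolFrameNear n e x)
    (hg : IsHolFrameNear n g x) (hx : x ∈ baseDomain n r E x₀) :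
    IsUnit (transMat x₀ e g (baseChart x₀ x)).det := by
  rw [transMat, (baseChart x₀).left_inv hx.1, Matrix.det_mul]
  exact (he.isUnit_det hx.2).mul (Matrix.isUnit_nonsing_inv_det _ (hg.isUnit_det hx.2))

variable (h : HermitianMetric n r E)

theorem gramInChart_transMat {x₀ x : X} (e : Fin r → ∀ x, E x) {g : Fin r → ∀ x, E x}
    (hg : IsHolFrameNear n g x) (hx : x ∈ baseDomain n r E x₀) :
    gramInChart h e x₀ =ᶠ[𝓝 (baseChart x₀ x)] fun z =>
      transMat x₀ e g z * gramInChart h g x₀ z * (transMat x₀ e g z)ᴴ := by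
  filter_upwards [eventually_chart_symm hx.1 hg.eventually, eventually_chart_symm hx.1
    ((trivializationAt (Fin r → ℂ) E x₀).open_baseSet.eventually_mem hx.2)] with z h1 h2
  refine Eq.trans ?_ (gramMat_matAct h _ _ _)
  rw [← matAct_transMat h2 h1]
  rfl

/-- The change of frame to a frame that is parallel at a point. -/
theorem dMat_transMat {x₀ x : X} {e g : Fin r → ∀ x, E x} (he : IsHolFrameNear n e x)
    (hg : IsHolFrameNear n g x) (hx : x ∈ baseDomain n r E x₀) {v : Fin n → ℂ}
    (hp : connMat (gramInChart h e x₀) (baseChart x₀ x) v = 0) :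
    dMat ℂ (transMat x₀ e g) (baseChart x₀ x) v =
      -(transMat x₀ e g (baseChart x₀ x) *
        connMat (gramInChart h g x₀) (baseChart x₀ x) v) := by
  have h1 := gramInChart_transMat h e hg hx
  obtain ⟨B, hB⟩ := hg.exists_basis
  refine dMat_of_parallel (fun i j => (contDiffAt_transMat he hg hx i j).differentiableAt (by simp))
    (fun i j => (contDiffAt_gramInChart hg hx i j).differentiableAt (by simp))
    (isUnit_det_transMat he hg hx) ?_ ?_
  · rw [gramInChart_self g hx.1]
    exact isUnit_det_gramMat h (hB ▸ B.linearIndependent)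
  · rw [← hp, connMat, connMat, dMat_congr h1, dMat_congr h1, h1.self_of_nhds]

variable {h}
variable {y₀ : FlagBundle n r E} {u : FlagModel n r} {e g : Fin r → ∀ x, E x}
  {ψ : FlagModel n r → PairIdx r → ℂ}

theorem tendsto_chart_symm_base (hu : u ∈ (flagChart y₀).target) :
    Tendsto (fun u' => ((flagChart y₀).symm u').base) (𝓝 u)
      (𝓝 ((flagChart y₀).symm u).base) :=
  (mdifferentiableAt_base _).continuousAt.tendsto.comp
    ((flagChart y₀).continuousAt_symm hu)

theorem chart_chart_symm_base (hu : u ∈ (flagChart y₀).target) :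
    baseChart y₀.base ((flagChart y₀).symm u).base = u.1 := by
  rw [chart_symm_base hu, (baseChart y₀.base).right_inv (mem_chart_target_iff.mp hu).1]

/-- Two frames that give the same flag differ by a lower triangular matrix. -/
theorem exists_lowerTri_transMat (hu : u ∈ (flagChart y₀).target)
    (he : IsHolFrameNear n e ((flagChart y₀).symm u).base)
    (had : Adapted (fun i => e i ((flagChart y₀).symm u).base)
      ((flagChart y₀).symm u).flag)
    (hg : IsHolFrameNear n g ((flagChart y₀).symm u).base) {ξ : PairIdx r → ℂ}
    (hξ : Adapted (tildeFrame (fun i => g i ((flagChart y₀).symm u).base) ξ)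
      ((flagChart y₀).symm u).flag) :
    ∃ L, LowerTri L ∧ IsUnit L.det ∧ transMat y₀.base e g u.1 = L * unipotent ξ ∧
      (fun i => e i ((flagChart y₀).symm u).base) =
        matAct L (tildeFrame (fun i => g i ((flagChart y₀).symm u).base) ξ) := by
  obtain ⟨L, hL, hLe⟩ := had.exists_lowerTri hξ
  obtain ⟨B, hB⟩ := he.exists_basis
  have h0 := chart_symm_base hu
  have hLd : IsUnit L.det := isUnit_det_of_matAct (w := tildeFrame _ ξ)
    (by rw [← hLe, ← hB]; exact B.linearIndependent)
  refine ⟨L, hL, hLd, ?_, hLe⟩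
  have h1 := hLe
  rw [tildeFrame_eq_matAct, ← matAct_mul] at h1
  have hm := (mem_chart_target_iff.mp hu).2
  rw [h0] at h1 hg
  obtain ⟨C, hC⟩ := hg.exists_basis
  refine matAct_injective (w := fun i => g i ((baseChart y₀.base).symm u.1))
    (hC ▸ C.linearIndependent) ((matAct_transMat hm hg).symm.trans h1)

theorem transMat_inv {x₀ x : X} {e g : Fin r → ∀ x, E x} (hg : IsHolFrameNear n g x)
    (hx : x ∈ baseDomain n r E x₀) :
    transMat x₀ g e (baseChart x₀ x) = (transMat x₀ e g (baseChart x₀ x))⁻¹ := by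
  rw [transMat, transMat, (baseChart x₀).left_inv hx.1, Matrix.mul_inv_rev,
    Matrix.nonsing_inv_nonsing_inv _ (hg.isUnit_det hx.2)]

/-- The coordinates given by a frame in terms of those given by another frame. -/
theorem eventually_flagCoord (hu : u ∈ (flagChart y₀).target)
    (he : IsHolFrameNear n e ((flagChart y₀).symm u).base)
    (had : Adapted (fun i => e i ((flagChart y₀).symm u).base)
      ((flagChart y₀).symm u).flag)
    (hg : IsHolFrameNear n g ((flagChart y₀).symm u).base)
    (hψ : ContinuousAt ψ u)
    (hψa : ∀ᶠ u' in 𝓝 u, Adapted (tildeFrame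
      (fun i => g i ((flagChart y₀).symm u').base) (ψ u'))
      ((flagChart y₀).symm u').flag) :
    ∀ᶠ u' in 𝓝 u, flagCoord (fun i => e i ((flagChart y₀).symm u').base)
        ((flagChart y₀).symm u').flag =
      blockCoord (unipotent (ψ u') * transMat y₀.base g e u'.1) ∧
      Adapted (tildeFrame (fun i => e i ((flagChart y₀).symm u').base)
        (flagCoord (fun i => e i ((flagChart y₀).symm u').base)
          ((flagChart y₀).symm u').flag))
        ((flagChart y₀).symm u').flag := by
  set φ := flagChart y₀ with hφ
  have hx := chart_symm_mem hu
  have hcx := chart_chart_symm_base hu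
  obtain ⟨L, hL, hLd, hLQ, -⟩ := exists_lowerTri_transMat hu he had hg hψa.self_of_nhds
  have hA : unipotent (ψ u) * transMat y₀.base g e u.1 = L⁻¹ := by
    rw [← hcx, transMat_inv hg hx, hcx, hLQ, Matrix.mul_inv_rev,
      Matrix.mul_nonsing_inv_cancel_left _ _ (isUnit_det_unipotent _)]
  have hcont : ∀ i j, ContinuousAt (fun u' : FlagModel n r =>
      (unipotent (ψ u') * transMat y₀.base g e u'.1) i j) u := fun i j => by
    have h1 : ∀ i j, ContinuousAt (fun u' => unipotent (ψ u') i j) u := fun i j => by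
      simp only [unipotent_apply]
      split_ifs
      · exact continuousAt_const
      · exact (continuous_apply _).continuousAt.comp hψ
      · exact continuousAt_const
    have h2 : ∀ i j, ContinuousAt (fun u' : FlagModel n r => transMat y₀.base g e u'.1 i j) u :=
      fun i j => by
        have h3 := (contDiffAt_transMat hg he hx i j).continuousAt
        rw [hcx] at h3
        exact ContinuousAt.comp (f := Prod.fst) (g := fun z => transMat y₀.base g e z i j) h3
          continuousAt_fst
    simp only [Matrix.mul_apply]
    exact tendsto_finsetSum _ fun k _ => (h1 i k).mul (h2 k j)
  -- the minors are different from zero near `u`, since they are so for the triangular matrix at `u`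
  have hdet : ∀ᶠ u' in 𝓝 u, ∀ k,
      (leadBlock (unipotent (ψ u') * transMat y₀.base g e u'.1) k).det ≠ 0 := by
    rw [eventually_all]
    intro k
    refine ContinuousAt.eventually_ne ?_ ?_
    · simp only [Matrix.det_apply, leadBlock, Matrix.submatrix_apply]
      refine tendsto_finsetSum _ fun σ _ => Tendsto.const_smul ?_ _
      exact tendsto_finsetProd _ fun i _ => hcont _ _
    · rw [hA]
      exact det_leadBlock_ne_zero (hL.inv hLd) (Matrix.isUnit_nonsing_inv_det _ hLd) k
  have htb := tendsto_chart_symm_base hu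
  filter_upwards [hψa, hdet, φ.open_target.mem_nhds hu, htb.eventually he.eventually,
    htb.eventually hg.eventually] with u' h1 h2 h3 h4 h5
  have h6 := chart_symm_base h3
  have h7 : transMat y₀.base g e u'.1 = frameCoords y₀.base g (φ.symm u').base *
      (frameCoords y₀.base e (φ.symm u').base)⁻¹ := by
    rw [transMat, ← h6]
  rw [h7] at h2 ⊢
  exact flagCoord_eq_blockCoord (chart_symm_mem h3).2 h4 h5 h1 h2

theorem contDiffAt_unipotent_mul_transMat (hu : u ∈ (flagChart y₀).target)
    (he : IsHolFrameNear n e ((flagChart y₀).symm u).base)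
    (hg : IsHolFrameNear n g ((flagChart y₀).symm u).base) {m : ℕ∞ω}
    (hψ : ContDiffAt ℂ m ψ u) (i j : Fin r) :
    ContDiffAt ℂ m (fun u' : FlagModel n r =>
      (unipotent (ψ u') * transMat y₀.base g e u'.1) i j) u := by
  refine contDiffAt_matrix_mul (contDiffAt_unipotent hψ) (fun i j => ?_) i j
  have h3 := contDiffAt_transMat hg he (chart_symm_mem hu) i j
  rw [chart_chart_symm_base hu] at h3
  exact (ContDiffAt.comp (f := Prod.fst) (g := fun z => transMat y₀.base g e z i j) u h3
    contDiffAt_fst).of_le le_top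

theorem contDiffAt_flagCoord (hu : u ∈ (flagChart y₀).target)
    (he : IsHolFrameNear n e ((flagChart y₀).symm u).base)
    (had : Adapted (fun i => e i ((flagChart y₀).symm u).base)
      ((flagChart y₀).symm u).flag) :
    ContDiffAt ℂ ω (fun u' => flagCoord (fun i => e i ((flagChart y₀).symm u').base)
      ((flagChart y₀).symm u').flag) u := by
  have hg := isHolFrameNear_chartFrame (chart_symm_mem hu)
  have hψa : ∀ᶠ u' in 𝓝 u, Adapted (tildeFrame (fun i => chartFrame y₀ i
      ((flagChart y₀).symm u').base) u'.2) ((flagChart y₀).symm u').flag := by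
    filter_upwards [(flagChart y₀).open_target.mem_nhds hu] with u' h1
    exact chart_symm_adapted h1
  obtain ⟨L, hL, hLd, hLQ, -⟩ := exists_lowerTri_transMat hu he had hg hψa.self_of_nhds
  have hcx := chart_chart_symm_base hu
  have hA : unipotent u.2 * transMat y₀.base (chartFrame y₀) e u.1 = L⁻¹ := by
    rw [← hcx, transMat_inv hg (chart_symm_mem hu), hcx, hLQ, Matrix.mul_inv_rev,
      Matrix.mul_nonsing_inv_cancel_left _ _ (isUnit_det_unipotent _)]
  refine (contDiffAt_blockCoord (contDiffAt_unipotent_mul_transMat (ψ := Prod.snd) hu he hg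
    contDiffAt_snd) fun k => ?_).congr_of_eventuallyEq
    ((eventually_flagCoord (ψ := Prod.snd) hu he had hg continuousAt_snd hψa).mono fun u' h => h.1)
  rw [hA]
  exact det_leadBlock_ne_zero (hL.inv hLd) (Matrix.isUnit_nonsing_inv_det _ hLd) k

/-- The differential of the coordinates given by a frame, in terms of arbitrary coordinates. -/
theorem coordDeriv_chart_symm (hu : u ∈ (flagChart y₀).target)
    (he : IsHolFrameNear n e ((flagChart y₀).symm u).base)
    (had : Adapted (fun i => e i ((flagChart y₀).symm u).base)
      ((flagChart y₀).symm u).flag)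
    (hg : IsHolFrameNear n g ((flagChart y₀).symm u).base)
    (hψ : ContDiffAt ℂ 1 ψ u)
    (hψa : ∀ᶠ u' in 𝓝 u, Adapted (tildeFrame
      (fun i => g i ((flagChart y₀).symm u').base) (ψ u'))
      ((flagChart y₀).symm u').flag) {L : Matrix (Fin r) (Fin r) ℂ}
    (hL : LowerTri L) (hLd : IsUnit L.det) (hLQ : transMat y₀.base e g u.1 = L * unipotent (ψ u))
    (p : PairIdx r) (v : FlagModel n r) :
    coordDeriv e ((flagChart y₀).symm u) p
      (mfderiv 𝓘(ℂ, FlagModel n r) 𝓘(ℂ, FlagModel n r) (flagChart y₀).symm u v) =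
    (L * strictUpper (fderiv ℂ ψ u v) * ((unipotent (ψ u))⁻¹ * L⁻¹) -
      dMat ℂ (transMat y₀.base e g) u.1 v.1 * (transMat y₀.base e g u.1)⁻¹) p.1.1 p.1.2 := by
  set φ := flagChart y₀ with hφ
  have hx := chart_symm_mem hu
  have hcx := chart_chart_symm_base hu
  have hev := eventually_flagCoord hu he had hg hψ.continuousAt hψa
  have hU := isUnit_det_unipotent (ψ u)
  have hA : unipotent (ψ u) * transMat y₀.base g e u.1 = L⁻¹ := by
    rw [← hcx, transMat_inv hg hx, hcx, hLQ, Matrix.mul_inv_rev,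
      Matrix.mul_nonsing_inv_cancel_left _ _ hU]
  have hAs := contDiffAt_unipotent_mul_transMat hu he hg hψ
  have hLi := hL.inv hLd
  have hd := hasFDerivAt_blockCoord hAs
    (fun i j => ((hAs i j).differentiableAt (by simp)).hasFDerivAt)
    (by rw [hA]; exact hLi) (by rw [hA]; exact Matrix.isUnit_nonsing_inv_det _ hLd) p
  have hf : (fun u' => flagCoord (fun i => e i (φ.symm u').base) (φ.symm u').flag p) =ᶠ[𝓝 u]
      fun u' => blockCoord (unipotent (ψ u') * transMat y₀.base g e u'.1) p :=
    hev.mono fun u' h => congrFun h.1 p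
  have h1 := hd.congr_of_eventuallyEq hf
  have h2 := mfderiv_comp_chart_symm (y₀ := y₀)
    (f := fun y' : FlagBundle n r E => flagCoord (fun i => e i y'.base) y'.flag p) hu
    h1.differentiableAt
  have h3 := DFunLike.congr_fun h2 v
  refine h3.trans ?_
  rw [h1.fderiv]
  -- the derivative of the product of the two matrices
  have hQe : transMat y₀.base g e u.1 = (transMat y₀.base e g u.1)⁻¹ := by
    rw [← hcx, transMat_inv hg hx]
  have hT : ∀ i j, ContDiffAt ℂ ω (fun z => transMat y₀.base e g z i j) u.1 := by
    have := contDiffAt_transMat he hg hx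
    rwa [hcx] at this
  have hTd : (transMat y₀.base e g u.1).det ≠ 0 := by
    have := isUnit_det_transMat he hg hx
    rw [hcx] at this
    exact this.ne_zero
  have hinv : (fun z => transMat y₀.base g e z) =ᶠ[𝓝 u.1] fun z => (transMat y₀.base e g z)⁻¹ := by
    have h4 := eventually_chart_symm hx.1 hg.eventually
    have h5 := eventually_chart_symm hx.1
      ((trivializationAt (Fin r → ℂ) E y₀.base).open_baseSet.eventually_mem hx.2)
    rw [hcx] at h4 h5
    filter_upwards [h4, h5] with z h6 h7
    rw [transMat, transMat, Matrix.mul_inv_rev, Matrix.nonsing_inv_nonsing_inv _ (h6.isUnit_det h7)]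
  have hdT := (dMat_congr (𝕜 := ℂ) hinv v.1).trans
    (dMat_inv (fun i j => (hT i j).of_le (by simp)) hTd v.1)
  have hTg : ∀ i j, DifferentiableAt ℂ (fun z => transMat y₀.base g e z i j) u.1 := by
    have := contDiffAt_transMat hg he hx
    rw [hcx] at this
    exact fun i j => (this i j).differentiableAt (by simp)
  have hdT2 : dMat ℂ (fun u' : FlagModel n r => transMat y₀.base g e u'.1) u v =
      dMat ℂ (transMat y₀.base g e) u.1 v.1 := by
    ext i j
    have h4 := (hTg i j).hasFDerivAt.comp u (hasFDerivAt_fst (𝕜 := ℂ) (p := u))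
    exact DFunLike.congr_fun h4.fderiv v
  have hdA : dMat ℂ (fun u' : FlagModel n r => unipotent (ψ u') * transMat y₀.base g e u'.1) u v =
      strictUpper (fderiv ℂ ψ u v) * (transMat y₀.base e g u.1)⁻¹ -
        L⁻¹ * dMat ℂ (transMat y₀.base e g) u.1 v.1 * (transMat y₀.base e g u.1)⁻¹ := by
    have h5 : ∀ i j, DifferentiableAt ℂ (fun u' : FlagModel n r => transMat y₀.base g e u'.1 i j) u :=
      fun i j => (hTg i j).comp u differentiableAt_fst
    rw [dMat_mul (fun i j => differentiableAt_unipotent (hψ.differentiableAt (by simp)) i j) h5,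
      dMat_unipotent
      (hψ.differentiableAt (by simp)), hdT2, hdT, hQe, Matrix.mul_neg, ← sub_eq_add_neg, ← hA, hQe]
    simp only [Matrix.mul_assoc]
  have h8 : (∑ k, (unipotent (ψ u) * transMat y₀.base g e u.1)⁻¹ p.1.1 k • fderiv ℂ
      (fun u' : FlagModel n r => (unipotent (ψ u') * transMat y₀.base g e u'.1) k p.1.2) u) v =
      (L * dMat ℂ (fun u' : FlagModel n r => unipotent (ψ u') * transMat y₀.base g e u'.1) u v)
        p.1.1 p.1.2 := by
    rw [hA, Matrix.nonsing_inv_nonsing_inv _ hLd, sum_apply, Matrix.mul_apply]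
    rfl
  refine h8.trans ?_
  rw [hdA, Matrix.mul_sub, ← Matrix.mul_assoc L, ← Matrix.mul_assoc L, ← Matrix.mul_assoc L,
    Matrix.mul_nonsing_inv _ hLd, Matrix.one_mul, hLQ, Matrix.mul_inv_rev]

/-- The differential of the coordinates given by a frame that is parallel at the point. -/
theorem coordDeriv_chart_symm_of_parallel (hu : u ∈ (flagChart y₀).target)
    (he : IsHolFrameNear n e ((flagChart y₀).symm u).base)
    (had : Adapted (fun i => e i ((flagChart y₀).symm u).base)
      ((flagChart y₀).symm u).flag)
    (hg : IsHolFrameNear n g ((flagChart y₀).symm u).base)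
    (hψ : ContDiffAt ℂ 1 ψ u)
    (hψa : ∀ᶠ u' in 𝓝 u, Adapted (tildeFrame
      (fun i => g i ((flagChart y₀).symm u').base) (ψ u'))
      ((flagChart y₀).symm u').flag) {L : Matrix (Fin r) (Fin r) ℂ}
    (hL : LowerTri L) (hLd : IsUnit L.det) (hLQ : transMat y₀.base e g u.1 = L * unipotent (ψ u))
    (hp : ∀ v, connMat (gramInChart h e y₀.base) u.1 v = 0)
    (p : PairIdx r) (v : FlagModel n r) :
    coordDeriv e ((flagChart y₀).symm u) p
      (mfderiv 𝓘(ℂ, FlagModel n r) 𝓘(ℂ, FlagModel n r) (flagChart y₀).symm u v) =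
    (L * (strictUpper (fderiv ℂ ψ u v) * (unipotent (ψ u))⁻¹ + unipotent (ψ u) *
      connMat (gramInChart h g y₀.base) u.1 v.1 * (unipotent (ψ u))⁻¹) * L⁻¹) p.1.1 p.1.2 := by
  have hcx := chart_chart_symm_base hu
  rw [coordDeriv_chart_symm hu he had hg hψ hψa hL hLd hLQ]
  have h1 := dMat_transMat h he hg (chart_symm_mem hu) (v := v.1) (by rw [hcx]; exact hp v.1)
  rw [hcx] at h1
  rw [h1, hLQ, Matrix.mul_inv_rev]
  noncomm_ring
end CoordinateDerivatives

section Triangular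
/-- The part above the diagonal of `X M Y` depends only on that of `M` if `X` and `Y` are lower
triangular. -/
theorem conjUpper_upperPart {X Y : Matrix (Fin r) (Fin r) ℂ} (hX : LowerTri X) (hY : LowerTri Y)
    (M : Matrix (Fin r) (Fin r) ℂ) : conjUpper X Y (upperPart M) = upperPart (X * M * Y) := by
  rw [conjUpper_apply]
  ext p
  simp only [upperPart, Matrix.mul_apply]
  refine Finset.sum_congr rfl fun l _ => ?_
  by_cases hl : p.1.2 ≤ l
  · congr 1
    refine Finset.sum_congr rfl fun k _ => ?_
    by_cases hk : k ≤ p.1.1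
    · rw [strictUpper, dif_pos (lt_of_le_of_lt hk (lt_of_lt_of_le p.2 hl))]
      rfl
    · rw [hX.apply (not_le.mp hk), zero_mul, zero_mul]
  · rw [hY.apply (not_le.mp hl), mul_zero, mul_zero]

theorem unipotent_upper (ξ : PairIdx r → ℂ) : (unipotent ξ).BlockTriangular id := by
  intro i j hij
  have : ¬ i < j := not_lt.mpr (le_of_lt hij)
  simp [unipotent_apply, (show j < i from hij).ne', this]

theorem unipotent_inv_upper (ξ : PairIdx r → ℂ) : ((unipotent ξ)⁻¹).BlockTriangular id := by
  have := (unipotent ξ).invertibleOfIsUnitDet (isUnit_det_unipotent ξ)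
  exact Matrix.blockTriangular_inv_of_blockTriangular (unipotent_upper ξ)

theorem unipotent_inv_diag (ξ : PairIdx r → ℂ) (i : Fin r) : (unipotent ξ)⁻¹ i i = 1 := by
  have h := congrFun (congrFun (Matrix.nonsing_inv_mul _ (isUnit_det_unipotent ξ)) i) i
  rw [Matrix.mul_apply, Finset.sum_eq_single i, Matrix.one_apply_eq] at h
  · simpa [unipotent_apply] using h
  · intro j _ hj
    rcases lt_or_gt_of_ne hj with h1 | h1
    · rw [unipotent_inv_upper ξ h1, zero_mul]
    · rw [unipotent_upper ξ h1, mul_zero]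
  · simp

theorem det_conjUpper_unipotent_inv (ξ : PairIdx r → ℂ) :
    LinearMap.det (conjUpper 1 (unipotent ξ)⁻¹ : (PairIdx r → ℂ) →ₗ[ℂ] (PairIdx r → ℂ)) = 1 := by
  rw [det_conjUpper_one_upper (unipotent_inv_upper ξ)]
  simp [unipotent_inv_diag]

theorem det_conjUpper_inv {L : Matrix (Fin r) (Fin r) ℂ} (hL : LowerTri L) (hLd : IsUnit L.det) :
    LinearMap.det (conjUpper L L⁻¹ : (PairIdx r → ℂ) →ₗ[ℂ] (PairIdx r → ℂ)) =
      ∏ p : PairIdx r, L p.1.1 p.1.1 * (L p.1.2 p.1.2)⁻¹ := by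
  rw [det_conjUpper_of_lower hL (hL.inv hLd)]
  simp only [hL.inv_diag hLd]

theorem det_conjUpper_inv_ne_zero {L : Matrix (Fin r) (Fin r) ℂ} (hL : LowerTri L)
    (hLd : IsUnit L.det) :
    LinearMap.det (conjUpper L L⁻¹ : (PairIdx r → ℂ) →ₗ[ℂ] (PairIdx r → ℂ)) ≠ 0 := by
  rw [det_conjUpper_inv hL hLd]
  exact Finset.prod_ne_zero_iff.mpr fun p _ =>
    mul_ne_zero (hL.diag_ne_zero hLd _) (inv_ne_zero (hL.diag_ne_zero hLd _))

theorem conjUpper_injective {X Y : Matrix (Fin r) (Fin r) ℂ}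
    (hd : LinearMap.det (conjUpper X Y : (PairIdx r → ℂ) →ₗ[ℂ] (PairIdx r → ℂ)) ≠ 0)
    {N : PairIdx r → ℂ} (h : conjUpper X Y N = 0) : N = 0 := by
  have h1 := (LinearMap.equivOfDetNeZero _ hd).injective
  exact h1 (h.trans (map_zero _).symm)

end Triangular

/-! ### Horizontal and vertical tangent vectors -/

section Splitting
/-- The holomorphic frame `e` of `E` near the base point of `y` gives the flag `y` there. -/
def IsAdaptedFrame (e : Fin r → ∀ x, E x) (y : FlagBundle n r E) : Prop :=
  IsHolFrameNear n e y.base ∧ Adapted (fun i => e i y.base) y.flag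

variable {h : HermitianMetric n r E}

theorem IsNormalFrame.isAdaptedFrame {e : Fin r → ∀ x, E x} {y : FlagBundle n r E}
    (he : IsNormalFrame h e y) : IsAdaptedFrame e y := ⟨he.1, he.2.1⟩

variable [IsManifold 𝓘(ℂ, Fin n → ℂ) ω X]
  [ContMDiffVectorBundle ω (Fin r → ℂ) E 𝓘(ℂ, Fin n → ℂ)]

/-- The differential at `y` of the flag coordinates given by a frame. -/
def coordMap (e : Fin r → ∀ x, E x) (y : FlagBundle n r E) :
    TangentSpace 𝓘(ℂ, FlagModel n r) y →L[ℂ] (PairIdx r → ℂ) :=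
  ContinuousLinearMap.pi (coordDeriv e y)

/-- The flag coordinates given by the frame `e`, in the preferred chart at `y₀`. -/
def flagCoordChart (e : Fin r → ∀ x, E x) (y₀ : FlagBundle n r E) (u : FlagModel n r) :
    PairIdx r → ℂ :=
  flagCoord (fun i => e i ((flagChart y₀).symm u).base)
    ((flagChart y₀).symm u).flag

variable {e e' : Fin r → ∀ x, E x} {y : FlagBundle n r E}

theorem IsAdaptedFrame.chart_symm (he : IsAdaptedFrame e y) :
    IsAdaptedFrame e ((flagChart y).symm (flagChart y y)) := by
  rw [(flagChart y).left_inv (mem_chart_source _ y)]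
  exact he

theorem IsAdaptedFrame.contDiffAt_flagCoordChart (he : IsAdaptedFrame e y) :
    ContDiffAt ℂ ω (flagCoordChart e y) (flagChart y y) :=
  contDiffAt_flagCoord (chart_self_mem_target y) he.chart_symm.1 he.chart_symm.2

theorem IsAdaptedFrame.flagCoord_eq_zero (he : IsAdaptedFrame e y) :
    flagCoord (fun i => e i y.base) y.flag = 0 := by
  obtain ⟨B, hB⟩ := he.1.exists_basis
  have h1 := he.2
  rw [← hB, ← tildeFrame_zero B] at h1
  rw [← hB]
  exact flagCoord_eq B h1

theorem IsAdaptedFrame.flagCoordChart_self (he : IsAdaptedFrame e y) :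
    flagCoordChart e y (flagChart y y) = 0 :=
  he.chart_symm.flagCoord_eq_zero

theorem eventually_adapted_chart (hu : u ∈ (flagChart y).target) :
    ∀ᶠ u' in 𝓝 u, Adapted (tildeFrame (fun i => chartFrame y i
      ((flagChart y).symm u').base) u'.2) ((flagChart y).symm u').flag := by
  filter_upwards [(flagChart y).open_target.mem_nhds hu] with u' h1
  exact chart_symm_adapted h1

theorem IsAdaptedFrame.eventually_adapted (he : IsAdaptedFrame e y) :
    ∀ᶠ u in 𝓝 (flagChart y y), Adapted (tildeFrame
      (fun i => e i ((flagChart y).symm u).base) (flagCoordChart e y u))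
      ((flagChart y).symm u).flag :=
  (eventually_flagCoord (ψ := Prod.snd) (chart_self_mem_target y) he.chart_symm.1 he.chart_symm.2
    (isHolFrameNear_chartFrame (chart_symm_mem (chart_self_mem_target y))) continuousAt_snd
    (eventually_adapted_chart (chart_self_mem_target y))).mono fun _ h => h.2

theorem coordMap_eq (he : IsAdaptedFrame e y) (v : FlagModel n r) :
    coordMap e y v = fderiv ℂ (flagCoordChart e y) (flagChart y y) v := by
  funext p
  have h1 := he.contDiffAt_flagCoordChart.differentiableAt (by simp)
  have h2 : DifferentiableAt ℂ (fun u => flagCoordChart e y u p) (flagChart y y) :=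
    differentiableAt_pi.mp h1 p
  have h3 := mfderiv_eq_fderiv_chart (f := fun y' : FlagBundle n r E =>
    flagCoord (fun i => e i y'.base) y'.flag p) y h2
  have h4 := (hasFDerivAt_pi'.mp h1.hasFDerivAt p).fderiv
  have h5 := DFunLike.congr_fun (h3.trans h4) v
  exact h5

/-- The same differential computed at the centre of the preferred chart as at any other point. -/
theorem coordMap_chart_symm (he : IsAdaptedFrame e y) (v : FlagModel n r) (p : PairIdx r) :
    coordMap e y v p = coordDeriv e ((flagChart y).symm (flagChart y y)) p
      (mfderiv 𝓘(ℂ, FlagModel n r) 𝓘(ℂ, FlagModel n r) (flagChart y).symm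
        (flagChart y y) v) := by
  have h1 := he.contDiffAt_flagCoordChart.differentiableAt (by simp)
  have h2 : DifferentiableAt ℂ (fun u => flagCoordChart e y u p) (flagChart y y) :=
    differentiableAt_pi.mp h1 p
  have h3 := mfderiv_comp_chart_symm (f := fun y' : FlagBundle n r E =>
    flagCoord (fun i => e i y'.base) y'.flag p) (chart_self_mem_target y) h2
  have h4 := (hasFDerivAt_pi'.mp h1.hasFDerivAt p).fderiv
  rw [coordMap_eq he]
  exact (DFunLike.congr_fun (h3.trans h4) v).symm

theorem chart_self_base : baseChart y.base y.base = (flagChart y y).1 := by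
  rw [chart_apply_self]

/-- The differentials of the coordinates given by two frames that are parallel at the point. -/
theorem exists_coordMap_eq (he : IsAdaptedFrame e y) (he' : IsAdaptedFrame e' y)
    (hp : ∀ v, connMat (gramInChart h e y.base) (baseChart y.base y.base) v = 0)
    (hp' : ∀ v, connMat (gramInChart h e' y.base) (baseChart y.base y.base) v = 0) :
    ∃ L, LowerTri L ∧ IsUnit L.det ∧ (fun i => e i y.base) = matAct L (fun i => e' i y.base) ∧
      ∀ v, coordMap e y v = conjUpper L L⁻¹ (coordMap e' y v) := by
  have hu := chart_self_mem_target y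
  have had := he'.eventually_adapted
  obtain ⟨L, hL, hLd, hLQ, hLe⟩ := exists_lowerTri_transMat hu he.chart_symm.1 he.chart_symm.2
    he'.chart_symm.1 had.self_of_nhds
  rw [he'.flagCoordChart_self, tildeFrame_zero, (flagChart y).left_inv
    (mem_chart_source _ y)] at hLe
  refine ⟨L, hL, hLd, hLe, fun v => ?_⟩
  funext p
  rw [chart_self_base] at hp hp'
  refine (coordMap_chart_symm he v p).trans ?_
  refine (coordDeriv_chart_symm_of_parallel hu he.chart_symm.1 he.chart_symm.2 he'.chart_symm.1
    (he'.contDiffAt_flagCoordChart.of_le le_top) had hL hLd hLQ hp p v).trans ?_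
  refine Eq.trans ?_ (congrFun (congrArg (conjUpper L L⁻¹) (coordMap_eq he' v).symm) p)
  rw [hp', he'.flagCoordChart_self, unipotent_zero, conjUpper_apply]
  simp [upperPart]

/-- The differential of the coordinates given by a frame, on vertical tangent vectors. -/
theorem coordDeriv_vertical {y₀ : FlagBundle n r E} {u : FlagModel n r}
    (hu : u ∈ (flagChart y₀).target)
    (he : IsAdaptedFrame e ((flagChart y₀).symm u)) {L : Matrix (Fin r) (Fin r) ℂ}
    (hL : LowerTri L) (hLd : IsUnit L.det)
    (hLQ : transMat y₀.base e (chartFrame y₀) u.1 = L * unipotent u.2) {v : FlagModel n r}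
    (hv : v.1 = 0) :
    coordMap e ((flagChart y₀).symm u)
      (mfderiv 𝓘(ℂ, FlagModel n r) 𝓘(ℂ, FlagModel n r) (flagChart y₀).symm u v) =
    conjUpper L L⁻¹ (conjUpper 1 (unipotent u.2)⁻¹ v.2) := by
  funext p
  have h1 := coordDeriv_chart_symm (ψ := Prod.snd) hu he.1 he.2
    (isHolFrameNear_chartFrame (chart_symm_mem hu)) contDiffAt_snd (eventually_adapted_chart hu)
    hL hLd hLQ p v
  refine h1.trans ?_
  have h2 : dMat ℂ (transMat y₀.base e (chartFrame y₀)) u.1 v.1 = 0 := by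
    rw [hv]
    ext i j
    simp [dMat]
  rw [h2, conjUpper_apply 1, Matrix.one_mul, conjUpper_upperPart hL (hL.inv hLd), fderiv_snd]
  simp [upperPart, Matrix.mul_assoc]

/-- The base point and the flag coordinates determine a tangent vector. -/
theorem coordMap_injective (he : IsAdaptedFrame e y) {v : TangentSpace 𝓘(ℂ, FlagModel n r) y}
    (h1 : projDeriv y v = 0) (h2 : coordMap e y v = 0) : v = 0 := by
  have hu := chart_self_mem_target y
  have hv : Prod.fst (α := Fin n → ℂ) (β := PairIdx r → ℂ) v = 0 :=
    (projDeriv_apply y v).symm.trans h1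
  obtain ⟨L, hL, hLd, hLQ, -⟩ := exists_lowerTri_transMat hu he.chart_symm.1 he.chart_symm.2
    (isHolFrameNear_chartFrame (chart_symm_mem hu)) (chart_symm_adapted hu)
  have h3 := coordDeriv_vertical hu he.chart_symm hL hLd hLQ hv
  have h4 : coordMap e y v = _ := (funext fun p => coordMap_chart_symm he v p).trans h3
  have h5 := conjUpper_injective (det_conjUpper_inv_ne_zero hL hLd) (h4.symm.trans h2)
  have h6 := conjUpper_injective (by rw [det_conjUpper_unipotent_inv]; exact one_ne_zero) h5
  exact Prod.ext hv h6

/-- The differentials of the base point and of the flag coordinates. -/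
def coordEquiv (he : IsAdaptedFrame e y) :
    TangentSpace 𝓘(ℂ, FlagModel n r) y ≃ₗ[ℂ] FlagModel n r :=
  LinearEquiv.ofBijective
    (LinearMap.prod (projDeriv y).toLinearMap (coordMap e y).toLinearMap : _ →ₗ[ℂ] FlagModel n r) (by
    have h1 : Function.Injective (LinearMap.prod (projDeriv y).toLinearMap
        (coordMap e y).toLinearMap : _ →ₗ[ℂ] FlagModel n r) := by
      rw [injective_iff_map_eq_zero]
      intro v hv
      exact coordMap_injective he (congrArg Prod.fst hv) (congrArg Prod.snd hv)
    exact ⟨h1, (LinearMap.injective_iff_surjective (K := ℂ) (V := FlagModel n r)).mp h1⟩)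

theorem coordEquiv_apply (he : IsAdaptedFrame e y) (v : TangentSpace 𝓘(ℂ, FlagModel n r) y) :
    coordEquiv he v = (projDeriv y v, coordMap e y v) := rfl

theorem mfderiv_comp_section {F : Type*} [NormedAddCommGroup F] [NormedSpace ℂ F] {Z : Type*}
    [TopologicalSpace Z] [ChartedSpace F Z] {f : FlagBundle n r E → Z} {s : X → FlagBundle n r E} {x : X} (hs : s x = y)
    (hf : MDifferentiableAt 𝓘(ℂ, FlagModel n r) 𝓘(ℂ, F) f y)
    (hsd : MDifferentiableAt 𝓘(ℂ, Fin n → ℂ) 𝓘(ℂ, FlagModel n r) s x)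
    (w : Fin n → ℂ) :
    mfderiv 𝓘(ℂ, FlagModel n r) 𝓘(ℂ, F) f y (mfderiv 𝓘(ℂ, Fin n → ℂ) 𝓘(ℂ, FlagModel n r) s x w) =
      mfderiv 𝓘(ℂ, Fin n → ℂ) 𝓘(ℂ, F) (f ∘ s) x w := by
  subst hs
  exact (mfderiv_comp_apply x hf hsd w).symm

theorem mdifferentiableAt_flagCoord (he : IsAdaptedFrame e y) (p : PairIdx r) :
    MDifferentiableAt 𝓘(ℂ, FlagModel n r) 𝓘(ℂ, ℂ)
      (fun y' : FlagBundle n r E => flagCoord (fun i => e i y'.base) y'.flag p) y :=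
  (mdifferentiableAt_iff_chart (mem_chart_source _ y)).mpr
    (differentiableAt_pi.mp (he.contDiffAt_flagCoordChart.differentiableAt (by simp)) p)

theorem coordMap_section {s : X → FlagBundle n r E} (he : IsAdaptedFrame e y) (hs : s y.base = y)
    (hsd : MDifferentiableAt 𝓘(ℂ, Fin n → ℂ) 𝓘(ℂ, FlagModel n r) s y.base)
    (hse : ∀ᶠ x in 𝓝 y.base, IsAdaptedFrame e (s x)) (w : Fin n → ℂ) :
    coordMap e y (mfderiv 𝓘(ℂ, Fin n → ℂ) 𝓘(ℂ, FlagModel n r) s y.base w) = 0 := by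
  funext p
  refine (mfderiv_comp_section hs (mdifferentiableAt_flagCoord he p) hsd w).trans ?_
  have h1 : (fun y' : FlagBundle n r E => flagCoord (fun i => e i y'.base) y'.flag p) ∘ s
      =ᶠ[𝓝 y.base] fun _ => 0 := by
    filter_upwards [hse] with x hx
    exact congrFun hx.flagCoord_eq_zero p
  rw [h1.mfderiv_eq, mfderiv_const]
  rfl

theorem connMat_eq_zero_iff (he : IsHolFrameNear n e y.base) : IsParallelAt h e y.base ↔
    ∀ v, connMat (gramInChart h e y.base) (baseChart y.base y.base) v = 0 :=
  connectionMatrix_eq_zero_iff fun i j =>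
    (contDiffAt_gramInChart he (mem_baseDomain y.base) i j).differentiableAt (by simp)

theorem IsNormalFrame.connMat_eq_zero (he : IsNormalFrame h e y) {x₀ : X}
    (hx : y.base ∈ (baseChart x₀).source) (v : Fin n → ℂ) :
    connMat (gramInChart h e x₀) (baseChart x₀ y.base) v = 0 := by
  rw [connMat, he.dMat_eq_zero hx, he.dMat_eq_zero hx]
  simp

/-- The section of the flag bundle given by a frame. -/
theorem IsAdaptedFrame.exists_section (he : IsAdaptedFrame e y) : ∃ s : X → FlagBundle n r E,
    s y.base = y ∧ MDifferentiableAt 𝓘(ℂ, Fin n → ℂ) 𝓘(ℂ, FlagModel n r) s y.base ∧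
      ∀ᶠ x in 𝓝 y.base, (s x).base = x ∧ Adapted (fun i => e i (s x).base) (s x).flag := by
  set φ := flagChart y with hφ
  set c := baseChart y.base with hc
  have hx := mem_baseDomain (n := n) (r := r) (E := E) y.base
  have hg := isHolFrameNear_chartFrame (y := y) hx
  let A : (Fin n → ℂ) → Matrix (Fin r) (Fin r) ℂ := transMat y.base e (chartFrame y)
  have hA : ∀ i j, ContDiffAt ℂ ω (fun z => A z i j) (c y.base) := contDiffAt_transMat he.1 hg hx
  have hu := chart_self_mem_target y
  obtain ⟨L, hL, hLd, hLQ, -⟩ := exists_lowerTri_transMat hu he.chart_symm.1 he.chart_symm.2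
    (isHolFrameNear_chartFrame (chart_symm_mem hu)) (chart_symm_adapted hu)
  have hLA : A (c y.base) = L := by
    have h1 : (flagChart y y).2 = 0 := by rw [chart_apply_self]
    rwa [h1, unipotent_zero, Matrix.mul_one, ← chart_self_base] at hLQ
  have hk : ∀ k, (leadBlock (A (c y.base)) k).det ≠ 0 := fun k => by
    rw [hLA]
    exact det_leadBlock_ne_zero hL hLd k
  have hAx : ∀ x, IsHolFrameNear n (chartFrame y) x → x ∈ baseDomain n r E y.base →
      (fun i => e i x) = matAct (A (c x)) fun i => chartFrame y i x := fun x h1 h2 => by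
    have h3 := matAct_transMat (x₀ := y.base) (e := e) (g := chartFrame y) (z := c x)
      (by rw [c.left_inv h2.1]; exact h2.2) (by rw [c.left_inv h2.1]; exact h1)
    rwa [c.left_inv h2.1] at h3
  let G : (Fin n → ℂ) → FlagModel n r := fun z => (z, blockCoord (A z))
  have hG0 : G (c y.base) = φ y := by
    rw [hφ, chart_apply_self]
    refine Prod.ext rfl ?_
    obtain ⟨B, hB⟩ := hg.exists_basis
    have h1 := he.2
    rw [hAx _ hg hx, ← hB] at h1
    have h2 := (h1.flagCoord_eq_blockCoord B (by rw [hLA]; exact hLd) hk).1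
    rw [hB] at h2
    exact h2.symm.trans (IsAdaptedFrame.flagCoord_eq_zero ⟨hg, adapted_chartFrame y⟩)
  have hGd : ContDiffAt ℂ ω G (c y.base) := contDiffAt_id.prodMk (contDiffAt_blockCoord hA hk)
  have hGm : MDifferentiableAt 𝓘(ℂ, Fin n → ℂ) 𝓘(ℂ, FlagModel n r) (fun x => G (c x)) y.base := by
    refine (mdifferentiableAt_iff_chart (mem_chart_source _ y.base)).mpr ?_
    refine (hGd.differentiableAt (by simp)).congr_of_eventuallyEq ?_
    filter_upwards [c.open_target.mem_nhds (c.map_source (mem_chart_source _ y.base))] with z hz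
    change G (c (c.symm z)) = G z
    rw [c.right_inv hz]
  refine ⟨fun x => φ.symm (G (c x)), ?_, ?_, ?_⟩
  · change φ.symm (G (c y.base)) = y
    rw [hG0, φ.left_inv (mem_chart_source _ y)]
  · refine MDifferentiableAt.comp (I' := 𝓘(ℂ, FlagModel n r)) (g := φ.symm) y.base ?_ hGm
    refine mdifferentiableAt_chart_symm ?_
    rw [hG0]
    exact hu
  · have h1 : ∀ᶠ z in 𝓝 (c y.base), ∀ k, (leadBlock (A z) k).det ≠ 0 := by
      rw [eventually_all]
      intro k
      exact (contDiffAt_det (A := fun z => leadBlock (A z) k) fun _ _ => hA _ _).continuousAt.eventually_ne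
        (hk k)
    have hct : Tendsto c (𝓝 y.base) (𝓝 (c y.base)) := c.continuousAt (mem_chart_source _ y.base)
    have h2 : ∀ᶠ z in 𝓝 (c y.base), G z ∈ φ.target :=
      hGd.continuousAt.eventually_mem (by rw [hG0]; exact φ.open_target.mem_nhds hu)
    filter_upwards [hct.eventually h1, hct.eventually h2, hg.eventually, he.1.eventually,
      baseDomain_mem_nhds y] with x h3 h4 h5 h6 h7
    have hb : (φ.symm (G (c x))).base = x := (chart_symm_base h4).trans (c.left_inv h7.1)
    refine ⟨hb, ?_⟩
    have h8 := chart_symm_adapted h4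
    change Adapted (tildeFrame _ (blockCoord (A (c x)))) _ at h8
    set y' := φ.symm (G (c x)) with hy'
    change y'.base = x at hb
    have h9 := hAx y'.base (by rw [hb]; exact h5) (by rw [hb]; exact h7)
    rw [← hb] at h3 h8 h5 h6
    obtain ⟨B, hB⟩ := h5.exists_basis
    obtain ⟨B', hB'⟩ := h6.exists_basis
    have hAd : IsUnit (A (c y'.base)).det := isUnit_det_of_matAct (w := B)
      (by rw [hB, ← h9, ← hB']; exact B'.linearIndependent)
    let f := flagOfFrame B B' B'.linearIndependent
    have h10 : Adapted B' f := fun i => rfl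
    have h11 := h10
    rw [hB', h9, ← hB] at h11
    obtain ⟨h12, h13⟩ := h11.flagCoord_eq_blockCoord B hAd h3
    rw [h12] at h13
    rw [← hB] at h8
    rw [h8.eq h13, ← hB']
    exact h10

/-- Horizontal vectors are those on which the coordinates given by a parallel frame are stationary. -/
theorem mem_horizontalSpace_iff (he : IsAdaptedFrame e y) (hp : IsParallelAt h e y.base)
    (v : TangentSpace 𝓘(ℂ, FlagModel n r) y) : v ∈ horizontalSpace h y ↔ coordMap e y v = 0 := by
  have hp1 := (connMat_eq_zero_iff he.1).mp hp
  constructor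
  · intro hv
    suffices h1 : horizontalSpace h y ≤ LinearMap.ker (coordMap e y).toLinearMap from h1 hv
    refine Submodule.span_le.mpr ?_
    rintro _ ⟨e', s, he', hp', hs, hse, w, rfl⟩
    have had' : IsAdaptedFrame e' y := ⟨he', hs ▸ hse.self_of_nhds.2⟩
    obtain ⟨L, -, -, -, hLe⟩ := exists_coordMap_eq he had' hp1 ((connMat_eq_zero_iff he').mp hp')
    have h1 : ∀ᶠ x in 𝓝 y.base, IsAdaptedFrame e' (s x) := by
      filter_upwards [hse, he'.eventually] with x h1 h2
      exact ⟨h1.1.symm ▸ h2, h1.2⟩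
    change coordMap e y _ = 0
    by_cases hsd : MDifferentiableAt 𝓘(ℂ, Fin n → ℂ) 𝓘(ℂ, FlagModel n r) s y.base
    · refine (hLe _).trans ?_
      have h2 := coordMap_section had' hs hsd h1 w
      exact (congrArg _ h2).trans (map_zero _)
    · rw [mfderiv_zero_of_not_mdifferentiableAt hsd]
      exact map_zero (coordMap e y)
  · intro hv
    obtain ⟨s, hs, hsd, hse⟩ := he.exists_section
    have h1 : ∀ᶠ x in 𝓝 y.base, IsAdaptedFrame e (s x) := by
      filter_upwards [hse, he.1.eventually] with x h1 h2
      exact ⟨h1.1.symm ▸ h2, h1.2⟩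
    refine Submodule.subset_span ⟨e, s, he.1, hp, hs, hse, projDeriv y v, ?_⟩
    have key : ∀ w : TangentSpace 𝓘(ℂ, FlagModel n r) y, projDeriv y w = projDeriv y v →
        coordMap e y w = 0 → v = w := fun w h2 h3 =>
      (coordEquiv he).injective (Prod.ext h2.symm (hv.trans h3.symm))
    refine key _ ?_ (coordMap_section he hs hsd h1 (projDeriv y v))
    refine (mfderiv_comp_section hs (mdifferentiableAt_base y) hsd _).trans ?_
    have h2 : FlagBundle.base ∘ s =ᶠ[𝓝 y.base] id := hse.mono fun x hx => hx.1
    rw [h2.mfderiv_eq, mfderiv_id]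
    rfl

theorem isCompl_horizontalSpace_verticalSpace (h : HermitianMetric n r E) (y : FlagBundle n r E) :
    IsCompl (horizontalSpace h y) (verticalSpace y) := by
  obtain ⟨e, he⟩ := exists_isNormalFrame h y
  have he' := he.isAdaptedFrame
  have hp : IsParallelAt h e y.base := (connMat_eq_zero_iff he'.1).mpr
    (he.connMat_eq_zero (mem_chart_source _ _))
  constructor
  · rw [Submodule.disjoint_def]
    intro v h1 h2
    exact coordMap_injective he' h2 ((mem_horizontalSpace_iff he' hp v).mp h1)
  · rw [codisjoint_iff, eq_top_iff]
    intro v _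
    have h1 : coordEquiv he' ((coordEquiv he').symm (projDeriv y v, 0)) = _ :=
      (coordEquiv he').apply_symm_apply _
    set w := (coordEquiv he').symm (projDeriv y v, 0) with hw
    rw [coordEquiv_apply] at h1
    refine Submodule.mem_sup.mpr ⟨w, (mem_horizontalSpace_iff he' hp w).mpr (congrArg Prod.snd h1),
      v - w, ?_, add_sub_cancel _ _⟩
    exact (ContinuousLinearMap.map_sub (projDeriv y) v w).trans
      (sub_eq_zero.mpr (congrArg Prod.fst h1).symm)
end Splitting

/-! ### Forms given by normal frames -/

section Unitary
theorem eq_diagonal_of_lowerTri_unitary {L : Matrix (Fin r) (Fin r) ℂ} (hL : LowerTri L)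
    (hu : L * Lᴴ = 1) : (∀ i j, i ≠ j → L i j = 0) ∧ ∀ i, ‖L i i‖ = 1 := by
  have hd : IsUnit L.det := by
    have h1 := congrArg Matrix.det hu
    rw [Matrix.det_mul, Matrix.det_one] at h1
    exact isUnit_iff_ne_zero.mpr (left_ne_zero_of_mul_eq_one h1)
  have hinv : L⁻¹ = Lᴴ := Matrix.inv_eq_right_inv hu
  have hoff : ∀ i j, i ≠ j → L i j = 0 := fun i j hij => by
    rcases lt_or_gt_of_ne hij with h1 | h1
    · exact hL.apply h1
    · have h2 := (hL.inv hd).apply h1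
      rw [hinv, Matrix.conjTranspose_apply, star_eq_zero] at h2
      exact h2
  refine ⟨hoff, fun i => ?_⟩
  have h1 := congrFun (congrFun hu i) i
  rw [Matrix.mul_apply, Finset.sum_eq_single i (fun j _ hj => by rw [hoff i j hj.symm, zero_mul])
    (by simp), Matrix.one_apply_eq, Matrix.conjTranspose_apply, Complex.star_def,
    Complex.mul_conj, Complex.normSq_eq_norm_sq] at h1
  have h2 : ‖L i i‖ ^ 2 = 1 := by exact_mod_cast h1
  exact (pow_eq_one_iff_of_nonneg (norm_nonneg _) two_ne_zero).mp h2

end Unitary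

section InvariantForms
variable (h : HermitianMetric n r E)

variable {h} in
theorem isUnitaryAdapted_iff {y : FlagBundle n r E} {v : Fin r → E y.base} :
    IsUnitaryAdapted h y v ↔ gramMat h y.base v = 1 ∧ Adapted v y.flag := by
  refine and_congr_left fun _ => ⟨fun h1 => ?_, fun h1 i j => ?_⟩
  · ext i j
    rw [Matrix.one_apply]
    exact h1 i j
  · rw [← Matrix.one_apply, ← h1]
    rfl

variable {h} in
theorem IsNormalFrame.isUnitaryAdapted {e : Fin r → ∀ x, E x} {y : FlagBundle n r E}
    (he : IsNormalFrame h e y) : IsUnitaryAdapted h y fun i => e i y.base :=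
  isUnitaryAdapted_iff.mpr ⟨he.gramMat_eq_one, he.2.1⟩

variable {h} in
theorem lowerTri_unitary {y : FlagBundle n r E} {v w : Fin r → E y.base}
    (hv : IsUnitaryAdapted h y v) (hw : IsUnitaryAdapted h y w) {L : Matrix (Fin r) (Fin r) ℂ}
    (hLe : v = matAct L w) : L * Lᴴ = 1 := by
  have h1 := gramMat_matAct h y.base L w
  rwa [← hLe, (isUnitaryAdapted_iff.mp hv).1, (isUnitaryAdapted_iff.mp hw).1, Matrix.mul_one,
    eq_comm] at h1

variable {h} in
/-- Orthonormal bases giving the same flag differ by phase factors. -/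
theorem IsUnitaryAdapted.exists_phase {y : FlagBundle n r E} {v w : Fin r → E y.base}
    (hv : IsUnitaryAdapted h y v) (hw : IsUnitaryAdapted h y w) :
    ∃ d : Fin r → ℂ, (∀ i, ‖d i‖ = 1) ∧ ∀ i, v i = d i • w i := by
  obtain ⟨L, hL, hLe⟩ := hv.2.exists_lowerTri hw.2
  obtain ⟨h2, h3⟩ := eq_diagonal_of_lowerTri_unitary hL (lowerTri_unitary hv hw hLe)
  refine ⟨fun i => L i i, h3, fun i => ?_⟩
  rw [hLe, matAct, Finset.sum_eq_single i (fun j _ hj => by rw [h2 i j hj.symm, zero_smul])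
    (by simp)]

theorem curvaturePairing_smul (x : X) (c d : ℂ) (s t : E x) :
    curvaturePairing h x (c • s) (d • t) = (c * (starRingEnd ℂ) d) • curvaturePairing h x s t := by
  have h1 : ∀ i, (trivializationAt (Fin r → ℂ) E x ⟨x, c • s⟩).2 i =
      c * (trivializationAt (Fin r → ℂ) E x ⟨x, s⟩).2 i := fun i => by
    have h2 := (Trivialization.linear ℂ (trivializationAt (Fin r → ℂ) E x)
      (FiberBundle.mem_baseSet_trivializationAt' x)).map_smul c s
    exact congrFun h2 i
  refine Eq.trans (Finset.sum_congr rfl fun i _ => ?_) Finset.smul_sum.symm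
  refine Eq.trans (Finset.sum_congr rfl fun j _ => ?_) Finset.smul_sum.symm
  have h3 : (trivializationAt (Fin r → ℂ) E x ⟨x, c • s⟩).2 i *
      h.inner x (stdFrame E x (Pi.basisFun ℂ (Fin r)) j x) (d • t) =
      (c * (starRingEnd ℂ) d) * ((trivializationAt (Fin r → ℂ) E x ⟨x, s⟩).2 i *
        h.inner x (stdFrame E x (Pi.basisFun ℂ (Fin r)) j x) t) := by
    rw [h1, LinearMap.map_smulₛₗ, smul_eq_mul]
    ring
  rw [h3]
  exact mul_smul _ _ _

variable [IsManifold 𝓘(ℂ, Fin n → ℂ) ω X]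
  [ContMDiffVectorBundle ω (Fin r → ℂ) E 𝓘(ℂ, Fin n → ℂ)]

variable {h} in
/-- The flag coordinates of two normal frames differ by phase factors, to first order. -/
theorem IsNormalFrame.exists_phase {e e' : Fin r → ∀ x, E x} {y : FlagBundle n r E}
    (he : IsNormalFrame h e y) (he' : IsNormalFrame h e' y) :
    ∃ d : PairIdx r → ℂ, (∀ p, ‖d p‖ = 1) ∧ ∀ p, coordDeriv e y p = d p • coordDeriv e' y p := by
  obtain ⟨L, hL, hLd, hLe, hLc⟩ := exists_coordMap_eq he.isAdaptedFrame he'.isAdaptedFrame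
    (he.connMat_eq_zero (mem_chart_source _ _)) (he'.connMat_eq_zero (mem_chart_source _ _))
  have h1 := lowerTri_unitary he.isUnitaryAdapted he'.isUnitaryAdapted hLe
  obtain ⟨h2, h3⟩ := eq_diagonal_of_lowerTri_unitary hL h1
  refine ⟨fun p => L p.1.1 p.1.1 * (starRingEnd ℂ) (L p.1.2 p.1.2), fun p => ?_, fun p => ?_⟩
  · rw [norm_mul, RCLike.norm_conj, h3, h3, one_mul]
  · ext v
    have h4 := congrFun (hLc v) p
    rw [conjUpper_apply, upperPart, mul_strictUpper_mul_apply, Matrix.inv_eq_right_inv h1,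
      Finset.sum_eq_single p, Matrix.conjTranspose_apply] at h4
    · refine h4.trans ?_
      change _ * coordDeriv e' y p v * _ = _ * coordDeriv e' y p v
      rw [Complex.star_def]
      ring
    · intro q _ hq
      by_cases h5 : p.1.1 = q.1.1
      · have h6 : p.1.2 ≠ q.1.2 := fun h6 => hq (pairIdx_ext h5.symm h6.symm)
        rw [Matrix.conjTranspose_apply, h2 _ _ h6, star_zero, mul_zero]
      · rw [h2 _ _ h5, zero_mul, zero_mul]
    · simp

/-- A chosen normal frame at each point of the flag bundle. -/
def normalFrame (y : FlagBundle n r E) : Fin r → ∀ x, E x := (exists_isNormalFrame h y).choose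

theorem isNormalFrame_normalFrame (y : FlagBundle n r E) : IsNormalFrame h (normalFrame h y) y :=
  (exists_isNormalFrame h y).choose_spec

/-- The horizontal part of the curvature of `Q^a`. -/
def horizontalForm (a : Fin r → ℝ) : DiffForm (FlagModel n r) (FlagBundle n r E) 2 := fun y =>
  -∑ i, (a i : ℂ) • pullForm (curvaturePairing h y.base (normalFrame h y i y.base)
    (normalFrame h y i y.base)) (projDeriv y)

/-- The vertical part of the curvature of `Q^a`. -/
def verticalForm (a : Fin r → ℝ) : DiffForm (FlagModel n r) (FlagBundle n r E) 2 := fun y =>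
  ∑ p : PairIdx r, ((a p.1.1 - a p.1.2 : ℝ) : ℂ) • wedgeConj (coordDeriv (normalFrame h y) y p)

variable (r) in
/-- The volume form `⋀_p i dξ_p ∧ dξbar_p`. -/
def volForm : (PairIdx r → ℂ) [⋀^Fin (2 * fiberDim r)]→L[ℝ] ℂ :=
  wedgeProd (fiberDim r) fun m => Complex.I • wedgeConj
    (ContinuousLinearMap.proj (R := ℂ) (φ := fun _ : PairIdx r => ℂ)
      ((Fintype.equivFin (PairIdx r)).symm m))

/-- The normalized relative volume form. -/
def relVolume : DiffForm (FlagModel n r) (FlagBundle n r E) (2 * fiberDim r) := fun y =>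
  pullForm (volForm r) (coordMap (normalFrame h y) y)

theorem pullForm_volForm_coordMap (e : Fin r → ∀ x, E x) (y : FlagBundle n r E) :
    pullForm (volForm r) (coordMap e y) = wedgeProd (fiberDim r) fun m =>
      Complex.I • wedgeConj (coordDeriv e y ((Fintype.equivFin (PairIdx r)).symm m)) := by
  refine (pullForm_wedgeProd _ _ _).trans (congrArg (wedgeProd _) (funext fun m => ?_))
  exact (pullForm_smul _ _ _).trans (congrArg (Complex.I • ·) (pullForm_wedgeConj _ _))

/-- Multiplying a functional by a phase factor does not change `ℓ ∧ conj ℓ`. -/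
theorem wedgeConj_smul_of_norm_eq_one {V : Type*} [AddCommGroup V] [Module ℂ V] [TopologicalSpace V]
    {c : ℂ} (hc : ‖c‖ = 1) {ℓ ℓ' : V →L[ℂ] ℂ} (hl : ℓ' = c • ℓ) :
    wedgeConj ℓ' = wedgeConj ℓ := by
  rw [hl, wedgeConj_smul, hc]
  simp

theorem isRelVolume_relVolume : IsRelVolume h (relVolume h (E := E)) := by
  intro y e he
  obtain ⟨d, hd, hde⟩ := (isNormalFrame_normalFrame h y).exists_phase he
  refine (pullForm_volForm_coordMap _ y).trans (congrArg (wedgeProd _) (funext fun m => ?_))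
  exact congrArg (Complex.I • ·) (wedgeConj_smul_of_norm_eq_one (hd _) (hde _))

theorem isHorizontalPart_horizontalForm (a : Fin r → ℝ) :
    IsHorizontalPart h a (horizontalForm h a (E := E)) := by
  intro y v hv
  obtain ⟨d, hd, hdv⟩ := (isNormalFrame_normalFrame h y).isUnitaryAdapted.exists_phase hv
  rw [horizontalForm]
  congr 1
  refine Finset.sum_congr rfl fun i _ => ?_
  have h1 : d i * (starRingEnd ℂ) (d i) = 1 := by
    rw [Complex.mul_conj, Complex.normSq_eq_norm_sq, hd]
    simp
  have h2 : normalFrame h y i y.base = d i • v i := hdv i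
  rw [h2, curvaturePairing_smul, h1, one_smul]

theorem isVerticalPart_verticalForm (a : Fin r → ℝ) :
    IsVerticalPart h a (verticalForm h a (E := E)) := by
  constructor
  · intro y u hu w
    have he := isNormalFrame_normalFrame h y
    have h1 := (mem_horizontalSpace_iff he.isAdaptedFrame ((connMat_eq_zero_iff he.1).mpr
      (he.connMat_eq_zero (mem_chart_source _ _))) u).mp hu
    have h2 : ∀ p, coordDeriv (normalFrame h y) y p u = 0 := fun p => congrFun h1 p
    refine (ContinuousAlternatingMap.sum_apply _ _).trans (Finset.sum_eq_zero fun p _ => ?_)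
    have h3 : wedgeConj (coordDeriv (normalFrame h y) y p) ![u, w] = 0 := by
      refine (wedgeConj_apply _ _).trans ?_
      have h4 : coordDeriv (normalFrame h y) y p (![u, w] 0) = 0 := h2 p
      rw [h4, zero_mul, map_zero, mul_zero, sub_zero]
    exact (congrArg (_ • ·) h3).trans (smul_zero _)
  · intro y e he
    obtain ⟨d, hd, hde⟩ := (isNormalFrame_normalFrame h y).exists_phase he
    refine Finset.sum_congr rfl fun p _ => ?_
    exact congrArg (_ • ·) (wedgeConj_smul_of_norm_eq_one (hd p) (hde p))

end InvariantForms

/-! ### Holomorphic functions of several variables are smooth -/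

section HolomorphicRegularity
variable {M : Type*} [NormedAddCommGroup M] [NormedSpace ℂ M]

theorem hasDerivAt_line {F : M → ℂ} {u v : M} {t : ℂ} (hF : DifferentiableAt ℂ F (u + t • v)) :
    HasDerivAt (fun t : ℂ => F (u + t • v)) (fderiv ℂ F (u + t • v) v) t := by
  have h1 : HasDerivAt (fun t : ℂ => u + t • v) v t := by
    simpa using ((hasDerivAt_id t).smul_const v).const_add u
  exact hF.hasFDerivAt.comp_hasDerivAt t h1

theorem line_mem_ball {u₀ u v : M} {ρ R : ℝ} (hu : u ∈ Metric.ball u₀ ρ) (hR : R * ‖v‖ ≤ ρ) {t : ℂ}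
    (ht : ‖t‖ ≤ R) : u + t • v ∈ Metric.ball u₀ (2 * ρ) := by
  rw [Metric.mem_ball, dist_eq_norm] at hu ⊢
  calc ‖u + t • v - u₀‖ = ‖(u - u₀) + t • v‖ := by congr 1; abel
    _ ≤ ‖u - u₀‖ + ‖t • v‖ := norm_add_le _ _
    _ < ρ + ρ := by
      refine add_lt_add_of_lt_of_le hu ?_
      rw [norm_smul]
      exact (mul_le_mul_of_nonneg_right ht (norm_nonneg v)).trans hR
    _ = 2 * ρ := by ring

theorem diffContOnCl_line {F : M → ℂ} {u₀ u v : M} {ρ R : ℝ}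
    (hF : DifferentiableOn ℂ F (Metric.ball u₀ (2 * ρ))) (hu : u ∈ Metric.ball u₀ ρ)
    (hR : R * ‖v‖ ≤ ρ) : DiffContOnCl ℂ (fun t : ℂ => F (u + t • v)) (Metric.ball 0 R) := by
  refine DifferentiableOn.diffContOnCl fun t ht => ?_
  have h1 : ‖t‖ ≤ R := by
    have := Metric.closure_ball_subset_closedBall ht
    simpa using this
  exact (hasDerivAt_line (hF.differentiableAt (Metric.isOpen_ball.mem_nhds
    (line_mem_ball hu hR h1)))).differentiableAt.differentiableWithinAt

/-- Cauchy's estimate for the differential. -/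
theorem norm_fderiv_le_of_ball {F : M → ℂ} {u₀ u : M} {ρ C : ℝ} (hρ : 0 < ρ)
    (hF : DifferentiableOn ℂ F (Metric.ball u₀ (2 * ρ)))
    (hC : ∀ w ∈ Metric.ball u₀ (2 * ρ), ‖F w‖ ≤ C) (hu : u ∈ Metric.ball u₀ ρ) :
    ‖fderiv ℂ F u‖ ≤ C / ρ := by
  have hC0 : 0 ≤ C := (norm_nonneg _).trans
    (hC u₀ (Metric.mem_ball_self (by linarith)))
  refine ContinuousLinearMap.opNorm_le_bound _ (by positivity) fun v => ?_
  by_cases hv : v = 0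
  · simp [hv]
  have hv' : 0 < ‖v‖ := norm_pos_iff.mpr hv
  have hR : ρ / ‖v‖ * ‖v‖ ≤ ρ := (div_mul_cancel₀ _ hv'.ne').le
  have h1 := Complex.norm_deriv_le_of_forall_mem_sphere_norm_le (C := C) (div_pos hρ hv')
    (diffContOnCl_line hF hu hR) fun z hz => hC _ (line_mem_ball hu hR (by simpa using hz.le))
  have h2 : u + (0 : ℂ) • v = u := by simp
  have h3 := hasDerivAt_line (F := F) (u := u) (v := v) (t := 0) (by
    rw [h2]
    exact hF.differentiableAt (Metric.isOpen_ball.mem_nhds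
      (Metric.ball_subset_ball (by linarith) hu)))
  rw [h3.deriv, h2] at h1
  refine h1.trans (le_of_eq ?_)
  field_simp

variable [FiniteDimensional ℂ M]

/-- The partial derivatives of a holomorphic function are holomorphic: they are given by Cauchy
integrals, which may be differentiated under the integral sign. -/
theorem differentiableAt_fderiv_of_ball {F : M → ℂ} {u₀ : M} {ρ C : ℝ} (hρ : 0 < ρ)
    (hF : DifferentiableOn ℂ F (Metric.ball u₀ (4 * ρ)))
    (hC : ∀ w ∈ Metric.ball u₀ (4 * ρ), ‖F w‖ ≤ C) (v : M) :
    DifferentiableAt ℂ (fun u => fderiv ℂ F u v) u₀ := by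
  borelize M
  have hsub : Metric.ball u₀ (2 * ρ) ⊆ Metric.ball u₀ (4 * ρ) := Metric.ball_subset_ball (by linarith)
  set R : ℝ := ρ / (‖v‖ + 1) with hRdef
  have hv : 0 < ‖v‖ + 1 := by positivity
  have hR : 0 < R := div_pos hρ hv
  have hRv : R * ‖v‖ ≤ ρ := by
    rw [hRdef, div_mul_eq_mul_div, div_le_iff₀ hv]
    nlinarith [norm_nonneg v]
  let k : ℝ → ℂ := fun θ => deriv (circleMap 0 R) θ * (1 / (circleMap 0 R θ - 0)) ^ (1 + 1)
  have hk : Continuous k := by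
    have h1 : Continuous fun θ => (circleMap (0 : ℂ) R θ - 0)⁻¹ :=
      continuous_circleMap_inv (Metric.mem_ball_self hR)
    simp only [k, deriv_circleMap, one_div]
    exact ((continuous_circleMap 0 R).mul continuous_const).mul (h1.pow 2)
  let w : M → ℝ → M := fun u θ => u + circleMap 0 R θ • v
  have hw : ∀ u, Continuous (w u) := fun u =>
    continuous_const.add ((continuous_circleMap 0 R).smul continuous_const)
  have hwm : ∀ u ∈ Metric.ball u₀ ρ, ∀ θ, w u θ ∈ Metric.ball u₀ (2 * ρ) := fun u hu θ =>
    line_mem_ball hu hRv (by simp [abs_of_pos hR])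
  have hFc : ∀ u ∈ Metric.ball u₀ ρ, Continuous fun θ => F (w u θ) := fun u hu =>
    (hF.continuousOn.mono hsub).comp_continuous (hw u) (hwm u hu)
  have hd : ∀ x ∈ Metric.ball u₀ (2 * ρ), DifferentiableAt ℂ F x := fun x hx =>
    hF.differentiableAt (Metric.isOpen_ball.mem_nhds (hsub hx))
  -- the Cauchy integral formula for the derivative in the direction of `v`
  have hrep : (fun u => fderiv ℂ F u v) =ᶠ[𝓝 u₀] fun u =>
      (2 * Real.pi * Complex.I)⁻¹ * ∫ θ in (0 : ℝ)..2 * Real.pi, k θ * F (w u θ) := by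
    filter_upwards [Metric.ball_mem_nhds u₀ hρ] with u hu
    have h1 := DiffContOnCl.circleIntegral_one_div_sub_center_pow_smul hR 1
      (diffContOnCl_line (hF.mono hsub) hu hRv)
    have h2 : u + (0 : ℂ) • v = u := by simp
    have h3 := hasDerivAt_line (F := F) (u := u) (v := v) (t := 0) (by
      rw [h2]
      exact hd u (Metric.ball_subset_ball (by linarith) hu))
    rw [iteratedDeriv_one, h3.deriv, h2, circleIntegral] at h1
    have h4 : ∫ θ in (0 : ℝ)..2 * Real.pi, k θ * F (w u θ) = 2 * Real.pi * Complex.I * fderiv ℂ F u v := by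
      refine Eq.trans ?_ (h1.trans ?_)
      · refine intervalIntegral.integral_congr fun θ _ => ?_
        simp only [k, w, smul_eq_mul]
        ring
      · simp
    rw [h4, inv_mul_cancel_left₀ Complex.two_pi_I_ne_zero]
  refine DifferentiableAt.congr_of_eventuallyEq ?_ hrep
  refine DifferentiableAt.const_mul ?_ _
  have hprop : ProperSpace (M →L[ℂ] ℂ) := FiniteDimensional.proper ℂ _
  have hbd : ∀ u ∈ Metric.ball u₀ ρ, ∀ θ, ‖k θ • fderiv ℂ F (w u θ)‖ ≤ ‖k θ‖ * (C / (2 * ρ)) :=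
    fun u hu θ => by
      rw [norm_smul]
      refine mul_le_mul_of_nonneg_left ?_ (norm_nonneg _)
      exact norm_fderiv_le_of_ball (u₀ := u₀) (by linarith) (by convert hF using 2; ring)
        (by rw [show 2 * (2 * ρ) = 4 * ρ by ring]; exact hC) (hwm u hu θ)
  have h5 := intervalIntegral.hasFDerivAt_integral_of_dominated_of_fderiv_le (𝕜 := ℂ)
    (μ := MeasureTheory.volume) (a := 0) (b := 2 * Real.pi)
    (F := fun u θ => k θ * F (w u θ)) (F' := fun u θ => k θ • fderiv ℂ F (w u θ))
    (bound := fun θ => ‖k θ‖ * (C / (2 * ρ)))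
    (Metric.ball_mem_nhds u₀ hρ) ?_ ?_ ?_ ?_ ?_ ?_
  · exact h5.differentiableAt
  · filter_upwards [Metric.ball_mem_nhds u₀ hρ] with u hu
    exact (hk.mul (hFc u hu)).aestronglyMeasurable
  · exact (hk.mul (hFc u₀ (Metric.mem_ball_self hρ))).intervalIntegrable _ _
  · refine hk.aestronglyMeasurable.smul ?_
    exact ((measurable_fderiv ℂ F).comp (hw u₀).measurable).aestronglyMeasurable
  · exact MeasureTheory.ae_of_all _ fun θ _ u hu => hbd u hu θ
  · exact (hk.norm.mul continuous_const).intervalIntegrable _ _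
  · refine MeasureTheory.ae_of_all _ fun θ _ u hu => ?_
    have h6 : HasFDerivAt (fun u => F (w u θ)) (fderiv ℂ F (w u θ)) u := by
      have h7 := (hd _ (hwm u hu θ)).hasFDerivAt.comp u ((hasFDerivAt_id u).add_const (circleMap 0 R θ • v))
      exact h7
    exact h6.const_mul (k θ)

theorem differentiableOn_fderiv {F : M → ℂ} {s : Set M} (hs : IsOpen s)
    (hF : DifferentiableOn ℂ F s) (v : M) : DifferentiableOn ℂ (fun u => fderiv ℂ F u v) s := by
  intro u hu
  have h1 : ∀ᶠ w in 𝓝 u, w ∈ s ∧ ‖F w‖ < ‖F u‖ + 1 := (hs.eventually_mem hu).and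
    ((hF.differentiableAt (hs.mem_nhds hu)).continuousAt.norm.eventually_lt_const (by simp))
  obtain ⟨ε, hε, hb⟩ := Metric.eventually_nhds_iff_ball.mp h1
  have h4 : 4 * (ε / 4) = ε := by ring
  refine (differentiableAt_fderiv_of_ball (ρ := ε / 4) (C := ‖F u‖ + 1) (by positivity)
    (hF.mono fun w hw => (hb w ?_).1) (fun w hw => (hb w ?_).2.le) v).differentiableWithinAt
  · rwa [h4] at hw
  · rwa [h4] at hw

/-- Holomorphic functions of several variables are smooth. -/
theorem contDiffOn_of_holomorphicOn {s : Set M} (hs : IsOpen s) (k : ℕ) {F : M → ℂ}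
    (hF : DifferentiableOn ℂ F s) : ContDiffOn ℂ k F s := by
  induction k generalizing F with
  | zero => exact contDiffOn_zero.mpr hF.continuousOn
  | succ k ih =>
    push_cast
    refine contDiffOn_succ_of_fderiv_apply hF (by simp) fun v => ?_
    refine (ih (differentiableOn_fderiv hs hF v)).congr fun u hu => ?_
    rw [fderivWithin_of_isOpen hs hu]

theorem contDiffAt_of_holomorphic {F : M → ℂ} {u : M} (k : ℕ)
    (hF : ∀ᶠ w in 𝓝 u, DifferentiableAt ℂ F w) : ContDiffAt ℂ k F u := by
  obtain ⟨s, hs, hso, hu⟩ := eventually_nhds_iff.mp hF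
  exact (contDiffOn_of_holomorphicOn hso k fun w hw => (hs w hw).differentiableWithinAt).contDiffAt
    (hso.mem_nhds hu)

end HolomorphicRegularity

/-! ### The tautological metrics -/

section TautologicalNorm
variable {h : HermitianMetric n r E}

theorem linearIndependent_of_gramMat_eq_one {x : X} {v : Fin r → E x} (hv : gramMat h x v = 1) :
    LinearIndependent ℂ v := by
  rw [Fintype.linearIndependent_iff]
  intro g hg k
  have h1 : h.inner x (∑ j, g j • v j) (v k) = g k := by
    have h2 : ∀ j, h.inner x (v j) (v k) = (1 : Matrix (Fin r) (Fin r) ℂ) j k := fun j => by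
      rw [← hv]; rfl
    simp [h2, Matrix.one_apply]
  rw [← h1, hg, map_zero, LinearMap.zero_apply]

theorem exists_basis_of_gramMat_eq_one {x : X} {v : Fin r → E x} (hv : gramMat h x v = 1) :
    ∃ B : Basis (Fin r) ℂ (E x), ⇑B = v := by
  obtain ⟨C, -⟩ := exists_basis_refFrame (E := E) (r := r)
    (FiberBundle.mem_baseSet_trivializationAt' (F := Fin r → ℂ) (E := E) x)
  have : FiniteDimensional ℂ (E x) := C.finiteDimensional_of_finite
  exact ⟨basisOfLinearIndependentOfCardEqFinrank' v (linearIndependent_of_gramMat_eq_one hv)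
    (finrank_eq_card_basis C).symm, coe_basisOfLinearIndependentOfCardEqFinrank' _ _ _⟩

theorem inner_self_of_basis {x : X} (B : Basis (Fin r) ℂ (E x)) (hB : gramMat h x B = 1) (w : E x) :
    (h.inner x w w).re = ∑ j, ‖B.repr w j‖ ^ 2 := by
  have h2 : ∀ j k, h.inner x (B j) (B k) = (1 : Matrix (Fin r) (Fin r) ℂ) j k := fun j k => by
    rw [← hB]; rfl
  have h3 : h.inner x w w = ∑ j, ((‖B.repr w j‖ ^ 2 : ℝ) : ℂ) := by
    conv_lhs => rw [← B.sum_repr w]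
    simp only [map_sum, LinearMap.sum_apply, LinearMap.map_smulₛₗ, LinearMap.smul_apply, h2, smul_eq_mul,
      RingHom.id_apply, Matrix.one_apply, mul_ite, mul_one, mul_zero, Finset.sum_ite_eq',
      Finset.mem_univ, if_true]
    refine Finset.sum_congr rfl fun j _ => ?_
    rw [← Complex.normSq_eq_norm_sq, ← Complex.mul_conj]
    ring
  rw [h3, ← Complex.ofReal_sum, Complex.ofReal_re]

theorem norm_repr_le_one {x : X} (B : Basis (Fin r) ℂ (E x)) (hB : gramMat h x B = 1) {w : E x}
    (hw : (h.inner x w w).re ≤ 1) (j : Fin r) : ‖B.repr w j‖ ^ 2 ≤ 1 := by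
  rw [inner_self_of_basis B hB] at hw
  exact (Finset.single_le_sum (f := fun j => ‖B.repr w j‖ ^ 2) (fun _ _ => sq_nonneg _)
    (Finset.mem_univ j)).trans hw

theorem le_dualNormSq {x : X} (B : Basis (Fin r) ℂ (E x)) (hB : gramMat h x B = 1)
    (σ : Dual ℂ (E x)) (i : Fin r) : ‖σ (B i)‖ ^ 2 ≤ dualNormSq h x σ := by
  refine le_csSup ?_ ⟨B i, ?_, rfl⟩
  · refine ⟨(∑ j, ‖σ (B j)‖) ^ 2, ?_⟩
    rintro _ ⟨w, hw, rfl⟩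
    gcongr
    conv_lhs => rw [← B.sum_repr w, map_sum]
    refine (norm_sum_le _ _).trans (Finset.sum_le_sum fun j _ => ?_)
    rw [map_smul, norm_smul]
    exact mul_le_of_le_one_left (norm_nonneg _)
      ((sq_le_one_iff₀ (norm_nonneg _)).mp (norm_repr_le_one B hB hw j))
  · have h1 : h.inner x (B i) (B i) = (1 : Matrix (Fin r) (Fin r) ℂ) i i := by rw [← hB]; rfl
    rw [h1, Matrix.one_apply_eq, Complex.one_re]

theorem dualNormSq_smul_coord_le {x : X} (B : Basis (Fin r) ℂ (E x)) (hB : gramMat h x B = 1)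
    (i : Fin r) (c : ℂ) : dualNormSq h x (c • B.coord i) ≤ ‖c‖ ^ 2 := by
  refine csSup_le ⟨0, 0, by simp, by simp⟩ ?_
  rintro _ ⟨w, hw, rfl⟩
  rw [LinearMap.smul_apply, norm_smul, mul_pow]
  exact mul_le_of_le_one_right (sq_nonneg _) (norm_repr_le_one B hB hw i)

theorem mem_space_iff {y : FlagBundle n r E} {v : Fin r → E y.base} (hv : Adapted v y.flag)
    (i : Fin (r + 1)) (σ : Dual ℂ (E y.base)) :
    σ ∈ y.flag.space i ↔ ∀ j : Fin r, j.castSucc < i → σ (v j) = 0 := by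
  rw [hv i, Submodule.mem_dualAnnihilator]
  constructor
  · exact fun h1 j hj => h1 _ (mem_leadSpan v hj)
  · intro h1 w hw
    have h2 : leadSpan v i ≤ LinearMap.ker σ := by
      refine Submodule.span_le.mpr ?_
      rintro _ ⟨j, hj, rfl⟩
      exact h1 j hj
    exact h2 hw

theorem tautFiber_mk_eq_iff {y : FlagBundle n r E} {v : Fin r → E y.base} (hv : Adapted v y.flag)
    (i : Fin r) (σ τ : y.flag.space i.castSucc) :
    (Submodule.Quotient.mk σ : TautFiber i y) = Submodule.Quotient.mk τ ↔
      (σ : Dual ℂ (E y.base)) (v i) = (τ : Dual ℂ (E y.base)) (v i) := by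
  have h1 : (Submodule.Quotient.mk σ : TautFiber i y) = Submodule.Quotient.mk τ ↔
      (σ : Dual ℂ (E y.base)) - τ ∈ y.flag.space i.succ := Submodule.Quotient.eq _
  rw [h1, mem_space_iff hv]
  have hσ := (mem_space_iff hv _ _).mp σ.2
  have hτ := (mem_space_iff hv _ _).mp τ.2
  constructor
  · intro h2
    exact sub_eq_zero.mp (h2 i (Fin.castSucc_lt_succ))
  · intro h2 j hj
    rcases (Fin.castSucc_lt_succ_iff.mp hj).lt_or_eq with h3 | rfl
    · rw [LinearMap.sub_apply, hσ j h3, hτ j h3, sub_zero]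
    · rw [LinearMap.sub_apply, h2, sub_self]

/-- The tautological norm in terms of an orthonormal basis that gives the flag. -/
theorem tautNormSq_mk {y : FlagBundle n r E} {v : Fin r → E y.base} (hv : IsUnitaryAdapted h y v)
    (i : Fin r) (σ : y.flag.space i.castSucc) :
    tautNormSq h i y (Submodule.Quotient.mk σ) = ‖(σ : Dual ℂ (E y.base)) (v i)‖ ^ 2 := by
  obtain ⟨h1, had⟩ := isUnitaryAdapted_iff.mp hv
  obtain ⟨B, rfl⟩ := exists_basis_of_gramMat_eq_one h1
  have hlb : ∀ t ∈ {t | ∃ τ : y.flag.space i.castSucc,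
      (Submodule.Quotient.mk τ : TautFiber i y) = Submodule.Quotient.mk σ ∧
        t = dualNormSq h y.base τ}, ‖(σ : Dual ℂ (E y.base)) (B i)‖ ^ 2 ≤ t := by
    rintro _ ⟨τ, h2, rfl⟩
    rw [← (tautFiber_mk_eq_iff had i τ σ).mp h2]
    exact le_dualNormSq B h1 _ i
  -- the infimum is attained by the functional that vanishes on the other basis vectors
  have hmem : (σ : Dual ℂ (E y.base)) (B i) • B.coord i ∈ y.flag.space i.castSucc := by
    rw [mem_space_iff had]
    intro j hj
    have h3 : j ≠ i := fun h4 => by simp [h4] at hj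
    simp [h3]
  refine le_antisymm ?_ (le_csInf ⟨_, σ, rfl, rfl⟩ hlb)
  refine (csInf_le ⟨_, hlb⟩ ⟨⟨_, hmem⟩, ?_, rfl⟩).trans (dualNormSq_smul_coord_le B h1 i _)
  rw [tautFiber_mk_eq_iff had]
  simp

end TautologicalNorm

/-! ### Second derivatives -/

section SecondDerivative
variable {G : Type*} [NormedAddCommGroup G] [NormedSpace ℂ G]

theorem fderiv_fderiv_eq {f : G → ℂ} {x : G} (hf : ContDiffAt ℝ 2 f x) (u v : G) :
    fderiv ℝ (fun z => fderiv ℝ f z v) x u = fderiv ℝ (fderiv ℝ f) x u v := by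
  rw [(differentiableAt_fderiv_apply hf v).fderiv]
  rfl

theorem eventually_differentiableAt {F : Type*} [NormedAddCommGroup F] [NormedSpace ℝ F] {f : G → F}
    {x : G} (hf : ContDiffAt ℝ 2 f x) : ∀ᶠ z in 𝓝 x, DifferentiableAt ℝ f z :=
  (hf.eventually (by simp)).mono fun _ hz => hz.differentiableAt (by simp)

theorem fderiv_fderiv_congr {f g : G → ℂ} {x : G} (hfg : f =ᶠ[𝓝 x] g) :
    fderiv ℝ (fderiv ℝ f) x = fderiv ℝ (fderiv ℝ g) x :=
  (hfg.fderiv (𝕜 := ℝ)).fderiv_eq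

theorem fderiv_fderiv_mul {f g : G → ℂ} {x : G} (hf : ContDiffAt ℝ 2 f x) (hg : ContDiffAt ℝ 2 g x)
    (u v : G) :
    fderiv ℝ (fderiv ℝ fun z => f z * g z) x u v = f x * fderiv ℝ (fderiv ℝ g) x u v +
      fderiv ℝ f x u * fderiv ℝ g x v + (g x * fderiv ℝ (fderiv ℝ f) x u v +
      fderiv ℝ g x u * fderiv ℝ f x v) := by
  rw [← fderiv_fderiv_eq (hf.mul hg)]
  have h1 : (fun z => fderiv ℝ (fun w => f w * g w) z v) =ᶠ[𝓝 x]
      fun z => f z * fderiv ℝ g z v + g z * fderiv ℝ f z v := by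
    filter_upwards [eventually_differentiableAt hf, eventually_differentiableAt hg] with z h2 h3
    rw [fderiv_fun_mul h2 h3]
    rfl
  have hf1 := (hf.differentiableAt (by simp)).hasFDerivAt
  have hg1 := (hg.differentiableAt (by simp)).hasFDerivAt
  have hD := (hf1.mul (differentiableAt_fderiv_apply hg v)).add
    (hg1.mul (differentiableAt_fderiv_apply hf v))
  rw [h1.fderiv_eq]
  refine (congrArg (fun D => D u) hD.fderiv).trans ?_
  simp only [add_apply, smul_apply, smul_eq_mul, ContinuousLinearMap.flip_apply]
  ring

theorem fderiv_fderiv_sum {κ : Type*} (s : Finset κ) {f : κ → G → ℂ} {x : G}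
    (hf : ∀ k ∈ s, ContDiffAt ℝ 2 (f k) x) (u v : G) :
    fderiv ℝ (fderiv ℝ fun z => ∑ k ∈ s, f k z) x u v =
      ∑ k ∈ s, fderiv ℝ (fderiv ℝ (f k)) x u v := by
  rw [← fderiv_fderiv_eq (ContDiffAt.sum hf)]
  have h1 : (fun z => fderiv ℝ (fun w => ∑ k ∈ s, f k w) z v) =ᶠ[𝓝 x]
      fun z => ∑ k ∈ s, fderiv ℝ (f k) z v := by
    have h2 : ∀ᶠ z in 𝓝 x, ∀ k ∈ s, DifferentiableAt ℝ (f k) z :=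
      (Finset.eventually_all s).mpr fun k hk => eventually_differentiableAt (hf k hk)
    filter_upwards [h2] with z hz
    rw [fderiv_fun_sum hz, sum_apply]
  rw [h1.fderiv_eq]
  refine (congrArg (fun D => D u) (HasFDerivAt.fun_sum fun k hk =>
    differentiableAt_fderiv_apply (hf k hk) v).fderiv).trans ?_
  rw [sum_apply]
  rfl

/-- The function `f` has value one and vanishing derivative at `x`. -/
def IsFlatOne (f : G → ℂ) (x : G) : Prop :=
  ContDiffAt ℝ 2 f x ∧ f x = 1 ∧ fderiv ℝ f x = 0

theorem IsFlatOne.mul {f g : G → ℂ} {x : G} (hf : IsFlatOne f x) (hg : IsFlatOne g x) :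
    IsFlatOne (fun z => f z * g z) x ∧ ∀ u v, fderiv ℝ (fderiv ℝ fun z => f z * g z) x u v =
      fderiv ℝ (fderiv ℝ f) x u v + fderiv ℝ (fderiv ℝ g) x u v := by
  refine ⟨⟨hf.1.mul hg.1, by simp only [hf.2.1, hg.2.1, one_mul], ?_⟩, fun u v => ?_⟩
  · rw [fderiv_fun_mul (hf.1.differentiableAt (by simp)) (hg.1.differentiableAt (by simp)), hf.2.2,
      hg.2.2]
    ext w
    change f x * 0 + g x * 0 = 0
    simp
  · rw [fderiv_fderiv_mul hf.1 hg.1, hf.2.1, hg.2.1, hf.2.2, hg.2.2]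
    simp [add_comm]

theorem isFlatOne_one (x : G) : IsFlatOne (fun _ : G => (1 : ℂ)) x :=
  ⟨contDiffAt_const, rfl, by simp⟩

theorem IsFlatOne.inv {f : G → ℂ} {x : G} (hf : IsFlatOne f x) :
    IsFlatOne (fun z => (f z)⁻¹) x ∧ ∀ u v, fderiv ℝ (fderiv ℝ fun z => (f z)⁻¹) x u v =
      -fderiv ℝ (fderiv ℝ f) x u v := by
  have h0 : f x ≠ 0 := by rw [hf.2.1]; exact one_ne_zero
  have h1 : IsFlatOne (fun z => (f z)⁻¹) x := by
    refine ⟨hf.1.inv h0, by simp [hf.2.1], ?_⟩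
    have h2 := (hf.1.differentiableAt (by simp)).hasFDerivAt
    rw [hf.2.2] at h2
    have h3 := ((hasFDerivAt_inv' (𝕜 := ℝ) h0).comp x h2).fderiv
    rw [ContinuousLinearMap.comp_zero] at h3
    exact h3
  refine ⟨h1, fun u v => ?_⟩
  have h2 : (fun z => f z * (f z)⁻¹) =ᶠ[𝓝 x] fun _ => 1 := by
    filter_upwards [hf.1.continuousAt.eventually_ne h0] with z hz
    exact mul_inv_cancel₀ hz
  have h3 := (hf.mul h1).2 u v
  rw [fderiv_fderiv_congr h2] at h3
  simp only [fderiv_fun_const, Pi.zero_def, zero_apply] at h3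
  exact (neg_eq_of_add_eq_zero_right (by simpa using h3.symm)).symm

theorem IsFlatOne.prod {κ : Type*} (s : Finset κ) {f : κ → G → ℂ} {x : G}
    (hf : ∀ k ∈ s, IsFlatOne (f k) x) :
    IsFlatOne (fun z => ∏ k ∈ s, f k z) x ∧ ∀ u v, fderiv ℝ (fderiv ℝ fun z => ∏ k ∈ s, f k z) x u v =
      ∑ k ∈ s, fderiv ℝ (fderiv ℝ (f k)) x u v := by
  classical
  induction s using Finset.induction_on with
  | empty => simp [isFlatOne_one]
  | insert a s ha ih =>
    have ih := ih fun k hk => hf k (Finset.mem_insert_of_mem hk)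
    have h1 := (hf a (Finset.mem_insert_self a s)).mul ih.1
    simp only [Finset.prod_insert ha, Finset.sum_insert ha]
    exact ⟨h1.1, fun u v => by rw [h1.2, ih.2]⟩

theorem IsFlatOne.log {f : G → ℂ} {x : G} (hf : IsFlatOne f x) :
    ContDiffAt ℝ 2 (fun z => Complex.log (f z)) x ∧
      ∀ u v, fderiv ℝ (fderiv ℝ fun z => Complex.log (f z)) x u v = fderiv ℝ (fderiv ℝ f) x u v := by
  have h0 : f x ∈ Complex.slitPlane := by rw [hf.2.1]; exact Complex.one_mem_slitPlane
  have hlog : ContDiffAt ℝ 2 (fun z => Complex.log (f z)) x :=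
    ((Complex.contDiffAt_log (n := 2) h0).restrict_scalars ℝ).comp x hf.1
  refine ⟨hlog, fun u v => ?_⟩
  rw [← fderiv_fderiv_eq hlog]
  have h1 : (fun z => fderiv ℝ (fun w => Complex.log (f w)) z v) =ᶠ[𝓝 x]
      fun z => (f z)⁻¹ * fderiv ℝ f z v := by
    filter_upwards [eventually_differentiableAt hf.1, hf.1.continuousAt.eventually
      (Complex.isOpen_slitPlane.mem_nhds h0)] with z h2 h3
    have h4 := ((Complex.hasStrictDerivAt_log h3).hasDerivAt.hasFDerivAt.restrictScalars ℝ).comp z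
      h2.hasFDerivAt
    refine (congrArg (fun D : G →L[ℝ] ℂ => D v) h4.fderiv).trans ?_
    simp [mul_comm]
  rw [h1.fderiv_eq]
  have hD := (hf.inv.1.1.differentiableAt (by simp)).hasFDerivAt.mul
    (differentiableAt_fderiv_apply hf.1 v)
  refine (congrArg (fun D => D u) hD.fderiv).trans ?_
  simp [hf.2.1, hf.2.2]

end SecondDerivative

section MatrixSecondDerivative
variable {G : Type*} [NormedAddCommGroup G] [NormedSpace ℂ G]
  {ι : Type*} [Fintype ι] [DecidableEq ι]

/-- The second derivative at `x` along `u` and `v` of a matrix-valued function, entry by entry. -/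
def d2Mat (A : G → Matrix ι ι ℂ) (x u v : G) : Matrix ι ι ℂ :=
  fun i j => fderiv ℝ (fderiv ℝ fun z => A z i j) x u v

theorem d2Mat_eq {A : G → Matrix ι ι ℂ} {x : G} (hA : ∀ i j, ContDiffAt ℝ 2 (fun z => A z i j) x)
    (u v : G) : dMat ℝ (fun z => dMat ℝ A z v) x u = d2Mat A x u v := by
  ext i j
  exact fderiv_fderiv_eq (hA i j) u v

theorem d2Mat_congr {A B : G → Matrix ι ι ℂ} {x : G} (hAB : A =ᶠ[𝓝 x] B) (u v : G) :
    d2Mat A x u v = d2Mat B x u v := by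
  ext i j
  have h1 : (fun u => A u i j) =ᶠ[𝓝 x] fun u => B u i j := hAB.mono fun u hu => by simp only [hu]
  rw [d2Mat, d2Mat, fderiv_fderiv_congr h1]

theorem d2Mat_mul {A B : G → Matrix ι ι ℂ} {x : G}
    (hA : ∀ i j, ContDiffAt ℝ 2 (fun z => A z i j) x)
    (hB : ∀ i j, ContDiffAt ℝ 2 (fun z => B z i j) x) (u v : G) :
    d2Mat (fun z => A z * B z) x u v = d2Mat A x u v * B x + A x * d2Mat B x u v +
      (dMat ℝ A x u * dMat ℝ B x v + dMat ℝ A x v * dMat ℝ B x u) := by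
  ext i j
  simp only [d2Mat, Matrix.mul_apply, Matrix.add_apply, dMat]
  rw [fderiv_fderiv_sum _ fun k _ => (hA i k).mul (hB k j)]
  simp only [← Finset.sum_add_distrib]
  refine Finset.sum_congr rfl fun k _ => ?_
  rw [fderiv_fderiv_mul (hA i k) (hB k j)]
  ring

theorem d2Mat_conjTranspose {A : G → Matrix ι ι ℂ} {x : G}
    (hA : ∀ i j, ContDiffAt ℝ 2 (fun z => A z i j) x) (u v : G) :
    d2Mat (fun z => (A z)ᴴ) x u v = (d2Mat A x u v)ᴴ := by
  ext i j
  exact fderiv_fderiv_clm_comp (Complex.conjCLE : ℂ →L[ℝ] ℂ) (hA j i) u v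

theorem d2Mat_inv {A : G → Matrix ι ι ℂ} {x : G} (hA : ∀ i j, ContDiffAt ℝ 2 (fun z => A z i j) x)
    (h1 : A x = 1) (u v : G) :
    d2Mat (fun z => (A z)⁻¹) x u v = dMat ℝ A x u * dMat ℝ A x v + dMat ℝ A x v * dMat ℝ A x u -
      d2Mat A x u v := by
  have hd : (A x).det ≠ 0 := by rw [h1, Matrix.det_one]; exact one_ne_zero
  have h2 : (fun u => A u * (A u)⁻¹) =ᶠ[𝓝 x] fun _ => 1 := by
    filter_upwards [(contDiffAt_det hA).continuousAt.eventually_ne hd] with u hu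
    exact Matrix.mul_nonsing_inv _ (isUnit_iff_ne_zero.mpr hu)
  have h3 := d2Mat_mul hA (contDiffAt_matrix_inv hA hd) u v
  have h4 : d2Mat (fun _ => (1 : Matrix ι ι ℂ)) x u v = 0 := by
    ext i j
    simp [d2Mat]
  have h5 : ∀ w, dMat ℝ (fun z => (A z)⁻¹) x w = -dMat ℝ A x w := fun w => by
    rw [dMat_inv (fun i j => (hA i j).of_le (by norm_num)) hd, h1]
    simp
  rw [d2Mat_congr h2, h4, h5, h5, h1, inv_one, Matrix.mul_one, Matrix.one_mul, Matrix.mul_neg,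
    Matrix.mul_neg] at h3
  have h6 := eq_sub_of_add_eq (eq_neg_of_add_eq_zero_left h3.symm)
  rw [eq_sub_iff_add_eq, ← sub_eq_zero]
  rw [← sub_eq_zero] at h3
  rw [← neg_eq_zero, ← h3]
  abel

end MatrixSecondDerivative

/-! ### Gram–Schmidt coefficients and their second derivatives -/

section QuotNorm
/-- The square of the `i`-th diagonal coefficient of the lower triangular matrix that makes a frame
with Gram matrix `S` orthonormal. -/
def quotNorm (S : Matrix (Fin r) (Fin r) ℂ) (i : Fin r) : ℂ :=
  (leadBlock S i)⁻¹ ⟨i, le_rfl⟩ ⟨i, le_rfl⟩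

theorem leadBlock_inv_of_conj_eq_one {L S : Matrix (Fin r) (Fin r) ℂ} (hL : LowerTri L)
    (hLd : IsUnit L.det) (hLS : L * S * Lᴴ = 1) (i : Fin r) :
    (leadBlock L i)ᴴ * leadBlock L i * leadBlock S i = 1 := by
  have h1 : L * S = (L⁻¹)ᴴ := by
    rw [Matrix.conjTranspose_nonsing_inv]
    exact (Matrix.inv_eq_left_inv hLS).symm
  have h2 : leadBlock (L⁻¹)ᴴ i = (leadBlock L⁻¹ i)ᴴ := rfl
  rw [Matrix.mul_assoc, ← leadBlock_mul hL, h1, h2, ← Matrix.conjTranspose_mul,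
    ← leadBlock_mul (hL.inv hLd), Matrix.nonsing_inv_mul _ hLd, leadBlock_one,
    Matrix.conjTranspose_one]

/-- If `L` makes a basis with Gram matrix `S` orthonormal, then `quotNorm S i` is the squared norm of the
`i`-th vector of the dual basis in the quotient `Q_i`. -/
theorem quotNorm_of_conj_eq_one {L S : Matrix (Fin r) (Fin r) ℂ} (hL : LowerTri L)
    (hLd : IsUnit L.det) (hLS : L * S * Lᴴ = 1) (i : Fin r) :
    quotNorm S i = ((‖L i i‖ ^ 2 : ℝ) : ℂ) := by
  rw [quotNorm, Matrix.inv_eq_left_inv (leadBlock_inv_of_conj_eq_one hL hLd hLS i), Matrix.mul_apply,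
    Finset.sum_eq_single ⟨i, le_rfl⟩]
  · rw [← Complex.normSq_eq_norm_sq, ← Complex.mul_conj, mul_comm]
    rfl
  · intro k _ hk
    have h1 : (k : Fin r) < i := lt_of_le_of_ne k.2 fun h => hk (Subtype.ext h)
    have h2 : leadBlock L i k ⟨i, le_rfl⟩ = 0 := hL.apply h1
    rw [h2, mul_zero]
  · simp

variable {G : Type*} [NormedAddCommGroup G] [NormedSpace ℂ G]

theorem contDiffAt_quotNorm {S : G → Matrix (Fin r) (Fin r) ℂ} {x : G} {m : ℕ∞ω}
    (hS : ∀ i j, ContDiffAt ℝ m (fun z => S z i j) x) (i : Fin r) (hd : (leadBlock (S x) i).det ≠ 0) :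
    ContDiffAt ℝ m (fun z => quotNorm (S z) i) x :=
  contDiffAt_matrix_inv (A := fun z => leadBlock (S z) i) (fun _ _ => hS _ _) hd _ _

/-- Expansion of the Gram–Schmidt coefficients to second order at the identity matrix. -/
theorem isFlatOne_quotNorm {S : G → Matrix (Fin r) (Fin r) ℂ} {x : G}
    (hS : ∀ i j, ContDiffAt ℝ 2 (fun z => S z i j) x) (h1 : S x = 1) (i : Fin r)
    (h0 : ∀ v, dMat ℝ S x v i i = 0) :
    IsFlatOne (fun z => quotNorm (S z) i) x ∧ ∀ u v,
      fderiv ℝ (fderiv ℝ fun z => quotNorm (S z) i) x u v =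
        ∑ j : {j : Fin r // j ≤ i}, (dMat ℝ S x u i j * dMat ℝ S x v j i +
          dMat ℝ S x v i j * dMat ℝ S x u j i) - d2Mat S x u v i i := by
  have hb1 : leadBlock (S x) i = 1 := by rw [h1, leadBlock_one]
  have hd : (leadBlock (S x) i).det ≠ 0 := by rw [hb1, Matrix.det_one]; exact one_ne_zero
  have hb : ∀ k l, ContDiffAt ℝ 2 (fun z => leadBlock (S z) i k l) x := fun _ _ => hS _ _
  refine ⟨⟨contDiffAt_quotNorm hS i hd, ?_, ?_⟩, fun u v => ?_⟩
  · simp [quotNorm, hb1]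
  · ext v
    have h2 := congrFun (congrFun (dMat_inv (A := fun z => leadBlock (S z) i)
      (fun k l => (hb k l).of_le (by norm_num)) hd v) ⟨i, le_rfl⟩) ⟨i, le_rfl⟩
    refine h2.trans ?_
    rw [hb1, inv_one, Matrix.mul_one, Matrix.one_mul]
    exact neg_eq_zero.mpr (h0 v)
  · have h2 := congrFun (congrFun (d2Mat_inv (A := fun z => leadBlock (S z) i) hb hb1 u v)
      ⟨i, le_rfl⟩) ⟨i, le_rfl⟩
    refine h2.trans ?_
    rw [Matrix.sub_apply, Matrix.add_apply, Matrix.mul_apply, Matrix.mul_apply,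
      ← Finset.sum_add_distrib]
    rfl

end QuotNorm

section FibreGram
/-- The Gram matrix of the frame `e_i + ∑_{j > i} ξ_{ij} e_j` at `z`, where `H` is that of `e`. -/
def fibreGram (H : (Fin n → ℂ) → Matrix (Fin r) (Fin r) ℂ) (w : FlagModel n r) :
    Matrix (Fin r) (Fin r) ℂ :=
  unipotent w.2 * H w.1 * (unipotent w.2)ᴴ

variable {H : (Fin n → ℂ) → Matrix (Fin r) (Fin r) ℂ} {z : Fin n → ℂ}

theorem contDiffAt_comp_fst {m : ℕ∞ω} (hH : ∀ i j, ContDiffAt ℝ m (fun z => H z i j) z)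
    {ξ : PairIdx r → ℂ} (i j : Fin r) :
    ContDiffAt ℝ m (fun w : FlagModel n r => H w.1 i j) (z, ξ) :=
  ContDiffAt.comp (z, ξ) (hH i j) contDiffAt_fst

theorem contDiffAt_unipotent_snd {m : ℕ∞ω} (x : FlagModel n r) (i j : Fin r) :
    ContDiffAt ℝ m (fun w : FlagModel n r => unipotent w.2 i j) x :=
  contDiffAt_unipotent contDiffAt_snd i j

theorem contDiffAt_conjTranspose {G : Type*} [NormedAddCommGroup G] [NormedSpace ℝ G] {m : ℕ∞ω}
    {A : G → Matrix (Fin r) (Fin r) ℂ} {x : G} (hA : ∀ i j, ContDiffAt ℝ m (fun z => A z i j) x)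
    (i j : Fin r) : ContDiffAt ℝ m (fun z => (A z)ᴴ i j) x :=
  (Complex.conjCLE : ℂ →L[ℝ] ℂ).contDiff.contDiffAt.comp x (hA j i)

theorem contDiffAt_fibreGram {m : ℕ∞ω} (hH : ∀ i j, ContDiffAt ℝ m (fun z => H z i j) z)
    (ξ : PairIdx r → ℂ) (i j : Fin r) : ContDiffAt ℝ m (fun w => fibreGram H w i j) (z, ξ) :=
  contDiffAt_matrix_mul (contDiffAt_matrix_mul (contDiffAt_unipotent_snd _) (contDiffAt_comp_fst hH))
    (contDiffAt_conjTranspose (contDiffAt_unipotent_snd _)) i j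

theorem dMat_unipotent_snd (x u : FlagModel n r) :
    dMat ℝ (fun w : FlagModel n r => unipotent w.2) x u = strictUpper u.2 := by
  rw [dMat_unipotent differentiableAt_snd, fderiv_snd]
  rfl

theorem d2Mat_unipotent_snd (x u v : FlagModel n r) :
    d2Mat (fun w : FlagModel n r => unipotent w.2) x u v = 0 := by
  rw [← d2Mat_eq (contDiffAt_unipotent_snd x)]
  simp only [dMat_unipotent_snd, dMat_const]

theorem dMat_comp_fst (hH : ∀ i j, DifferentiableAt ℝ (fun z => H z i j) z) (ξ : PairIdx r → ℂ)
    (u : FlagModel n r) : dMat ℝ (fun w : FlagModel n r => H w.1) (z, ξ) u = dMat ℝ H z u.1 := by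
  ext i j
  exact congrArg (fun D : FlagModel n r →L[ℝ] ℂ => D u)
    ((hH i j).hasFDerivAt.comp (z, ξ) hasFDerivAt_fst).fderiv

theorem d2Mat_comp_fst (hH : ∀ i j, ContDiffAt ℝ 2 (fun z => H z i j) z) (ξ : PairIdx r → ℂ)
    (u v : FlagModel n r) :
    d2Mat (fun w : FlagModel n r => H w.1) (z, ξ) u v = d2Mat H z u.1 v.1 := by
  rw [← d2Mat_eq (contDiffAt_comp_fst hH), ← d2Mat_eq hH]
  have h1 : ∀ᶠ z' in 𝓝 z, ∀ i j, DifferentiableAt ℝ (fun z => H z i j) z' :=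
    eventually_all.mpr fun i => eventually_all.mpr fun j => eventually_differentiableAt (hH i j)
  have h2 : (fun w : FlagModel n r => dMat ℝ (fun w : FlagModel n r => H w.1) w v) =ᶠ[𝓝 (z, ξ)]
      fun w => dMat ℝ H w.1 v.1 := by
    filter_upwards [continuousAt_fst.eventually h1] with w hw
    exact dMat_comp_fst hw w.2 v
  rw [dMat_congr h2]
  exact dMat_comp_fst (H := fun z => dMat ℝ H z v.1)
    (fun i j => (differentiableAt_fderiv_apply (hH i j) v.1).differentiableAt) ξ u

theorem dMat_fibreGram (hH : ∀ i j, ContDiffAt ℝ 2 (fun z => H z i j) z) (h1 : H z = 1)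
    (h0 : ∀ v, dMat ℝ H z v = 0) (u : FlagModel n r) :
    dMat ℝ (fibreGram H) (z, 0) u = strictUpper u.2 + (strictUpper u.2)ᴴ := by
  have hU : ∀ i j, DifferentiableAt ℝ (fun w : FlagModel n r => unipotent w.2 i j) (z, 0) := fun i j =>
    (contDiffAt_unipotent_snd (m := 1) _ i j).differentiableAt (by simp)
  have hH' : ∀ i j, DifferentiableAt ℝ (fun w : FlagModel n r => H w.1 i j) (z, 0) := fun i j =>
    (contDiffAt_comp_fst hH i j).differentiableAt (by simp)
  have hUH : ∀ i j, DifferentiableAt ℝ (fun w : FlagModel n r => (unipotent w.2 * H w.1) i j) (z, 0) :=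
    fun i j => (contDiffAt_matrix_mul (contDiffAt_unipotent_snd _)
      (contDiffAt_comp_fst fun i j => (hH i j)) i j).differentiableAt (by simp)
  have hUc : ∀ i j, DifferentiableAt ℝ
      (fun w : FlagModel n r => (unipotent w.2)ᴴ i j) (z, 0) := fun i j =>
    (contDiffAt_conjTranspose (m := 1) (contDiffAt_unipotent_snd _) i j).differentiableAt (by simp)
  refine (dMat_mul hUH hUc u).trans ?_
  rw [dMat_conjTranspose, dMat_mul hU hH', dMat_unipotent_snd,
    dMat_comp_fst (fun i j => (hH i j).differentiableAt (by simp)), h0]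
  simp [h1, unipotent_zero]

theorem d2Mat_fibreGram (hH : ∀ i j, ContDiffAt ℝ 2 (fun z => H z i j) z) (h1 : H z = 1)
    (h0 : ∀ v, dMat ℝ H z v = 0) (u v : FlagModel n r) :
    d2Mat (fibreGram H) (z, 0) u v = d2Mat H z u.1 v.1 +
      (strictUpper u.2 * (strictUpper v.2)ᴴ +
        strictUpper v.2 * (strictUpper u.2)ᴴ) := by
  have hU : ∀ i j, DifferentiableAt ℝ (fun w : FlagModel n r => unipotent w.2 i j) (z, 0) := fun i j =>
    (contDiffAt_unipotent_snd (m := 1) _ i j).differentiableAt (by simp)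
  have hH' : ∀ i j, DifferentiableAt ℝ (fun w : FlagModel n r => H w.1 i j) (z, 0) := fun i j =>
    (contDiffAt_comp_fst hH i j).differentiableAt (by simp)
  have hUH : ∀ i j, ContDiffAt ℝ 2 (fun w : FlagModel n r => (unipotent w.2 * H w.1) i j) (z, 0) :=
    contDiffAt_matrix_mul (contDiffAt_unipotent_snd _) (contDiffAt_comp_fst hH)
  refine (d2Mat_mul hUH (contDiffAt_conjTranspose (contDiffAt_unipotent_snd _)) u v).trans ?_
  rw [d2Mat_conjTranspose (contDiffAt_unipotent_snd _),
    d2Mat_mul (contDiffAt_unipotent_snd _) (contDiffAt_comp_fst hH), d2Mat_unipotent_snd,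
    d2Mat_comp_fst hH, dMat_conjTranspose, dMat_conjTranspose]
  simp only [dMat_mul hU hH', dMat_unipotent_snd,
    dMat_comp_fst (fun i j => (hH i j).differentiableAt (by simp)), h0]
  simp [h1, unipotent_zero]

/-- The Levi form of the logarithm of the `i`-th Gram–Schmidt coefficient in normal coordinates. -/
theorem quotNorm_fibreGram (hH : ∀ i j, ContDiffAt ℝ 2 (fun z => H z i j) z) (h1 : H z = 1)
    (h0 : ∀ v, dMat ℝ H z v = 0) (i : Fin r) :
    IsFlatOne (fun w => quotNorm (fibreGram H w) i) (z, 0) ∧ ∀ u v,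
      leviPart (fderiv ℝ (fderiv ℝ fun w => quotNorm (fibreGram H w) i) (z, 0)) u v =
        ∑ j, strictUpper u.2 j i * (starRingEnd ℂ) (strictUpper v.2 j i) -
        ∑ j, strictUpper u.2 i j * (starRingEnd ℂ) (strictUpper v.2 i j) -
        leviPart (fderiv ℝ (fderiv ℝ fun z => H z i i) z) u.1 v.1 := by
  have hone : fibreGram H (z, 0) = 1 := by simp [fibreGram, h1, unipotent_zero]
  have hd := dMat_fibreGram hH h1 h0
  have hz : ∀ (N : PairIdx r → ℂ) {k l : Fin r}, ¬ k < l → strictUpper N k l = 0 :=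
    fun N k l hkl => dif_neg hkl
  obtain ⟨hf, h2⟩ := isFlatOne_quotNorm (contDiffAt_fibreGram hH 0) hone i fun v => by
    rw [hd, Matrix.add_apply, Matrix.conjTranspose_apply, hz _ (lt_irrefl i)]
    simp
  refine ⟨hf, fun u v => ?_⟩
  have h3 : ∀ u v, fderiv ℝ (fderiv ℝ fun w => quotNorm (fibreGram H w) i) (z, 0) u v =
      ∑ j, (strictUpper u.2 j i * (starRingEnd ℂ) (strictUpper v.2 j i) +
        strictUpper v.2 j i * (starRingEnd ℂ) (strictUpper u.2 j i)) -
      ∑ j, (strictUpper u.2 i j * (starRingEnd ℂ) (strictUpper v.2 i j) +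
        strictUpper v.2 i j * (starRingEnd ℂ) (strictUpper u.2 i j)) -
      fderiv ℝ (fderiv ℝ fun z => H z i i) z u.1 v.1 := fun u v => by
    rw [h2, d2Mat_fibreGram hH h1 h0, Matrix.add_apply, Matrix.add_apply, Matrix.mul_apply,
      Matrix.mul_apply, ← Finset.sum_add_distrib]
    have h4 : ∑ j : {j : Fin r // j ≤ i}, (dMat ℝ (fibreGram H) (z, 0) u i j *
        dMat ℝ (fibreGram H) (z, 0) v j i + dMat ℝ (fibreGram H) (z, 0) v i j *
        dMat ℝ (fibreGram H) (z, 0) u j i) =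
        ∑ j, (strictUpper u.2 j i * (starRingEnd ℂ) (strictUpper v.2 j i) +
          strictUpper v.2 j i * (starRingEnd ℂ) (strictUpper u.2 j i)) := by
      rw [← Finset.sum_subset (Finset.subset_univ (Finset.univ.filter fun l : Fin r => l ≤ i))]
      · rw [Finset.sum_subtype (p := fun l => l ≤ i) _ (by simp)]
        refine Finset.sum_congr rfl fun j _ => ?_
        simp only [hd, Matrix.add_apply, Matrix.conjTranspose_apply, hz _ (not_lt.mpr j.2),
          star_zero, add_zero, zero_add]
        rw [add_comm, mul_comm, mul_comm (star _)]
        rfl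
      · intro l _ hl
        have hl' : i < l := by simpa using hl
        simp [hz _ (not_lt.mpr hl'.le)]
    rw [h4, sub_sub]
    exact congrArg (_ - ·) (add_comm _ _)
  let b : (Fin r → Fin r × Fin r) → FlagModel n r → FlagModel n r → ℂ := fun s u v =>
    ∑ j, (strictUpper u.2 (s j).1 (s j).2 * (starRingEnd ℂ) (strictUpper v.2 (s j).1 (s j).2) +
      strictUpper v.2 (s j).1 (s j).2 * (starRingEnd ℂ) (strictUpper u.2 (s j).1 (s j).2))
  have hI : ∀ (N : PairIdx r → ℂ) (k l : Fin r),
      strictUpper (Complex.I • N) k l = Complex.I * strictUpper N k l := fun N k l => by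
    by_cases hkl : k < l
    · simp [strictUpper, hkl]
    · simp [hz _ hkl]
  -- the Levi part of a sum of terms `ℓ u * conj (ℓ v) + ℓ v * conj (ℓ u)` retains `ℓ u * conj (ℓ v)`
  have hsum : ∀ (s : Fin r → Fin r × Fin r) (u v : FlagModel n r),
      ∑ j, strictUpper u.2 (s j).1 (s j).2 * (starRingEnd ℂ) (strictUpper v.2 (s j).1 (s j).2) =
      1 / 4 * ((b s u v - Complex.I * b s (Complex.I • u) v) +
        (Complex.I * b s u (Complex.I • v) + b s (Complex.I • u) (Complex.I • v))) := by
    intro s u v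
    simp only [b, Finset.mul_sum, ← Finset.sum_sub_distrib, ← Finset.sum_add_distrib]
    refine Finset.sum_congr rfl fun j _ => ?_
    simp only [Prod.smul_snd, hI, map_mul, Complex.conj_I]
    linear_combination (3 / 4 * strictUpper u.2 (s j).1 (s j).2 *
      (starRingEnd ℂ) (strictUpper v.2 (s j).1 (s j).2) - 1 / 4 * strictUpper v.2 (s j).1 (s j).2 *
      (starRingEnd ℂ) (strictUpper u.2 (s j).1 (s j).2)) * Complex.I_mul_I
  rw [hsum (fun j => (j, i)), hsum fun j => (i, j)]
  simp only [leviPart, h3, Prod.smul_fst, smul_eq_mul, b]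
  ring

end FibreGram

/-! ### The complex Hessian of a function -/

section ComplexHessian
variable {M : Type*} [NormedAddCommGroup M] [NormedSpace ℂ M]

/-- The form `∂ ∂bar f` of a function on a complex vector space. -/
def ddbar (f : M → ℂ) (x : M) : M [⋀^Fin 2]→L[ℝ] ℂ :=
  del (delbar fun y => ContinuousAlternatingMap.constOfIsEmpty ℝ M (Fin 0) (f y)) x

theorem ddbar_apply {f : M → ℂ} {x : M} (hf : ContDiffAt ℝ 2 f x) (w : Fin 2 → M) :
    ddbar f x w = leviPart (fderiv ℝ (fderiv ℝ f) x) (w 0) (w 1) -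
      leviPart (fderiv ℝ (fderiv ℝ f) x) (w 1) (w 0) := by
  rw [← del_delbar_constOfIsEmpty hf, ddbar]
  congr 1
  ext i
  fin_cases i <;> rfl

theorem ddbar_congr {f g : M → ℂ} {x : M} (hfg : f =ᶠ[𝓝 x] g) : ddbar f x = ddbar g x :=
  del_congr (delbar_congr (hfg.mono fun y hy => by simp only [hy]))

theorem ddbar_sum {κ : Type*} (s : Finset κ) {f : κ → M → ℂ} {x : M}
    (hf : ∀ k ∈ s, ContDiffAt ℝ 2 (f k) x) :
    ddbar (fun z => ∑ k ∈ s, f k z) x = ∑ k ∈ s, ddbar (f k) x := by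
  ext w
  rw [ddbar_apply (ContDiffAt.sum hf), ContinuousAlternatingMap.sum_apply,
    Finset.sum_congr rfl fun k hk => ddbar_apply (hf k hk) w]
  simp only [leviPart, fderiv_fderiv_sum s hf, Finset.sum_sub_distrib, Finset.sum_add_distrib,
    ← Finset.smul_sum]

theorem ddbar_add {f g : M → ℂ} {x : M} (hf : ContDiffAt ℝ 2 f x) (hg : ContDiffAt ℝ 2 g x) :
    ddbar (fun z => f z + g z) x = ddbar f x + ddbar g x := by
  have h := ddbar_sum (Finset.univ : Finset (Fin 2)) (f := ![f, g]) (x := x)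
    fun k _ => by fin_cases k <;> assumption
  simpa [Fin.sum_univ_two] using h

theorem ddbar_const (c : ℂ) (x : M) : ddbar (fun _ => c) x = 0 := by
  ext w
  rw [ddbar_apply contDiffAt_const]
  simp [leviPart]

theorem ddbar_const_mul (c : ℂ) {f : M → ℂ} {x : M} (hf : ContDiffAt ℝ 2 f x) :
    ddbar (fun z => c * f z) x = c • ddbar f x := by
  ext w
  have h1 : ∀ u v, fderiv ℝ (fderiv ℝ fun z => c * f z) x u v = c * fderiv ℝ (fderiv ℝ f) x u v :=
    fun u v => by
      rw [fderiv_fderiv_mul contDiffAt_const hf]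
      simp
  rw [ddbar_apply (contDiffAt_const.mul hf), ContinuousAlternatingMap.smul_apply, ddbar_apply hf]
  simp only [leviPart, h1, smul_eq_mul]
  ring

theorem fderiv_fderiv_of_holomorphic {f : M → ℂ} {x : M} (hf : ContDiffAt ℂ 2 f x) (u v : M) :
    fderiv ℝ (fderiv ℝ f) x (Complex.I • u) v = Complex.I * fderiv ℝ (fderiv ℝ f) x u v ∧
      fderiv ℝ (fderiv ℝ f) x u (Complex.I • v) = Complex.I * fderiv ℝ (fderiv ℝ f) x u v := by
  have hfR : ContDiffAt ℝ 2 f x := hf.restrict_scalars ℝ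
  have h1 : ∀ w, (fun z => fderiv ℝ f z w) =ᶠ[𝓝 x] fun z => fderiv ℂ f z w := fun w => by
    filter_upwards [hf.eventually (by simp)] with z hz
    rw [fderiv_restrictScalars (hz.differentiableAt (by simp))]
    rfl
  have h2 : ∀ w, DifferentiableAt ℂ (fun z => fderiv ℂ f z w) x := fun w =>
    ((hf.fderiv_right (m := 1) (by norm_num)).differentiableAt (by simp)).clm_apply
      (differentiableAt_const w)
  have h3 : ∀ u w, fderiv ℝ (fderiv ℝ f) x u w = fderiv ℂ (fun z => fderiv ℂ f z w) x u :=
    fun u w => by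
      rw [← fderiv_fderiv_eq hfR, (h1 w).fderiv_eq, fderiv_restrictScalars (h2 w)]
      rfl
  constructor
  · rw [h3, h3, map_smul, smul_eq_mul]
  · rw [h3, h3]
    simp only [map_smul]
    rw [fderiv_fun_const_smul (h2 v)]
    rfl

theorem ddbar_of_holomorphic {f : M → ℂ} {x : M} (hf : ContDiffAt ℂ 2 f x) : ddbar f x = 0 := by
  ext w
  rw [ddbar_apply (hf.restrict_scalars ℝ)]
  simp only [leviPart, (fderiv_fderiv_of_holomorphic hf _ _).1,
    (fderiv_fderiv_of_holomorphic hf _ _).2, smul_eq_mul]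
  simp [← mul_assoc, Complex.I_mul_I]

theorem ddbar_conj_of_holomorphic {f : M → ℂ} {x : M} (hf : ContDiffAt ℂ 2 f x) :
    ddbar (fun z => (starRingEnd ℂ) (f z)) x = 0 := by
  ext w
  have hfR : ContDiffAt ℝ 2 f x := hf.restrict_scalars ℝ
  have hc : ContDiffAt ℝ 2 (fun z => (starRingEnd ℂ) (f z)) x :=
    (Complex.conjCLE : ℂ →L[ℝ] ℂ).contDiff.contDiffAt.comp x hfR
  have h1 : ∀ u v, fderiv ℝ (fderiv ℝ fun z => (starRingEnd ℂ) (f z)) x u v =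
      (starRingEnd ℂ) (fderiv ℝ (fderiv ℝ f) x u v) := fun u v =>
    fderiv_fderiv_clm_comp (Complex.conjCLE : ℂ →L[ℝ] ℂ) hfR u v
  rw [ddbar_apply hc]
  simp only [leviPart, h1, (fderiv_fderiv_of_holomorphic hf _ _).1,
    (fderiv_fderiv_of_holomorphic hf _ _).2, smul_eq_mul, map_mul, Complex.conj_I]
  simp [← mul_assoc, Complex.I_mul_I]

theorem ddbar_comp {M' : Type*} [NormedAddCommGroup M'] [NormedSpace ℂ M'] {f : M' → ℂ} {Ψ : M → M'}
    {x : M} (hf : ContDiffAt ℝ 2 f (Ψ x)) (hΨ : ContDiffAt ℂ 2 Ψ x) :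
    ddbar (fun z => f (Ψ z)) x = pullForm (ddbar f (Ψ x)) (fderiv ℂ Ψ x) := by
  rw [ddbar, ddbar, ← del_delbar_pullForm (contDiffAt_constOfIsEmpty hf) hΨ]
  refine del_congr (delbar_congr (Eventually.of_forall fun z => ?_))
  ext w
  rfl

/-- The logarithm of the modulus of a holomorphic function without zeros is pluriharmonic. -/
theorem ddbar_log_norm_sq [FiniteDimensional ℂ M] {f : M → ℂ} {x : M}
    (hf : ∀ᶠ z in 𝓝 x, DifferentiableAt ℂ f z) (h0 : f x ≠ 0) :
    ContDiffAt ℝ 2 (fun z => ((Real.log (‖f z‖ ^ 2) : ℝ) : ℂ)) x ∧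
      ddbar (fun z => ((Real.log (‖f z‖ ^ 2) : ℝ) : ℂ)) x = 0 := by
  have hf2 : ContDiffAt ℂ 2 f x := contDiffAt_of_holomorphic 2 hf
  have hslit : f x / f x ∈ Complex.slitPlane := by rw [div_self h0]; exact Complex.one_mem_slitPlane
  have hk : ContDiffAt ℂ 2 (fun z => Complex.log (f z / f x)) x :=
    ContDiffAt.comp (g := Complex.log) x (Complex.contDiffAt_log hslit) (hf2.div_const _)
  have hkR : ContDiffAt ℝ 2 (fun z => Complex.log (f z / f x)) x := hk.restrict_scalars ℝ
  have hkc : ContDiffAt ℝ 2 (fun z => (starRingEnd ℂ) (Complex.log (f z / f x))) x :=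
    (Complex.conjCLE : ℂ →L[ℝ] ℂ).contDiff.contDiffAt.comp x hkR
  have h1 : (fun z => ((Real.log (‖f z‖ ^ 2) : ℝ) : ℂ)) =ᶠ[𝓝 x] fun z =>
      ((Real.log (‖f x‖ ^ 2) : ℝ) : ℂ) + (Complex.log (f z / f x) +
        (starRingEnd ℂ) (Complex.log (f z / f x))) := by
    filter_upwards [hf2.continuousAt.eventually_ne h0] with z hz
    rw [Complex.add_conj, Complex.log_re, norm_div, Real.log_div (norm_ne_zero_iff.mpr hz)
      (norm_ne_zero_iff.mpr h0), Real.log_pow, Real.log_pow]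
    push_cast
    ring
  refine ⟨(contDiffAt_const.add (hkR.add hkc)).congr_of_eventuallyEq h1, ?_⟩
  rw [ddbar_congr h1, ddbar_add contDiffAt_const (hkR.add hkc), ddbar_add hkR hkc, ddbar_const,
    ddbar_of_holomorphic hk, ddbar_conj_of_holomorphic hk, add_zero, add_zero]

end ComplexHessian

/-! ### The curvature of the tautological line bundles -/

section TautologicalCurvature
theorem apply_matAct_of_mem {y : FlagBundle n r E} {w : Fin r → E y.base} (had : Adapted w y.flag)
    {L : Matrix (Fin r) (Fin r) ℂ} (hL : LowerTri L) (i : Fin r) (σ : y.flag.space i.castSucc) :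
    (σ : Dual ℂ (E y.base)) (matAct L w i) = L i i * (σ : Dual ℂ (E y.base)) (w i) := by
  rw [matAct, map_sum, Finset.sum_eq_single i]
  · rw [map_smul, smul_eq_mul]
  · intro j _ hj
    rw [map_smul]
    rcases lt_or_gt_of_ne hj with h2 | h2
    · rw [(mem_space_iff had _ _).mp σ.2 j h2, smul_zero]
    · rw [hL.apply h2, zero_smul]
  · simp

variable {h : HermitianMetric n r E}

variable [IsManifold 𝓘(ℂ, Fin n → ℂ) ω X]
  [ContMDiffVectorBundle ω (Fin r → ℂ) E 𝓘(ℂ, Fin n → ℂ)]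

/-- The coordinates `(z, ξ)` on the flag bundle given by the frame `e`, in the preferred chart at `y`.
-/
def frameChart (e : Fin r → ∀ x, E x) (y : FlagBundle n r E) (u : FlagModel n r) : FlagModel n r :=
  (u.1, flagCoordChart e y u)

variable {e : Fin r → ∀ x, E x} {y : FlagBundle n r E}

theorem IsAdaptedFrame.contDiffAt_frameChart (he : IsAdaptedFrame e y) :
    ContDiffAt ℂ ω (frameChart e y) (flagChart y y) :=
  contDiffAt_fst.prodMk he.contDiffAt_flagCoordChart

theorem IsAdaptedFrame.frameChart_self (he : IsAdaptedFrame e y) :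
    frameChart e y (flagChart y y) = (baseChart y.base y.base, 0) :=
  Prod.ext chart_self_base.symm he.flagCoordChart_self

theorem IsAdaptedFrame.fderiv_frameChart (he : IsAdaptedFrame e y) (v : FlagModel n r) :
    fderiv ℂ (frameChart e y) (flagChart y y) v = (v.1, coordMap e y v) := by
  have h1 := (he.contDiffAt_flagCoordChart.differentiableAt (by simp)).hasFDerivAt
  rw [coordMap_eq he]
  exact congrArg (fun D : FlagModel n r →L[ℂ] FlagModel n r => D v) (hasFDerivAt_fst.prodMk h1).fderiv

theorem gramMat_tildeFrame {u : FlagModel n r} (hu : u ∈ (flagChart y).target)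
    (ξ : PairIdx r → ℂ) :
    gramMat h ((flagChart y).symm u).base
      (tildeFrame (fun i => e i ((flagChart y).symm u).base) ξ) =
      fibreGram (gramInChart h e y.base) (u.1, ξ) := by
  have h1 : gramMat h ((flagChart y).symm u).base
      (fun i => e i ((flagChart y).symm u).base) = gramInChart h e y.base u.1 := by
    rw [← chart_chart_symm_base hu, gramInChart_self e (chart_symm_mem hu).1]
  rw [tildeFrame_eq_matAct, gramMat_matAct, h1, fibreGram]

/-- Near `y`, the Gram–Schmidt process makes the frame of the coordinates `ξ` orthonormal. -/
theorem IsAdaptedFrame.eventually_gramSchmidt (he : IsAdaptedFrame e y) :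
    ∀ᶠ u in 𝓝 (flagChart y y), u ∈ (flagChart y).target ∧
      IsHolFrameNear n e ((flagChart y).symm u).base ∧
      Adapted (tildeFrame (fun i => e i ((flagChart y).symm u).base)
        (flagCoordChart e y u)) ((flagChart y).symm u).flag ∧
      ∃ L, LowerTri L ∧ IsUnit L.det ∧
        L * fibreGram (gramInChart h e y.base) (frameChart e y u) * Lᴴ = 1 ∧
        IsUnitaryAdapted h ((flagChart y).symm u) (matAct L
          (tildeFrame (fun i => e i ((flagChart y).symm u).base)
            (flagCoordChart e y u))) := by
  have ht := tendsto_chart_symm_base (chart_self_mem_target y)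
  rw [(flagChart y).left_inv (mem_chart_source _ y)] at ht
  filter_upwards [(flagChart y).open_target.mem_nhds (chart_self_mem_target y),
    ht.eventually he.1.eventually, he.eventually_adapted] with u hu hef had
  refine ⟨hu, hef, had, ?_⟩
  obtain ⟨B, hB⟩ := hef.exists_basis
  have hli : LinearIndependent ℂ (tildeFrame
      (fun i => e i ((flagChart y).symm u).base) (flagCoordChart e y u)) := by
    rw [tildeFrame_eq_matAct, ← hB]
    exact linearIndependent_matAct B.linearIndependent (isUnit_det_unipotent _)
  obtain ⟨L, hL, hLd, hLS⟩ := exists_lowerTri_conj_eq_one (posDef_gramMat (h := h) hli)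
  have hG := gramMat_tildeFrame (h := h) (e := e) hu (flagCoordChart e y u)
  refine ⟨L, hL, hLd, ?_, isUnitaryAdapted_iff.mpr ⟨?_, had.matAct hL hLd⟩⟩
  · rw [hG] at hLS
    exact hLS
  · rw [gramMat_matAct, hLS]

/-- The tautological norm in terms of the frame of the coordinates `ξ`. -/
theorem tautNormSq_mk_of_gramSchmidt {w : Fin r → E y.base} (had : Adapted w y.flag)
    {L : Matrix (Fin r) (Fin r) ℂ} (hL : LowerTri L) (hLu : IsUnitaryAdapted h y (matAct L w))
    (i : Fin r) (σ : y.flag.space i.castSucc) :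
    tautNormSq h i y (Submodule.Quotient.mk σ) =
      ‖L i i‖ ^ 2 * ‖(σ : Dual ℂ (E y.base)) (w i)‖ ^ 2 := by
  rw [tautNormSq_mk hLu, apply_matAct_of_mem had hL, norm_mul, mul_pow]

end TautologicalCurvature

/-! ### Holomorphic frames of the tautological line bundles -/

section TautologicalFrame
section Fibre
variable {y : FlagBundle n r E}

open Classical in
/-- The functional in `V_{i-1}` that is the `i`-th element of the basis dual to `w`, for a basis `w`
giving the flag `y` (junk value `0` otherwise). -/
def adaptedDual (y : FlagBundle n r E) (w : Fin r → E y.base) (i : Fin r) :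
    y.flag.space i.castSucc :=
  if hB : ∃ B : Basis (Fin r) ℂ (E y.base), ⇑B = w ∧ Adapted w y.flag then
    ⟨hB.choose.coord i, (mem_space_iff hB.choose_spec.2 _ _).mpr fun j hj => by
      have h3 : j ≠ i := fun h4 => by simp [h4] at hj
      refine (congrArg (hB.choose.coord i) (congrFun hB.choose_spec.1 j).symm).trans ?_
      simp [h3]⟩
  else 0

theorem adaptedDual_apply {B : Basis (Fin r) ℂ (E y.base)} {w : Fin r → E y.base} (hBw : ⇑B = w)
    (hB : Adapted w y.flag) (i j : Fin r) :
    (adaptedDual y w i : Dual ℂ (E y.base)) (w j) = if j = i then 1 else 0 := by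
  have h1 : ∃ B' : Basis (Fin r) ℂ (E y.base), ⇑B' = w ∧ Adapted w y.flag := ⟨B, hBw, hB⟩
  rw [adaptedDual, dif_pos h1]
  have h2 : w j = h1.choose j := congrFun h1.choose_spec.1.symm j
  rw [h2, Basis.coord_apply, Basis.repr_self, Finsupp.single_apply]

end Fibre

variable [IsManifold 𝓘(ℂ, Fin n → ℂ) ω X]
  [ContMDiffVectorBundle ω (Fin r → ℂ) E 𝓘(ℂ, Fin n → ℂ)]

/-- The matrix of the frame of the coordinates `ξ` in the reference frame, in the preferred chart at `y`.
-/
def frameMat (e : Fin r → ∀ x, E x) (y : FlagBundle n r E) (u : FlagModel n r) :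
    Matrix (Fin r) (Fin r) ℂ :=
  unipotent (flagCoordChart e y u) *
    frameCoords y.base e ((baseChart y.base).symm u.1)

variable {e : Fin r → ∀ x, E x} {y : FlagBundle n r E}

theorem tildeFrame_eq_frameMat {u : FlagModel n r} (hu : u ∈ (flagChart y).target) :
    tildeFrame (fun i => e i ((flagChart y).symm u).base) (flagCoordChart e y u) =
      matAct (frameMat e y u) fun i => refFrame E y.base i ((flagChart y).symm u).base := by
  have hx := chart_symm_mem hu
  rw [tildeFrame_eq_matAct, matAct_frameCoords hx.2 e, ← matAct_mul, frameMat, chart_symm_base hu]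

theorem IsAdaptedFrame.contDiffAt_frameMat (he : IsAdaptedFrame e y) (i j : Fin r) :
    ContDiffAt ℂ ω (fun u => frameMat e y u i j) (flagChart y y) := by
  refine contDiffAt_matrix_mul (fun i j => contDiffAt_unipotent he.contDiffAt_flagCoordChart i j)
    (fun i j => ?_) i j
  have h1 := he.1.contDiffAt_frameCoords (x₀ := y.base) (mem_baseDomain y.base) i j
  rw [chart_self_base] at h1
  exact ContDiffAt.comp (flagChart y y) h1 contDiffAt_fst

theorem isUnit_det_frameMat {u : FlagModel n r} (hu : u ∈ (flagChart y).target)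
    (he : IsHolFrameNear n e ((flagChart y).symm u).base) :
    IsUnit (frameMat e y u).det := by
  have h1 := he.isUnit_det (chart_symm_mem hu).2
  rw [chart_symm_base hu] at h1
  rw [frameMat, Matrix.det_mul]
  exact (isUnit_det_unipotent _).mul h1

theorem tendsto_chart_symm_base_self (y : FlagBundle n r E) :
    Tendsto (fun u => ((flagChart y).symm u).base) (𝓝 (flagChart y y))
      (𝓝 y.base) := by
  have ht := tendsto_chart_symm_base (chart_self_mem_target y)
  rwa [(flagChart y).left_inv (mem_chart_source _ y)] at ht

theorem eventually_mem_target (y : FlagBundle n r E) :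
    ∀ᶠ u in 𝓝 (flagChart y y), u ∈ (flagChart y).target :=
  (flagChart y).open_target.mem_nhds (chart_self_mem_target y)

theorem IsAdaptedFrame.eventually_differentiableAt_frameMat (he : IsAdaptedFrame e y) :
    ∀ᶠ u in 𝓝 (flagChart y y), ∀ i j, ContDiffAt ℂ 1 (fun u => frameMat e y u i j) u :=
  eventually_all.mpr fun i => eventually_all.mpr fun j =>
    (((he.contDiffAt_frameMat i j).of_le le_top).eventually (n := 1) (by simp))

/-- A holomorphic section of the pull-back of `E^*`, evaluated on the frame of the coordinates `ξ`. -/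
theorem IsAdaptedFrame.eventually_differentiableAt_pairing (he : IsAdaptedFrame e y)
    {σ : ∀ y : FlagBundle n r E, Dual ℂ (E y.base)}
    (hσ : ∀ j, HolomorphicNear (FlagModel n r)
      (fun y' => σ y' (stdFrame E y.base (Pi.basisFun ℂ (Fin r)) j y'.base)) y) (i : Fin r) :
    ∀ᶠ u in 𝓝 (flagChart y y), DifferentiableAt ℂ (fun u =>
      σ ((flagChart y).symm u) (tildeFrame
        (fun i => e i ((flagChart y).symm u).base) (flagCoordChart e y u) i)) u := by
  have h1 : ∀ᶠ u in 𝓝 (flagChart y y), ∀ j, DifferentiableAt ℂ (fun u =>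
      σ ((flagChart y).symm u)
        (refFrame E y.base j ((flagChart y).symm u).base)) u :=
    eventually_all.mpr fun j => holomorphicNear_iff.mp (hσ j)
  filter_upwards [h1, he.eventually_differentiableAt_frameMat,
    (flagChart y).open_target.mem_nhds (chart_self_mem_target y)] with u h2 h3 hu
  have h4 : (fun u => σ ((flagChart y).symm u) (tildeFrame
      (fun i => e i ((flagChart y).symm u).base) (flagCoordChart e y u) i)) =ᶠ[𝓝 u]
      fun u => ∑ j, frameMat e y u i j * σ ((flagChart y).symm u)
        (refFrame E y.base j ((flagChart y).symm u).base) := by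
    filter_upwards [(flagChart y).open_target.mem_nhds hu] with u' hu'
    rw [tildeFrame_eq_frameMat hu', matAct, map_sum]
    exact Finset.sum_congr rfl fun j _ => map_smul _ _ _
  refine DifferentiableAt.congr_of_eventuallyEq ?_ h4
  exact DifferentiableAt.fun_sum fun j _ => ((h3 i j).differentiableAt (by simp)).mul (h2 j)

/-- The frame of the `Q_i` dual to the frame of the coordinates `ξ`. -/
def tautFrame (e : Fin r → ∀ x, E x) (i : Fin r) (y : FlagBundle n r E) : TautFiber i y :=
  Submodule.Quotient.mk (adaptedDual y (tildeFrame (fun i => e i y.base)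
    (flagCoord (fun i => e i y.base) y.flag)) i)

theorem exists_basis_tildeFrame {V : Type*} [AddCommGroup V] [Module ℂ V] (B : Basis (Fin r) ℂ V)
    (ξ : PairIdx r → ℂ) : ∃ C : Basis (Fin r) ℂ V, ⇑C = tildeFrame B ξ := by
  have : FiniteDimensional ℂ V := B.finiteDimensional_of_finite
  have hli : LinearIndependent ℂ (tildeFrame B ξ) := by
    rw [tildeFrame_eq_matAct]
    exact linearIndependent_matAct B.linearIndependent (isUnit_det_unipotent _)
  exact ⟨basisOfLinearIndependentOfCardEqFinrank' _ hli (finrank_eq_card_basis B).symm,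
    coe_basisOfLinearIndependentOfCardEqFinrank' _ _ _⟩

theorem IsAdaptedFrame.isTautFrame_tautFrame (he : IsAdaptedFrame e y) :
    IsTautFrame (fun i => tautFrame e i) y := by
  have hval : ∀ y' : FlagBundle n r E, IsHolFrameNear n e y'.base →
      Adapted (tildeFrame (fun i => e i y'.base) (flagCoord (fun i => e i y'.base) y'.flag)) y'.flag →
      ∀ i j, (adaptedDual y' (tildeFrame (fun i => e i y'.base)
        (flagCoord (fun i => e i y'.base) y'.flag)) i : Dual ℂ (E y'.base))
        (tildeFrame (fun i => e i y'.base) (flagCoord (fun i => e i y'.base) y'.flag) j) =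
        if j = i then 1 else 0 := fun y' h1 h2 i j => by
    obtain ⟨B, hB⟩ := h1.exists_basis
    obtain ⟨C, hC⟩ := exists_basis_tildeFrame B (flagCoord (fun i => e i y'.base) y'.flag)
    rw [hB] at hC
    exact adaptedDual_apply hC h2 i j
  intro i
  refine ⟨⟨fun y' => adaptedDual y' _ i, Eventually.of_forall fun y' => rfl, fun k => ?_⟩, ?_⟩
  · rw [holomorphicNear_iff]
    filter_upwards [(eventually_mem_target y).eventually_nhds,
      ((tendsto_chart_symm_base_self y).eventually he.1.eventually).eventually_nhds,
      he.eventually_adapted.eventually_nhds, he.eventually_differentiableAt_frameMat] with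
      u hu hef had hd
    have h1 : (fun u => (adaptedDual ((flagChart y).symm u) (tildeFrame
        (fun i => e i ((flagChart y).symm u).base) (flagCoordChart e y u)) i :
        Dual ℂ (E ((flagChart y).symm u).base))
        (refFrame E y.base k ((flagChart y).symm u).base)) =ᶠ[𝓝 u]
        fun u => (frameMat e y u)⁻¹ k i := by
      filter_upwards [hu, hef, had] with u' hu' hef' had'
      have h2 : (fun i => refFrame E y.base i ((flagChart y).symm u').base) =
          matAct (frameMat e y u')⁻¹ (tildeFrame (fun i => e i
            ((flagChart y).symm u').base) (flagCoordChart e y u')) := by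
        rw [tildeFrame_eq_frameMat hu', ← matAct_mul,
          Matrix.nonsing_inv_mul _ (isUnit_det_frameMat hu' hef'), matAct_one]
      refine (congrArg _ (congrFun h2 k)).trans ((map_sum _ _ _).trans ?_)
      refine (Finset.sum_eq_single i (fun j _ hj => ?_) (by simp)).trans ?_
      · refine (map_smul _ _ _).trans ((congrArg (_ • ·) (hval _ hef' had' i j)).trans ?_)
        simp [hj]
      · refine (map_smul _ _ _).trans ((congrArg (_ • ·) (hval _ hef' had' i i)).trans ?_)
        simp
    refine DifferentiableAt.congr_of_eventuallyEq ?_ h1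
    exact differentiableAt_matrix_inv (fun i j => hd i j)
      (isUnit_det_frameMat hu.self_of_nhds hef.self_of_nhds).ne_zero k i
  · intro h0
    have hel := he.2
    have hf : flagCoord (fun i => e i y.base) y.flag = 0 := he.flagCoord_eq_zero
    have had : Adapted (tildeFrame (fun i => e i y.base)
        (flagCoord (fun i => e i y.base) y.flag)) y.flag := by
      rwa [hf, tildeFrame_zero]
    have h1 := (tautFiber_mk_eq_iff had i _ 0).mp (h0.trans (Submodule.Quotient.mk_zero _).symm)
    rw [hval y he.1 had i i] at h1
    simp at h1

end TautologicalFrame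

section CurvatureFormula
theorem strictUpper_of_not_lt (N : PairIdx r → ℂ) {i j : Fin r} (hij : ¬ i < j) :
    strictUpper N i j = 0 := dif_neg hij

/-- The form `∂ ∂bar` of the logarithm of a Gram–Schmidt coefficient in normal coordinates. -/
theorem ddbar_log_quotNorm {H : (Fin n → ℂ) → Matrix (Fin r) (Fin r) ℂ} {z : Fin n → ℂ}
    (hH : ∀ i j, ContDiffAt ℝ 2 (fun z => H z i j) z) (h1 : H z = 1)
    (h0 : ∀ v, dMat ℝ H z v = 0) (i : Fin r) :
    ContDiffAt ℝ 2 (fun w => Complex.log (quotNorm (fibreGram H w) i)) (z, 0) ∧ ∀ u v,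
      ddbar (fun w => Complex.log (quotNorm (fibreGram H w) i)) (z, 0) ![u, v] =
        ∑ j, (strictUpper u.2 j i * (starRingEnd ℂ) (strictUpper v.2 j i) -
          strictUpper v.2 j i * (starRingEnd ℂ) (strictUpper u.2 j i)) -
        ∑ j, (strictUpper u.2 i j * (starRingEnd ℂ) (strictUpper v.2 i j) -
          strictUpper v.2 i j * (starRingEnd ℂ) (strictUpper u.2 i j)) +
        (leviPart (fderiv ℝ (fderiv ℝ fun z => H z i i) z) v.1 u.1 -
          leviPart (fderiv ℝ (fderiv ℝ fun z => H z i i) z) u.1 v.1) := by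
  obtain ⟨hf, hl⟩ := quotNorm_fibreGram hH h1 h0 i
  refine ⟨hf.log.1, fun u v => ?_⟩
  have h2 : ∀ u v, leviPart (fderiv ℝ (fderiv ℝ fun w =>
      Complex.log (quotNorm (fibreGram H w) i)) (z, 0)) u v =
      leviPart (fderiv ℝ (fderiv ℝ fun w => quotNorm (fibreGram H w) i) (z, 0)) u v :=
    fun u v => by simp only [leviPart, hf.log.2]
  rw [ddbar_apply hf.log.1, h2, h2]
  change leviPart _ u v - leviPart _ v u = _
  rw [hl, hl]
  simp only [Finset.sum_sub_distrib]
  ring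

theorem sum_weights_sub (a : Fin r → ℝ) (W : Fin r → Fin r → ℂ) (hW : ∀ i j, ¬ i < j → W i j = 0) :
    -∑ i, (a i : ℂ) * (∑ j, W j i - ∑ j, W i j) =
      ∑ p : PairIdx r, ((a p.1.1 - a p.1.2 : ℝ) : ℂ) * W p.1.1 p.1.2 := by
  rw [sum_pairs fun i j => ((a i - a j : ℝ) : ℂ) * W i j]
  have h1 : ∀ i j, (if i < j then ((a i - a j : ℝ) : ℂ) * W i j else 0) =
      (a i : ℂ) * W i j - (a j : ℂ) * W i j := fun i j => by
    split_ifs with hij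
    · push_cast
      ring
    · rw [hW i j hij, mul_zero, mul_zero, sub_zero]
  simp only [h1, mul_sub, Finset.mul_sum, Finset.sum_sub_distrib]
  rw [Finset.sum_comm (f := fun i j => (a i : ℂ) * W j i)]
  ring

end CurvatureFormula

/-! ### The curvature form -/

section TautologicalCurvatureForm
variable (h : HermitianMetric n r E)

variable [IsManifold 𝓘(ℂ, Fin n → ℂ) ω X]
  [ContMDiffVectorBundle ω (Fin r → ℂ) E 𝓘(ℂ, Fin n → ℂ)]

theorem horizontalForm_apply (a : Fin r → ℝ) (y : FlagBundle n r E) (u v : FlagModel n r) :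
    horizontalForm h a y ![u, v] = -∑ i, (a i : ℂ) * curvaturePairing h y.base
      (normalFrame h y i y.base) (normalFrame h y i y.base) ![u.1, v.1] := by
  refine congrArg Neg.neg ((ContinuousAlternatingMap.sum_apply _ _).trans
    (Finset.sum_congr rfl fun i _ => ?_))
  refine congrArg ((a i : ℂ) * ·) ?_
  refine (pullForm_apply _ _ _).trans (congrArg _ ?_)
  ext1 k
  fin_cases k
  · exact projDeriv_apply y u
  · exact projDeriv_apply y v

theorem verticalForm_apply (a : Fin r → ℝ) (y : FlagBundle n r E) (u v : FlagModel n r) :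
    verticalForm h a y ![u, v] = ∑ p : PairIdx r, ((a p.1.1 - a p.1.2 : ℝ) : ℂ) *
      (coordMap (normalFrame h y) y u p * (starRingEnd ℂ) (coordMap (normalFrame h y) y v p) -
        coordMap (normalFrame h y) y v p * (starRingEnd ℂ) (coordMap (normalFrame h y) y u p)) := by
  refine (ContinuousAlternatingMap.sum_apply _ _).trans (Finset.sum_congr rfl fun p _ => ?_)
  exact congrArg (((a p.1.1 - a p.1.2 : ℝ) : ℂ) * ·) (wedgeConj_apply _ _)

theorem delDelbar_funForm (F : FlagBundle n r E → ℂ) (y : FlagBundle n r E) :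
    DiffForm.delDelbar (M := FlagModel n r) (funForm F) y =
      ddbar (fun u => F ((flagChart y).symm u)) (flagChart y y) := by
  refine del_congr (delbar_congr (Eventually.of_forall fun u => ?_))
  ext w
  rfl

variable {h} in
/-- The logarithm of the tautological norm of a frame, in normal coordinates: up to pluriharmonic
terms it is the sum of the logarithms of the Gram–Schmidt coefficients. -/
theorem IsNormalFrame.ddbar_log_tautNormSq {e : Fin r → ∀ x, E x} {y : FlagBundle n r E}
    (he : IsNormalFrame h e y) (a : Fin r → ℝ) {s : ∀ i, ∀ y : FlagBundle n r E, TautFiber i y}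
    {f : FlagBundle n r E → ℂ} (hs : IsTautFrame s y) (hf : HolomorphicNear (FlagModel n r) f y)
    (hf0 : f y ≠ 0) :
    ddbar (fun u => ((Real.log (‖f ((flagChart y).symm u)‖ ^ 2 *
      ∏ i, tautNormSq h i ((flagChart y).symm u)
        (s i ((flagChart y).symm u)) ^ a i) : ℝ) : ℂ)) (flagChart y y) =
      ∑ i, (a i : ℂ) • pullForm (ddbar (fun w => Complex.log (quotNorm
        (fibreGram (gramInChart h e y.base) w) i)) (baseChart y.base y.base, 0))
        (fderiv ℂ (frameChart e y) (flagChart y y)) := by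
  have hea := he.isAdaptedFrame
  choose σ hσs hσ using fun i => (hs i).1
  set φ := flagChart y with hφ
  let F : Fin r → FlagModel n r → ℂ := fun i u => (σ i (φ.symm u) : Dual ℂ (E (φ.symm u).base))
    (tildeFrame (fun i => e i (φ.symm u).base) (flagCoordChart e y u) i)
  have hFd : ∀ i, ∀ᶠ u in 𝓝 (φ y), DifferentiableAt ℂ (F i) u := fun i =>
    hea.eventually_differentiableAt_pairing (hσ i) i
  have hyy : φ.symm (φ y) = y := φ.left_inv (mem_chart_source _ y)
  have hσe : ∀ i, ∀ᶠ u in 𝓝 (φ y), s i (φ.symm u) = Submodule.Quotient.mk (σ i (φ.symm u)) :=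
    fun i => eventually_chart_symm (mem_chart_source _ y) (hσs i)
  have hF0 : ∀ i, F i (φ y) ≠ 0 := fun i h0 => by
    have h1 : s i (φ.symm (φ y)) ≠ 0 := by
      rw [hyy]
      exact (hs i).2
    refine h1 ((hσe i).self_of_nhds.trans ?_)
    exact ((tautFiber_mk_eq_iff hea.eventually_adapted.self_of_nhds i _ 0).mpr h0).trans
      (Submodule.Quotient.mk_zero _)
  have hfd : ∀ᶠ u in 𝓝 (φ y), DifferentiableAt ℂ (fun u => f (φ.symm u)) u := holomorphicNear_iff.mp hf
  have hf0' : f (φ.symm (φ y)) ≠ 0 := by rwa [hyy]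
  obtain ⟨hfc, hfdd⟩ := ddbar_log_norm_sq hfd hf0'
  have hFl := fun i => ddbar_log_norm_sq (hFd i) (hF0 i)
  have hx := mem_baseDomain (n := n) (r := r) (E := E) y.base
  have hH : ∀ i j, ContDiffAt ℝ 2 (fun z => gramInChart h e y.base z i j)
      (baseChart y.base y.base) := fun i j =>
    (contDiffAt_gramInChart he.1 hx i j).of_le (WithTop.coe_le_coe.mpr le_top)
  have hH1 : gramInChart h e y.base (baseChart y.base y.base) = 1 := by
    rw [gramInChart_self e hx.1, he.gramMat_eq_one]
  have hq := fun i => ddbar_log_quotNorm hH hH1 (he.dMat_eq_zero hx.1) i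
  have hqc : ∀ i, ContDiffAt ℝ 2 (fun w => Complex.log (quotNorm
      (fibreGram (gramInChart h e y.base) w) i)) (frameChart e y (φ y)) := fun i => by
    rw [hea.frameChart_self]
    exact (hq i).1
  have hΨ : ContDiffAt ℂ 2 (frameChart e y) (φ y) := hea.contDiffAt_frameChart.of_le le_top
  have hqΨ : ∀ i, ContDiffAt ℝ 2 (fun u => Complex.log (quotNorm
      (fibreGram (gramInChart h e y.base) (frameChart e y u)) i)) (φ y) := fun i =>
    ContDiffAt.comp (φ y) (hqc i) (hΨ.restrict_scalars ℝ)
  have hsum : (fun u => ((Real.log (‖f (φ.symm u)‖ ^ 2 * ∏ i, tautNormSq h i (φ.symm u)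
      (s i (φ.symm u)) ^ a i) : ℝ) : ℂ)) =ᶠ[𝓝 (φ y)] fun u =>
      ((Real.log (‖f (φ.symm u)‖ ^ 2) : ℝ) : ℂ) + ∑ i, (a i : ℂ) * (Complex.log (quotNorm
        (fibreGram (gramInChart h e y.base) (frameChart e y u)) i) +
          ((Real.log (‖F i u‖ ^ 2) : ℝ) : ℂ)) := by
    filter_upwards [hfd.self_of_nhds.continuousAt.eventually_ne hf0',
      eventually_all.mpr fun i => (hFd i).self_of_nhds.continuousAt.eventually_ne (hF0 i),
      eventually_all.mpr hσe, hea.eventually_gramSchmidt (h := h)] with u h1 h2 h3 h4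
    obtain ⟨-, -, had, L, hL, hLd, hLS, hLu⟩ := h4
    have h5 : ∀ i, tautNormSq h i (φ.symm u) (s i (φ.symm u)) = ‖L i i‖ ^ 2 * ‖F i u‖ ^ 2 :=
      fun i => by
        rw [h3 i]
        exact tautNormSq_mk_of_gramSchmidt had hL hLu i _
    have hLi : ∀ i, 0 < ‖L i i‖ ^ 2 := fun i =>
      pow_pos (norm_pos_iff.mpr (hL.diag_ne_zero hLd i)) 2
    have hFi : ∀ i, 0 < ‖F i u‖ ^ 2 := fun i => pow_pos (norm_pos_iff.mpr (h2 i)) 2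
    have h6 : ∀ i, 0 < (‖L i i‖ ^ 2 * ‖F i u‖ ^ 2) ^ a i := fun i =>
      Real.rpow_pos_of_pos (mul_pos (hLi i) (hFi i)) _
    simp only [h5, quotNorm_of_conj_eq_one hL hLd hLS]
    rw [Real.log_mul (pow_pos (norm_pos_iff.mpr h1) 2).ne' (Finset.prod_pos fun i _ => h6 i).ne',
      Real.log_prod fun i _ => (h6 i).ne']
    push_cast
    congr 1
    refine Finset.sum_congr rfl fun i _ => ?_
    rw [Real.log_rpow (mul_pos (hLi i) (hFi i)), Real.log_mul (hLi i).ne' (hFi i).ne']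
    push_cast [Complex.ofReal_log (hLi i).le]
    ring
  rw [ddbar_congr hsum, ddbar_add hfc (ContDiffAt.sum fun i _ =>
    contDiffAt_const.mul ((hqΨ i).add (hFl i).1)), hfdd, zero_add,
    ddbar_sum _ fun i _ => contDiffAt_const.mul ((hqΨ i).add (hFl i).1)]
  refine Finset.sum_congr rfl fun i _ => ?_
  rw [ddbar_const_mul _ ((hqΨ i).add (hFl i).1), ddbar_add (hqΨ i) (hFl i).1, (hFl i).2, add_zero,
    ddbar_comp (hqc i) hΨ, hea.frameChart_self]

variable {h} in
theorem IsNormalFrame.sum_ddbar_apply {e : Fin r → ∀ x, E x} {y : FlagBundle n r E}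
    (he : IsNormalFrame h e y) (a : Fin r → ℝ) (u v : FlagModel n r) :
    (∑ i, (a i : ℂ) • pullForm (ddbar (fun w => Complex.log (quotNorm
        (fibreGram (gramInChart h e y.base) w) i)) (baseChart y.base y.base, 0))
        (fderiv ℂ (frameChart e y) (flagChart y y))) ![u, v] =
      ∑ i, (a i : ℂ) * curvaturePairing h y.base (e i y.base) (e i y.base) ![u.1, v.1] -
      ∑ p : PairIdx r, ((a p.1.1 - a p.1.2 : ℝ) : ℂ) *
        (coordMap e y u p * (starRingEnd ℂ) (coordMap e y v p) -
          coordMap e y v p * (starRingEnd ℂ) (coordMap e y u p)) := by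
  have hea := he.isAdaptedFrame
  have hx := mem_baseDomain (n := n) (r := r) (E := E) y.base
  have hH : ∀ i j, ContDiffAt ℝ 2 (fun z => gramInChart h e y.base z i j)
      (baseChart y.base y.base) := fun i j =>
    (contDiffAt_gramInChart he.1 hx i j).of_le (WithTop.coe_le_coe.mpr le_top)
  have hH1 : gramInChart h e y.base (baseChart y.base y.base) = 1 := by
    rw [gramInChart_self e hx.1, he.gramMat_eq_one]
  have hq := fun i => (ddbar_log_quotNorm hH hH1 (he.dMat_eq_zero hx.1) i).2
  have hcurv := fun i => curvaturePairing_of_normal h he.1 he.gramMat_eq_one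
    (he.dMat_eq_zero hx.1) i i u.1 v.1
  have hD : ∀ i, pullForm (ddbar (fun w => Complex.log (quotNorm
      (fibreGram (gramInChart h e y.base) w) i)) (baseChart y.base y.base, 0))
      (fderiv ℂ (frameChart e y) (flagChart y y)) ![u, v] =
      ddbar (fun w => Complex.log (quotNorm (fibreGram (gramInChart h e y.base) w) i))
      (baseChart y.base y.base, 0) ![(u.1, coordMap e y u), (v.1, coordMap e y v)] :=
    fun i => by
      refine (pullForm_apply _ _ _).trans (congrArg _ ?_)
      ext1 k
      fin_cases k
      · exact hea.fderiv_frameChart u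
      · exact hea.fderiv_frameChart v
  have hW := sum_weights_sub a (fun i j => strictUpper (coordMap e y u) i j *
    (starRingEnd ℂ) (strictUpper (coordMap e y v) i j) - strictUpper (coordMap e y v) i j *
    (starRingEnd ℂ) (strictUpper (coordMap e y u) i j)) fun i j hij => by
      simp only [strictUpper_of_not_lt _ hij, zero_mul, sub_zero]
  have hp : ∀ (N : PairIdx r → ℂ) (p : PairIdx r), strictUpper N p.1.1 p.1.2 = N p :=
    fun N p => dif_pos p.2
  simp only [hp] at hW
  rw [← hW, ContinuousAlternatingMap.sum_apply, sub_neg_eq_add, ← Finset.sum_add_distrib]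
  refine Finset.sum_congr rfl fun i _ => ?_
  rw [ContinuousAlternatingMap.smul_apply, hD, hq, hcurv, smul_eq_mul]
  ring

/-- The curvature of `Q^a` is the sum of its horizontal and its vertical part. -/
theorem isTautCurvature (a : Fin r → ℝ) :
    IsTautCurvature h a fun y : FlagBundle n r E => horizontalForm h a y + verticalForm h a y := by
  intro y
  have he := isNormalFrame_normalFrame h y
  refine ⟨⟨_, he.isAdaptedFrame.isTautFrame_tautFrame⟩, fun s f hs hf hf0 => ?_⟩
  have h1 := delDelbar_funForm (fun y : FlagBundle n r E =>
    ((Real.log (‖f y‖ ^ 2 * ∏ i, tautNormSq h i y (s i y) ^ a i) : ℝ) : ℂ)) y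
  have h2 := he.ddbar_log_tautNormSq a hs hf hf0
  refine Eq.trans ?_ (congrArg Neg.neg h1.symm)
  rw [h2]
  refine ContinuousAlternatingMap.ext fun w => ?_
  obtain ⟨u, v, rfl⟩ : ∃ u v : FlagModel n r, w = ![u, v] :=
    ⟨w 0, w 1, by ext1 k; fin_cases k <;> rfl⟩
  refine (congrArg₂ (· + ·) (horizontalForm_apply h a y u v) (verticalForm_apply h a y u v)).trans ?_
  refine Eq.trans ?_ (congrArg Neg.neg (he.sum_ddbar_apply a u v).symm)
  ring

end TautologicalCurvatureForm

/-! ### Powers of lines -/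

section Lines
variable {L : Type*} [AddCommGroup L] [Module ℂ L]

/-- The identification of `L^{⊗ k}` with `ℂ` given by an identification of `L` with `ℂ`. -/
def linePowEquiv (e : L ≃ₗ[ℂ] ℂ) (k : ℤ) : LinePow L k ≃ₗ[ℂ] ℂ :=
  (TensorProduct.congr
    ((PiTensorProduct.congr fun _ => e).trans
      (PiTensorProduct.constantBaseRingEquiv (Fin k.toNat) ℂ).toLinearEquiv)
    ((PiTensorProduct.congr fun _ => e.dualMap.symm.trans (LinearMap.ringLmapEquivSelf ℂ ℂ ℂ)).trans
      (PiTensorProduct.constantBaseRingEquiv (Fin (-k).toNat) ℂ).toLinearEquiv)).trans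
    (TensorProduct.lid ℂ ℂ)

theorem linePowEquiv_linePowVec (e : L ≃ₗ[ℂ] ℂ) (k : ℤ) {s : L} {t : Dual ℂ L} (hst : t s = 1) :
    linePowEquiv e k (linePowVec s t k) = e s ^ k := by
  have h1 : linePowEquiv e k (linePowVec s t k) =
      (∏ _ : Fin k.toNat, e s) * ∏ _ : Fin (-k).toNat, t (e.symm 1) := by
    simp only [linePowEquiv, linePowVec, LinearEquiv.trans_apply, TensorProduct.congr_tmul,
      PiTensorProduct.congr_tprod, TensorProduct.lid_tmul, smul_eq_mul]
    congr 1
    · exact PiTensorProduct.constantBaseRingEquiv_tprod _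
    · exact PiTensorProduct.constantBaseRingEquiv_tprod _
  have h0 : e s ≠ 0 := fun h0 => by
    rw [e.map_eq_zero_iff.mp h0, map_zero] at hst
    exact zero_ne_one hst
  have h2 : e.symm 1 = (e s)⁻¹ • s := by
    rw [LinearEquiv.symm_apply_eq, map_smul, smul_eq_mul, inv_mul_cancel₀ h0]
  rw [h1, h2, map_smul, hst, smul_eq_mul, mul_one, Finset.prod_const, Finset.prod_const,
    Finset.card_univ, Finset.card_univ, Fintype.card_fin, Fintype.card_fin]
  rcases Int.le_total 0 k with hk | hk
  · obtain ⟨m, rfl⟩ := Int.eq_ofNat_of_zero_le hk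
    simp
  · obtain ⟨m, hm⟩ := Int.eq_ofNat_of_zero_le (Int.neg_nonneg.mpr hk)
    obtain rfl : k = -(m : ℤ) := by omega
    simp

/-- The identification of a tensor product of powers of lines with `ℂ`. -/
def tensorLineEquiv {r : ℕ} {L : Fin r → Type*} [∀ i, AddCommGroup (L i)] [∀ i, Module ℂ (L i)]
    (e : ∀ i, L i ≃ₗ[ℂ] ℂ) (a : Fin r → ℤ) : (⨂[ℂ] i, LinePow (L i) (a i)) ≃ₗ[ℂ] ℂ :=
  (PiTensorProduct.congr fun i => linePowEquiv (e i) (a i)).trans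
    (PiTensorProduct.constantBaseRingEquiv (Fin r) ℂ).toLinearEquiv

theorem tensorLineEquiv_tprod {r : ℕ} {L : Fin r → Type*} [∀ i, AddCommGroup (L i)]
    [∀ i, Module ℂ (L i)] (e : ∀ i, L i ≃ₗ[ℂ] ℂ) (a : Fin r → ℤ) {s : ∀ i, L i}
    {t : ∀ i, Dual ℂ (L i)} (hst : ∀ i, t i (s i) = 1) :
    tensorLineEquiv e a (PiTensorProduct.tprod ℂ fun i => linePowVec (s i) (t i) (a i)) =
      ∏ i, e i (s i) ^ a i := by
  rw [tensorLineEquiv, LinearEquiv.trans_apply, PiTensorProduct.congr_tprod]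
  refine (PiTensorProduct.constantBaseRingEquiv_tprod _).trans (Finset.prod_congr rfl fun i _ => ?_)
  exact linePowEquiv_linePowVec (e i) (a i) (hst i)

theorem tensorLineEquiv_of_smul {r : ℕ} {L : Fin r → Type*} [∀ i, AddCommGroup (L i)]
    [∀ i, Module ℂ (L i)] {e e' : ∀ i, L i ≃ₗ[ℂ] ℂ} (a : Fin r → ℤ) {c : Fin r → ℂ}
    (hc : ∀ i v, e' i v = c i * e i v) (x : ⨂[ℂ] i, LinePow (L i) (a i)) :
    tensorLineEquiv e' a x = (∏ i, c i ^ a i) * tensorLineEquiv e a x := by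
  -- both sides are linear, and the space is spanned by the following vector
  let s : ∀ i, L i := fun i => (e i).symm 1
  let t : ∀ i, Dual ℂ (L i) := fun i => (e i : L i →ₗ[ℂ] ℂ)
  have hst : ∀ i, t i (s i) = 1 := fun i => (e i).apply_symm_apply 1
  let S : ⨂[ℂ] i, LinePow (L i) (a i) := PiTensorProduct.tprod ℂ fun i => linePowVec (s i) (t i) (a i)
  have hS : tensorLineEquiv e a S = 1 := by
    rw [tensorLineEquiv_tprod e a hst]
    exact Finset.prod_eq_one fun i _ => by simp [s]
  have hS' : tensorLineEquiv e' a S = ∏ i, c i ^ a i := by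
    rw [tensorLineEquiv_tprod e' a hst]
    exact Finset.prod_congr rfl fun i _ => by simp [s, hc]
  obtain ⟨k, rfl⟩ : ∃ k : ℂ, x = k • S := ⟨tensorLineEquiv e a x, by
    apply (tensorLineEquiv e a).injective
    rw [map_smul, hS, smul_eq_mul, mul_one]⟩
  rw [map_smul, map_smul, hS, hS', smul_eq_mul, smul_eq_mul, mul_one, mul_comm]

end Lines

section TautologicalLines
variable {y : FlagBundle n r E}

/-- The identification of the fibre of `Q_i` with `ℂ`, by evaluation on the `i`-th vector of a basis
that gives the flag. -/
def tautEquiv (B : Basis (Fin r) ℂ (E y.base)) (hB : Adapted B y.flag) (i : Fin r) :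
    TautFiber i y ≃ₗ[ℂ] ℂ :=
  LinearEquiv.ofBijective
    (Submodule.liftQ _ ((Dual.eval ℂ (E y.base) (B i)).comp (y.flag.space i.castSucc).subtype)
      fun σ hσ => by
        have h1 := (tautFiber_mk_eq_iff hB i σ 0).mp ((Submodule.Quotient.mk_eq_zero _).mpr hσ)
        exact h1) (by
      constructor
      · intro p q hpq
        induction p using Submodule.Quotient.induction_on with | _ σ
        induction q using Submodule.Quotient.induction_on with | _ τ
        exact (tautFiber_mk_eq_iff hB i σ τ).mpr hpq
      · intro c
        refine ⟨c • Submodule.Quotient.mk (adaptedDual y B i), ?_⟩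
        rw [map_smul]
        have h1 := adaptedDual_apply (B := B) rfl hB i i
        rw [if_pos rfl] at h1
        exact (congrArg (c • ·) h1).trans (mul_one c))

theorem tautEquiv_mk (B : Basis (Fin r) ℂ (E y.base)) (hB : Adapted B y.flag) (i : Fin r)
    (σ : y.flag.space i.castSucc) :
    tautEquiv B hB i (Submodule.Quotient.mk σ) = (σ : Dual ℂ (E y.base)) (B i) := rfl

theorem tautEquiv_matAct {B C : Basis (Fin r) ℂ (E y.base)} (hB : Adapted B y.flag)
    (hC : Adapted C y.flag) {L : Matrix (Fin r) (Fin r) ℂ} (hL : LowerTri L) (hCB : ⇑C = matAct L B)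
    (i : Fin r) (q : TautFiber i y) : tautEquiv C hC i q = L i i * tautEquiv B hB i q := by
  induction q using Submodule.Quotient.induction_on with | _ σ
  rw [tautEquiv_mk, tautEquiv_mk, hCB, apply_matAct_of_mem hB hL]

end TautologicalLines

/-! ### The relative canonical bundle -/

section RelativeCanonical
variable (r) in
/-- The standard basis of the space of flag coordinates. -/
def pairBasis : Basis (Fin (fiberDim r)) ℂ (PairIdx r → ℂ) :=
  (Pi.basisFun ℂ (PairIdx r)).reindex (Fintype.equivFin (PairIdx r))

/-- The identification of the top forms with `ℂ` by evaluation on a basis. -/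
def topFormEquiv {V : Type*} [AddCommGroup V] [Module ℂ V] {m : ℕ} (b : Basis (Fin m) ℂ V) :
    (V [⋀^Fin m]→ₗ[ℂ] ℂ) ≃ₗ[ℂ] ℂ where
  toFun κ := κ b
  map_add' _ _ := rfl
  map_smul' _ _ := rfl
  invFun c := c • b.det
  left_inv κ := (κ.eq_smul_basis_det b).symm
  right_inv c := (congrArg (c * ·) b.det_self).trans (mul_one c)

variable [IsManifold 𝓘(ℂ, Fin n → ℂ) ω X]
  [ContMDiffVectorBundle ω (Fin r → ℂ) E 𝓘(ℂ, Fin n → ℂ)]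

variable {e : Fin r → ∀ x, E x} {y : FlagBundle n r E}

/-- The flag coordinates given by an adapted frame identify the vertical tangent space with the model
space. -/
def verticalEquiv (he : IsAdaptedFrame e y) : verticalSpace y ≃ₗ[ℂ] (PairIdx r → ℂ) :=
  LinearEquiv.ofBijective ((coordMap e y).toLinearMap.comp (verticalSpace y).subtype) (by
    constructor
    · refine (injective_iff_map_eq_zero _).mpr fun v hv => ?_
      exact Subtype.ext (coordMap_injective he v.2 hv)
    · intro N
      have h1 := coordEquiv_apply he ((coordEquiv he).symm (0, N))
      rw [LinearEquiv.apply_symm_apply] at h1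
      exact ⟨⟨(coordEquiv he).symm (0, N), (congrArg Prod.fst h1).symm⟩, (congrArg Prod.snd h1).symm⟩)

theorem isAdaptedFrame_chartFrame (y : FlagBundle n r E) : IsAdaptedFrame (chartFrame y) y :=
  ⟨isHolFrameNear_chartFrame (mem_baseDomain y.base), adapted_chartFrame y⟩

/-- The basis of the fibre of `E` that underlies the preferred chart at `y`. -/
def fibreBasis (y : FlagBundle n r E) : Basis (Fin r) ℂ (E y.base) :=
  (isAdaptedFrame_chartFrame y).1.exists_basis.choose

theorem coe_fibreBasis (y : FlagBundle n r E) : ⇑(fibreBasis y) = fun i => chartFrame y i y.base :=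
  (isAdaptedFrame_chartFrame y).1.exists_basis.choose_spec

theorem adapted_fibreBasis (y : FlagBundle n r E) : Adapted (fibreBasis y) y.flag := by
  rw [coe_fibreBasis]
  exact adapted_chartFrame y

/-- The isomorphism `K_{Y/X} ≃ Q^ρ`: it takes the form that is one on the coordinate vectors `∂/∂ξ` of the
flag coordinates given by a frame to the product of powers of the dual sections of the `Q_i`. -/
def relCanonicalEquiv (y : FlagBundle n r E) : RelCanonical y ≃ₗ[ℂ] TautPow (canonicalWeight r) y :=
  (topFormEquiv ((pairBasis r).map (verticalEquiv (isAdaptedFrame_chartFrame y)).symm)).trans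
    (tensorLineEquiv (tautEquiv (fibreBasis y) (adapted_fibreBasis y)) (canonicalWeight r)).symm

/-- The vertical vectors with given coordinates in the preferred chart at `y`. -/
def chartVertical {u : FlagModel n r} (hu : u ∈ (flagChart y).target)
    (N : PairIdx r → ℂ) : verticalSpace ((flagChart y).symm u) :=
  ⟨mfderiv 𝓘(ℂ, FlagModel n r) 𝓘(ℂ, FlagModel n r) (flagChart y).symm u
    ((0, N) : FlagModel n r), (chart_mem_verticalSpace_iff hu _).mpr rfl⟩

theorem tensorLineEquiv_relCanonicalEquiv_self (y : FlagBundle n r E) (κ : RelCanonical y) :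
    tensorLineEquiv (tautEquiv (fibreBasis y) (adapted_fibreBasis y)) (canonicalWeight r)
      (relCanonicalEquiv y κ) =
      κ ((pairBasis r).map (verticalEquiv (isAdaptedFrame_chartFrame y)).symm) :=
  LinearEquiv.apply_symm_apply _ _

/-- The vertical parts of two charts differ by a map whose determinant is a product of powers of the
diagonal entries of the triangular matrix that relates the frames. -/
theorem det_chartVertical {u : FlagModel n r} (hu : u ∈ (flagChart y).target)
    (he : IsAdaptedFrame e ((flagChart y).symm u))
    {L : Matrix (Fin r) (Fin r) ℂ} (hL : LowerTri L) (hLd : IsUnit L.det)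
    (hLQ : transMat y.base e (chartFrame y) u.1 = L * unipotent u.2) :
    ((pairBasis r).map (verticalEquiv he).symm).det (fun m => chartVertical hu (pairBasis r m)) =
      ∏ i, (L i i)⁻¹ ^ canonicalWeight r i := by
  rw [Basis.det_map]
  have h5 : ((verticalEquiv he).symm.symm ∘ fun m => chartVertical hu (pairBasis r m)) =
      ((conjUpper L L⁻¹ : (PairIdx r → ℂ) →ₗ[ℂ] (PairIdx r → ℂ)) ∘ₗ
        (conjUpper 1 (unipotent u.2)⁻¹ : (PairIdx r → ℂ) →ₗ[ℂ] (PairIdx r → ℂ))) ∘ pairBasis r := by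
    funext m
    exact coordDeriv_vertical hu he hL hLd hLQ (v := ((0, pairBasis r m) : FlagModel n r)) rfl
  rw [h5, Basis.det_comp, Basis.det_self, mul_one, LinearMap.det_comp, det_conjUpper_unipotent_inv,
    mul_one, det_conjUpper_inv hL hLd]
  exact prod_pairs_div (fun i => L i i) fun i => hL.diag_ne_zero hLd i

/-- The identification of `K_{Y/X}` and `Q^ρ` by the preferred chart may be computed from other adapted bases,
because both sides change by the same factor. -/
theorem tensorLineEquiv_relCanonicalEquiv_of_det {B : Basis (Fin r) ℂ (E y.base)}
    (hB : Adapted B y.flag) {L : Matrix (Fin r) (Fin r) ℂ} (hL : LowerTri L) (hLd : IsUnit L.det)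
    (hC : ⇑(fibreBasis y) = matAct L B) (κ : RelCanonical y) {v : Fin (fiberDim r) → verticalSpace y}
    (hv : ((pairBasis r).map (verticalEquiv (isAdaptedFrame_chartFrame y)).symm).det v =
      ∏ i, (L i i)⁻¹ ^ canonicalWeight r i) :
    tensorLineEquiv (tautEquiv B hB) (canonicalWeight r) (relCanonicalEquiv y κ) = κ v := by
  have h1 := tensorLineEquiv_of_smul (canonicalWeight r) (fun i q =>
    tautEquiv_matAct hB (adapted_fibreBasis y) hL hC i q) (relCanonicalEquiv y κ)
  rw [tensorLineEquiv_relCanonicalEquiv_self] at h1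
  have h3 : κ v = κ ((pairBasis r).map (verticalEquiv (isAdaptedFrame_chartFrame y)).symm) *
      ((pairBasis r).map (verticalEquiv (isAdaptedFrame_chartFrame y)).symm).det v := by
    conv_lhs => rw [κ.eq_smul_basis_det
      ((pairBasis r).map (verticalEquiv (isAdaptedFrame_chartFrame y)).symm)]
    rfl
  rw [h3, h1, hv, mul_right_comm, ← Finset.prod_mul_distrib, Finset.prod_eq_one, one_mul]
  intro i _
  rw [← mul_zpow, mul_inv_cancel₀ (hL.diag_ne_zero hLd i), one_zpow]

/-- The isomorphism `K_{Y/X} ≃ Q^ρ` in a chart. -/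
theorem tensorLineEquiv_relCanonicalEquiv {u : FlagModel n r}
    (hu : u ∈ (flagChart y).target) {y' : FlagBundle n r E}
    (hy' : y' = (flagChart y).symm u) {B : Basis (Fin r) ℂ (E y'.base)}
    (hB : Adapted B y'.flag) (hBt : ⇑B = tildeFrame (fun i => chartFrame y i y'.base) u.2)
    (κ : RelCanonical y') {v : Fin (fiberDim r) → verticalSpace y'}
    (hv : ∀ m, ((v m).1 : FlagModel n r) = mfderiv 𝓘(ℂ, FlagModel n r) 𝓘(ℂ, FlagModel n r)
      (flagChart y).symm u ((0, pairBasis r m) : FlagModel n r)) :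
    tensorLineEquiv (tautEquiv B hB) (canonicalWeight r) (relCanonicalEquiv y' κ) = κ v := by
  have he := isAdaptedFrame_chartFrame y'
  have h1 : ∃ L, LowerTri L ∧ IsUnit L.det ∧ ⇑(fibreBasis y') = matAct L B ∧
      ((pairBasis r).map (verticalEquiv he).symm).det v = ∏ i, (L i i)⁻¹ ^ canonicalWeight r i := by
    subst hy'
    obtain ⟨L, hL, hLd, hLQ, hLe⟩ := exists_lowerTri_transMat hu he.1 he.2
      (isHolFrameNear_chartFrame (chart_symm_mem hu)) (chart_symm_adapted hu)
    refine ⟨L, hL, hLd, (coe_fibreBasis _).trans (hLe.trans (congrArg (matAct L) hBt.symm)), ?_⟩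
    obtain rfl : v = fun m => chartVertical hu (pairBasis r m) := funext fun m => Subtype.ext (hv m)
    exact det_chartVertical hu he hL hLd hLQ
  obtain ⟨L, hL, hLd, hC, hd⟩ := h1
  exact tensorLineEquiv_relCanonicalEquiv_of_det hB hL hLd hC κ hd

end RelativeCanonical

/-! ### Holomorphic sections of the relative canonical bundle -/

section RelativeCanonicalHolomorphic
variable [IsManifold 𝓘(ℂ, Fin n → ℂ) ω X]
  [ContMDiffVectorBundle ω (Fin r → ℂ) E 𝓘(ℂ, Fin n → ℂ)]

/-- The frame of `E` at the base point of `y'` that belongs to the coordinates of `y'` in the preferred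
chart at `y`. -/
def movingFrame (y y' : FlagBundle n r E) : Fin r → E y'.base :=
  tildeFrame (fun i => chartFrame y i y'.base) (flagCoord (fun i => chartFrame y i y'.base) y'.flag)

theorem movingFrame_chart_symm {y : FlagBundle n r E} {u : FlagModel n r}
    (hu : u ∈ (flagChart y).target) :
    movingFrame y ((flagChart y).symm u) =
      tildeFrame (fun i => chartFrame y i ((flagChart y).symm u).base) u.2 := by
  obtain ⟨B, hB⟩ := (isHolFrameNear_chartFrame (chart_symm_mem hu)).exists_basis
  have h1 := chart_symm_adapted hu
  rw [movingFrame]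
  rw [← hB] at h1 ⊢
  rw [flagCoord_eq B h1]

theorem exists_basis_movingFrame {y y' : FlagBundle n r E}
    (hy : y' ∈ (flagChart y).source) :
    ∃ B : Basis (Fin r) ℂ (E y'.base), ⇑B = movingFrame y y' ∧ Adapted B y'.flag := by
  obtain ⟨u, hu, rfl⟩ : ∃ u, ∃ _ : u ∈ (flagChart y).target,
      y' = (flagChart y).symm u :=
    ⟨_, (flagChart y).map_source hy, ((flagChart y).left_inv hy).symm⟩
  obtain ⟨B, hB⟩ := (isHolFrameNear_chartFrame (chart_symm_mem hu)).exists_basis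
  obtain ⟨C, hC⟩ := exists_basis_tildeFrame B u.2
  rw [hB] at hC
  exact ⟨C, hC.trans (movingFrame_chart_symm hu).symm, hC ▸ chart_symm_adapted hu⟩

open Classical in
/-- The coefficient of an element of the fibre of `Q^a` with respect to the frame given by the preferred
chart at `y` (junk value `0` outside of this chart). -/
def tautCoeff (a : Fin r → ℤ) (y y' : FlagBundle n r E) (x : TautPow a y') : ℂ :=
  if hB : ∃ B : Basis (Fin r) ℂ (E y'.base), ⇑B = movingFrame y y' ∧ Adapted B y'.flag then
    tensorLineEquiv (tautEquiv hB.choose hB.choose_spec.2) a x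
  else 0

theorem tautCoeff_eq (a : Fin r → ℤ) {y y' : FlagBundle n r E} {B : Basis (Fin r) ℂ (E y'.base)}
    (hB : ⇑B = movingFrame y y') (had : Adapted B y'.flag) (x : TautPow a y') :
    tautCoeff a y y' x = tensorLineEquiv (tautEquiv B had) a x := by
  have h1 : ∃ B : Basis (Fin r) ℂ (E y'.base), ⇑B = movingFrame y y' ∧ Adapted B y'.flag :=
    ⟨B, hB, had⟩
  have h2 : h1.choose = B := DFunLike.coe_injective (h1.choose_spec.1.trans hB.symm)
  have h3 : ∀ (C : Basis (Fin r) ℂ (E y'.base)) (hC : Adapted C y'.flag), C = B →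
      tensorLineEquiv (tautEquiv C hC) a x = tensorLineEquiv (tautEquiv B had) a x := by
    rintro _ _ rfl
    rfl
  rw [tautCoeff, dif_pos h1]
  exact h3 _ _ h2

theorem eventually_mem_source (y : FlagBundle n r E) :
    ∀ᶠ y' in 𝓝 y, y' ∈ (flagChart y).source :=
  (flagChart y).open_source.mem_nhds (mem_chart_source _ y)

/-- The frame of the `Q_i` given by the preferred chart takes the value one under the identification with
`ℂ`. -/
theorem tautEquiv_tautFrame {y y' : FlagBundle n r E} {B : Basis (Fin r) ℂ (E y'.base)}
    (hB : ⇑B = movingFrame y y') (had : Adapted B y'.flag) (i : Fin r) :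
    tautEquiv B had i (tautFrame (chartFrame y) i y') = 1 := by
  have h1 := adaptedDual_apply (B := B) hB (hB ▸ had) i i
  rw [if_pos rfl] at h1
  refine (tautEquiv_mk B had i _).trans (Eq.trans ?_ h1)
  exact congrArg _ (congrFun hB i)

/-- A section of `Q^a` is holomorphic if its coefficient in the preferred chart is. -/
theorem isHolTautPowSection_of_tautCoeff (a : Fin r → ℤ) {S : ∀ y : FlagBundle n r E, TautPow a y}
    {y : FlagBundle n r E}
    (hS : HolomorphicNear (FlagModel n r) (fun y' => tautCoeff a y y' (S y')) y) :
    IsHolTautPowSection a S y := by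
  have hB : ∀ y', y' ∈ (flagChart y).source →
      ∃ t : ∀ i, Dual ℂ (TautFiber i y'), (∀ i, t i (tautFrame (chartFrame y) i y') = 1) ∧
        S y' = tautCoeff a y y' (S y') • PiTensorProduct.tprod ℂ fun i =>
          linePowVec (tautFrame (chartFrame y) i y') (t i) (a i) := fun y' hy' => by
    obtain ⟨B, hB, had⟩ := exists_basis_movingFrame hy'
    have h1 := fun i => tautEquiv_tautFrame hB had i
    refine ⟨fun i => (tautEquiv B had i).toLinearMap, h1, ?_⟩
    apply (tensorLineEquiv (tautEquiv B had) a).injective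
    rw [map_smul, tensorLineEquiv_tprod (tautEquiv B had) a h1, ← tautCoeff_eq a hB had]
    simp only [h1, one_zpow, Finset.prod_const_one, smul_eq_mul, mul_one]
  choose! t ht using hB
  exact ⟨_, fun i => tautFrame (chartFrame y) i, fun i y' => t y' i, hS,
    (isAdaptedFrame_chartFrame y).isTautFrame_tautFrame,
    (eventually_mem_source y).mono fun y' hy' => (ht y' hy').1,
    (eventually_mem_source y).mono fun y' hy' => (ht y' hy').2⟩

theorem IsHolTautPowSection.tautCoeff {a : Fin r → ℤ} {S : ∀ y : FlagBundle n r E, TautPow a y}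
    {y : FlagBundle n r E} (hS : IsHolTautPowSection a S y) :
    HolomorphicNear (FlagModel n r) (fun y' => _root_.tautCoeff a y y' (S y')) y := by
  obtain ⟨f, s, t, hf, hs, ht, hfs⟩ := hS
  have he := isAdaptedFrame_chartFrame y
  choose σ hσ hσd using fun i => (hs i).1
  have h0 : ∀ᶠ y' in 𝓝 y, (∀ i, (σ i y' : Dual ℂ (E y'.base)) (movingFrame y y' i) ≠ 0) ∧
      _root_.tautCoeff a y y' (S y') =
        f y' * ∏ i, (σ i y' : Dual ℂ (E y'.base)) (movingFrame y y' i) ^ a i := by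
    filter_upwards [ht, hfs, eventually_all.mpr hσ, eventually_mem_source y] with y' ht hfs hσ hy
    obtain ⟨B, hB, had⟩ := exists_basis_movingFrame hy
    have h1 : ∀ i, tautEquiv B had i (s i y') =
        (σ i y' : Dual ℂ (E y'.base)) (movingFrame y y' i) := fun i => by
      rw [hσ i, tautEquiv_mk, hB]
    refine ⟨fun i h2 => ?_, ?_⟩
    · rw [← h1, LinearEquiv.map_eq_zero_iff] at h2
      have h3 := ht i
      rw [h2, map_zero] at h3
      exact zero_ne_one h3
    · rw [tautCoeff_eq a hB had, hfs, map_smul, tensorLineEquiv_tprod (tautEquiv B had) a ht, smul_eq_mul]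
      simp only [h1]
  have h1 : HolomorphicNear (FlagModel n r) (fun y' => f y' *
      ∏ i, (σ i y' : Dual ℂ (E y'.base)) (movingFrame y y' i) ^ a i) y := by
    rw [holomorphicNear_iff] at hf ⊢
    have h2 : ∀ᶠ u in 𝓝 (flagChart y y), ∀ i, DifferentiableAt ℂ (fun u =>
        (σ i ((flagChart y).symm u) :
          Dual ℂ (E ((flagChart y).symm u).base))
          (movingFrame y ((flagChart y).symm u) i)) u :=
      eventually_all.mpr fun i => he.eventually_differentiableAt_pairing
        (σ := fun y' => (σ i y' : Dual ℂ (E y'.base))) (hσd i) i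
    filter_upwards [hf, h2, eventually_chart_symm (mem_chart_source _ y) (h0.mono fun _ h => h.1)] with u hf h2 h3
    refine hf.mul (HasFDerivAt.finsetProd fun i _ => DifferentiableAt.hasFDerivAt
      (f := fun v => (σ i ((flagChart y).symm v) : Dual ℂ (E _))
        (movingFrame y ((flagChart y).symm v) i) ^ a i) ?_).differentiableAt
    exact (differentiableAt_zpow.mpr (Or.inl (h3 i))).comp u (h2 i)
  have h2 := h0.eventually_nhds
  filter_upwards [h1, h2] with y' h1 h2
  exact h1.congr_of_eventuallyEq (h2.mono fun _ h => h.2)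

theorem tautCoeff_relCanonicalEquiv {y : FlagBundle n r E} {u : FlagModel n r}
    (hu : u ∈ (flagChart y).target)
    (κ : RelCanonical ((flagChart y).symm u)) :
    tautCoeff (canonicalWeight r) y ((flagChart y).symm u)
      (relCanonicalEquiv ((flagChart y).symm u) κ) =
      κ fun m => chartVertical hu (pairBasis r m) := by
  obtain ⟨B, hB, had⟩ := exists_basis_movingFrame ((flagChart y).map_target hu)
  rw [tautCoeff_eq _ hB had]
  exact tensorLineEquiv_relCanonicalEquiv hu rfl had (hB.trans (movingFrame_chart_symm hu)) κ
    fun m => rfl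

theorem continuous_pairBasis_det : Continuous fun v : Fin (fiberDim r) → PairIdx r → ℂ =>
    (pairBasis r).det v := by
  simp only [Basis.det_apply]
  refine Continuous.matrix_det (continuous_matrix fun i j => ?_)
  have h1 : ∀ v : Fin (fiberDim r) → PairIdx r → ℂ, (pairBasis r).toMatrix v i j =
      v j ((Fintype.equivFin (PairIdx r)).symm i) := fun v => by
    simp [Basis.toMatrix_apply, pairBasis]
  simp only [h1]
  fun_prop

variable (r) in
/-- The complex volume form on the space of flag coordinates. -/
def pairDet : (PairIdx r → ℂ) [⋀^Fin (fiberDim r)]→L[ℂ] ℂ :=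
  { (pairBasis r).det with cont := continuous_pairBasis_det }

theorem chartVertical_basis {y : FlagBundle n r E} {u : FlagModel n r}
    (hu : u ∈ (flagChart y).target) :
    ∃ b : Basis (Fin (fiberDim r)) ℂ (verticalSpace ((flagChart y).symm u)),
      ∀ m, b m = chartVertical hu (pairBasis r m) := by
  let f : (PairIdx r → ℂ) →ₗ[ℂ] verticalSpace ((flagChart y).symm u) :=
    { toFun := chartVertical hu
      map_add' := fun N N' => Subtype.ext (by
        refine Eq.trans ?_ (ContinuousLinearMap.map_add (mfderiv 𝓘(ℂ, FlagModel n r) 𝓘(ℂ, FlagModel n r)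
          (flagChart y).symm u) ((0, N) : FlagModel n r) ((0, N') : FlagModel n r))
        exact congrArg (mfderiv 𝓘(ℂ, FlagModel n r) 𝓘(ℂ, FlagModel n r)
          (flagChart y).symm u) (Prod.ext (add_zero (0 : Fin n → ℂ)).symm rfl :
          ((0, N + N') : FlagModel n r) = (0, N) + (0, N')))
      map_smul' := fun c N => Subtype.ext (by
        refine Eq.trans ?_ (ContinuousLinearMap.map_smul (mfderiv 𝓘(ℂ, FlagModel n r) 𝓘(ℂ, FlagModel n r)
          (flagChart y).symm u) c ((0, N) : FlagModel n r))
        exact congrArg (mfderiv 𝓘(ℂ, FlagModel n r) 𝓘(ℂ, FlagModel n r)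
          (flagChart y).symm u) (Prod.ext (smul_zero c).symm rfl :
          ((0, c • N) : FlagModel n r) = c • ((0, N) : FlagModel n r))) }
  have hf : Function.Bijective f := by
    have h0 := bijective_mfderiv_chart_symm hu
    constructor
    · intro N N' hN
      exact congrArg Prod.snd (h0.1 (congrArg Subtype.val hN))
    · intro v
      obtain ⟨w, hw⟩ := h0.2 v.1
      have h1 : w.1 = 0 := (chart_mem_verticalSpace_iff hu w).mp (by rw [hw]; exact v.2)
      exact ⟨w.2, Subtype.ext (Eq.trans (congrArg (mfderiv 𝓘(ℂ, FlagModel n r) 𝓘(ℂ, FlagModel n r)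
        (flagChart y).symm u) (Prod.ext h1.symm rfl : ((0, w.2) : FlagModel n r) = w)) hw)⟩
  exact ⟨(pairBasis r).map (LinearEquiv.ofBijective f hf), fun m => rfl⟩

/-- A section of the relative canonical bundle is holomorphic if and only if its coefficient in the
preferred chart is. -/
theorem isHolRelCanonicalSection_iff_coeff {κ : ∀ y : FlagBundle n r E, RelCanonical y}
    {y : FlagBundle n r E} {C : FlagBundle n r E → ℂ}
    (hC : ∀ u (hu : u ∈ (flagChart y).target),
      C ((flagChart y).symm u) = κ ((flagChart y).symm u)
        fun m => chartVertical hu (pairBasis r m)) :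
    IsHolRelCanonicalSection κ y ↔ HolomorphicNear (FlagModel n r) C y := by
  have hy := mem_chart_source (FlagModel n r) y
  constructor
  · rintro ⟨β, hβ, hκ⟩
    refine holomorphicNear_iff.mpr ?_
    filter_upwards [hβ, (eventually_mem_target y).eventually_nhds,
      (eventually_chart_symm hy hκ).eventually_nhds] with u hβ hu hκ
    have h1 := ((ContinuousAlternatingMap.apply ℂ (FlagModel n r) ℂ
      (fun m => ((0, pairBasis r m) : FlagModel n r))).differentiableAt).comp u hβ
    refine h1.congr_of_eventuallyEq ?_
    filter_upwards [hu, hκ] with v hv hκ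
    rw [hC v hv, hκ]
    rfl
  · intro hS
    have h1 := holomorphicNear_iff.mp hS
    let β : ∀ y' : FlagBundle n r E,
        TangentSpace 𝓘(ℂ, FlagModel n r) y' [⋀^Fin (fiberDim r)]→L[ℂ] ℂ := fun y' =>
      C y' • (pairDet r).compContinuousLinearMap
        ((ContinuousLinearMap.snd ℂ (Fin n → ℂ) (PairIdx r → ℂ)).comp
          (mfderiv 𝓘(ℂ, FlagModel n r) 𝓘(ℂ, FlagModel n r) (flagChart y) y'))
    have hβ : ∀ u ∈ (flagChart y).target,
        ((β ((flagChart y).symm u)).compContinuousLinearMap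
          (mfderiv 𝓘(ℂ, FlagModel n r) 𝓘(ℂ, FlagModel n r) (flagChart y).symm u) :
          FlagModel n r [⋀^Fin (fiberDim r)]→L[ℂ] ℂ) =
        C ((flagChart y).symm u) • (pairDet r).compContinuousLinearMap
          (ContinuousLinearMap.snd ℂ (Fin n → ℂ) (PairIdx r → ℂ)) := fun u hu => by
      have : IsManifold 𝓘(ℂ, FlagModel n r) 1 (FlagBundle n r E) := IsManifold.of_le (n := ω) (by simp)
      have h2 : ∀ w : FlagModel n r, mfderiv 𝓘(ℂ, FlagModel n r) 𝓘(ℂ, FlagModel n r)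
          (flagChart y) ((flagChart y).symm u)
          (mfderiv 𝓘(ℂ, FlagModel n r) 𝓘(ℂ, FlagModel n r) (flagChart y).symm u w) = w :=
        fun w => congrArg (fun D : FlagModel n r →L[ℂ] FlagModel n r => D w)
          ((mdifferentiable_chart (I := 𝓘(ℂ, FlagModel n r)) y).comp_symm_deriv hu)
      refine ContinuousAlternatingMap.ext fun w => ?_
      exact congrArg (fun v : Fin (fiberDim r) → PairIdx r → ℂ => C _ * pairDet r v)
        (funext fun m => congrArg Prod.snd (h2 (w m)))
    refine ⟨β, ?_, ?_⟩
    · filter_upwards [h1, (eventually_mem_target y).eventually_nhds] with u h1 hu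
      refine DifferentiableAt.congr_of_eventuallyEq ?_ (hu.mono fun v hv => hβ v hv)
      exact h1.smul_const _
    · filter_upwards [eventually_mem_source y] with y' hy'
      obtain ⟨u, hu, rfl⟩ : ∃ u, ∃ _ : u ∈ (flagChart y).target,
          y' = (flagChart y).symm u :=
        ⟨_, (flagChart y).map_source hy', ((flagChart y).left_inv hy').symm⟩
      obtain ⟨b, hb⟩ := chartVertical_basis hu
      have h3 : ⇑b = fun m => chartVertical hu (pairBasis r m) := funext hb
      have h4 : (β ((flagChart y).symm u)).toAlternatingMap.compLinearMap
          (verticalSpace _).subtype b = κ _ b := by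
        have h5 := congrArg (fun α : FlagModel n r [⋀^Fin (fiberDim r)]→L[ℂ] ℂ =>
          α fun m => ((0, pairBasis r m) : FlagModel n r)) (hβ u hu)
        have h6 : C ((flagChart y).symm u) * (pairBasis r).det (pairBasis r) =
            κ ((flagChart y).symm u) b := by
          rw [Basis.det_self, mul_one, h3]
          exact hC u hu
        refine Eq.trans ?_ (h5.trans h6)
        rw [h3]
        rfl
      rw [(κ _).eq_smul_basis_det b, AlternatingMap.eq_smul_basis_det b
        ((β ((flagChart y).symm u)).toAlternatingMap.compLinearMap
          (verticalSpace _).subtype), h4]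

/-- The isomorphism `K_{Y/X} ≃ Q^ρ` is holomorphic. -/
theorem isHolRelCanonicalSection_iff (κ : ∀ y : FlagBundle n r E, RelCanonical y)
    (y : FlagBundle n r E) : IsHolRelCanonicalSection κ y ↔
      IsHolTautPowSection (canonicalWeight r)
        (fun y' : FlagBundle n r E => relCanonicalEquiv y' (κ y')) y :=
  (isHolRelCanonicalSection_iff_coeff
    fun _ hu => tautCoeff_relCanonicalEquiv hu _).trans
    ⟨isHolTautPowSection_of_tautCoeff _, IsHolTautPowSection.tautCoeff⟩

end RelativeCanonicalHolomorphic

/-! ### The relative volume form in the coordinates of a normal frame -/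

theorem trace_real_eq {ι : Type*} [Fintype ι] [DecidableEq ι] (f : (ι → ℂ) →ₗ[ℂ] (ι → ℂ)) :
    LinearMap.trace ℝ (ι → ℂ) (f.restrictScalars ℝ) = 2 * (LinearMap.trace ℂ (ι → ℂ) f).re := by
  rw [LinearMap.trace_eq_matrix_trace ℝ (Complex.basisOneI.smulTower (Pi.basisFun ℂ ι)),
    LinearMap.trace_eq_matrix_trace ℂ (Pi.basisFun ℂ ι), Matrix.trace, Matrix.trace,
    Fintype.sum_prod_type, Fin.sum_univ_two, Complex.re_sum, Finset.mul_sum,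
    ← Finset.sum_add_distrib]
  refine Finset.sum_congr rfl fun p _ => ?_
  simp only [Matrix.diag_apply, LinearMap.toMatrix_apply, Basis.smulTower_repr, Basis.smulTower_apply,
    LinearMap.restrictScalars_apply, Complex.coe_basisOneI, Complex.coe_basisOneI_repr, map_smul,
    Pi.basisFun_repr, Finsupp.smul_apply, smul_eq_mul]
  simp [two_mul]

section ConnectionLinear
variable {G : Type*} [NormedAddCommGroup G] [NormedSpace ℂ G] {ι : Type*} [Fintype ι] [DecidableEq ι]
  {H : G → Matrix ι ι ℂ}

theorem connMat_add (x u v : G) : connMat H x (u + v) = connMat H x u + connMat H x v := by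
  have h1 : ∀ u v : G, dMat ℝ H x (u + v) = dMat ℝ H x u + dMat ℝ H x v := fun u v => by
    ext i j
    simp [dMat]
  rw [connMat, connMat, connMat, smul_add, h1, h1, ← add_mul, ← smul_add]
  congr 2
  rw [smul_add]
  abel

theorem connMat_smul (x : G) (c : ℂ) (v : G) : connMat H x (c • v) = c • connMat H x v := by
  rw [connMat, connMat, ← Matrix.smul_mul]
  congr 1
  ext i j
  exact linPart_smul (fderiv ℝ (fun u => H u i j) x) c v

theorem contDiffAt_connMat {H : G → Matrix ι ι ℂ} {x : G}
    (hH : ∀ i j, ContDiffAt ℝ ∞ (fun u => H u i j) x) (hd : (H x).det ≠ 0) (v : G) (i j : ι) :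
    ContDiffAt ℝ ∞ (fun z => connMat H z v i j) x := by
  have h1 : ∀ v i j, ContDiffAt ℝ ∞ (fun z => dMat ℝ H z v i j) x := fun v i j =>
    ((hH i j).fderiv_right (m := ∞) (by simp)).clm_apply contDiffAt_const
  refine contDiffAt_matrix_mul (fun i j => ?_) (contDiffAt_matrix_inv hH hd) i j
  exact contDiffAt_const.mul ((h1 v i j).sub (contDiffAt_const.mul (h1 (Complex.I • v) i j)))

end ConnectionLinear

section RelativeVolumeModel
/-- The linear map `N ↦ upper(N B - B N + upper(B) N)` on strictly upper triangular matrices. -/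
def commUpper (B : Matrix (Fin r) (Fin r) ℂ) : (PairIdx r → ℂ) →L[ℂ] (PairIdx r → ℂ) :=
  conjUpper 1 B - conjUpper B 1 + conjUpper (strictUpper (upperPart B)) 1

theorem trace_conjUpper (X Y : Matrix (Fin r) (Fin r) ℂ) :
    LinearMap.trace ℂ (PairIdx r → ℂ) (conjUpper X Y) =
      ∑ p : PairIdx r, X p.1.1 p.1.1 * Y p.1.2 p.1.2 := by
  have h1 : (conjUpper X Y : (PairIdx r → ℂ) →ₗ[ℂ] (PairIdx r → ℂ)) =
    Matrix.toLin' (Matrix.of fun p q : PairIdx r => X p.1.1 q.1.1 * Y q.1.2 p.1.2) := rfl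
  rw [h1, Matrix.trace_toLin'_eq]
  rfl

/-- The trace of the action of the connection on the flag coordinates: the second origin of the canonical
weight. -/
theorem trace_commUpper (B : Matrix (Fin r) (Fin r) ℂ) :
    LinearMap.trace ℂ (PairIdx r → ℂ) (commUpper B) = ∑ i, (canonicalWeight r i : ℂ) * B i i := by
  have h1 : (commUpper B : (PairIdx r → ℂ) →ₗ[ℂ] (PairIdx r → ℂ)) =
      (conjUpper 1 B : (PairIdx r → ℂ) →ₗ[ℂ] (PairIdx r → ℂ)) - conjUpper B 1 +
        conjUpper (strictUpper (upperPart B)) 1 := rfl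
  refine Eq.trans ?_ ((congrArg Neg.neg (sum_pairs_sub fun i => B i i)).trans (neg_neg _))
  rw [h1, map_add, map_sub, trace_conjUpper, trace_conjUpper, trace_conjUpper,
    ← Finset.sum_sub_distrib, ← Finset.sum_neg_distrib, ← Finset.sum_add_distrib]
  refine Finset.sum_congr rfl fun p _ => ?_
  rw [strictUpper_of_not_lt _ (lt_irrefl _), Matrix.one_apply_eq, Matrix.one_apply_eq]
  ring

/-- The part of the differential of the flag coordinates of a parallel frame that involves the
connection. -/
def connTwist (H : (Fin n → ℂ) → Matrix (Fin r) (Fin r) ℂ) (w : FlagModel n r) (a : Fin n → ℂ) :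
    PairIdx r → ℂ :=
  upperPart (strictUpper (upperPart (unipotent w.2 * connMat H w.1 a * (unipotent w.2)⁻¹)) *
    unipotent w.2)

theorem strictUpper_add (N N' : PairIdx r → ℂ) :
    strictUpper (N + N') = strictUpper N + strictUpper N' := by
  ext i j
  by_cases h : i < j <;> simp [strictUpper, h]

theorem strictUpper_smul (c : ℂ) (N : PairIdx r → ℂ) : strictUpper (c • N) = c • strictUpper N := by
  ext i j
  by_cases h : i < j <;> simp [strictUpper, h]

theorem upperPart_add (X Y : Matrix (Fin r) (Fin r) ℂ) : upperPart (X + Y) = upperPart X + upperPart Y :=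
  rfl

theorem upperPart_smul (c : ℂ) (X : Matrix (Fin r) (Fin r) ℂ) : upperPart (c • X) = c • upperPart X := rfl

theorem upperPart_strictUpper (N : PairIdx r → ℂ) : upperPart (strictUpper N) = N := by
  funext p
  exact dif_pos p.2

/-- The differential of the flag coordinates of a parallel frame, up to a factor of determinant of
modulus given by `relDensity`. -/
def connForm (H : (Fin n → ℂ) → Matrix (Fin r) (Fin r) ℂ) (w : FlagModel n r) :
    FlagModel n r →L[ℂ] (PairIdx r → ℂ) :=
  LinearMap.toContinuousLinearMap
    { toFun := fun v => v.2 + connTwist H w v.1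
      map_add' := fun u v => by
        simp only [connTwist, Prod.fst_add, Prod.snd_add, connMat_add, mul_add, add_mul, upperPart_add,
          strictUpper_add]
        abel
      map_smul' := fun c v => by
        simp only [connTwist, Prod.smul_fst, Prod.smul_snd, connMat_smul, Matrix.mul_smul, Matrix.smul_mul,
          upperPart_smul, strictUpper_smul, smul_add, RingHom.id_apply] }

theorem connForm_apply (H : (Fin n → ℂ) → Matrix (Fin r) (Fin r) ℂ) (w v : FlagModel n r) :
    connForm H w v = v.2 + connTwist H w v.1 := rfl

theorem connTwist_zero (H : (Fin n → ℂ) → Matrix (Fin r) (Fin r) ℂ) (w : FlagModel n r) :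
    connTwist H w 0 = 0 := by
  have h1 := connForm_apply H w 0
  rw [map_zero] at h1
  simpa using h1.symm

/-- The density of the relative volume form. -/
def relDensity (H : (Fin n → ℂ) → Matrix (Fin r) (Fin r) ℂ) (w : FlagModel n r) : ℂ :=
  ∏ p : PairIdx r, quotNorm (fibreGram H w) p.1.1 * (quotNorm (fibreGram H w) p.1.2)⁻¹

/-- The relative volume form in the coordinates `(z, ξ)` of a frame with Gram matrix `H`. -/
def relForm (H : (Fin n → ℂ) → Matrix (Fin r) (Fin r) ℂ) (w : FlagModel n r) :
    FlagModel n r [⋀^Fin (2 * fiberDim r)]→L[ℝ] ℂ :=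
  relDensity H w • pullForm (volForm r) (connForm H w)

theorem relForm_apply (H : (Fin n → ℂ) → Matrix (Fin r) (Fin r) ℂ) (w : FlagModel n r)
    (v : Fin (2 * fiberDim r) → FlagModel n r) :
    relForm H w v = relDensity H w * volForm r fun k => (v k).2 + connTwist H w (v k).1 := rfl

/-- A form depends smoothly on parameters if its values on constant vectors do. -/
theorem contDiffAt_form {G V : Type*} [NormedAddCommGroup G] [NormedSpace ℝ G] [NormedAddCommGroup V]
    [NormedSpace ℝ V] [FiniteDimensional ℝ V] {k : ℕ} {m : ℕ∞ω} {α : G → V [⋀^Fin k]→L[ℝ] ℂ} {x : G}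
    (hα : ∀ v, ContDiffAt ℝ m (fun u => α u v) x) : ContDiffAt ℝ m α x := by
  -- the evaluations on tuples of basis vectors are finitely many linear functionals that separate points
  let b := Module.finBasis ℝ V
  let ev : (V [⋀^Fin k]→L[ℝ] ℂ) →ₗ[ℝ] ((Fin k → Fin (finrank ℝ V)) → ℂ) :=
    { toFun := fun α s => α fun i => b (s i)
      map_add' := fun _ _ => rfl
      map_smul' := fun _ _ => rfl }
  have hev : LinearMap.ker ev = ⊥ := by
    refine (Submodule.eq_bot_iff _).mpr fun β hβ => ?_
    refine ContinuousAlternatingMap.toAlternatingMap_injective (Basis.ext_alternating b fun s _ => ?_)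
    exact congrFun (LinearMap.mem_ker.mp hβ) s
  obtain ⟨g, hg⟩ := ev.exists_leftInverse_of_injective hev
  have h1 : ∀ u, LinearMap.toContinuousLinearMap g (ev (α u)) = α u := fun u =>
    congrArg (fun f => f (α u)) hg
  have h2 : ContDiffAt ℝ m (fun u => ev (α u)) x := contDiffAt_pi.mpr fun s => hα _
  exact ((LinearMap.toContinuousLinearMap g).contDiff.contDiffAt.comp x h2).congr_of_eventuallyEq
    (Eventually.of_forall fun u => (h1 u).symm)

variable {H : (Fin n → ℂ) → Matrix (Fin r) (Fin r) ℂ} {z : Fin n → ℂ}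

theorem fibreGram_self (h1 : H z = 1) : fibreGram H (z, 0) = 1 := by
  simp [fibreGram, h1, unipotent_zero]

theorem contDiffAt_connTwist (hH : ∀ i j, ContDiffAt ℝ ∞ (fun u => H u i j) z) (h1 : H z = 1)
    (a : Fin n → ℂ) : ContDiffAt ℝ ∞ (fun w => connTwist H w a) (z, 0) := by
  have hU := contDiffAt_unipotent_snd (n := n) (m := ∞) (z, (0 : PairIdx r → ℂ))
  have hA := contDiffAt_comp_fst (ξ := (0 : PairIdx r → ℂ))
    (contDiffAt_connMat hH (by rw [h1, Matrix.det_one]; exact one_ne_zero) a)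
  have hM := contDiffAt_matrix_mul (contDiffAt_matrix_mul hU hA) (contDiffAt_matrix_inv hU
    (isUnit_det_unipotent _).ne_zero)
  refine contDiffAt_pi.mpr fun p => contDiffAt_matrix_mul (fun i j => ?_) hU p.1.1 p.1.2
  by_cases hij : i < j
  · simpa only [strictUpper, upperPart, hij, dif_pos] using hM i j
  · simpa only [strictUpper, hij, dif_neg, not_false_eq_true] using contDiffAt_const

theorem contDiffAt_relDensity (hH : ∀ i j, ContDiffAt ℝ ∞ (fun u => H u i j) z) (h1 : H z = 1) :
    ContDiffAt ℝ ∞ (relDensity H) (z, 0) := by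
  have h2 : ∀ i, ContDiffAt ℝ ∞ (fun w => quotNorm (fibreGram H w) i) (z, 0) := fun i =>
    contDiffAt_quotNorm (contDiffAt_fibreGram hH 0) i (by
      rw [fibreGram_self h1, leadBlock_one, Matrix.det_one]; exact one_ne_zero)
  refine contDiffAt_prod fun p _ => (h2 _).mul ((h2 _).inv ?_)
  simp [fibreGram_self h1, quotNorm, leadBlock_one]

end RelativeVolumeModel

/-! ### Second derivatives of the relative volume form -/

section RelativeVolumeDerivatives
variable {M : Type*} [NormedAddCommGroup M] [NormedSpace ℂ M]

theorem leviPart_lincomb {κ : Type*} (s : Finset κ) (c : κ → ℂ) {B : M →L[ℝ] M →L[ℝ] ℂ}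
    {M' : Type*} [NormedAddCommGroup M'] [NormedSpace ℂ M'] {Q : κ → M' →L[ℝ] M' →L[ℝ] ℂ}
    (L : M →ₗ[ℂ] M') (h : ∀ u v, B u v = ∑ k ∈ s, c k * Q k (L u) (L v)) (u v : M) :
    leviPart B u v = ∑ k ∈ s, c k * leviPart (Q k) (L u) (L v) := by
  simp only [leviPart, h, map_smul, smul_eq_mul, Finset.mul_sum, ← Finset.sum_sub_distrib,
    ← Finset.sum_add_distrib]
  exact Finset.sum_congr rfl fun k _ => by ring

/-- The Levi form of a real function is Hermitian. -/
theorem conj_leviPart {f : M → ℂ} {x : M} (hf : ContDiffAt ℝ 2 f x)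
    (hr : ∀ z, (starRingEnd ℂ) (f z) = f z) (u v : M) :
    (starRingEnd ℂ) (leviPart (fderiv ℝ (fderiv ℝ f) x) u v) =
      leviPart (fderiv ℝ (fderiv ℝ f) x) v u := by
  have h1 : ∀ u v, (starRingEnd ℂ) (fderiv ℝ (fderiv ℝ f) x u v) = fderiv ℝ (fderiv ℝ f) x v u :=
    fun u v => by
    have h2 := fderiv_fderiv_clm_comp (Complex.conjCLE : ℂ →L[ℝ] ℂ) hf u v
    have h3 : (fun y => (Complex.conjCLE : ℂ →L[ℝ] ℂ) (f y)) = f := funext hr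
    rw [h3] at h2
    exact h2.symm.trans ((hf.isSymmSndFDerivAt (by simp)) u v)
  simp only [leviPart, smul_eq_mul, map_mul, map_add, map_sub, h1, Complex.conj_I, map_div₀, map_one,
    map_ofNat]
  ring

theorem fderiv_vertical {f : FlagModel n r → ℂ} {w : FlagModel n r} (hf : DifferentiableAt ℝ f w)
    (s : PairIdx r → ℂ) : fderiv ℝ f w (0, s) = fderiv ℝ (fun ξ => f (w.1, ξ)) w.2 s := by
  have h1 := (hasFDerivAt_prodMk_right (𝕜 := ℝ) w.1 w.2)
  exact (congrArg (fun D : (PairIdx r → ℂ) →L[ℝ] ℂ => D s)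
    (HasFDerivAt.comp (g := f) w.2 hf.hasFDerivAt h1).fderiv).symm

theorem fderiv_fderiv_vertical {f : FlagModel n r → ℂ} {w : FlagModel n r} (hf : ContDiffAt ℝ 2 f w)
    (h0 : ∀ ξ, f (w.1, ξ) = 0) (s t : PairIdx r → ℂ) :
    fderiv ℝ (fderiv ℝ f) w (0, s) (0, t) = 0 := by
  have h1 : DifferentiableAt ℝ (fun w => fderiv ℝ f w ((0, t) : FlagModel n r)) w :=
    (differentiableAt_fderiv_apply hf _).differentiableAt
  rw [← fderiv_fderiv_eq hf, fderiv_vertical h1]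
  have h2 : (fun ξ => fderiv ℝ f (w.1, ξ) ((0, t) : FlagModel n r)) =ᶠ[𝓝 w.2] fun _ => 0 := by
    have h3 : Tendsto (fun ξ : PairIdx r → ℂ => ((w.1, ξ) : FlagModel n r)) (𝓝 w.2) (𝓝 w) :=
      (Continuous.prodMk_right w.1).continuousAt
    filter_upwards [h3.eventually (eventually_differentiableAt hf)] with ξ hξ
    rw [fderiv_vertical hξ]
    simp only [h0, fderiv_fun_const, Pi.zero_apply, zero_apply]
  rw [h2.fderiv_eq]
  simp

variable {H : (Fin n → ℂ) → Matrix (Fin r) (Fin r) ℂ} {z : Fin n → ℂ}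

/-- The second derivative of the density of the relative volume form. -/
theorem relDensity_normal (hH : ∀ i j, ContDiffAt ℝ 2 (fun u => H u i j) z) (h1 : H z = 1)
    (h0 : ∀ v, dMat ℝ H z v = 0) : IsFlatOne (relDensity H) (z, 0) ∧ ∀ a b : Fin n → ℂ,
      leviPart (fderiv ℝ (fderiv ℝ (relDensity H)) (z, 0)) (a, 0) (b, 0) =
        ∑ i, (canonicalWeight r i : ℂ) * leviPart (fderiv ℝ (fderiv ℝ fun z => H z i i) z) a b := by
  have hq := quotNorm_fibreGram hH h1 h0
  have hp : ∀ p : PairIdx r, _ := fun p => (hq p.1.1).1.mul (hq p.1.2).1.inv.1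
  have hP := IsFlatOne.prod Finset.univ fun p _ => (hp p).1
  refine ⟨hP.1, fun a b => ?_⟩
  have h2 : ∀ u v, fderiv ℝ (fderiv ℝ (relDensity H)) (z, 0) u v = ∑ i, -(canonicalWeight r i : ℂ) *
      fderiv ℝ (fderiv ℝ fun w => quotNorm (fibreGram H w) i) (z, 0) u v := fun u v => by
    refine (hP.2 u v).trans (Eq.trans (Finset.sum_congr rfl fun p _ => ?_) ((sum_pairs_sub fun i =>
      fderiv ℝ (fderiv ℝ fun w => quotNorm (fibreGram H w) i) (z, 0) u v).trans ?_))
    · rw [(hp p).2, (hq p.1.2).1.inv.2, sub_eq_add_neg]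
    · rw [← Finset.sum_neg_distrib]
      exact Finset.sum_congr rfl fun i _ => (neg_mul _ _).symm
  rw [leviPart_lincomb Finset.univ _ LinearMap.id h2]
  refine Finset.sum_congr rfl fun i _ => ?_
  rw [LinearMap.id_apply, LinearMap.id_apply, (hq i).2]
  simp [strictUpper]

theorem connMat_of_flat (h0 : ∀ v, dMat ℝ H z v = 0) (a : Fin n → ℂ) : connMat H z a = 0 := by
  simp [connMat, h0]

/-- The mixed second derivative of the connection part. -/
theorem fderiv_fderiv_connTwist (hH : ∀ i j, ContDiffAt ℝ ∞ (fun u => H u i j) z) (h1 : H z = 1)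
    (h0 : ∀ v, dMat ℝ H z v = 0) (a b : Fin n → ℂ) (s : PairIdx r → ℂ) :
    fderiv ℝ (fderiv ℝ fun w => connTwist H w b) (z, 0) (a, 0) (0, s) =
      commUpper (dMat ℝ (fun z => connMat H z b) z a) s := by
  have h2 : ((2 : ℕ) : ℕ∞ω) ≤ ∞ := WithTop.coe_le_coe.mpr le_top
  have hU := contDiffAt_unipotent_snd (n := n) (m := 2) (z, (0 : PairIdx r → ℂ))
  have hU1 : (unipotent ((z, 0) : FlagModel n r).2).det ≠ 0 := (isUnit_det_unipotent _).ne_zero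
  have hV := contDiffAt_matrix_inv hU hU1
  have hA0 : ∀ i j, ContDiffAt ℝ 2 (fun z => connMat H z b i j) z := fun i j =>
    (contDiffAt_connMat hH (by rw [h1, Matrix.det_one]; exact one_ne_zero) b i j).of_le h2
  have hA := contDiffAt_comp_fst (ξ := (0 : PairIdx r → ℂ)) hA0
  have hd : ∀ {f : FlagModel n r → Matrix (Fin r) (Fin r) ℂ},
      (∀ i j, ContDiffAt ℝ 2 (fun w => f w i j) (z, 0)) →
      ∀ i j, DifferentiableAt ℝ (fun w => f w i j) (z, 0) := fun hf i j =>
    (hf i j).differentiableAt (by simp)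
  have hUA := contDiffAt_matrix_mul hU hA
  have hM := contDiffAt_matrix_mul hUA hV
  set S : FlagModel n r → Matrix (Fin r) (Fin r) ℂ := fun w =>
    strictUpper (upperPart (unipotent w.2 * connMat H w.1 b * (unipotent w.2)⁻¹)) with hS
  have hSe : ∀ i j, (fun w => S w i j) = if i < j then
      fun w : FlagModel n r => (unipotent w.2 * connMat H w.1 b * (unipotent w.2)⁻¹) i j
      else fun _ => 0 := fun i j => by
    by_cases hij : i < j <;> simp [hS, strictUpper, upperPart, hij]
  have hSc : ∀ i j, ContDiffAt ℝ 2 (fun w => S w i j) (z, 0) := fun i j => by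
    rw [hSe]
    split_ifs
    · exact hM i j
    · exact contDiffAt_const
  set B := dMat ℝ (fun z => connMat H z b) z a with hB
  have hAz := connMat_of_flat h0 b
  have e1 : dMat ℝ (fun w : FlagModel n r => connMat H w.1 b) (z, 0) (a, 0) = B :=
    dMat_comp_fst (fun i j => (hA0 i j).differentiableAt (by simp)) 0 _
  have e2 : dMat ℝ (fun w : FlagModel n r => connMat H w.1 b) (z, 0) (0, s) = 0 :=
    (dMat_comp_fst (fun i j => (hA0 i j).differentiableAt (by simp)) 0 _).trans (by
      ext i j
      simp [dMat])
  -- as the connection matrix `A` vanishes at the point, the mixed derivative of `U A U⁻¹` is a commutator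
  have e3 : d2Mat (fun w : FlagModel n r => connMat H w.1 b) (z, 0) (a, 0) (0, s) = 0 :=
    (d2Mat_comp_fst hA0 0 _ _).trans (by
      ext i j
      simp [d2Mat])
  have u1 : dMat ℝ (fun w : FlagModel n r => unipotent w.2) (z, 0) (a, 0) = 0 := by
    rw [dMat_unipotent_snd]
    ext i j
    simp [strictUpper]
  have u2 : dMat ℝ (fun w : FlagModel n r => unipotent w.2) (z, 0) (0, s) = strictUpper s :=
    dMat_unipotent_snd _ _
  have m1 : ∀ v, dMat ℝ (fun w : FlagModel n r => unipotent w.2 * connMat H w.1 b) (z, 0) v =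
      dMat ℝ (fun w : FlagModel n r => connMat H w.1 b) (z, 0) v := fun v => by
    rw [dMat_mul (hd hU) (hd hA), hAz, unipotent_zero, mul_zero, zero_add, one_mul]
  have m2 : d2Mat (fun w : FlagModel n r => unipotent w.2 * connMat H w.1 b) (z, 0) (a, 0) (0, s) =
      strictUpper s * B := by
    rw [d2Mat_mul hU hA, hAz, e1, e2, e3, u1, u2]
    simp
  have hval : (unipotent ((z, 0) : FlagModel n r).2 * connMat H ((z, 0) : FlagModel n r).1 b) = 0 := by
    rw [hAz, mul_zero]
  have m3 : dMat ℝ (fun w : FlagModel n r => unipotent w.2 * connMat H w.1 b * (unipotent w.2)⁻¹)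
      (z, 0) (a, 0) = B := by
    rw [dMat_mul (hd hUA) (hd hV), hval, m1, e1, unipotent_zero, inv_one, zero_mul, add_zero, mul_one]
  have m4 : d2Mat (fun w : FlagModel n r => unipotent w.2 * connMat H w.1 b * (unipotent w.2)⁻¹)
      (z, 0) (a, 0) (0, s) = strictUpper s * B - B * strictUpper s := by
    rw [d2Mat_mul hUA hV, hval, m1, m1, e1, e2, m2, dMat_inv (fun i j => (hU i j).of_le (by norm_num)) hU1,
      u2, unipotent_zero, inv_one]
    simp [sub_eq_add_neg]
  have hlin : ∀ (D : (FlagModel n r → ℂ) → ℂ) (_ : D (fun _ => 0) = 0) (i j : Fin r),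
      D (fun w => S w i j) = strictUpper (upperPart fun i j => D fun w =>
        (unipotent w.2 * connMat H w.1 b * (unipotent w.2)⁻¹) i j) i j := fun D hD i j => by
    rw [hSe]
    by_cases hij : i < j <;> simp [strictUpper, upperPart, hij, hD]
  have s1 : dMat ℝ S (z, 0) (a, 0) = strictUpper (upperPart B) := by
    rw [← m3]
    ext i j
    exact hlin (fun f => fderiv ℝ f (z, 0) (a, 0)) (by simp) i j
  have s2 : d2Mat S (z, 0) (a, 0) (0, s) =
      strictUpper (upperPart (strictUpper s * B - B * strictUpper s)) := by
    rw [← m4]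
    ext i j
    exact hlin (fun f => fderiv ℝ (fderiv ℝ f) (z, 0) (a, 0) (0, s)) (by simp) i j
  have s0 : S (z, 0) = 0 := by
    rw [hS]
    simp only [hval, zero_mul]
    ext i j
    simp [strictUpper, upperPart]
  funext p
  have hc : ContDiffAt ℝ 2 (fun w => connTwist H w b) (z, 0) := (contDiffAt_connTwist hH h1 b).of_le h2
  have h4 := fderiv_fderiv_clm_comp (ContinuousLinearMap.proj (R := ℝ) (φ := fun _ : PairIdx r => ℂ) p)
    hc (a, 0) (0, s)
  refine h4.symm.trans ?_
  have h5 : d2Mat (fun w => S w * unipotent w.2) (z, 0) (a, 0) (0, s) =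
      strictUpper (upperPart (strictUpper s * B - B * strictUpper s)) +
        strictUpper (upperPart B) * strictUpper s := by
    rw [d2Mat_mul hSc hU, d2Mat_unipotent_snd, s0, s1, s2, u1, u2, unipotent_zero]
    simp
  refine (congrFun (congrFun h5 p.1.1) p.1.2).trans ?_
  have h6 : ∀ X : Matrix (Fin r) (Fin r) ℂ, strictUpper (upperPart X) p.1.1 p.1.2 = X p.1.1 p.1.2 :=
    fun X => dif_pos p.2
  rw [Matrix.add_apply, h6]
  simp only [commUpper, add_apply, sub_apply, Pi.add_apply, Pi.sub_apply, conjUpper_apply, upperPart,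
    Matrix.one_mul, Matrix.mul_one, Matrix.sub_apply]

end RelativeVolumeDerivatives

section RelativeVolumeLevi
variable {H : (Fin n → ℂ) → Matrix (Fin r) (Fin r) ℂ} {z : Fin n → ℂ}

theorem relForm_vertical (w : FlagModel n r) {v : Fin (2 * fiberDim r) → FlagModel n r}
    (hv : ∀ k, (v k).1 = 0) : relForm H w v = relDensity H w * volForm r fun k => (v k).2 := by
  rw [relForm_apply]
  simp only [hv, connTwist_zero, add_zero]

theorem relForm_update (w : FlagModel n r) {v : Fin (2 * fiberDim r) → FlagModel n r}
    (hv : ∀ k, (v k).1 = 0) (j : Fin (2 * fiberDim r)) (b : Fin n → ℂ) :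
    relForm H w (Function.update v j (b, 0)) = relDensity H w *
      volForm r (Function.update (fun k => (v k).2) j (connTwist H w b)) := by
  rw [relForm_apply]
  congr 2
  funext k
  rcases eq_or_ne k j with rfl | hk
  · simp
  · simp [hk, hv, connTwist_zero]

theorem contDiffAt_relForm (hH : ∀ i j, ContDiffAt ℝ ∞ (fun u => H u i j) z) (h1 : H z = 1) :
    ContDiffAt ℝ ∞ (relForm H) (z, 0) := by
  refine contDiffAt_form fun v => ?_
  refine (contDiffAt_relDensity hH h1).mul (ContDiffAt.comp (z, 0)
    (volForm r).toContinuousMultilinearMap.contDiff.contDiffAt (contDiffAt_pi.mpr fun k => ?_))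
  exact contDiffAt_const.add (contDiffAt_connTwist hH h1 _)

/-- At the base point of a normal frame there is no connection term, on the whole fibre. -/
theorem connTwist_self (h0 : ∀ v, dMat ℝ H z v = 0) (ξ : PairIdx r → ℂ) (a : Fin n → ℂ) :
    connTwist H (z, ξ) a = 0 := by
  rw [connTwist, connMat_of_flat h0]
  funext p
  simp [upperPart, Matrix.mul_apply, strictUpper]

variable (r) in
/-- The volume form as a function of its `j`-th argument. -/
def volFormAt (x : Fin (2 * fiberDim r) → PairIdx r → ℂ) (j : Fin (2 * fiberDim r)) :
    (PairIdx r → ℂ) →L[ℝ] ℂ := (volForm r).toContinuousMultilinearMap.toContinuousLinearMap x j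

theorem volFormAt_apply (x : Fin (2 * fiberDim r) → PairIdx r → ℂ) (j : Fin (2 * fiberDim r))
    (b : PairIdx r → ℂ) : volFormAt r x j b = volForm r (Function.update x j b) := rfl

/-- The mixed second derivatives of the relative volume form at a normal frame. -/
theorem fderiv_fderiv_relForm_update (hH : ∀ i j, ContDiffAt ℝ ∞ (fun u => H u i j) z) (h1 : H z = 1)
    (h0 : ∀ v, dMat ℝ H z v = 0) {v : Fin (2 * fiberDim r) → FlagModel n r}
    (hv : ∀ k, (v k).1 = 0) (j : Fin (2 * fiberDim r)) (a b : Fin n → ℂ) (s : PairIdx r → ℂ) :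
    fderiv ℝ (fderiv ℝ fun w => relForm H w (Function.update v j (b, 0))) (z, 0) (a, 0) (0, s) =
        volFormAt r (fun k => (v k).2) j (commUpper (dMat ℝ (fun z => connMat H z b) z a) s) ∧
    fderiv ℝ (fderiv ℝ fun w => relForm H w (Function.update v j (b, 0))) (z, 0) (0, s) (a, 0) =
        volFormAt r (fun k => (v k).2) j (commUpper (dMat ℝ (fun z => connMat H z b) z a) s) := by
  have h2 : ((2 : ℕ) : ℕ∞ω) ≤ ∞ := WithTop.coe_le_coe.mpr le_top
  have hT : ContDiffAt ℝ 2 (fun w => connTwist H w b) (z, 0) := (contDiffAt_connTwist hH h1 b).of_le h2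
  have hD := (relDensity_normal (fun i j => (hH i j).of_le h2) h1 h0).1
  have hf : (fun w => relForm H w (Function.update v j (b, 0))) = fun w =>
      relDensity H w * volFormAt r (fun k => (v k).2) j (connTwist H w b) :=
    funext fun w => relForm_update w hv j b
  have hm : ContDiffAt ℝ 2 (fun w => volFormAt r (fun k => (v k).2) j (connTwist H w b)) (z, 0) :=
    (volFormAt r _ j).contDiff.contDiffAt.comp (z, 0) hT
  have h3 : fderiv ℝ (fderiv ℝ fun w => relForm H w (Function.update v j (b, 0))) (z, 0) (a, 0) (0, s) =
      volFormAt r (fun k => (v k).2) j (commUpper (dMat ℝ (fun z => connMat H z b) z a) s) := by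
    rw [hf, fderiv_fderiv_mul hD.1 hm, hD.2.1, hD.2.2, connTwist_self h0]
    have h4 := fderiv_fderiv_clm_comp (volFormAt r (fun k => (v k).2) j) hT (a, 0) (0, s)
    rw [h4, fderiv_fderiv_connTwist hH h1 h0]
    simp
  refine ⟨h3, Eq.trans ?_ h3⟩
  have h5 : ContDiffAt ℝ 2 (fun w => relForm H w (Function.update v j (b, 0))) (z, 0) := by
    rw [hf]
    exact hD.1.mul hm
  exact (h5.isSymmSndFDerivAt (by simp)) _ _

theorem sum_volFormAt {x : Fin (2 * fiberDim r) → PairIdx r → ℂ} (hx : LinearIndependent ℝ x) (c : ℂ)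
    (B : Matrix (Fin r) (Fin r) ℂ) :
    ∑ j, volFormAt r x j (commUpper B (c • x j)) =
      (2 * (c * ∑ i, (canonicalWeight r i : ℂ) * B i i).re : ℝ) * volForm r x := by
  have h1 := sum_update_eq_trace (V := PairIdx r → ℂ) (m := 2 * fiberDim r)
    (by rw [finrank_real_of_complex, finrank_fintype_fun_eq_card]) (volForm r)
    (((c • commUpper B : (PairIdx r → ℂ) →L[ℂ] (PairIdx r → ℂ)) :
      (PairIdx r → ℂ) →ₗ[ℂ] (PairIdx r → ℂ)).restrictScalars ℝ) x hx
  rw [trace_real_eq] at h1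
  have h2 : LinearMap.trace ℂ (PairIdx r → ℂ)
      ((c • commUpper B : (PairIdx r → ℂ) →L[ℂ] (PairIdx r → ℂ)) :
      (PairIdx r → ℂ) →ₗ[ℂ] (PairIdx r → ℂ)) = c * ∑ i, (canonicalWeight r i : ℂ) * B i i := by
    rw [← trace_commUpper]
    exact map_smul _ c (commUpper B : (PairIdx r → ℂ) →ₗ[ℂ] (PairIdx r → ℂ))
  rw [h2] at h1
  refine Eq.trans (Finset.sum_congr rfl fun j _ => ?_) h1
  rw [volFormAt_apply, map_smul]
  rfl

/-- The trace of the mixed Levi forms of the relative volume form. -/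
theorem sum_leviPart_relForm_update (hH : ∀ i j, ContDiffAt ℝ ∞ (fun u => H u i j) z) (h1 : H z = 1)
    (h0 : ∀ v, dMat ℝ H z v = 0) {v : Fin (2 * fiberDim r) → FlagModel n r}
    (hv : ∀ k, (v k).1 = 0) (hli : LinearIndependent ℝ fun k => (v k).2) (a b : Fin n → ℂ) :
    ∑ j, leviPart (fderiv ℝ (fderiv ℝ (relForm H)) (z, 0)) (v j) (a, 0) (Function.update v j (b, 0)) =
        (∑ i, (canonicalWeight r i : ℂ) * leviPart (fderiv ℝ (fderiv ℝ fun z => H z i i) z) b a) *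
          volForm r (fun k => (v k).2) ∧
    ∑ j, leviPart (fderiv ℝ (fderiv ℝ (relForm H)) (z, 0)) (a, 0) (v j) (Function.update v j (b, 0)) =
        (starRingEnd ℂ) (∑ i, (canonicalWeight r i : ℂ) *
          leviPart (fderiv ℝ (fderiv ℝ fun z => H z i i) z) b a) * volForm r (fun k => (v k).2) := by
  have h2 : ((2 : ℕ) : ℕ∞ω) ≤ ∞ := WithTop.coe_le_coe.mpr le_top
  have hα : ContDiffAt ℝ 2 (relForm H) (z, 0) := (contDiffAt_relForm hH h1).of_le h2
  set t : (Fin n → ℂ) → ℂ := fun a =>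
    ∑ i, (canonicalWeight r i : ℂ) * dMat ℝ (fun z => connMat H z b) z a i i with ht
  have hM : ∑ i, (canonicalWeight r i : ℂ) * leviPart (fderiv ℝ (fderiv ℝ fun z => H z i i) z) b a =
      (1 / 2 : ℂ) * (t a + Complex.I * t (Complex.I • a)) := by
    rw [ht]
    simp only [Finset.mul_sum, ← Finset.sum_add_distrib]
    refine Finset.sum_congr rfl fun i _ => ?_
    rw [← dbarMat_connMat_of_normal (fun i j => (hH i j).of_le h2) h1 h0 a b i i]
    simp only [dbarMat, Matrix.smul_apply, Matrix.add_apply, smul_eq_mul]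
    ring
  have hvj : ∀ j, v j = (0, (v j).2) := fun j => Prod.ext (hv j) rfl
  have hI : ∀ j, Complex.I • v j = (0, Complex.I • (v j).2) := fun j =>
    Prod.ext ((congrArg (Complex.I • ·) (hv j)).trans (smul_zero _)) rfl
  have hIa : (Complex.I • (a, 0) : FlagModel n r) = (Complex.I • a, 0) :=
    Prod.ext rfl (smul_zero _)
  have hD := fun j a s => fderiv_fderiv_relForm_update hH h1 h0 hv j a b s
  have hS : ∀ a, ∑ j, volFormAt r (fun k => (v k).2) j
        (commUpper (dMat ℝ (fun z => connMat H z b) z a) (v j).2) =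
          (2 * (t a).re : ℝ) * volForm r (fun k => (v k).2) ∧
      ∑ j, volFormAt r (fun k => (v k).2) j
        (commUpper (dMat ℝ (fun z => connMat H z b) z a) (Complex.I • (v j).2)) =
          (2 * (Complex.I * t a).re : ℝ) * volForm r (fun k => (v k).2) := fun a => by
    have h3 := sum_volFormAt hli 1 (dMat ℝ (fun z => connMat H z b) z a)
    simp only [one_smul, one_mul] at h3
    exact ⟨h3, sum_volFormAt hli Complex.I _⟩
  have hre : ∀ c : ℂ, ((c.re : ℝ) : ℂ) = (1 / 2) * (c + (starRingEnd ℂ) c) := fun c => by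
    rw [Complex.add_conj]
    push_cast
    ring
  have hI2 := Complex.I_mul_I
  rw [hM]
  constructor
  · have h3 : ∀ j, leviPart (fderiv ℝ (fderiv ℝ (relForm H)) (z, 0)) (v j) (a, 0)
        (Function.update v j (b, 0)) = (1 / 4 : ℂ) * (
        volFormAt r (fun k => (v k).2) j (commUpper (dMat ℝ (fun z => connMat H z b) z a) (v j).2) -
        Complex.I * volFormAt r (fun k => (v k).2) j
          (commUpper (dMat ℝ (fun z => connMat H z b) z a) (Complex.I • (v j).2)) +
        Complex.I * volFormAt r (fun k => (v k).2) j
          (commUpper (dMat ℝ (fun z => connMat H z b) z (Complex.I • a)) (v j).2) +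
        volFormAt r (fun k => (v k).2) j
          (commUpper (dMat ℝ (fun z => connMat H z b) z (Complex.I • a)) (Complex.I • (v j).2))) :=
      fun j => by
      rw [leviPart_fderiv_apply hα, leviPart, hI, hIa]
      simp only [smul_eq_mul]
      rw [← (hD j a (v j).2).2, ← (hD j a (Complex.I • (v j).2)).2, ← (hD j (Complex.I • a) (v j).2).2,
        ← (hD j (Complex.I • a) (Complex.I • (v j).2)).2, ← hvj]
    rw [Finset.sum_congr rfl fun j _ => h3 j, ← Finset.mul_sum, Finset.sum_add_distrib,
      Finset.sum_add_distrib, Finset.sum_sub_distrib, ← Finset.mul_sum, ← Finset.mul_sum,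
      (hS a).1, (hS a).2, (hS (Complex.I • a)).1, (hS (Complex.I • a)).2]
    push_cast
    simp only [hre, map_mul, Complex.conj_I]
    linear_combination (-(1 / 4) * (t a - (starRingEnd ℂ) (t a)) * volForm r fun k => (v k).2) * hI2
  · have h3 : ∀ j, leviPart (fderiv ℝ (fderiv ℝ (relForm H)) (z, 0)) (a, 0) (v j)
        (Function.update v j (b, 0)) = (1 / 4 : ℂ) * (
        volFormAt r (fun k => (v k).2) j (commUpper (dMat ℝ (fun z => connMat H z b) z a) (v j).2) -
        Complex.I * volFormAt r (fun k => (v k).2) j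
          (commUpper (dMat ℝ (fun z => connMat H z b) z (Complex.I • a)) (v j).2) +
        Complex.I * volFormAt r (fun k => (v k).2) j
          (commUpper (dMat ℝ (fun z => connMat H z b) z a) (Complex.I • (v j).2)) +
        volFormAt r (fun k => (v k).2) j
          (commUpper (dMat ℝ (fun z => connMat H z b) z (Complex.I • a)) (Complex.I • (v j).2))) :=
      fun j => by
      rw [leviPart_fderiv_apply hα, leviPart, hI, hIa]
      simp only [smul_eq_mul]
      rw [← (hD j a (v j).2).1, ← (hD j a (Complex.I • (v j).2)).1, ← (hD j (Complex.I • a) (v j).2).1,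
        ← (hD j (Complex.I • a) (Complex.I • (v j).2)).1, ← hvj]
    rw [Finset.sum_congr rfl fun j _ => h3 j, ← Finset.mul_sum, Finset.sum_add_distrib,
      Finset.sum_add_distrib, Finset.sum_sub_distrib, ← Finset.mul_sum, ← Finset.mul_sum,
      (hS a).1, (hS a).2, (hS (Complex.I • a)).1, (hS (Complex.I • a)).2]
    push_cast
    simp only [hre, map_mul, map_add, map_div₀, map_one, map_ofNat, Complex.conj_I]
    linear_combination ((1 / 4) * (t a - (starRingEnd ℂ) (t a)) * volForm r fun k => (v k).2) * hI2

end RelativeVolumeLevi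

section RelativeVolumeDdbar
variable {H : (Fin n → ℂ) → Matrix (Fin r) (Fin r) ℂ} {z : Fin n → ℂ}

/-- The contribution of the density. -/
theorem leviPart_relForm_vertical (hH : ∀ i j, ContDiffAt ℝ ∞ (fun u => H u i j) z) (h1 : H z = 1)
    (h0 : ∀ v, dMat ℝ H z v = 0) {v : Fin (2 * fiberDim r) → FlagModel n r}
    (hv : ∀ k, (v k).1 = 0) (a b : Fin n → ℂ) :
    leviPart (fderiv ℝ (fderiv ℝ (relForm H)) (z, 0)) (a, 0) (b, 0) v =
      (∑ i, (canonicalWeight r i : ℂ) * leviPart (fderiv ℝ (fderiv ℝ fun z => H z i i) z) a b) *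
        volForm r (fun k => (v k).2) := by
  have h2 : ((2 : ℕ) : ℕ∞ω) ≤ ∞ := WithTop.coe_le_coe.mpr le_top
  have hα : ContDiffAt ℝ 2 (relForm H) (z, 0) := (contDiffAt_relForm hH h1).of_le h2
  have hD := relDensity_normal (fun i j => (hH i j).of_le h2) h1 h0
  rw [leviPart_fderiv_apply hα, ← hD.2]
  have hf : (fun w => relForm H w v) = fun w =>
      (volForm r fun k => (v k).2) * relDensity H w :=
    funext fun w => (relForm_vertical w hv).trans (mul_comm _ _)
  rw [hf]
  refine (leviPart_lincomb (Finset.univ : Finset (Fin 1)) (fun _ => volForm r fun k => (v k).2)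
    (Q := fun _ => fderiv ℝ (fderiv ℝ (relDensity H)) (z, 0)) LinearMap.id (fun u v' => ?_)
    (a, 0) (b, 0)).trans ?_
  · rw [fderiv_fderiv_mul contDiffAt_const hD.1.1, fderiv_fun_const]
    simp
  · simpa using mul_comm _ _

/-- There is no contribution of second derivatives along the fibre: the coefficient vanishes on the fibre. -/
theorem leviPart_relForm_fibre (hH : ∀ i j, ContDiffAt ℝ ∞ (fun u => H u i j) z) (h1 : H z = 1)
    (h0 : ∀ v, dMat ℝ H z v = 0) {u v : FlagModel n r} (hu : u.1 = 0) (hv : v.1 = 0)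
    {x : Fin (2 * fiberDim r) → FlagModel n r} {k : Fin (2 * fiberDim r)} (hx : (x k).2 = 0) :
    leviPart (fderiv ℝ (fderiv ℝ (relForm H)) (z, 0)) u v x = 0 := by
  have h2 : ((2 : ℕ) : ℕ∞ω) ≤ ∞ := WithTop.coe_le_coe.mpr le_top
  have hα : ContDiffAt ℝ 2 (relForm H) (z, 0) := (contDiffAt_relForm hH h1).of_le h2
  rw [leviPart_fderiv_apply hα]
  have hf : ContDiffAt ℝ 2 (fun w => relForm H w x) (z, 0) :=
    (ContinuousAlternatingMap.apply ℝ (FlagModel n r) ℂ x).contDiff.contDiffAt.comp (z, 0) hα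
  have hf0 : ∀ ξ, relForm H (((z, 0) : FlagModel n r).1, ξ) x = 0 := fun ξ => by
    rw [relForm_apply, ContinuousAlternatingMap.map_coord_zero (i := k), mul_zero]
    rw [hx, connTwist_self h0, add_zero]
  have h3 : ∀ u v : FlagModel n r, u.1 = 0 → v.1 = 0 →
      fderiv ℝ (fderiv ℝ fun w => relForm H w x) (z, 0) u v = 0 := fun u v hu hv => by
    obtain ⟨_, s⟩ := u
    obtain ⟨_, t⟩ := v
    obtain rfl := hu
    obtain rfl := hv
    exact fderiv_fderiv_vertical hf hf0 s t
  have hI : ∀ {u : FlagModel n r}, u.1 = 0 → (Complex.I • u).1 = 0 := fun hu =>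
    (congrArg (Complex.I • ·) hu).trans (smul_zero _)
  rw [leviPart, h3 _ _ hu hv, h3 _ _ (hI hu) hv, h3 _ _ hu (hI hv), h3 _ _ (hI hu) (hI hv)]
  simp

/-- The form `∂ ∂bar` of the relative volume form, on two horizontal and otherwise vertical vectors. -/
theorem del_delbar_relForm (hH : ∀ i j, ContDiffAt ℝ ∞ (fun u => H u i j) z) (h1 : H z = 1)
    (h0 : ∀ v, dMat ℝ H z v = 0) (hr : ∀ z, (H z)ᴴ = H z) (a b : Fin n → ℂ)
    {v : Fin (2 * fiberDim r) → FlagModel n r}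
    (hv : ∀ k, (v k).1 = 0) (hli : LinearIndependent ℝ fun k => (v k).2) :
    del (delbar (relForm H)) (z, 0)
        (Fin.cons (a, 0) (Fin.cons (b, 0) v) : Fin (2 * fiberDim r + 2) → FlagModel n r) =
      (∑ i, (canonicalWeight r i : ℂ) * (leviPart (fderiv ℝ (fderiv ℝ fun z => H z i i) z) b a -
        leviPart (fderiv ℝ (fderiv ℝ fun z => H z i i) z) a b)) * volForm r (fun k => (v k).2) := by
  have h2 : ((2 : ℕ) : ℕ∞ω) ≤ ∞ := WithTop.coe_le_coe.mpr le_top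
  have hα : ContDiffAt ℝ 2 (relForm H) (z, 0) := (contDiffAt_relForm hH h1).of_le h2
  rw [del_delbar_apply hα, alternating_sum_cons_cons (fun u v =>
    leviPart (fderiv ℝ (fderiv ℝ (relForm H)) (z, 0)) u v) (a, 0) (b, 0) v
    (fun i j x ⟨k, _, _, hk, _⟩ => leviPart_relForm_fibre hH h1 h0 (hv i) (hv j) (k := k) (by rw [hk]))
    _ rfl]
  have hc : ∀ a b, (starRingEnd ℂ) (∑ i, (canonicalWeight r i : ℂ) *
      leviPart (fderiv ℝ (fderiv ℝ fun z => H z i i) z) b a) = ∑ i, (canonicalWeight r i : ℂ) *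
      leviPart (fderiv ℝ (fderiv ℝ fun z => H z i i) z) a b := fun a b => by
    rw [map_sum]
    refine Finset.sum_congr rfl fun i _ => ?_
    rw [map_mul, conj_leviPart ((hH i i).of_le h2) fun z => congrFun (congrFun (hr z) i) i]
    simp
  rw [leviPart_relForm_vertical hH h1 h0 hv, leviPart_relForm_vertical hH h1 h0 hv,
    (sum_leviPart_relForm_update hH h1 h0 hv hli a b).1,
    (sum_leviPart_relForm_update hH h1 h0 hv hli a b).2,
    (sum_leviPart_relForm_update hH h1 h0 hv hli b a).1,
    (sum_leviPart_relForm_update hH h1 h0 hv hli b a).2, hc, hc]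
  simp only [mul_sub, Finset.sum_sub_distrib]
  ring

/-- A form on the model space vanishes on a tuple with more vertical vectors than the real dimension of
the fibre. -/
theorem form_eq_zero_of_vertical {m : ℕ} (ζ : FlagModel n r [⋀^Fin (m + 2)]→L[ℝ] ℂ)
    {x : Fin (m + 2) → FlagModel n r} (i : Fin (m + 2)) (hx : ∀ k, k ≠ i → (x k).1 = 0)
    (hm : m = 2 * fiberDim r) : ζ x = 0 := by
  by_contra h
  have h1 : LinearIndependent ℝ x := by
    by_contra h2
    exact h (ζ.toAlternatingMap.map_linearDependent x h2)
  have h2 : LinearIndependent ℝ fun k : {k // k ≠ i} => (x k).2 := by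
    have h3 : LinearIndependent ℝ ((LinearMap.inr ℝ (Fin n → ℂ) (PairIdx r → ℂ)) ∘
        fun k : {k // k ≠ i} => (x k).2) := by
      have h4 : ((LinearMap.inr ℝ (Fin n → ℂ) (PairIdx r → ℂ)) ∘
          fun k : {k // k ≠ i} => (x k).2) = x ∘ ((↑) : {k // k ≠ i} → Fin (m + 2)) :=
        funext fun k => Prod.ext (hx k.1 k.2).symm rfl
      rw [h4]
      exact h1.comp _ Subtype.val_injective
    exact h3.of_comp _
  have h3 := h2.fintype_card_le_finrank
  have h5 : finrank ℝ (PairIdx r → ℂ) = 2 * fiberDim r := by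
    rw [finrank_real_of_complex, finrank_fintype_fun_eq_card]
  rw [h5, Fintype.card_subtype_compl, Fintype.card_fin, Fintype.card_subtype_eq] at h3
  omega

/-- To show that the product of a form with all forms of top degree from the base vanishes, it suffices to
consider two horizontal and otherwise vertical vectors. -/
theorem wedge_pullForm_fst_eq_zero (ζ : FlagModel n r [⋀^Fin (2 * fiberDim r + 2)]→L[ℝ] ℂ)
    (hζ : ∀ (a b : Fin n → ℂ) (v : Fin (2 * fiberDim r) → FlagModel n r), (∀ k, (v k).1 = 0) →
      (LinearIndependent ℝ fun k => (v k).2) →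
      ζ (Fin.cons (a, 0) (Fin.cons (b, 0) v) : Fin (2 * fiberDim r + 2) → FlagModel n r) = 0)
    (β : (Fin n → ℂ) [⋀^Fin (2 * (n - 1))]→L[ℝ] ℂ) :
    wedge ζ (pullForm β (ContinuousLinearMap.fst ℂ (Fin n → ℂ) (PairIdx r → ℂ))) = 0 := by
  let b := ((finBasis ℝ (PairIdx r → ℂ)).prod (finBasis ℝ (Fin n → ℂ))).map
    (LinearEquiv.prodComm ℝ (PairIdx r → ℂ) (Fin n → ℂ))
  refine wedge_pullForm_eq_zero _ b (fun i => ?_) ?_ ζ (fun h₁ h₂ v hv hli => ?_) β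
  · simp [b]
  · rw [Fintype.card_fin, finrank_real_of_complex, finrank_fintype_fun_eq_card, Fintype.card_fin]
    omega
  · have hli2 : LinearIndependent ℝ fun k => (v k).2 := by
      refine LinearIndependent.of_comp (LinearMap.inr ℝ (Fin n → ℂ) (PairIdx r → ℂ)) ?_
      have h4 : ((LinearMap.inr ℝ (Fin n → ℂ) (PairIdx r → ℂ)) ∘ fun k => (v k).2) = v :=
        funext fun k => Prod.ext (hv k).symm rfl
      rwa [h4]
    have e1 : ∀ h : FlagModel n r, h = (h.1, 0) + (0, h.2) := fun h => by simp
    have e2 : ∀ (h s : FlagModel n r), s.1 = 0 →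
        ζ (Fin.cons s (Fin.cons h v) : Fin (2 * fiberDim r + 2) → FlagModel n r) = 0 := fun h s hs => by
      refine form_eq_zero_of_vertical ζ 1 (fun k hk => ?_) rfl
      refine Fin.cases (fun _ => hs) (fun k hk => ?_) k hk
      refine Fin.cases (fun hk => absurd rfl hk) (fun k _ => hv k) k hk
    have e3 : ∀ (h s : FlagModel n r), s.1 = 0 →
        ζ (Fin.cons h (Fin.cons s v) : Fin (2 * fiberDim r + 2) → FlagModel n r) = 0 := fun h s hs => by
      refine form_eq_zero_of_vertical ζ 0 (fun k hk => ?_) rfl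
      refine Fin.cases (fun hk => absurd rfl hk) (fun k _ => ?_) k hk
      exact Fin.cases hs (fun k => hv k) k
    have a1 : ∀ s t x, ζ (Fin.cons (s + t) x : Fin (2 * fiberDim r + 2) → FlagModel n r) =
        ζ (Fin.cons s x : Fin (2 * fiberDim r + 2) → FlagModel n r) +
          ζ (Fin.cons t x : Fin (2 * fiberDim r + 2) → FlagModel n r) := fun s t x =>
      ζ.toContinuousMultilinearMap.cons_add x s t
    have a2 : ∀ h s t, ζ (Fin.cons h (Fin.cons (s + t) v) : Fin (2 * fiberDim r + 2) → FlagModel n r) =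
        ζ (Fin.cons h (Fin.cons s v) : Fin (2 * fiberDim r + 2) → FlagModel n r) +
          ζ (Fin.cons h (Fin.cons t v) : Fin (2 * fiberDim r + 2) → FlagModel n r) := fun h s t => by
      have h5 := fun s => congrArg ζ (show (Fin.cons h (Fin.cons s v) :
        Fin (2 * fiberDim r + 2) → FlagModel n r) =
        Function.update (Fin.cons h (Fin.cons 0 v)) 1 s from by
          rw [← Fin.succ_zero_eq_one, ← Fin.cons_update, Fin.update_cons_zero])
      rw [h5, h5 s, h5 t]
      exact ζ.toAlternatingMap.map_update_add _ _ _ _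
    rw [e1 h₁, a1, e2 h₂ (0, h₁.2) rfl, add_zero, e1 h₂, a2, e3 (h₁.1, 0) (0, h₂.2) rfl, add_zero]
    exact hζ _ _ v hv hli2

end RelativeVolumeDdbar

/-! ### The relative volume form on the flag bundle -/

section RelativeVolumeChart
theorem strictUpper_upperPart_mul_unipotent (N ξ : PairIdx r → ℂ) :
    strictUpper (upperPart (strictUpper N * unipotent ξ)) = strictUpper N * unipotent ξ := by
  ext i j
  by_cases hij : i < j
  · exact dif_pos hij
  · rw [strictUpper, dif_neg hij, Matrix.mul_apply]
    refine (Finset.sum_eq_zero fun k _ => ?_).symm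
    by_cases hik : i < k
    · have h1 : j < k := lt_of_le_of_lt (not_lt.mp hij) hik
      simp [unipotent, strictUpper, h1.ne', h1.not_gt]
    · simp [strictUpper, hik]

/-- The differentials of the flag coordinates of a parallel frame are given by `connForm`, up to two
triangular linear maps. -/
theorem conjUpper_connForm (H : (Fin n → ℂ) → Matrix (Fin r) (Fin r) ℂ) (w v : FlagModel n r)
    {L : Matrix (Fin r) (Fin r) ℂ} (hL : LowerTri L) (hLd : IsUnit L.det) :
    conjUpper L L⁻¹ (conjUpper 1 (unipotent w.2)⁻¹ (connForm H w v)) =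
      upperPart (L * (strictUpper v.2 * (unipotent w.2)⁻¹ + unipotent w.2 * connMat H w.1 v.1 *
        (unipotent w.2)⁻¹) * L⁻¹) := by
  rw [← conjUpper_upperPart hL (hL.inv hLd), connForm_apply, conjUpper_apply 1, Matrix.one_mul,
    strictUpper_add, add_mul, connTwist, strictUpper_upperPart_mul_unipotent, Matrix.mul_assoc,
    Matrix.mul_nonsing_inv _ (isUnit_det_unipotent _), Matrix.mul_one, upperPart_add, upperPart_add,
    upperPart_strictUpper]

variable [IsManifold 𝓘(ℂ, Fin n → ℂ) ω X]
  [ContMDiffVectorBundle ω (Fin r → ℂ) E 𝓘(ℂ, Fin n → ℂ)]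

theorem IsAdaptedFrame.eventually_fderiv_frameChart {e : Fin r → ∀ x, E x} {y : FlagBundle n r E}
    (he : IsAdaptedFrame e y) : ∀ᶠ u in 𝓝 (flagChart y y),
      ContDiffAt ℂ 1 (flagCoordChart e y) u ∧
      ∀ v, fderiv ℂ (frameChart e y) u v = (v.1, fderiv ℂ (flagCoordChart e y) u v) := by
  filter_upwards [(he.contDiffAt_flagCoordChart.of_le (m := 1) le_top).eventually (by simp)] with u hu
  refine ⟨hu, fun v => ?_⟩
  exact congrArg (fun D : FlagModel n r →L[ℂ] FlagModel n r => D v)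
    (hasFDerivAt_fst.prodMk (hu.differentiableAt (by simp)).hasFDerivAt).fderiv

/-- The density is the squared modulus of the determinant of the change from the flag coordinates to those of
an orthonormal frame. -/
theorem relDensity_of_conj_eq_one {H : (Fin n → ℂ) → Matrix (Fin r) (Fin r) ℂ} {w : FlagModel n r}
    {L : Matrix (Fin r) (Fin r) ℂ} (hL : LowerTri L) (hLd : IsUnit L.det)
    (hLS : L * fibreGram H w * Lᴴ = 1) :
    relDensity H w = ((‖LinearMap.det (conjUpper L L⁻¹ : (PairIdx r → ℂ) →ₗ[ℂ] (PairIdx r → ℂ))‖ ^ 2 :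
      ℝ) : ℂ) := by
  rw [det_conjUpper_inv hL hLd, norm_prod, ← Finset.prod_pow, Complex.ofReal_prod, relDensity]
  refine Finset.prod_congr rfl fun p _ => ?_
  rw [quotNorm_of_conj_eq_one hL hLd hLS, quotNorm_of_conj_eq_one hL hLd hLS, norm_mul, norm_inv]
  push_cast
  ring

variable {h : HermitianMetric n r E}

theorem finrank_real_pairs (r : ℕ) : finrank ℝ (PairIdx r → ℂ) = 2 * fiberDim r := by
  rw [finrank_real_of_complex, finrank_fintype_fun_eq_card]

/-- The relative volume form in the coordinates of a normal frame. Since it is given at each point by a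
normal frame there, it is the pull-back of the standard volume form under the differentials of flag
coordinates of parallel frames. -/
theorem IsNormalFrame.relVolume_inChart {g : Fin r → ∀ x, E x} {y : FlagBundle n r E}
    (hg : IsNormalFrame h g y) : DiffForm.inChart (relVolume h) y =ᶠ[𝓝 (flagChart y y)]
      fun u => pullForm (relForm (gramInChart h g y.base) (frameChart g y u))
        (fderiv ℂ (frameChart g y) u) := by
  filter_upwards [eventually_mem_target y, (tendsto_chart_symm_base_self y).eventually hg.1.eventually,
    hg.isAdaptedFrame.eventually_adapted.eventually_nhds,
    hg.isAdaptedFrame.eventually_fderiv_frameChart] with u hu hgu had hD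
  set y' := (flagChart y).symm u with hy'
  have he := isNormalFrame_normalFrame h y'
  obtain ⟨L, hL, hLd, hLQ, hLe⟩ := exists_lowerTri_transMat hu he.1 he.2.1 hgu had.self_of_nhds
  have hx : y'.base ∈ (baseChart y.base).source := (chart_symm_mem hu).1
  have hp : ∀ v, connMat (gramInChart h (normalFrame h y') y.base) u.1 v = 0 := fun v => by
    rw [← chart_chart_symm_base hu]
    exact he.connMat_eq_zero hx v
  -- the frame that is normal at `y'` is orthonormal there, so `L` is the Gram–Schmidt matrix
  have hLS : L * fibreGram (gramInChart h g y.base) (frameChart g y u) * Lᴴ = 1 := by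
    have h1 := he.gramMat_eq_one
    rw [hLe, gramMat_matAct, gramMat_tildeFrame hu] at h1
    exact h1
  have hc : ∀ v : FlagModel n r, coordMap (normalFrame h y') y'
      (mfderiv 𝓘(ℂ, FlagModel n r) 𝓘(ℂ, FlagModel n r) (flagChart y).symm u v) =
      conjUpper L L⁻¹ (conjUpper 1 (unipotent (flagCoordChart g y u))⁻¹
        (connForm (gramInChart h g y.base) (frameChart g y u) (fderiv ℂ (frameChart g y) u v))) :=
    fun v => by
      have h1 := conjUpper_connForm (gramInChart h g y.base) (frameChart g y u)
        (fderiv ℂ (frameChart g y) u v) hL hLd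
      rw [hD.2] at h1 ⊢
      exact funext fun p => (coordDeriv_chart_symm_of_parallel hu he.1 he.2.1 hgu hD.1 had hL hLd hLQ
        hp p v).trans (congrFun h1.symm p)
  refine ContinuousAlternatingMap.ext fun v => ?_
  have h1 := congrArg (fun ζ : (PairIdx r → ℂ) [⋀^Fin (2 * fiberDim r)]→L[ℝ] ℂ => ζ fun k =>
    conjUpper 1 (unipotent (flagCoordChart g y u))⁻¹ (connForm (gramInChart h g y.base)
      (frameChart g y u) (fderiv ℂ (frameChart g y) u (v k))))
    (pullForm_of_top (finrank_real_pairs r) (volForm r) (conjUpper L L⁻¹))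
  have h2 := congrArg (fun ζ : (PairIdx r → ℂ) [⋀^Fin (2 * fiberDim r)]→L[ℝ] ℂ => ζ fun k =>
    connForm (gramInChart h g y.base) (frameChart g y u) (fderiv ℂ (frameChart g y) u (v k)))
    (pullForm_of_top (finrank_real_pairs r) (volForm r) (conjUpper 1 (unipotent (flagCoordChart g y u))⁻¹))
  rw [det_conjUpper_unipotent_inv, norm_one, one_pow, Complex.ofReal_one, one_smul] at h2
  rw [← relDensity_of_conj_eq_one hL hLd hLS] at h1
  exact (congrArg (volForm r) (funext fun k => hc (v k))).trans
    (h1.trans (congrArg (relDensity (gramInChart h g y.base) (frameChart g y u) * ·) h2))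

theorem relVolume_smooth : (relVolume h (E := E)).Smooth := by
  intro y
  have hg := isNormalFrame_normalFrame h y
  set g := normalFrame h y
  have hx := mem_baseDomain (n := n) (r := r) (E := E) y.base
  have hH := contDiffAt_gramInChart hg.1 hx (h := h)
  have h1 : gramInChart h g y.base (baseChart y.base y.base) = 1 :=
    (gramInChart_self g hx.1).trans hg.gramMat_eq_one
  have hΨ : ContDiffAt ℂ ω (frameChart g y) (flagChart y y) :=
    hg.isAdaptedFrame.contDiffAt_frameChart
  have hΨr : ContDiffAt ℝ ∞ (frameChart g y) (flagChart y y) :=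
    (hΨ.restrict_scalars ℝ).of_le le_top
  have hDr : ∀ v, ContDiffAt ℝ ∞ (fun u => fderiv ℂ (frameChart g y) u v)
      (flagChart y y) := fun v =>
    (((hΨ.fderiv_right (m := ω) le_top).clm_apply contDiffAt_const).restrict_scalars ℝ).of_le le_top
  have hΨ0 := hg.isAdaptedFrame.frameChart_self
  refine ContDiffAt.congr_of_eventuallyEq (contDiffAt_form fun v => ?_) hg.relVolume_inChart
  have h2 : (fun u => pullForm (relForm (gramInChart h g y.base) (frameChart g y u))
      (fderiv ℂ (frameChart g y) u) v) =ᶠ[𝓝 (flagChart y y)] fun u =>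
      relDensity (gramInChart h g y.base) (frameChart g y u) * volForm r fun k =>
        (fderiv ℂ (frameChart g y) u (v k)).2 +
          connTwist (gramInChart h g y.base) (frameChart g y u) (v k).1 := by
    filter_upwards [hg.isAdaptedFrame.eventually_fderiv_frameChart] with u hu
    refine congrArg (relDensity (gramInChart h g y.base) (frameChart g y u) * volForm r ·)
      (funext fun k => ?_)
    have h3 : (fderiv ℂ (frameChart g y) u (v k)).1 = (v k).1 := by rw [hu.2]
    exact congrArg (fun a => (fderiv ℂ (frameChart g y) u (v k)).2 +
      connTwist (gramInChart h g y.base) (frameChart g y u) a) h3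
  refine ContDiffAt.congr_of_eventuallyEq (ContDiffAt.mul ?_ ?_) h2
  · refine ContDiffAt.comp (g := relDensity (gramInChart h g y.base)) _ ?_ hΨr
    rw [hΨ0]
    exact contDiffAt_relDensity hH h1
  · refine (volForm r).toContinuousMultilinearMap.contDiff.contDiffAt.comp _
      (contDiffAt_pi.mpr fun k => (hDr (v k)).snd.add ?_)
    refine ContDiffAt.comp (g := fun w => connTwist (gramInChart h g y.base) w (v k).1) _ ?_ hΨr
    rw [hΨ0]
    exact contDiffAt_connTwist hH h1 _

theorem relVolume_delDelbar {g : Fin r → ∀ x, E x} {y : FlagBundle n r E}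
    (hg : IsNormalFrame h g y) : (relVolume h).delDelbar y =
      pullForm (del (delbar (relForm (gramInChart h g y.base))) (baseChart y.base y.base, 0))
        (fderiv ℂ (frameChart g y) (flagChart y y)) := by
  have hx := mem_baseDomain (n := n) (r := r) (E := E) y.base
  have h1 : gramInChart h g y.base (baseChart y.base y.base) = 1 :=
    (gramInChart_self g hx.1).trans hg.gramMat_eq_one
  have h2 : ((2 : ℕ) : ℕ∞ω) ≤ ∞ := WithTop.coe_le_coe.mpr le_top
  rw [← hg.isAdaptedFrame.frameChart_self]
  refine (del_congr (delbar_congr hg.relVolume_inChart)).trans (del_delbar_pullForm ?_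
    (hg.isAdaptedFrame.contDiffAt_frameChart.of_le le_top))
  rw [hg.isAdaptedFrame.frameChart_self]
  exact (contDiffAt_relForm (contDiffAt_gramInChart hg.1 hx) h1).of_le h2

/-- After multiplication by forms of degree `2 (n - 1)` from the base, the form `i ∂∂bar η` is the product of `η`
with the horizontal part of the curvature of `Q^ρ`. -/
theorem wedge_delDelbar_relVolume (y : FlagBundle n r E)
    (β : (Fin n → ℂ) [⋀^Fin (2 * (n - 1))]→L[ℝ] ℂ) :
    wedge (Complex.I • (relVolume h).delDelbar y) (pullForm (V := TangentSpace 𝓘(ℂ, FlagModel n r) y) β (projDeriv y)) =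
      wedge (wedge (relVolume h y) (-(Complex.I • horizontalForm h (fun i => (canonicalWeight r i : ℝ)) y)))
        (pullForm β (projDeriv y)) := by
  have hg := isNormalFrame_normalFrame h y
  have hη : relVolume h y = pullForm (volForm r) (coordMap (normalFrame h y) y) := rfl
  have hθ : horizontalForm h (fun i => (canonicalWeight r i : ℝ)) y = -∑ i, (canonicalWeight r i : ℂ) •
      pullForm (curvaturePairing h y.base (normalFrame h y i y.base) (normalFrame h y i y.base))
        (projDeriv y) := by
    simp only [horizontalForm, Complex.ofReal_intCast]
  set g := normalFrame h y
  have hx := mem_baseDomain (n := n) (r := r) (E := E) y.base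
  have h1 : gramInChart h g y.base (baseChart y.base y.base) = 1 :=
    (gramInChart_self g hx.1).trans hg.gramMat_eq_one
  let Θ : (Fin n → ℂ) [⋀^Fin 2]→L[ℝ] ℂ := Complex.I • ∑ i, (canonicalWeight r i : ℂ) •
    curvaturePairing h y.base (g i y.base) (g i y.base)
  let D : FlagModel n r →L[ℂ] FlagModel n r := fderiv ℂ (frameChart g y) (flagChart y y)
  let fst' := ContinuousLinearMap.fst ℂ (Fin n → ℂ) (PairIdx r → ℂ)
  let snd' := ContinuousLinearMap.snd ℂ (Fin n → ℂ) (PairIdx r → ℂ)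
  let δ := del (delbar (relForm (gramInChart h g y.base))) (baseChart y.base y.base, 0)
  -- both sides agree on two horizontal and otherwise vertical vectors
  have key : wedge (Complex.I • δ) (pullForm β fst') =
      wedge (wedge (pullForm (volForm r) snd') (pullForm Θ fst')) (pullForm β fst') := by
    refine sub_eq_zero.mp ((wedge_sub_left _ _ _).symm.trans (wedge_pullForm_fst_eq_zero _
      (fun a b v hv hli => ?_) β))
    have h2 := wedge_cons_cons fst' (pullForm (volForm r) snd') Θ (a, 0) (b, 0) v hv
    have h3 := del_delbar_relForm (contDiffAt_gramInChart hg.1 hx) h1 (hg.dMat_eq_zero hx.1)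
      (fun z => conjTranspose_gramMat h _ _) a b hv hli
    refine sub_eq_zero.mpr ((congrArg (Complex.I * ·) h3).trans (Eq.trans ?_ h2.symm))
    have h4 : Θ ![a, b] = Complex.I * ∑ i, (canonicalWeight r i : ℂ) *
        (leviPart (fderiv ℝ (fderiv ℝ fun z => gramInChart h g y.base z i i)
          (baseChart y.base y.base)) b a -
        leviPart (fderiv ℝ (fderiv ℝ fun z => gramInChart h g y.base z i i)
          (baseChart y.base y.base)) a b) := by
      refine congrArg (Complex.I * ·) ((ContinuousAlternatingMap.sum_apply _ _).trans
        (Finset.sum_congr rfl fun i _ => congrArg ((canonicalWeight r i : ℂ) * ·) ?_))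
      exact curvaturePairing_of_normal h hg.1 hg.gramMat_eq_one (hg.dMat_eq_zero hx.1) i i a b
    refine Eq.trans ?_ (congrArg ((volForm r fun k => (v k).2) * ·) h4.symm)
    ring
  have hfst : fst'.comp D = projDeriv y := ContinuousLinearMap.ext fun v =>
    (congrArg Prod.fst (hg.isAdaptedFrame.fderiv_frameChart v)).trans (projDeriv_apply y v).symm
  have hsnd : snd'.comp D = coordMap g y := ContinuousLinearMap.ext fun v =>
    congrArg Prod.snd (hg.isAdaptedFrame.fderiv_frameChart v)
  have hpull := congrArg (fun ζ : FlagModel n r [⋀^Fin _]→L[ℝ] ℂ => pullForm ζ D) key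
  simp only [pullForm_wedge] at hpull
  have hβ : pullForm (pullForm β fst') D = pullForm β (projDeriv y) := congrArg (pullForm β) hfst
  have hΘ : pullForm (pullForm Θ fst') D =
      -(Complex.I • horizontalForm h (fun i => (canonicalWeight r i : ℝ)) y) := by
    refine (congrArg (pullForm Θ) hfst).trans ?_
    rw [hθ, smul_neg, neg_neg]
    exact congrArg (Complex.I • ·) (pullForm_sum _ _ _)
  have hv : pullForm (pullForm (volForm r) snd') D = relVolume h y :=
    congrArg (pullForm (volForm r)) hsnd
  have hδ : pullForm (Complex.I • δ) D = Complex.I • (relVolume h).delDelbar y :=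
    congrArg (Complex.I • ·) (relVolume_delDelbar hg).symm
  rw [hβ, hΘ, hv, hδ] at hpull
  exact hpull

theorem wedge_relVolume_horizontalForm (y : FlagBundle n r E) {v : Fin r → E y.base}
    (hv : IsUnitaryAdapted h y v) (β : TangentSpace 𝓘(ℂ, FlagModel n r) y [⋀^Fin (2 * (n - 1))]→L[ℝ] ℂ) :
    wedge (wedge (relVolume h y) (-(Complex.I • horizontalForm h (fun i => (canonicalWeight r i : ℝ)) y)))
      β = ∑ i, (canonicalWeight r i : ℂ) • wedge (wedge (relVolume h y)
        (pullForm (Complex.I • curvaturePairing h y.base (v i) (v i)) (projDeriv y))) β := by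
  have hθ : -(Complex.I • horizontalForm h (fun i => (canonicalWeight r i : ℝ)) y) =
      ∑ i, (canonicalWeight r i : ℂ) •
        pullForm (Complex.I • curvaturePairing h y.base (v i) (v i)) (projDeriv y) := by
    rw [isHorizontalPart_horizontalForm h _ y v hv, smul_neg, neg_neg, Finset.smul_sum]
    refine Finset.sum_congr rfl fun i _ => ?_
    rw [Complex.ofReal_intCast, smul_comm]
    rfl
  rw [hθ, wedge_sum_right, wedge_sum_left]
  refine Finset.sum_congr rfl fun i _ => ?_
  rw [wedge_smul_right, wedge_smul_left]

end RelativeVolumeChart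

end Geometry
end

theorem propositionA10 {n r : ℕ} {X : Type*} [TopologicalSpace X] [ChartedSpace (Fin n → ℂ) X]
    [IsManifold 𝓘(ℂ, Fin n → ℂ) ω X]
    {E : X → Type*} [TopologicalSpace (TotalSpace (Fin r → ℂ) E)]
    [∀ x, AddCommGroup (E x)] [∀ x, Module ℂ (E x)] [∀ x, TopologicalSpace (E x)]
    [FiberBundle (Fin r → ℂ) E] [VectorBundle ℂ (Fin r → ℂ) E]
    [ContMDiffVectorBundle ω (Fin r → ℂ) E 𝓘(ℂ, Fin n → ℂ)]
    (h : HermitianMetric n r E) :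
    (∀ y : FlagBundle n r E, ∃ e, IsNormalFrame h e y) ∧
    (∀ y : FlagBundle n r E, IsCompl (horizontalSpace h y) (verticalSpace y)) ∧
    ∃ θH θV : (Fin r → ℝ) → DiffForm (FlagModel n r) (FlagBundle n r E) 2,
      (∀ a, IsHorizontalPart h a (θH a) ∧ IsVerticalPart h a (θV a) ∧
        IsTautCurvature h a fun y => θH a y + θV a y) ∧
      (∃ Φ : ∀ y : FlagBundle n r E, RelCanonical y ≃ₗ[ℂ] TautPow (canonicalWeight r) y,
        ∀ κ y₀, IsHolRelCanonicalSection κ y₀ ↔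
          IsHolTautPowSection (canonicalWeight r) (fun y => Φ y (κ y)) y₀) ∧
      ∃ η : DiffForm (FlagModel n r) (FlagBundle n r E) (2 * fiberDim r),
        IsRelVolume h η ∧ η.Smooth ∧
        ∀ κ : DiffForm (Fin n → ℂ) X 2, IsPositiveForm κ → ∀ y : FlagBundle n r E,
          wedge (Complex.I • η.delDelbar y) (pullForm (wedgePow (κ y.base) (n - 1)) (projDeriv y)) =
            wedge (wedge (η y) (-(Complex.I • θH (fun i => (canonicalWeight r i : ℝ)) y)))
              (pullForm (wedgePow (κ y.base) (n - 1)) (projDeriv y)) ∧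
          ∀ v, IsUnitaryAdapted h y v →
            wedge (wedge (η y) (-(Complex.I • θH (fun i => (canonicalWeight r i : ℝ)) y)))
              (pullForm (wedgePow (κ y.base) (n - 1)) (projDeriv y)) =
            ∑ i, (canonicalWeight r i : ℂ) • wedge (wedge (η y)
              (pullForm (Complex.I • curvaturePairing h y.base (v i) (v i)) (projDeriv y)))
              (pullForm (wedgePow (κ y.base) (n - 1)) (projDeriv y)) := by
  refine ⟨exists_isNormalFrame h, isCompl_horizontalSpace_verticalSpace h,
    horizontalForm h, verticalForm h, fun a => ⟨isHorizontalPart_horizontalForm h a,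
      isVerticalPart_verticalForm h a, isTautCurvature h a⟩,
    ⟨relCanonicalEquiv, isHolRelCanonicalSection_iff⟩,
    relVolume h, isRelVolume_relVolume h, relVolume_smooth, fun κ _ y => ⟨?_, fun v hv => ?_⟩⟩
  · exact wedge_delDelbar_relVolume y _
  · exact wedge_relVolume_horizontalForm y hv _
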